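/- **Setting.** Let $U_q$ be the quantum loop algebra of $\mathfrak{sl}_2$ over $\mathbb C(q)$, with Drinfeld generators $x^\pm_k$ ($k\in\mathbb Z$), $a_n$ ($n\ne0$), $t_1^{\pm1}$ and relations $[t_1,a_n]=[a_m,a_n]=0$, $t_1x^\pm_kt_1^{-1}=q^{\pm2}x^\pm_k$, $[a_n,x^\pm_k]=\pm\frac{[2n]}{n}x^\pm_{k+n}$, $x^\pm_{k+1}x^\pm_l-q^{\pm2}x^\pm_lx^\pm_{k+1}=q^{\pm2}x^\pm_kx^\pm_{l+1}-x^\pm_{l+1}x^\pm_k$, $[x^+_k,x^-_l]=(\varphi^+_{k+l}-\varphi^-_{k+l})/(q-q^{-1})$, where $\sum_k\varphi^\pm_{\pm k}z^k=t_1^{\pm1}\exp(\pm(q-q^{-1})\sum_{n\ge1}a_{\pm n}z^n)$ and $[j]=\frac{q^j-q^{-j}}{q-q^{-1}}$. Let $U_q^{\rm res}$ be the $\mathbb C[q,q^{-1}]$-subalgebra generated by $(x^\pm_n)^{(r)}=(x_n^\pm)^r/[r]!$, $t_1^{\pm1}$, $\prod_{s=1}^r\frac{t_1q^{n-s+1}-t_1^{-1}q^{-n+s-1}}{q^s-q^{-s}}$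 and $\tilde a_n=\frac n{[n]}a_n$, and let $U_{\sqrt{-1}}$ be its specialization at $q=i=\sqrt{-1}$. Put $\mathcal X^+_{\ge0}(t)=\sum_{k\ge0}x^+_k(q^{-1}t)^k$, similarly $\mathcal X^+_{<0}$, $\mathcal X^-_{>0}$, $\mathcal X^-_{\le0}$, $\mathcal X^{(2)}=\mathcal X^2/[2]$, and $a_\pm(t)=\sum_{\pm n>0}\tilde a_nt^n$. Let $K_n=\mathbb C(z_1,\dots,z_n)$, and let $A_n=\bigoplus_lA_{n,l}$, where $A_{n,l}$ is the space of skew-symmetric polynomials $P(X_1,\dots,X_l)$ over $K_n$ of degree at most $n-1$ in each $X_a$. Write $\Theta_n(x)=\prod_j(1-z_jx)$, $\Theta_n(x,y)=\Theta_n(x)\Theta_n(y)-\Theta_n(-x)\Theta_n(-y)$, $F_n(t|x)=\frac{t}{2(x-t)}\frac{\Theta_n(t,-x)}{\Theta_n(t)}$, and $$F^{(2)}_n(t|x,y)=\tfrac{t}{x+t}\tfrac{t}{y+t}\tfrac{x-y}{x+y}\Theta_n(x,y)+\tfrac{t}{x-t}\tfrac{t}{y+t}\tfrac{\Theta_n(-y)}{\Theta_n(t)}\Theta_n(t,-x)-\tfrac{t}{y-t}\tfrac{t}{x+t}\tfrac{\Theta_n(-x)}{\Theta_n(t)}\Theta_n(t,-y).$$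 Let the generators act on $P\in A_{n,l}$ as follows (expansion at $t=0$, except for $a_-(t)$, where it is at $t=\infty$): $t_1^{\pm1}.P=i^{\pm(n-2l)}P$; $\mathcal X^-_{>0}(t).P=F_n(t)\wedge P$; $-4i\,\mathcal X^-_{>0}(t)^{(2)}.P=F^{(2)}_n(t)\wedge P$; $i^{1-n}\mathcal X^+_{\ge0}(t).P=\Theta_n(t)^{-1}P(X_1,\dots,X_{l-1},t)$ (and $0$ if $l=0$); $$i(-1)^{n+1}\mathcal X^+_{\ge0}(t)^{(2)}.P=\sum_{a=1}^n\operatorname{res}_{u=z_a^{-1}}\frac{P(X_1,\dots,X_{l-2},-u,u)}{\Theta_n(-u)\Theta_n(u)}\frac{du}{u-t}\quad(\text{and }0\text{ if }l\le1);$$ $$a_+(t).P=\sum_j\tfrac{z_jt}{1-z_jt}P+\sum_{p=1}^l\Big\{\tfrac{t}{X_p-t}\Big(\tfrac{\Theta_n(X_p)}{\Theta_n(t)}P|_{X_p=t}-P\Big)+(t\to-t)\Big\},$$ $$a_-(t).P=-\sum_j\tfrac{1}{1-z_jt}P-\sum_{p=1}^l\Big\{\tfrac{t}{X_p-t}\Big(\tfrac{\Theta_n(X_p)}{\Theta_n(t)}P|_{X_p=t}-\tfrac{X_p}{t}P\Big)+(t\to-t)\Big\};$$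 and $-\mathcal X^-_{\le0}(t)$, $-4i\mathcal X^-_{\le0}(t)^{(2)}$, $-i^{1-n}\mathcal X^+_{<0}(t)$, $i(-1)^{n+1}\mathcal X^+_{<0}(t)^{(2)}$ act by the expansions at $t=\infty$ of the corresponding right hand sides. For a noncommutative polynomial $f$ in these generators (the coefficients of the series, and $t_1^{\pm1}$), write $f.P$ for the result of applying it. Let $\widehat C_{n,l}\subset A_{n,l}$ be the set of those $P$ whose coefficients are symmetric Laurent polynomials in $z_1,\dots,z_n$. A pair $P_{n,l}\in\widehat C_{n,l}$, $P_{n+2,l+1}\in\widehat C_{n+2,l+1}$ is a *link* if $$P_{n+2,l+1}(X_1,\dots,X_l,z^{-1}|z_1,\dots,z_n,z,-z)=z^{-n-1}\prod_{a=1}^l(1-X_a^2z^2)\cdot P_{n,l}(X_1,\dots,X_l|z_1,\dots,z_n).$$ A pair of elements $Q\in\bigoplus_l\widehat C_{n,l}$, $Q'\in\bigoplus_l\widehat C_{n+2,l}$ is a link if $(Q_l,Q'_{l+1})$ is a link for all $l\ge0$. An *$\infty$-cycle of weight $m\in\mathbb Z$* is a sequence $(P_{n,l})_{n,l\ge0,\,n-2l=m}$,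 $P_{n,l}\in\widehat C_{n,l}$, such that all pairs $(P_{n,l},P_{n+2,l+1})$ are links; $\overline{\mathcal Z}$ is the direct sum over $m$ of the spaces of $\infty$-cycles of weight $m$, on which operators act componentwise. **Proposition 3.1.** Let $g\in U_{\sqrt{-1}}$. 1. $g$ is a noncommutative polynomial in the above generators. For every noncommutative polynomial $f$ whose value in $U_{\sqrt{-1}}$ is $g$: if $(P_{n,l},P_{n+2,l+1})$ is a link, then $(f.P_{n,l},f.P_{n+2,l+1})$ is a link; and $f$ maps $\overline{\mathcal Z}$ into itself. 2. Consequently, for the $U_{\sqrt{-1}}$-module structures on the spaces $A_n$ in which the generators act by the formulas above: if $(P_{n,l},P_{n+2,l+1})$ is a link, then $(g.P_{n,l},g.P_{n+2,l+1})$ is a link; and $g.\overline{\mathcal Z}\subset\overline{\mathcal Z}$, so that $U_{\sqrt{-1}}$ acts on $\infty$-cycles. -/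

import Mathlib

open scoped BigOperators

noncomputable section

namespace LoopSl2

/-! ## The quantum loop algebra over `ℂ(q)` (Drinfeld generators) -/

/-- The field `ℂ(q)`. -/
abbrev Cq : Type := RatFunc ℂ

/-- The indeterminate `q`. -/
def q : Cq := RatFunc.X

/-- The quantum integer `[j] = (q^j - q^{-j}) / (q - q^{-1})`. -/
def qInt (j : ℤ) : Cq := (q ^ j - q ^ (-j)) / (q - q⁻¹)

/-- `[r]! = [1][2]⋯[r]`. -/
def qFact (r : ℕ) : Cq := ∏ j ∈ Finset.Icc 1 r, qInt (j : ℤ)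

/-- Drinfeld generators: `x 1 k` is `x⁺_k`, `x (-1) k` is `x⁻_k`, `a n _` is `a_n` (`n ≠ 0`),
`t`, `tinv` are `t₁`, `t₁⁻¹`. -/
inductive DGen : Type
  | x (s : ℤˣ) (k : ℤ)
  | a (n : ℤ) (hn : n ≠ 0)
  | t
  | tinv

/-- The free `ℂ(q)`-algebra on the Drinfeld generators. -/
abbrev FreeD : Type := FreeAlgebra Cq DGen

namespace FreeD

/-- `x^±_k` in the free algebra. -/
def x (s : ℤˣ) (k : ℤ) : FreeD := FreeAlgebra.ι Cq (DGen.x s k)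

/-- `a_n` in the free algebra. -/
def a (n : ℤ) (hn : n ≠ 0) : FreeD := FreeAlgebra.ι Cq (DGen.a n hn)

/-- `t₁^{±1}` in the free algebra. -/
def t (s : ℤˣ) : FreeD := FreeAlgebra.ι Cq (if s = 1 then DGen.t else DGen.tinv)

/-- The series `± (q - q⁻¹) ∑_{n ≥ 1} a_{± n} z^n`. -/
def aSeries (s : ℤˣ) : PowerSeries FreeD :=
  PowerSeries.mk fun n =>
    if hn : n = 0 then 0
    else (((s : ℤ) : Cq) * (q - q⁻¹)) •
      a ((s : ℤ) * (n : ℤ)) (mul_ne_zero s.ne_zero (Int.natCast_ne_zero.mpr hn))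

/-- The coefficient of `z^m` in `exp (± (q - q⁻¹) ∑_{n ≥ 1} a_{± n} z^n)`; as the series in the
exponent has no constant term, only the powers `j ≤ m` contribute. -/
def expCoeff (s : ℤˣ) (m : ℕ) : FreeD :=
  ∑ j ∈ Finset.range (m + 1), ((j.factorial : Cq)⁻¹) • PowerSeries.coeff m (aSeries s ^ j)

/-- `φ^±_k`, where `∑_k φ^±_{±k} z^k = t₁^{±1} exp (± (q - q⁻¹) ∑_{n ≥ 1} a_{±n} z^n)`. -/
def phi (s : ℤˣ) (k : ℤ) : FreeD :=
  if 0 ≤ (s : ℤ) * k then t s * expCoeff s ((s : ℤ) * k).toNat else 0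

end FreeD

open FreeD in
/-- The defining relations of the quantum loop algebra. -/
inductive DRel : FreeD → FreeD → Prop
  | t_mul_tinv : DRel (t 1 * t (-1)) 1
  | tinv_mul_t : DRel (t (-1) * t 1) 1
  | t_a (n : ℤ) (hn : n ≠ 0) : DRel (t 1 * a n hn) (a n hn * t 1)
  | a_a (m n : ℤ) (hm : m ≠ 0) (hn : n ≠ 0) : DRel (a m hm * a n hn) (a n hn * a m hm)
  | t_x (s : ℤˣ) (k : ℤ) : DRel (t 1 * x s k * t (-1)) (q ^ (2 * (s : ℤ)) • x s k)
  | a_x (n : ℤ) (hn : n ≠ 0) (s : ℤˣ) (k : ℤ) :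
      DRel (a n hn * x s k - x s k * a n hn)
        ((((s : ℤ) : Cq) * (qInt (2 * n) / (n : Cq))) • x s (k + n))
  | x_x (s : ℤˣ) (k l : ℤ) :
      DRel (x s (k + 1) * x s l - q ^ (2 * (s : ℤ)) • (x s l * x s (k + 1)))
        (q ^ (2 * (s : ℤ)) • (x s k * x s (l + 1)) - x s (l + 1) * x s k)
  | xp_xm (k l : ℤ) :
      DRel (x 1 k * x (-1) l - x (-1) l * x 1 k)
        ((q - q⁻¹)⁻¹ • (phi 1 (k + l) - phi (-1) (k + l)))

/-- The quantum loop algebra `U_q` of `sl₂`, a `ℂ(q)`-algebra. -/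
abbrev Uq : Type := RingQuot DRel

namespace Uq

/-- The quotient map from the free algebra. -/
def mk : FreeD →ₐ[Cq] Uq := RingQuot.mkAlgHom Cq DRel

/-- `x^±_k`. -/
def x (s : ℤˣ) (k : ℤ) : Uq := mk (FreeD.x s k)

/-- `t₁^{±1}`. -/
def t (s : ℤˣ) : Uq := mk (FreeD.t s)

/-- `ã_n = (n / [n]) a_n`. -/
def atilde (n : ℤ) (hn : n ≠ 0) : Uq := ((n : Cq) / qInt n) • mk (FreeD.a n hn)

/-- The divided power `(x^±_k)^{(r)} = (x^±_k)^r / [r]!`. -/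
def xDiv (s : ℤˣ) (k : ℤ) (r : ℕ) : Uq := (qFact r)⁻¹ • x s k ^ r

/-- `[t₁; n; r] = ∏_{s=1}^r (t₁ q^{n-s+1} - t₁⁻¹ q^{-n+s-1}) / (q^s - q^{-s})`. -/
def tBinom (n : ℤ) (r : ℕ) : Uq :=
  ((List.range r).map fun s' =>
    (q ^ ((s' : ℤ) + 1) - q ^ (-((s' : ℤ) + 1)))⁻¹ •
      (q ^ (n - (s' : ℤ)) • t 1 - q ^ (-n + (s' : ℤ)) • t (-1))).prod

end Uq

/-! ## The integral form and its specialization at `q = √-1` -/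

/-- The subalgebra `U_q^res`: generated over `ℂ[q, q⁻¹]` by the divided powers `(x^±_n)^{(r)}`,
`t₁^{±1}`, `[t₁; n; r]` and `ã_n`.  As a `ℂ`-subalgebra it is generated by these elements together
with the central elements `q^{±1}`. -/
def Ures : Subalgebra ℂ Uq :=
  Algebra.adjoin ℂ
    ({u | u = algebraMap Cq Uq q ∨ u = algebraMap Cq Uq q⁻¹} ∪
      {u | ∃ s n r, u = Uq.xDiv s n r} ∪
      {u | ∃ s, u = Uq.t s} ∪
      {u | ∃ n r, u = Uq.tBinom n r} ∪
      {u | ∃ n, ∃ hn : n ≠ 0, u = Uq.atilde n hn})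

theorem algebraMap_q_mem : algebraMap Cq Uq q ∈ Ures :=
  Algebra.subset_adjoin (Or.inl (Or.inl (Or.inl (Or.inl (Or.inl rfl)))))

theorem algebraMap_qinv_mem : algebraMap Cq Uq q⁻¹ ∈ Ures :=
  Algebra.subset_adjoin (Or.inl (Or.inl (Or.inl (Or.inl (Or.inr rfl)))))

theorem xDiv_mem (s : ℤˣ) (n : ℤ) (r : ℕ) : Uq.xDiv s n r ∈ Ures :=
  Algebra.subset_adjoin (Or.inl (Or.inl (Or.inl (Or.inr ⟨s, n, r, rfl⟩))))

theorem t_mem (s : ℤˣ) : Uq.t s ∈ Ures :=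
  Algebra.subset_adjoin (Or.inl (Or.inl (Or.inr ⟨s, rfl⟩)))

theorem atilde_mem (n : ℤ) (hn : n ≠ 0) : Uq.atilde n hn ∈ Ures :=
  Algebra.subset_adjoin (Or.inr ⟨n, hn, rfl⟩)

/-- The algebra `U_{√-1} = U_q^res ⊗_{ℂ[q,q⁻¹]} ℂ` (with `q ↦ √-1`), as the quotient of `U_q^res`
by the relation `q = √-1`. -/
abbrev Ui : Type :=
  RingQuot fun u v : Ures =>
    u = ⟨algebraMap Cq Uq q, algebraMap_q_mem⟩ ∧ v = algebraMap ℂ Ures Complex.I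

/-- The specialization map `U_q^res → U_{√-1}`. -/
def specialize : Ures →ₐ[ℂ] Ui := RingQuot.mkAlgHom ℂ _

/-- Which expansion of a rational function of `t` is taken: at `t = 0` or at `t = ∞`. -/
inductive Side : Type
  | zero
  | inf

/-- The half currents are `∑_k x^±_k (q⁻¹ t)^k` over `k ≥ start` (expansion at `0`) or
`k < start` (expansion at `∞`), with `start = 0` for `x⁺` and `start = 1` for `x⁻`. -/
def start (s : ℤˣ) : ℤ := if s = 1 then 0 else 1

/-- The (finite) set of `k` for which `x^±_k` and `x^±_{N-k}` both occur in the half current. -/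
def pairs (s : ℤˣ) (e : Side) (N : ℤ) : Finset ℤ :=
  match e with
  | Side.zero => Finset.Icc (start s) (N - start s)
  | Side.inf => Finset.Icc (N - start s + 1) (start s - 1)

/-- The coefficient of `(q⁻¹ t)^N` in the divided square `X(t)^{(2)} = X(t)² / [2]` of a half
current `X(t)`. -/
def Uq.curSq (s : ℤˣ) (e : Side) (N : ℤ) : Uq :=
  (qInt 2)⁻¹ • ∑ k ∈ pairs s e N, Uq.x s k * Uq.x s (N - k)

theorem q_ne_zero : q ≠ 0 := RatFunc.X_ne_zero

theorem q_sq_ne_C (c : ℂ) : q * q ≠ RatFunc.C c := by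
  intro h
  have h1 : algebraMap (Polynomial ℂ) Cq (Polynomial.X * Polynomial.X)
      = algebraMap (Polynomial ℂ) Cq (Polynomial.C c) := by
    rw [map_mul, RatFunc.algebraMap_X, RatFunc.algebraMap_C]
    exact h
  have h2 := congrArg Polynomial.natDegree (RatFunc.algebraMap_injective ℂ h1)
  simp at h2

theorem q_sub_ne_zero : q - q⁻¹ ≠ 0 := by
  intro h
  refine q_sq_ne_C 1 ?_
  have h0 := q_ne_zero
  field_simp at h
  rw [map_one]
  linear_combination h

theorem qInt_one : qInt 1 = 1 := by
  simp only [qInt, zpow_neg, zpow_one]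
  exact div_self q_sub_ne_zero

theorem qInt_two : qInt 2 = q + q⁻¹ := by
  have h := q_sub_ne_zero
  rw [qInt, div_eq_iff h, zpow_neg]
  have h0 := q_ne_zero
  rw [show (2 : ℤ) = ((2 : ℕ) : ℤ) from rfl, zpow_natCast]
  field_simp
  ring

theorem qInt_two_ne_zero : qInt 2 ≠ 0 := by
  rw [qInt_two]
  intro h
  refine q_sq_ne_C (-1) ?_
  have h0 := q_ne_zero
  field_simp at h
  rw [map_neg, map_one]
  linear_combination h

theorem x_mem (s : ℤˣ) (n : ℤ) : Uq.x s n ∈ Ures := by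
  have h := xDiv_mem s n 1
  simpa [Uq.xDiv, qFact, qInt_one] using h

theorem xDiv_two (s : ℤˣ) (n : ℤ) :
    Uq.xDiv s n 2 = (qInt 2)⁻¹ • (Uq.x s n * Uq.x s n) := by
  simp [Uq.xDiv, qFact, qInt_one, pow_two, Finset.prod_Icc_succ_top]

theorem q_smul_mem (s : ℤˣ) {u : Uq} (hu : u ∈ Ures) : q ^ (s : ℤ) • u ∈ Ures := by
  rw [Algebra.smul_def]
  refine mul_mem ?_ hu
  rcases Int.units_eq_one_or s with rfl | rfl
  · simpa using algebraMap_q_mem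
  · simpa using algebraMap_qinv_mem

theorem x_x_rel (s : ℤˣ) (k l : ℤ) :
    Uq.x s (k + 1) * Uq.x s l - q ^ (2 * (s : ℤ)) • (Uq.x s l * Uq.x s (k + 1))
      = q ^ (2 * (s : ℤ)) • (Uq.x s k * Uq.x s (l + 1)) - Uq.x s (l + 1) * Uq.x s k := by
  have h := RingQuot.mkAlgHom_rel Cq (DRel.x_x s k l)
  simp only [map_sub, map_smul, map_mul] at h
  exact h

/-- The symmetrized product `(x_k x_l + x_l x_k) / [2]`. -/
def Uq.symm (s : ℤˣ) (k l : ℤ) : Uq :=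
  (qInt 2)⁻¹ • (Uq.x s k * Uq.x s l + Uq.x s l * Uq.x s k)

theorem symm_step (s : ℤˣ) (k l : ℤ) :
    Uq.symm s (l + 1) k = q ^ (s : ℤ) • (Uq.x s k * Uq.x s (l + 1))
      + q ^ (s : ℤ) • (Uq.x s l * Uq.x s (k + 1)) - Uq.symm s l (k + 1) := by
  have h := x_x_rel s l k
  have hQ : (qInt 2)⁻¹ * (1 + q ^ (2 * (s : ℤ))) = q ^ (s : ℤ) := by
    have h2 := qInt_two_ne_zero
    rw [inv_mul_eq_iff_eq_mul₀ h2, qInt_two]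
    have h0 := q_ne_zero
    rcases Int.units_eq_one_or s with rfl | rfl
    · simp only [Units.val_one, mul_one, zpow_ofNat]
      field_simp
      ring
    · simp only [Units.val_neg, Units.val_one, mul_neg, mul_one, zpow_neg, zpow_ofNat]
      field_simp
  have h' : Uq.x s (l + 1) * Uq.x s k = q ^ (2 * (s : ℤ)) • (Uq.x s k * Uq.x s (l + 1))
      + q ^ (2 * (s : ℤ)) • (Uq.x s l * Uq.x s (k + 1)) - Uq.x s (k + 1) * Uq.x s l := by
    rw [sub_eq_iff_eq_add] at h
    rw [h]
    abel
  rw [Uq.symm, Uq.symm, h', ← hQ]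
  simp only [mul_smul, add_smul, one_smul, smul_add, smul_sub]
  abel

theorem symm_comm (s : ℤˣ) (k l : ℤ) : Uq.symm s k l = Uq.symm s l k := by
  rw [Uq.symm, Uq.symm, add_comm]

theorem symm_self_mem (s : ℤˣ) (k : ℤ) : Uq.symm s k k ∈ Ures := by
  have h := add_mem (xDiv_mem s k 2) (xDiv_mem s k 2)
  rwa [xDiv_two, ← smul_add] at h

theorem step_mem (s : ℤˣ) (k l : ℤ) :
    q ^ (s : ℤ) • (Uq.x s k * Uq.x s (l + 1)) + q ^ (s : ℤ) • (Uq.x s l * Uq.x s (k + 1))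
      ∈ Ures :=
  add_mem (q_smul_mem s (mul_mem (x_mem s _) (x_mem s _)))
    (q_smul_mem s (mul_mem (x_mem s _) (x_mem s _)))

theorem symm_add_mem (s : ℤˣ) (m : ℕ) : ∀ k : ℤ, Uq.symm s (k + m) k ∈ Ures := by
  induction m using Nat.strong_induction_on with
  | _ m ih =>
    intro k
    match m, ih with
    | 0, _ => simpa using symm_self_mem s k
    | 1, _ =>
      have h := symm_step s k k
      rw [symm_comm s k (k + 1)] at h
      have h2 : Uq.symm s (k + 1) k = (1 / 2 : ℂ) • (q ^ (s : ℤ) • (Uq.x s k * Uq.x s (k + 1))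
          + q ^ (s : ℤ) • (Uq.x s k * Uq.x s (k + 1))) := by
        rw [eq_sub_iff_add_eq] at h
        rw [← h]
        module
      simp only [Nat.cast_one]
      rw [h2]
      exact Ures.smul_mem (step_mem s k k) _
    | m + 2, ih =>
      have h := symm_step s k (k + 1 + m)
      have e : k + ((m + 2 : ℕ) : ℤ) = k + 1 + m + 1 := by push_cast; ring
      rw [e, h]
      exact sub_mem (step_mem s k _) (ih m (by omega) (k + 1))

theorem symm_mem (s : ℤˣ) (k l : ℤ) : Uq.symm s k l ∈ Ures := by
  rcases le_total k l with h | h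
  · obtain ⟨m, rfl⟩ := Int.le.dest h
    rw [symm_comm]
    exact symm_add_mem s m k
  · obtain ⟨m, rfl⟩ := Int.le.dest h
    exact symm_add_mem s m l

theorem sum_mem_Ures (s : ℤˣ) (N : ℤ) (I : Finset ℤ) (hI : ∀ k ∈ I, N - k ∈ I) :
    (qInt 2)⁻¹ • ∑ k ∈ I, Uq.x s k * Uq.x s (N - k) ∈ Ures := by
  have h : ∑ k ∈ I, Uq.x s (N - k) * Uq.x s k = ∑ k ∈ I, Uq.x s k * Uq.x s (N - k) :=
    Finset.sum_nbij' (fun k => N - k) (fun k => N - k) hI hI (by simp) (by simp) (by simp)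
  have h2 : (qInt 2)⁻¹ • ∑ k ∈ I, Uq.x s k * Uq.x s (N - k)
      = (1 / 2 : ℂ) • ∑ k ∈ I, Uq.symm s k (N - k) := by
    simp only [Uq.symm, ← Finset.smul_sum, Finset.sum_add_distrib, h]
    rw [← two_smul ℂ (∑ k ∈ I, Uq.x s k * Uq.x s (N - k)), smul_comm (qInt 2)⁻¹ (2 : ℂ), smul_smul]
    norm_num
  rw [h2]
  exact Ures.smul_mem (sum_mem fun k _ => symm_mem s _ _) _

theorem curSq_mem (s : ℤˣ) (e : Side) (N : ℤ) : Uq.curSq s e N ∈ Ures := by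
  apply sum_mem_Ures
  intro k hk
  cases e <;> simp only [pairs, Finset.mem_Icc] at hk ⊢ <;> omega

/-- Names for the generators of `U_{√-1}`: `t s` is `t₁^{±1}`, `a n` is `ã_n`, `x s k` is `x^±_k`,
and `xx s e N` is the coefficient of `(q⁻¹ t)^N` in the divided square of a half current. -/
inductive UGen : Type
  | t (s : ℤˣ)
  | a (n : ℤ) (hn : n ≠ 0)
  | x (s : ℤˣ) (k : ℤ)
  | xx (s : ℤˣ) (e : Side) (N : ℤ)

/-- The element of `U_{√-1}` named by a generator. -/
def UGen.toUi : UGen → Ui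
  | .t s => specialize ⟨_, t_mem s⟩
  | .a n hn => specialize ⟨_, atilde_mem n hn⟩
  | .x s k => specialize ⟨_, x_mem s k⟩
  | .xx s e N => specialize ⟨_, curSq_mem s e N⟩

/-- Noncommutative polynomials in the generators. -/
abbrev Expr : Type := FreeAlgebra ℂ UGen

/-- The value in `U_{√-1}` of a noncommutative polynomial in the generators. -/
def Expr.toUi : Expr →ₐ[ℂ] Ui := FreeAlgebra.lift ℂ UGen.toUi

/-! ## The spaces `A_n` -/

/-- The field `K_n = ℂ(z_1, …, z_n)`. -/
def K (n : ℕ) : Type := FractionRing (MvPolynomial (Fin n) ℂ)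

instance (n : ℕ) : Field (K n) :=
  inferInstanceAs (Field (FractionRing (MvPolynomial (Fin n) ℂ)))

instance (n : ℕ) : Algebra (MvPolynomial (Fin n) ℂ) (K n) :=
  inferInstanceAs (Algebra _ (FractionRing (MvPolynomial (Fin n) ℂ)))

instance (n : ℕ) : IsFractionRing (MvPolynomial (Fin n) ℂ) (K n) :=
  inferInstanceAs (IsFractionRing _ (FractionRing (MvPolynomial (Fin n) ℂ)))

instance (n : ℕ) : Algebra ℂ (K n) :=
  inferInstanceAs (Algebra ℂ (FractionRing (MvPolynomial (Fin n) ℂ)))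

instance (n : ℕ) : IsScalarTower ℂ (MvPolynomial (Fin n) ℂ) (K n) :=
  inferInstanceAs (IsScalarTower ℂ _ (FractionRing (MvPolynomial (Fin n) ℂ)))

/-- The variable `z_j`. -/
def z {n : ℕ} (j : Fin n) : K n := algebraMap (MvPolynomial (Fin n) ℂ) (K n) (MvPolynomial.X j)

/-- Sequences of polynomials, the `l`-th one in the variables `X_1, …, X_l` over `K_n`. -/
abbrev V (n : ℕ) : Type := (l : ℕ) → MvPolynomial (Fin l) (K n)

/-- Skew-symmetric polynomials. -/
def IsSkew {l : ℕ} {R : Type*} [CommRing R] (P : MvPolynomial (Fin l) R) : Prop :=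
  ∀ σ : Equiv.Perm (Fin l), MvPolynomial.rename σ P = ((Equiv.Perm.sign σ : ℤˣ) : ℤ) • P

/-- The degree in each of the variables is at most `n - 1`. -/
def DegLT (n : ℕ) {l : ℕ} {R : Type*} [CommRing R] (P : MvPolynomial (Fin l) R) : Prop :=
  ∀ s ∈ P.support, ∀ i, s i < n

/-- `A_n = ⊕_l A_{n,l}`, where `A_{n,l}` is the space of skew-symmetric polynomials in
`X_1, …, X_l` over `K_n` of degree at most `n - 1` in each variable.  Since `A_{n,l} = 0` for
`l > n`, the product over all `l` is the direct sum over `0 ≤ l ≤ n`. -/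
def A (n : ℕ) : Submodule (K n) (V n) where
  carrier := {P | ∀ l, IsSkew (P l) ∧ DegLT n (P l)}
  zero_mem' := by
    intro l
    refine ⟨fun σ => by simp, fun s hs => by simp at hs⟩
  add_mem' := by
    intro P Q hP hQ l
    refine ⟨fun σ => ?_, fun s hs i => ?_⟩
    · simp only [Pi.add_apply, map_add, (hP l).1 σ, (hQ l).1 σ, smul_add]
    · classical
      rcases Finset.mem_union.mp (MvPolynomial.support_add hs) with h | h
      · exact (hP l).2 s h i
      · exact (hQ l).2 s h i
  smul_mem' := by
    intro c P hP l
    refine ⟨fun σ => ?_, fun s hs i => ?_⟩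
    · simp only [Pi.smul_apply, map_smul, (hP l).1 σ]
      exact smul_comm _ _ _
    · exact (hP l).2 s (MvPolynomial.support_smul hs) i

/-! ## Formulas for the action

The right hand sides of the formulas are written in a field `B` containing the coefficient field
`k`, for elements `zs` (the variables `z_1, …, z_n`), `Xs` (the variables `X_1, …, X_l`) and `t`
of `B`. -/

section Formulas

/-- `Θ_n(x) = ∏_j (1 - z_j x)`. -/
def Th {B : Type*} [Field B] {n : ℕ} (zs : Fin n → B) (x : B) : B := ∏ j, (1 - zs j * x)

/-- `Θ_n(x, y) = Θ_n(x) Θ_n(y) - Θ_n(-x) Θ_n(-y)`. -/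
def Th2 {B : Type*} [Field B] {n : ℕ} (zs : Fin n → B) (x y : B) : B :=
  Th zs x * Th zs y - Th zs (-x) * Th zs (-y)

/-- `F_n(t | x)`. -/
def F {B : Type*} [Field B] {n : ℕ} (zs : Fin n → B) (t x : B) : B :=
  t / (2 * (x - t)) * (Th2 zs t (-x) / Th zs t)

/-- `F^{(2)}_n(t | x, y)`. -/
def F2 {B : Type*} [Field B] {n : ℕ} (zs : Fin n → B) (t x y : B) : B :=
  t / (x + t) * (t / (y + t)) * ((x - y) / (x + y)) * Th2 zs x y
    + t / (x - t) * (t / (y + t)) * (Th zs (-y) / Th zs t) * Th2 zs t (-x)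
    - t / (y - t) * (t / (x + t)) * (Th zs (-x) / Th zs t) * Th2 zs t (-y)

/-- The polynomial `Θ_n(-u) Θ_n(u) (u - t)` in `u`. -/
def resDenom {B : Type*} [Field B] {n : ℕ} (zs : Fin n → B) (t : B) : Polynomial B :=
  (∏ j, (1 + Polynomial.C (zs j) * Polynomial.X)) * (∏ j, (1 - Polynomial.C (zs j) * Polynomial.X))
    * (Polynomial.X - Polynomial.C t)

variable {k B : Type*} [Field k] [Field B] [Algebra k B] {n l : ℕ}

/-- `P ↦ P(v_1, …, v_m)`. -/
def ev {m : ℕ} (v : Fin m → B) : MvPolynomial (Fin m) k →ₗ[k] B := (MvPolynomial.aeval v).toLinearMap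

/-- `P ↦ F_n(t) ∧ P`. -/
def formXm (zs : Fin n → B) (t : B) (Xs : Fin (l + 1) → B) : MvPolynomial (Fin l) k →ₗ[k] B :=
  ((l.factorial : B)⁻¹) • ∑ σ : Equiv.Perm (Fin (l + 1)),
    ((((Equiv.Perm.sign σ : ℤˣ) : ℤ) : B) * F zs t (Xs (σ 0))) •
      ev fun i : Fin l => Xs (σ i.succ)

/-- `P ↦ F^{(2)}_n(t) ∧ P`. -/
def formXm2 (zs : Fin n → B) (t : B) (Xs : Fin (l + 2) → B) : MvPolynomial (Fin l) k →ₗ[k] B :=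
  ((2 * l.factorial : B)⁻¹) • ∑ σ : Equiv.Perm (Fin (l + 2)),
    ((((Equiv.Perm.sign σ : ℤˣ) : ℤ) : B) * F2 zs t (Xs (σ 0)) (Xs (σ 1))) •
      ev fun i : Fin l => Xs (σ i.succ.succ)

/-- `P ↦ Θ_n(t)⁻¹ P(X_1, …, X_l, t)`. -/
def formXp (zs : Fin n → B) (t : B) (Xs : Fin l → B) : MvPolynomial (Fin (l + 1)) k →ₗ[k] B :=
  (1 / Th zs t) • ev (Fin.snoc Xs t : Fin (l + 1) → B)

/-- `P ↦ ∑_a res_{u = 1/z_a} P(X_1, …, X_l, -u, u) / (Θ_n(-u) Θ_n(u)) du / (u - t)`.  The residue of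
`N(u) du / D(u)` at a simple zero `u₀` of `D` is `N(u₀) / D'(u₀)`; here
`N(u) = P(X_1, …, X_l, -u, u)` and `D(u) = Θ_n(-u) Θ_n(u) (u - t)`. -/
def formXp2 (zs : Fin n → B) (t : B) (Xs : Fin l → B) : MvPolynomial (Fin (l + 2)) k →ₗ[k] B :=
  ∑ a : Fin n, ((resDenom zs t).derivative.eval (zs a)⁻¹)⁻¹ •
    ev (Fin.snoc (Fin.snoc Xs (-(zs a)⁻¹) : Fin (l + 1) → B) (zs a)⁻¹ : Fin (l + 2) → B)

/-- `P ↦ a_+(t).P`. -/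
def formAp (zs : Fin n → B) (t : B) (Xs : Fin l → B) : MvPolynomial (Fin l) k →ₗ[k] B :=
  (∑ j, zs j * t / (1 - zs j * t)) • ev Xs
    + ∑ p : Fin l,
      ((t / (Xs p - t)) • ((Th zs (Xs p) / Th zs t) • ev (Function.update Xs p t) - ev Xs)
        + (-t / (Xs p - -t)) •
          ((Th zs (Xs p) / Th zs (-t)) • ev (Function.update Xs p (-t)) - ev Xs))

/-- `P ↦ a_-(t).P`. -/
def formAm (zs : Fin n → B) (t : B) (Xs : Fin l → B) : MvPolynomial (Fin l) k →ₗ[k] B :=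
  -((∑ j, 1 / (1 - zs j * t)) • ev Xs)
    - ∑ p : Fin l,
      ((t / (Xs p - t)) •
          ((Th zs (Xs p) / Th zs t) • ev (Function.update Xs p t) - (Xs p / t) • ev Xs)
        + (-t / (Xs p - -t)) •
          ((Th zs (Xs p) / Th zs (-t)) • ev (Function.update Xs p (-t)) - (Xs p / -t) • ev Xs))

end Formulas

/-! ## Expansion in `t` -/

/-- Laurent series over `K_n`. -/
def L (n : ℕ) : Type := LaurentSeries (K n)

instance (n : ℕ) : Field (L n) := inferInstanceAs (Field (LaurentSeries (K n)))

instance (n : ℕ) : Algebra (K n) (L n) :=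
  (HahnSeries.instAlgebra : Algebra (K n) (HahnSeries ℤ (K n)))

/-- The element `t`, as a Laurent series in `t` (expansion at `0`) or in `t⁻¹` (expansion
at `∞`). -/
def tau (n : ℕ) : Side → L n
  | Side.zero => (HahnSeries.single 1 1 : LaurentSeries (K n))
  | Side.inf => (HahnSeries.single (-1) 1 : LaurentSeries (K n))

/-- Laurent series in the parameter `w`, where `w = t` or `w = t⁻¹`: the coefficient of `t^k`. -/
def tCoeff (n : ℕ) (e : Side) (k : ℤ) : L n →ₗ[K n] K n where
  toFun f := HahnSeries.coeff (Γ := ℤ) (R := K n) f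
    (match e with
      | Side.zero => k
      | Side.inf => -k)
  map_add' _ _ := rfl
  map_smul' c f := HahnSeries.coeff_smul (Γ := ℤ) (V := K n) (r := c) (x := f)

/-- The field of rational functions in `X_1, …, X_l` over the Laurent series; the right hand sides
of the formulas for the action are computed there. -/
def B (n l : ℕ) : Type := FractionRing (MvPolynomial (Fin l) (L n))

instance (n l : ℕ) : Field (B n l) :=
  inferInstanceAs (Field (FractionRing (MvPolynomial (Fin l) (L n))))

instance (n l : ℕ) : Algebra (MvPolynomial (Fin l) (L n)) (B n l) :=
  inferInstanceAs (Algebra _ (FractionRing (MvPolynomial (Fin l) (L n))))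

instance (n l : ℕ) : IsFractionRing (MvPolynomial (Fin l) (L n)) (B n l) :=
  inferInstanceAs (IsFractionRing _ (FractionRing (MvPolynomial (Fin l) (L n))))

instance (n l : ℕ) : Algebra (L n) (B n l) :=
  inferInstanceAs (Algebra (L n) (FractionRing (MvPolynomial (Fin l) (L n))))

instance (n l : ℕ) : IsScalarTower (L n) (MvPolynomial (Fin l) (L n)) (B n l) :=
  inferInstanceAs (IsScalarTower (L n) _ (FractionRing (MvPolynomial (Fin l) (L n))))

instance (n l : ℕ) : Algebra (K n) (B n l) :=
  ((algebraMap (L n) (B n l)).comp (algebraMap (K n) (L n))).toAlgebra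

instance (n l : ℕ) : IsScalarTower (K n) (L n) (B n l) := IsScalarTower.of_algebraMap_eq' rfl

/-- The variables `X_i` in `B n l`. -/
def X (n l : ℕ) (i : Fin l) : B n l :=
  algebraMap (MvPolynomial (Fin l) (L n)) (B n l) (MvPolynomial.X i)

/-- The element `t` of `B n l`. -/
def tB (n l : ℕ) (e : Side) : B n l := algebraMap (L n) (B n l) (tau n e)

/-- The variables `z_j` in `B n l`. -/
def zB (n l : ℕ) (j : Fin n) : B n l := algebraMap (K n) (B n l) (z j)

theorem exists_toPoly (n l : ℕ) :
    ∃ f : B n l →ₗ[L n] MvPolynomial (Fin l) (L n),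
      f ∘ₗ (IsScalarTower.toAlgHom (L n) (MvPolynomial (Fin l) (L n)) (B n l)).toLinearMap
        = LinearMap.id := by
  apply LinearMap.exists_leftInverse_of_injective
  rw [LinearMap.ker_eq_bot]
  exact IsFractionRing.injective (MvPolynomial (Fin l) (L n)) (B n l)

/-- A linear map that sends a rational function which is a polynomial in `X_1, …, X_l` to that
polynomial; below it is only applied to such elements, for which the choice is irrelevant. -/
def toPoly (n l : ℕ) : B n l →ₗ[L n] MvPolynomial (Fin l) (L n) := (exists_toPoly n l).choose

theorem toPoly_algebraMap (n l : ℕ) (p : MvPolynomial (Fin l) (L n)) :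
    toPoly n l (algebraMap _ (B n l) p) = p :=
  LinearMap.congr_fun (exists_toPoly n l).choose_spec p

/-- The coefficient of `t^k`, taken in every coefficient of a polynomial. -/
def coeffPoly (n l : ℕ) (e : Side) (k : ℤ) :
    MvPolynomial (Fin l) (L n) →ₗ[K n] MvPolynomial (Fin l) (K n) where
  toFun p := AddMonoidAlgebra.map (tCoeff n e k).toAddMonoidHom p
  map_add' p p' := by
    ext m
    simp [MvPolynomial.coeff]
  map_smul' c p := by
    ext m
    simp [MvPolynomial.coeff]

/-- The coefficient of `t^k` in the expansion of an element of `B n l` which is a polynomial in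
`X_1, …, X_l`. -/
def coeffT (n l : ℕ) (e : Side) (k : ℤ) : B n l →ₗ[K n] MvPolynomial (Fin l) (K n) :=
  coeffPoly n l e k ∘ₗ (toPoly n l).restrictScalars (K n)

/-- A family of maps preserving the number of variables. -/
def keep {n : ℕ} (f : (l : ℕ) → MvPolynomial (Fin l) (K n) →ₗ[K n] MvPolynomial (Fin l) (K n)) :
    Module.End (K n) (V n) :=
  LinearMap.pi fun l => f l ∘ₗ LinearMap.proj l

/-- A family of maps raising the number of variables by one. -/
def up1 {n : ℕ}
    (f : (l : ℕ) → MvPolynomial (Fin l) (K n) →ₗ[K n] MvPolynomial (Fin (l + 1)) (K n)) :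
    Module.End (K n) (V n) :=
  LinearMap.pi fun l =>
    match l with
    | 0 => 0
    | l + 1 => f l ∘ₗ LinearMap.proj l

/-- A family of maps raising the number of variables by two. -/
def up2 {n : ℕ}
    (f : (l : ℕ) → MvPolynomial (Fin l) (K n) →ₗ[K n] MvPolynomial (Fin (l + 2)) (K n)) :
    Module.End (K n) (V n) :=
  LinearMap.pi fun l =>
    match l with
    | 0 => 0
    | 1 => 0
    | l + 2 => f l ∘ₗ LinearMap.proj l

/-- A family of maps lowering the number of variables by `r`; polynomials in fewer than `r`
variables are sent to `0`. -/
def down {n : ℕ} (r : ℕ)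
    (f : (l : ℕ) → MvPolynomial (Fin (l + r)) (K n) →ₗ[K n] MvPolynomial (Fin l) (K n)) :
    Module.End (K n) (V n) :=
  LinearMap.pi fun l => f l ∘ₗ LinearMap.proj (l + r)

/-- The square root `i = √-1` in `K_n`. -/
def iK (n : ℕ) : K n := algebraMap ℂ (K n) Complex.I

/-- The side on which `x^±_k` is read off. -/
def sideOf (s : ℤˣ) (k : ℤ) : Side := if start s ≤ k then Side.zero else Side.inf

/-- The sign `1` for the expansion at `0` and `-1` for the expansion at `∞`. -/
def sideSign : Side → ℤ
  | Side.zero => 1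
  | Side.inf => -1

/-- The action of the generators.  The coefficient of `t^k` in a half current is
`q^{-k} x^±_k = i^{-k} x^±_k`, and likewise for the divided squares. -/
def UGen.op (n : ℕ) : UGen → Module.End (K n) (V n)
  | .t s => keep fun l => iK n ^ ((s : ℤ) * ((n : ℤ) - 2 * (l : ℤ))) • LinearMap.id
  | .a m _ => keep fun l =>
      if 0 < m then
        coeffT n l Side.zero m ∘ₗ formAp (zB n l) (tB n l Side.zero) (X n l)
      else
        coeffT n l Side.inf m ∘ₗ formAm (zB n l) (tB n l Side.inf) (X n l)
  | .x s k =>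
      let e := sideOf s k
      if s = 1 then
        ((sideSign e : K n) * iK n ^ k * (iK n ^ (1 - (n : ℤ)))⁻¹) •
          down 1 fun l => coeffT n l e k ∘ₗ formXp (zB n l) (tB n l e) (X n l)
      else
        ((sideSign e : K n) * iK n ^ k) •
          up1 fun l => coeffT n (l + 1) e k ∘ₗ formXm (zB n (l + 1)) (tB n (l + 1) e) (X n (l + 1))
  | .xx s e N =>
      if s = 1 then
        (iK n ^ N * (iK n * (-1) ^ (n + 1))⁻¹) •
          down 2 fun l => coeffT n l e N ∘ₗ formXp2 (zB n l) (tB n l e) (X n l)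
      else
        (iK n ^ N * (-4 * iK n)⁻¹) •
          up2 fun l =>
            coeffT n (l + 2) e N ∘ₗ formXm2 (zB n (l + 2)) (tB n (l + 2) e) (X n (l + 2))

/-- The operator given by a noncommutative polynomial in the generators. -/
def Expr.op (n : ℕ) : Expr →ₐ[ℂ] Module.End (K n) (V n) := FreeAlgebra.lift ℂ (UGen.op n)

/-- A family of actions of `U_{√-1}` on the spaces `A_n` in which the generators act by the given
formulas. -/
def IsAction (ρ : (n : ℕ) → Ui →ₐ[ℂ] Module.End (K n) (A n)) : Prop :=
  ∀ (n : ℕ) (γ : UGen) (P : A n), ((ρ n γ.toUi P : A n) : V n) = UGen.op n γ (P : V n)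

/-! ## Deformed cycles, links and `∞`-cycles -/

/-- Symmetric Laurent polynomials in `z_1, …, z_n`. -/
def IsSymmLaurent {n : ℕ} (r : K n) : Prop :=
  ∃ (N : ℕ) (p : MvPolynomial (Fin n) ℂ), p.IsSymmetric ∧
    r * (∏ j, z j) ^ N = algebraMap (MvPolynomial (Fin n) ℂ) (K n) p

/-- `P ∈ Ĉ_{n,l}`: a skew-symmetric polynomial of degree at most `n - 1` in each variable whose
coefficients are symmetric Laurent polynomials. -/
def IsDeformedCycle (n l : ℕ) (P : MvPolynomial (Fin l) (K n)) : Prop :=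
  IsSkew P ∧ DegLT n P ∧ ∀ s, IsSymmLaurent (P.coeff s)

/-- The ring of Laurent polynomials `ℂ[z_1^{±1}, …, z_n^{±1}]`. -/
abbrev Lau (n : ℕ) : Type :=
  Localization.Away (∏ j : Fin n, (MvPolynomial.X j : MvPolynomial (Fin n) ℂ))

/-- The inclusion of Laurent polynomials into rational functions. -/
def lauToK (n : ℕ) : Lau n →+* K n :=
  IsLocalization.Away.lift (∏ j : Fin n, (MvPolynomial.X j : MvPolynomial (Fin n) ℂ))
    (g := algebraMap (MvPolynomial (Fin n) ℂ) (K n)) (by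
      rw [isUnit_iff_ne_zero, Ne, IsFractionRing.to_map_eq_zero_iff, Finset.prod_eq_zero_iff]
      rintro ⟨j, -, hj⟩
      exact MvPolynomial.X_ne_zero j hj)

/-- The field `ℂ(z_1, …, z_n, z)`, as `K_n(z)`. -/
abbrev Kz (n : ℕ) : Type := RatFunc (K n)

/-- The values of the variables under `z_{n+1} = z`, `z_{n+2} = -z`. -/
def specVals (n : ℕ) : Fin (n + 2) → Kz n :=
  Fin.snoc (Fin.snoc (fun j : Fin n => RatFunc.C (z j)) RatFunc.X : Fin (n + 1) → Kz n)
    (-RatFunc.X)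

theorem specVals_ne_zero (n : ℕ) (j : Fin (n + 2)) : specVals n j ≠ 0 := by
  induction j using Fin.lastCases with
  | last => simp [specVals, RatFunc.X_ne_zero]
  | cast j =>
    induction j using Fin.lastCases with
    | last => simp [specVals, RatFunc.X_ne_zero]
    | cast j =>
      simp only [specVals, Fin.snoc_castSucc]
      rw [Ne, map_eq_zero, z, IsFractionRing.to_map_eq_zero_iff]
      exact MvPolynomial.X_ne_zero j

/-- The specialization `z_{n+1} = z`, `z_{n+2} = -z` of Laurent polynomials. -/
def spec (n : ℕ) : Lau (n + 2) →+* Kz n :=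
  IsLocalization.Away.lift (∏ j : Fin (n + 2), (MvPolynomial.X j : MvPolynomial (Fin (n + 2)) ℂ))
    (g := MvPolynomial.eval₂Hom (RatFunc.C.comp (algebraMap ℂ (K n))) (specVals n)) (by
      rw [isUnit_iff_ne_zero, map_prod, Finset.prod_ne_zero_iff]
      intro j _
      simpa using specVals_ne_zero n j)

/-- `(P, P')` with `P ∈ Ĉ_{n,l}`, `P' ∈ Ĉ_{n+2,l+1}` is a link:
`P'(X_1, …, X_l, z⁻¹ | z_1, …, z_n, z, -z) = z^{-n-1} ∏_a (1 - X_a² z²) · P(X_1, …, X_l)`.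
Here `Q` is `P'` with its coefficients viewed as Laurent polynomials. -/
def IsLink (n l : ℕ) (P : MvPolynomial (Fin l) (K n))
    (P' : MvPolynomial (Fin (l + 1)) (K (n + 2))) : Prop :=
  IsDeformedCycle n l P ∧ IsDeformedCycle (n + 2) (l + 1) P' ∧
    ∃ Q : MvPolynomial (Fin (l + 1)) (Lau (n + 2)), MvPolynomial.map (lauToK (n + 2)) Q = P' ∧
      MvPolynomial.eval₂ ((MvPolynomial.C : Kz n →+* MvPolynomial (Fin l) (Kz n)).comp (spec n))
          (Fin.snoc MvPolynomial.X (MvPolynomial.C RatFunc.X⁻¹) :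
            Fin (l + 1) → MvPolynomial (Fin l) (Kz n)) Q
        = MvPolynomial.C ((RatFunc.X⁻¹ : Kz n) ^ (n + 1))
          * (∏ a : Fin l, (1 - MvPolynomial.X a ^ 2 * MvPolynomial.C (RatFunc.X ^ 2)))
          * MvPolynomial.map (RatFunc.C : K n →+* Kz n) P

/-- The element `P` has a component in `l` variables only. -/
def Pure {n : ℕ} (l : ℕ) (P : V n) : Prop := ∀ k, k ≠ l → P k = 0

/-- Links for arbitrary elements: all components are deformed cycles, and the components in `l` and
in `l + 1` variables form a link for every `l`. -/
def IsLinkPair (n : ℕ) (P : V n) (P' : V (n + 2)) : Prop :=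
  IsDeformedCycle (n + 2) 0 (P' 0) ∧ ∀ l, IsLink n l (P l) (P' (l + 1))

/-- `p` is an `∞`-cycle of weight `m`: a sequence of deformed cycles `P_{n,l} ∈ Ĉ_{n,l}`, indexed by
`n, l ≥ 0` with `n - 2l = m`, such that all `(P_{n,l}, P_{n+2,l+1})` are links. -/
def IsInfCycle (m : ℤ) (p : (n : ℕ) → V n) : Prop :=
  ∀ n l : ℕ,
    ((n : ℤ) - 2 * (l : ℤ) ≠ m → p n l = 0) ∧
    ((n : ℤ) - 2 * (l : ℤ) = m →
      IsDeformedCycle n l (p n l) ∧ IsLink n l (p n l) (p (n + 2) (l + 1)))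

/-- The space of `∞`-cycles: the sum over all weights `m` of the spaces of `∞`-cycles of
weight `m`. -/
def InfCycles : Submodule ℂ ((n : ℕ) → V n) :=
  Submodule.span ℂ {p | ∃ m : ℤ, IsInfCycle m p}

end LoopSl2

end

open scoped BigOperators

noncomputable section

set_option linter.unusedSectionVars false

/-! Links are stable under sums, complex multiples and iterated operators, so everything reduces to
two facts: each generator preserves links, and every element of `Ui` is the value of a
noncommutative polynomial in the generators (`toUi_surjective`).

Links. Adjoining the pair z, -z multiplies Θ(x) by 1 - x²z², which is even in x (`Th_addPair`).
Hence F and F^{(2)} acquire one factor 1 - x²z² for each of their variables, the factor belonging to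
t cancels, and they vanish at x = z⁻¹. In a wedge product only those terms survive in which z⁻¹ is
an argument of P', and the acquired factors complete the ones supplied by the link of P and P'
(`gXm_link`, `gXm2_link`). For x⁺ the factor 1 - t²z² cancels against Θ(t), and exchanging t with
z⁻¹ gives a sign that i^{1-n} compensates (`gXp_link`). For a_± the summand of the variable z⁻¹
cancels the two new terms of the sum over j (`gAp_link`, `gAm_link`).

Coefficients. The formulas live in a field of rational functions, while the conclusions concern
coefficients of powers of t. The bridge is `Represents`: a polynomial over Laurent series in t with
Laurent polynomials in the z_j as coefficients, whose values in all fields, at arguments in general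
position, are given by the formula. It exists because the apparent denominators divide out and Θ(t)
is inverted by geometric series. Evaluating it at generic points, also after a permutation or a
specialization of the z_j, gives skew-symmetry, symmetry and the link relation; all three pass to
the coefficients of t^k.

The divided square of x⁺ needs a separate argument. The coefficient of t^k is a constant times the
sum over a of z_a^k P(…, -z_a⁻¹, z_a⁻¹) / ∏_{j≠a}(1 - z_j²z_a⁻²), with apparent poles at z_a = ±z_b.
At z_a = z_b the residues cancel. At z_a = -z_b the numerators have to vanish, which is not true of
every element of Ĉ but follows from the link relation (`SpecEq.pairVanish_left`,
`SpecEq.pairVanish_right`); then the Vandermonde determinant of the z_a² divides the common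
numerator (`exists_map_eq_resSum`). In the link relation for the sums (`SpecEq.specEqOver_resSum`)
the summand of z vanishes by skew-symmetry, that of -z by a double zero, and the others match one by
one.

Generation. At q = i the only obstruction is [2] = 0, since [2j+1] and [2j]/[2] (j ≥ 1) have nonzero
values there. The square (x_k^±)²/[2] is recovered from a coefficient of the divided square of a
half current (`xDiv_two_mem_genSub`), and the binomial of length 2 in t₁ from a commutator of such
squares (`tBinom_zero_two_eq`). The remaining divided powers and binomials are products of these, up
to invertible scalars. -/

namespace LoopSl2

/-! ### Laurent series in t or t⁻¹, and the expansions of 1/(1 - zt) -/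

section Series

variable {R S : Type*} [CommRing R] [CommRing S]

/-- A ring homomorphism applied to all coefficients of a Laurent series. -/
def mapT (φ : R →+* S) : HahnSeries ℤ R →+* HahnSeries ℤ S where
  toFun x := x.map φ
  map_one' := by
    ext k
    by_cases h : k = 0 <;> simp [HahnSeries.coeff_one, h]
  map_zero' := by ext k; simp
  map_add' x y := by ext k; simp
  map_mul' x y := by
    have hx : (x.map φ).support ⊆ x.support := fun a ha h => ha (by simp [h])
    have hy : (y.map φ).support ⊆ y.support := fun a ha h => ha (by simp [h])
    ext k
    -- `φ` may kill coefficients and so shrink the supports. The product of the images is summed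
    -- over the support of `x` on the left; the terms then missing on the right are zero.
    rw [HahnSeries.map_coeff, HahnSeries.coeff_mul_left' x.isPWO_support hx,
      HahnSeries.coeff_mul, map_sum]
    simp only [map_mul, HahnSeries.map_coeff]
    symm
    refine Finset.sum_subset (fun a ha => ?_) fun a ha hna => ?_
    · rw [Finset.mem_antidiagonal] at ha ⊢
      exact ⟨ha.1, hy ha.2.1, ha.2.2⟩
    · rw [Finset.mem_antidiagonal] at ha hna
      have : (y.map φ).coeff a.2 = 0 := by
        by_contra h
        exact hna ⟨ha.1, h, ha.2.2⟩
      simp only [HahnSeries.map_coeff] at this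
      simp [this]

@[simp] theorem mapT_coeff (φ : R →+* S) (x : HahnSeries ℤ R) (k : ℤ) :
    (mapT φ x).coeff k = φ (x.coeff k) := rfl

@[simp] theorem mapT_C (φ : R →+* S) (r : R) :
    mapT φ (HahnSeries.C r) = HahnSeries.C (φ r) := by
  ext k
  by_cases h : k = 0 <;> simp [HahnSeries.C_apply, h]

variable (R) in
/-- The element `t` as a Laurent series over `R`. -/
def tauR : Side → HahnSeries ℤ R
  | Side.zero => HahnSeries.single 1 1
  | Side.inf => HahnSeries.single (-1) 1

@[simp] theorem mapT_tauR (φ : R →+* S) (e : Side) : mapT φ (tauR R e) = tauR S e := by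
  cases e <;> ext k <;> simp only [mapT_coeff, tauR, HahnSeries.coeff_single] <;> split_ifs <;>
    simp

/-- The exponent of the series parameter which belongs to `t ^ k`. -/
def expo : Side → ℤ → ℤ
  | Side.zero, k => k
  | Side.inf, k => -k

/-- The coefficient of `z ^ k * t ^ k` in the expansion of `1 / (1 - z t)`. -/
def geomSign : Side → ℤ → ℤ
  | Side.zero, k => if 0 ≤ k then 1 else 0
  | Side.inf, k => if k < 0 then -1 else 0

/-- The expansion of `1 / (1 - z t)`. -/
def geom (z : Rˣ) : Side → HahnSeries ℤ R
  | Side.zero => HahnSeries.ofPowerSeries ℤ R (PowerSeries.mk fun k => (z : R) ^ k)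
  | Side.inf => -(HahnSeries.single (1 : ℤ) ((z⁻¹ : Rˣ) : R) *
      HahnSeries.ofPowerSeries ℤ R (PowerSeries.mk fun k => ((z⁻¹ : Rˣ) : R) ^ k))

theorem one_sub_mul_geomSeries (r : R) :
    (1 - HahnSeries.single (1 : ℤ) r) *
      HahnSeries.ofPowerSeries ℤ R (PowerSeries.mk fun k => r ^ k) = 1 := by
  have h : (HahnSeries.single (1 : ℤ) r : HahnSeries ℤ R)
      = HahnSeries.ofPowerSeries ℤ R (PowerSeries.C r * PowerSeries.X) := by
    rw [map_mul, HahnSeries.ofPowerSeries_C, HahnSeries.ofPowerSeries_X, HahnSeries.C_apply,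
      HahnSeries.single_mul_single]
    simp
  rw [h, ← map_one (HahnSeries.ofPowerSeries ℤ R), ← map_sub, ← map_mul]
  congr 1
  ext k
  rw [sub_mul, one_mul, mul_assoc, map_sub, PowerSeries.coeff_C_mul, PowerSeries.coeff_mk]
  cases k with
  | zero => simp
  | succ k => rw [PowerSeries.coeff_succ_X_mul]; simp [PowerSeries.coeff_one, pow_succ']

/-- At `∞` the series parameter is w = t⁻¹ and 1 - zw⁻¹ = -zw⁻¹(1 - z⁻¹w), so the same geometric
series serves with z⁻¹w in place of zt. This uses that `z` is a unit, so the expansions stay inside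
Laurent polynomials. -/
theorem one_sub_mul_geom (z : Rˣ) (e : Side) :
    (1 - HahnSeries.C (z : R) * tauR R e) * geom z e = 1 := by
  cases e with
  | zero =>
    have : (HahnSeries.C (z : R) * tauR R Side.zero) = HahnSeries.single (1 : ℤ) (z : R) := by
      simp [tauR, HahnSeries.C_apply]
    rw [this]
    exact one_sub_mul_geomSeries _
  | inf =>
    have : (HahnSeries.C (z : R) * tauR R Side.inf) = HahnSeries.single (-1 : ℤ) (z : R) := by
      simp [tauR, HahnSeries.C_apply]
    rw [this, geom, mul_neg, ← mul_assoc, ← neg_mul, sub_mul, HahnSeries.single_mul_single, one_mul]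
    simp only [neg_add_cancel, Units.mul_inv]
    rw [neg_sub]
    exact one_sub_mul_geomSeries _

theorem geom_coeff (z : Rˣ) (e : Side) (k : ℤ) :
    (geom z e).coeff (expo e k) = (geomSign e k : R) * ((z ^ k : Rˣ) : R) := by
  cases e with
  | zero =>
    simp only [geom, expo, geomSign]
    split_ifs with h
    · obtain ⟨m, rfl⟩ := Int.eq_ofNat_of_zero_le h
      rw [show ((m : ℕ) : ℤ) = (m : ℤ) from rfl, HahnSeries.ofPowerSeries_apply_coeff]
      simp
    · rw [HahnSeries.ofPowerSeries_apply, HahnSeries.embDomain_of_notMem_range]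
      · simp
      · rintro ⟨m, hm⟩
        simp at hm
        omega
  | inf =>
    simp only [geom, expo, geomSign, HahnSeries.coeff_neg]
    rw [show -k = (-k - 1) + 1 by ring, HahnSeries.coeff_single_mul_add]
    split_ifs with h
    · obtain ⟨m, hm⟩ := Int.eq_ofNat_of_zero_le (show 0 ≤ -k - 1 by omega)
      rw [hm, HahnSeries.ofPowerSeries_apply_coeff]
      have hk : k = -((m : ℤ) + 1) := by omega
      subst hk
      rw [zpow_neg, ← inv_zpow, zpow_add, zpow_natCast, zpow_one, PowerSeries.coeff_mk]
      push_cast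
      ring
    · rw [HahnSeries.ofPowerSeries_apply, HahnSeries.embDomain_of_notMem_range]
      · simp
      · rintro ⟨m, hm⟩
        simp at hm
        omega

end Series

/-! ### The coefficient of t^k, taken in every coefficient of a polynomial -/

section Coeff

variable {R S : Type*} [CommRing R] [CommRing S] {σ τ : Type*}

/-- The coefficient of `t ^ k`, taken in every coefficient of a polynomial. -/
def cP (e : Side) (k : ℤ) : MvPolynomial σ (HahnSeries ℤ R) →+ MvPolynomial σ R where
  toFun p := AddMonoidAlgebra.map
    (HahnSeries.coeff.addMonoidHom (R := R) (expo e k)) p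
  map_zero' := by
    ext m
    simp [MvPolynomial.coeff]
  map_add' p p' := by
    ext m
    simp [MvPolynomial.coeff]

@[simp] theorem coeff_cP (e : Side) (k : ℤ) (p : MvPolynomial σ (HahnSeries ℤ R)) (m : σ →₀ ℕ) :
    (cP e k p).coeff m = (p.coeff m).coeff (expo e k) := by
  simp [cP, MvPolynomial.coeff, HahnSeries.coeff.addMonoidHom]

end Coeff

section CoeffExtraction

variable {R S : Type*} [CommRing R] [CommRing S] {σ τ : Type*}

theorem cP_map (φ : R →+* S) (e : Side) (k : ℤ) (p : MvPolynomial σ (HahnSeries ℤ R)) :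
    cP e k (MvPolynomial.map (mapT φ) p) = MvPolynomial.map φ (cP e k p) := by
  ext m
  simp [MvPolynomial.coeff_map]

theorem cP_C_mul_map_C (e : Side) (k : ℤ) (a : HahnSeries ℤ R) (q : MvPolynomial σ R) :
    cP e k (MvPolynomial.C a * MvPolynomial.map HahnSeries.C q)
      = MvPolynomial.C (a.coeff (expo e k)) * q := by
  ext m
  simp [MvPolynomial.coeff_C_mul, MvPolynomial.coeff_map, HahnSeries.C_apply,
    HahnSeries.coeff_mul_single_zero]

theorem cP_monomial (e : Side) (k : ℤ) (m : σ →₀ ℕ) (a : HahnSeries ℤ R) :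
    cP e k (MvPolynomial.monomial m a) = MvPolynomial.monomial m (a.coeff (expo e k)) := by
  classical
  ext m'
  rw [coeff_cP, MvPolynomial.coeff_monomial, MvPolynomial.coeff_monomial]
  split_ifs <;> simp

/-- Extraction of coefficients commutes with substitutions that do not involve `t`. -/
theorem cP_aeval (e : Side) (k : ℤ) (g : σ → MvPolynomial τ R)
    (p : MvPolynomial σ (HahnSeries ℤ R)) :
    cP e k (MvPolynomial.aeval (fun i => MvPolynomial.map HahnSeries.C (g i)) p)
      = MvPolynomial.aeval g (cP e k p) := by
  induction p using MvPolynomial.monomial_add_induction_on with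
  | C a =>
    rw [MvPolynomial.C_apply, cP_monomial, ← MvPolynomial.C_apply, ← MvPolynomial.C_apply]
    simpa using cP_C_mul_map_C e k a (1 : MvPolynomial τ R)
  | monomial_add m a f _ _ ih =>
    rw [map_add, map_add, ih, map_add, map_add, cP_monomial, MvPolynomial.aeval_monomial,
      MvPolynomial.aeval_monomial]
    congr 1
    have : (m.prod fun i j => MvPolynomial.map HahnSeries.C (g i) ^ j)
        = MvPolynomial.map (HahnSeries.C (Γ := ℤ)) (m.prod fun i j => g i ^ j) := by
      simp [Finsupp.prod, map_prod]
    rw [this]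
    exact cP_C_mul_map_C e k a _

/-- Extraction is linear over polynomials free of t. The factor in the link relation is of this kind
and can therefore be moved through it. -/
theorem cP_mul_map_C (e : Side) (k : ℤ) (p : MvPolynomial σ (HahnSeries ℤ R))
    (q : MvPolynomial σ R) :
    cP e k (p * MvPolynomial.map HahnSeries.C q) = cP e k p * q := by
  induction p using MvPolynomial.monomial_add_induction_on with
  | C a =>
    rw [cP_C_mul_map_C, show cP e k (MvPolynomial.C a) = MvPolynomial.C _ from cP_monomial e k 0 a]
  | monomial_add m a f _ _ ih =>
    rw [add_mul, map_add, ih, map_add, cP_monomial, add_mul]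
    congr 1
    have h1 : (MvPolynomial.monomial m a : MvPolynomial σ (HahnSeries ℤ R))
        = MvPolynomial.C a * MvPolynomial.map HahnSeries.C (MvPolynomial.monomial m (1 : R)) := by
      rw [MvPolynomial.map_monomial, map_one, MvPolynomial.C_mul_monomial, mul_one]
    rw [h1, mul_assoc, ← map_mul, cP_C_mul_map_C, ← mul_assoc, MvPolynomial.C_mul_monomial, mul_one]

theorem cP_rename (e : Side) (k : ℤ) (f : σ → τ) (p : MvPolynomial σ (HahnSeries ℤ R)) :
    cP e k (MvPolynomial.rename f p) = MvPolynomial.rename f (cP e k p) := by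
  have h := cP_aeval e k (fun i => (MvPolynomial.X (f i) : MvPolynomial τ R)) p
  simp only [MvPolynomial.map_X] at h
  rw [MvPolynomial.rename_eq_aeval, MvPolynomial.rename_eq_aeval]
  exact h

end CoeffExtraction

/-! ### Degrees in a single variable, and division by X_i - c -/

section Degree

variable {R S : Type*} [CommRing R] [CommRing S] {σ τ : Type*}

/-- The degree in the variable `i` is less than `n`. -/
def DegIn (i : σ) (n : ℕ) (p : MvPolynomial σ R) : Prop := ∀ s ∈ p.support, s i < n

theorem DegIn.add {i : σ} {n : ℕ} {p p' : MvPolynomial σ R} (h : DegIn i n p) (h' : DegIn i n p') :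
    DegIn i n (p + p') := by
  classical
  intro s hs
  rcases Finset.mem_union.mp (MvPolynomial.support_add hs) with hs | hs
  · exact h s hs
  · exact h' s hs

theorem degIn_zero (i : σ) (n : ℕ) : DegIn i n (0 : MvPolynomial σ R) := fun s hs => by simp at hs

theorem DegIn.sum {ι : Type*} {i : σ} {n : ℕ} {I : Finset ι} {p : ι → MvPolynomial σ R}
    (h : ∀ j ∈ I, DegIn i n (p j)) : DegIn i n (∑ j ∈ I, p j) :=
  Finset.sum_induction p (DegIn i n) (fun _ _ => DegIn.add) (degIn_zero i n) h

theorem DegIn.mul {i : σ} {n : ℕ} {p r : MvPolynomial σ R} (h : DegIn i n p)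
    (hr : MvPolynomial.degreeOf i r = 0) : DegIn i n (r * p) := by
  classical
  intro s hs
  obtain ⟨a, ha, b, hb, rfl⟩ := Finset.mem_add.mp (MvPolynomial.support_mul r p hs)
  have h1 := MvPolynomial.monomial_le_degreeOf i ha
  have h2 := h b hb
  simp only [Finsupp.add_apply]
  omega

theorem DegIn.neg {i : σ} {n : ℕ} {p : MvPolynomial σ R} (h : DegIn i n p) : DegIn i n (-p) := by
  intro s hs
  rw [MvPolynomial.support_neg] at hs
  exact h s hs

theorem DegIn.sub {i : σ} {n : ℕ} {p p' : MvPolynomial σ R} (h : DegIn i n p) (h' : DegIn i n p') :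
    DegIn i n (p - p') := sub_eq_add_neg p p' ▸ h.add h'.neg

theorem degIn_of_degreeOf_lt {i : σ} {n : ℕ} {p : MvPolynomial σ R}
    (h : MvPolynomial.degreeOf i p < n) : DegIn i n p := fun _ hs =>
  (MvPolynomial.monomial_le_degreeOf i hs).trans_lt h

theorem DegIn.rename {f : σ → τ} (hf : Function.Injective f) {i : σ} {n : ℕ}
    {p : MvPolynomial σ R} (h : DegIn i n p) : DegIn (f i) n (MvPolynomial.rename f p) := by
  classical
  intro s hs
  rw [MvPolynomial.support_rename_of_injective hf] at hs
  obtain ⟨u, hu, rfl⟩ := Finset.mem_image.mp hs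
  rw [Finsupp.mapDomain_apply hf]
  exact h u hu

theorem degreeOf_rename_of_notMem {f : σ → τ} {i : τ} (hi : ∀ j, f j ≠ i)
    (p : MvPolynomial σ R) : MvPolynomial.degreeOf i (MvPolynomial.rename f p) = 0 := by
  classical
  rw [← Nat.le_zero, MvPolynomial.degreeOf_le_iff]
  intro s hs
  obtain ⟨u, rfl, _⟩ := MvPolynomial.coeff_rename_ne_zero f p s (MvPolynomial.mem_support_iff.mp hs)
  rw [Finsupp.mapDomain_of_notMem_range _ _ ?_]
  rintro ⟨j, hj⟩
  exact hi j hj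

theorem DegIn.cP (e : Side) (k : ℤ) {i : σ} {n : ℕ} {p : MvPolynomial σ (HahnSeries ℤ R)}
    (h : DegIn i n p) : DegIn i n (cP e k p) := fun s hs => h s (by
  rw [MvPolynomial.mem_support_iff] at hs ⊢
  rintro h0
  exact hs (by simp [h0]))

/-- Division with remainder by `X_i - c`. -/
theorem X_sub_dvd_sub_aeval [DecidableEq σ] (i : σ) (c p : MvPolynomial σ R) :
    MvPolynomial.X i - c ∣ p - MvPolynomial.aeval (Function.update MvPolynomial.X i c) p := by
  -- Modulo `X_i - c` the substitution `X_i ↦ c` is the identity, since it is so on each variable.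
  rw [← Ideal.mem_span_singleton, ← Ideal.Quotient.eq]
  set I := Ideal.span {(MvPolynomial.X i - c : MvPolynomial σ R)}
  have h : (Ideal.Quotient.mkₐ R I).comp
      (MvPolynomial.aeval (Function.update MvPolynomial.X i c)) = Ideal.Quotient.mkₐ R I := by
    ext j
    simp only [AlgHom.comp_apply, MvPolynomial.aeval_X, Ideal.Quotient.mkₐ_eq_mk]
    rcases eq_or_ne j i with rfl | hj
    · rw [Function.update_self, eq_comm, Ideal.Quotient.eq]
      exact Ideal.mem_span_singleton_self _
    · rw [Function.update_of_ne hj]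
  exact (DFunLike.congr_fun h p).symm

theorem X_sub_dvd_of_aeval_eq_zero [DecidableEq σ] {i : σ} {c p : MvPolynomial σ R}
    (h : MvPolynomial.aeval (Function.update MvPolynomial.X i c) p = 0) :
    MvPolynomial.X i - c ∣ p := by
  have h' := X_sub_dvd_sub_aeval i c p
  rwa [h, sub_zero] at h'

theorem degIn_of_forall_aeval {n l : ℕ} {P : MvPolynomial (Fin l) R} :
    DegLT n P ↔ ∀ i, DegIn i n P := ⟨fun h i s hs => h s hs i, fun h s hs i => h i s hs⟩

end Degree

/-- Divisibility by a product of elements, each of which generates the kernel of a homomorphism to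
a domain. -/
theorem prod_dvd_of_ker {R ι : Type*} [CommRing R] [DecidableEq ι] (I : Finset ι) (d : ι → R)
    (D : ι → Type*) [∀ i, CommRing (D i)] [∀ i, IsDomain (D i)] (φ : ∀ i, R →+* D i)
    (hφ : ∀ i ∈ I, ∀ p, φ i p = 0 → d i ∣ p) (hd : ∀ i ∈ I, ∀ j ∈ I, i ≠ j → φ i (d j) ≠ 0)
    (p : R) (hp : ∀ i ∈ I, φ i p = 0) : ∏ i ∈ I, d i ∣ p := by
  induction I using Finset.induction_on with
  | empty => simp
  | insert i I hi ih =>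
    obtain ⟨r, hr⟩ := ih (fun j hj => hφ j (Finset.mem_insert_of_mem hj))
      (fun j hj k hk => hd j (Finset.mem_insert_of_mem hj) k (Finset.mem_insert_of_mem hk))
      (fun j hj => hp j (Finset.mem_insert_of_mem hj))
    -- Write `p` as the product of the earlier `d j` times `r`. The map `φ i` kills `p` but none of
    -- these `d j`, and its target is a domain, so it kills `r`. No unique factorization is needed.
    have h0 := hp i (Finset.mem_insert_self i I)
    rw [hr, map_mul, map_prod] at h0
    rcases mul_eq_zero.mp h0 with h | h
    · obtain ⟨j, hj, hj0⟩ := Finset.prod_eq_zero_iff.mp h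
      exact absurd hj0 (hd i (Finset.mem_insert_self i I) j (Finset.mem_insert_of_mem hj)
        (by rintro rfl; exact hi hj))
    · obtain ⟨u, hu⟩ := hφ i (Finset.mem_insert_self i I) r h
      rw [Finset.prod_insert hi, hr, hu]
      exact ⟨u, by ring⟩

/-! ### Laurent polynomials as coefficients of deformed cycles and links -/

section Laurent

variable {n : ℕ}

/-- The product of the variables. -/
abbrev varProd (n : ℕ) : MvPolynomial (Fin n) ℂ := ∏ j : Fin n, MvPolynomial.X j

theorem varProd_ne_zero : varProd n ≠ 0 :=
  Finset.prod_ne_zero_iff.mpr fun j _ => MvPolynomial.X_ne_zero j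

theorem powers_varProd_le : Submonoid.powers (varProd n) ≤ nonZeroDivisors _ :=
  powers_le_nonZeroDivisors_of_noZeroDivisors varProd_ne_zero

instance : IsDomain (Lau n) :=
  IsLocalization.isDomain_of_le_nonZeroDivisors (Lau n) (powers_varProd_le (n := n))

theorem algebraMap_lau_injective :
    Function.Injective (algebraMap (MvPolynomial (Fin n) ℂ) (Lau n)) :=
  IsLocalization.injective (Lau n) (powers_varProd_le (n := n))

theorem isUnit_algebraMap_X (j : Fin n) :
    IsUnit (algebraMap (MvPolynomial (Fin n) ℂ) (Lau n) (MvPolynomial.X j)) :=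
  isUnit_of_dvd_unit (map_dvd _ (Finset.dvd_prod_of_mem _ (Finset.mem_univ j)))
    (IsLocalization.Away.algebraMap_isUnit (S := Lau n) (varProd n))

/-- The variable `z_j` as a unit of the ring of Laurent polynomials. -/
def LZ (j : Fin n) : (Lau n)ˣ := (isUnit_algebraMap_X j).unit

theorem coe_LZ (j : Fin n) :
    ((LZ j : (Lau n)ˣ) : Lau n) = algebraMap (MvPolynomial (Fin n) ℂ) (Lau n) (MvPolynomial.X j) :=
  rfl

theorem lau_hom_ext {D : Type*} [CommRing D] {f g : Lau n →+* D}
    (h0 : ∀ c, f (algebraMap ℂ (Lau n) c) = g (algebraMap ℂ (Lau n) c))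
    (h : ∀ j : Fin n, f (LZ j) = g (LZ j)) : f = g := by
  apply IsLocalization.ringHom_ext (Submonoid.powers (varProd n))
  apply MvPolynomial.ringHom_ext
  · intro c
    simpa [IsScalarTower.algebraMap_apply ℂ (MvPolynomial (Fin n) ℂ) (Lau n)] using h0 c
  · exact h

/-- The homomorphism from Laurent polynomials given by units. -/
def lauHom {D : Type*} [CommRing D] (f : ℂ →+* D) (v : Fin n → Dˣ) : Lau n →+* D :=
  IsLocalization.Away.lift (varProd n) (g := MvPolynomial.eval₂Hom f fun j => (v j : D)) (by
    rw [map_prod]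
    simp only [MvPolynomial.eval₂Hom_X']
    rw [← Units.coe_prod]
    exact Units.isUnit _)

@[simp] theorem lauHom_algebraMap {D : Type*} [CommRing D] (f : ℂ →+* D) (v : Fin n → Dˣ)
    (p : MvPolynomial (Fin n) ℂ) :
    lauHom f v (algebraMap _ (Lau n) p) = MvPolynomial.eval₂ f (fun j => (v j : D)) p := by
  rw [lauHom, IsLocalization.Away.lift_eq]
  rfl

@[simp] theorem lauHom_C {D : Type*} [CommRing D] (f : ℂ →+* D) (v : Fin n → Dˣ) (c : ℂ) :
    lauHom f v (algebraMap ℂ (Lau n) c) = f c := by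
  rw [IsScalarTower.algebraMap_apply ℂ (MvPolynomial (Fin n) ℂ) (Lau n), lauHom_algebraMap]
  simp

@[simp] theorem lauHom_LZ {D : Type*} [CommRing D] (f : ℂ →+* D) (v : Fin n → Dˣ) (j : Fin n) :
    lauHom f v (LZ j) = v j := by
  rw [coe_LZ, lauHom_algebraMap]
  simp

theorem lauToK_algebraMap (p : MvPolynomial (Fin n) ℂ) :
    lauToK n (algebraMap _ (Lau n) p) = algebraMap _ (K n) p :=
  IsLocalization.Away.lift_eq ..

@[simp] theorem lauToK_LZ (j : Fin n) : lauToK n (LZ j) = z j := lauToK_algebraMap _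

@[simp] theorem lauToK_C (c : ℂ) : lauToK n (algebraMap ℂ (Lau n) c) = algebraMap ℂ (K n) c := by
  rw [IsScalarTower.algebraMap_apply ℂ (MvPolynomial (Fin n) ℂ) (Lau n), lauToK_algebraMap,
    ← IsScalarTower.algebraMap_apply]

@[simp] theorem spec_LZ (j : Fin (n + 2)) : spec n (LZ j) = specVals n j := by
  rw [coe_LZ, spec, IsLocalization.Away.lift_eq]
  simp

@[simp] theorem spec_C (c : ℂ) :
    spec n (algebraMap ℂ (Lau (n + 2)) c) = RatFunc.C (algebraMap ℂ (K n) c) := by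
  rw [IsScalarTower.algebraMap_apply ℂ (MvPolynomial (Fin (n + 2)) ℂ) (Lau (n + 2)), spec,
    IsLocalization.Away.lift_eq]
  simp

theorem algebraMap_K_injective :
    Function.Injective (algebraMap (MvPolynomial (Fin n) ℂ) (K n)) :=
  IsFractionRing.injective _ _

theorem z_ne_zero (j : Fin n) : (z j : K n) ≠ 0 := by
  rw [z, Ne, IsFractionRing.to_map_eq_zero_iff]
  exact MvPolynomial.X_ne_zero j

/-- Every Laurent polynomial is a polynomial up to a unit. -/
theorem lau_exists_mul (s : Lau n) : ∃ (N : ℕ) (p : MvPolynomial (Fin n) ℂ),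
    s * algebraMap _ (Lau n) (varProd n) ^ N = algebraMap _ (Lau n) p :=
  IsLocalization.Away.surj (varProd n) s

theorem isUnit_varProd : IsUnit (algebraMap (MvPolynomial (Fin n) ℂ) (Lau n) (varProd n)) :=
  IsLocalization.Away.algebraMap_isUnit _

theorem lauToK_injective : Function.Injective (lauToK n) := by
  rw [injective_iff_map_eq_zero]
  intro s hs
  obtain ⟨N, p, hp⟩ := lau_exists_mul s
  have h : algebraMap _ (K n) p = 0 := by
    rw [← lauToK_algebraMap, ← hp, map_mul, hs, zero_mul]
  rw [map_eq_zero_iff _ algebraMap_K_injective] at h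
  rw [h, map_zero] at hp
  exact (isUnit_varProd.pow N).mul_left_eq_zero.mp hp

/-- A permutation of the variables of Laurent polynomials. -/
def permLau (π : Equiv.Perm (Fin n)) : Lau n →+* Lau n :=
  lauHom (algebraMap ℂ (Lau n)) fun j => LZ (π j)

@[simp] theorem permLau_LZ (π : Equiv.Perm (Fin n)) (j : Fin n) :
    permLau π (LZ j) = LZ (π j) := lauHom_LZ ..

@[simp] theorem permLau_C (π : Equiv.Perm (Fin n)) (c : ℂ) :
    permLau π (algebraMap ℂ (Lau n) c) = algebraMap ℂ (Lau n) c := lauHom_C ..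

theorem permLau_algebraMap (π : Equiv.Perm (Fin n)) (p : MvPolynomial (Fin n) ℂ) :
    permLau π (algebraMap _ (Lau n) p) = algebraMap _ (Lau n) (MvPolynomial.rename π p) := by
  have h : (permLau π).comp (algebraMap (MvPolynomial (Fin n) ℂ) (Lau n))
      = (algebraMap (MvPolynomial (Fin n) ℂ) (Lau n)).comp
        (MvPolynomial.rename π : MvPolynomial (Fin n) ℂ →ₐ[ℂ] _).toRingHom := by
    apply MvPolynomial.ringHom_ext
    · intro c
      have := permLau_C π c
      rw [IsScalarTower.algebraMap_apply ℂ (MvPolynomial (Fin n) ℂ) (Lau n)] at this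
      simpa using this
    · intro j
      have := permLau_LZ π j
      rw [coe_LZ, coe_LZ] at this
      simpa using this
  exact RingHom.congr_fun h p

theorem rename_varProd (π : Equiv.Perm (Fin n)) : MvPolynomial.rename π (varProd n) = varProd n := by
  simp only [varProd, map_prod, MvPolynomial.rename_X]
  exact Equiv.prod_comp π fun j => (MvPolynomial.X j : MvPolynomial (Fin n) ℂ)

theorem permLau_varProd (π : Equiv.Perm (Fin n)) :
    permLau π (algebraMap _ (Lau n) (varProd n)) = algebraMap _ (Lau n) (varProd n) := by
  rw [permLau_algebraMap, rename_varProd]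

/-- The product of the variables is itself symmetric and invertible among Laurent polynomials, so
multiplying by its powers does not affect invariance, and symmetry of the numerator amounts to
invariance of the fraction. -/
theorem isSymmLaurent_iff {r : K n} :
    IsSymmLaurent r ↔ ∃ s : Lau n, lauToK n s = r ∧ ∀ π, permLau π s = s := by
  have hz : (∏ j, z j : K n) = lauToK n (algebraMap _ (Lau n) (varProd n)) := by
    rw [lauToK_algebraMap, map_prod]
    rfl
  constructor
  · rintro ⟨N, p, hp, hr⟩
    obtain ⟨u, hu⟩ := (isUnit_varProd (n := n)).pow N
    refine ⟨algebraMap _ (Lau n) p * (u⁻¹ : (Lau n)ˣ), ?_, fun π => ?_⟩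
    · rw [map_mul, lauToK_algebraMap, ← hr, hz, ← map_pow, ← hu, mul_assoc, ← map_mul]
      simp
    · rw [Units.eq_mul_inv_iff_mul_eq]
      conv_lhs => rw [hu, ← permLau_varProd π, ← map_pow, ← hu, ← map_mul]
      rw [mul_assoc, Units.inv_mul, mul_one, permLau_algebraMap, hp π]
  · rintro ⟨s, rfl, hs⟩
    obtain ⟨N, p, hp⟩ := lau_exists_mul s
    refine ⟨N, p, fun π => ?_, ?_⟩
    · apply algebraMap_lau_injective
      rw [← permLau_algebraMap, ← hp, map_mul, map_pow, permLau_varProd, hs]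
    · rw [hz, ← map_pow, ← map_mul, hp, lauToK_algebraMap]

/-- Skew-symmetric polynomials of degree less than `n` in each variable, with symmetric Laurent
polynomials as coefficients. -/
structure LD (n l : ℕ) (Q : MvPolynomial (Fin l) (Lau n)) : Prop where
  skew : IsSkew Q
  deg : DegLT n Q
  symm : ∀ π, MvPolynomial.map (permLau π) Q = Q

theorem map_isSkew {R S : Type*} [CommRing R] [CommRing S] {l : ℕ} (φ : R →+* S)
    {Q : MvPolynomial (Fin l) R} (h : IsSkew Q) : IsSkew (MvPolynomial.map φ Q) := by
  intro σ
  rw [← MvPolynomial.map_rename, h σ, map_zsmul]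

theorem isSkew_of_map {R S : Type*} [CommRing R] [CommRing S] {l : ℕ} {φ : R →+* S}
    (hφ : Function.Injective φ) {Q : MvPolynomial (Fin l) R}
    (h : IsSkew (MvPolynomial.map φ Q)) : IsSkew Q := by
  intro σ
  apply MvPolynomial.map_injective φ hφ
  rw [MvPolynomial.map_rename, h σ, map_zsmul]

/-- The coefficients are lifted one at a time and reassembled; since `lauToK` is injective,
skew-symmetry and the degree bound descend to the lift. -/
theorem isDeformedCycle_iff {l : ℕ} {P : MvPolynomial (Fin l) (K n)} :
    IsDeformedCycle n l P ↔ ∃ Q, MvPolynomial.map (lauToK n) Q = P ∧ LD n l Q := by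
  constructor
  · rintro ⟨h1, h2, h3⟩
    choose f hf hinv using fun s => isSymmLaurent_iff.mp (h3 s)
    have hQ : MvPolynomial.map (lauToK n) (∑ m ∈ P.support, MvPolynomial.monomial m (f m)) = P := by
      conv_rhs => rw [← MvPolynomial.support_sum_monomial_coeff P]
      rw [map_sum]
      exact Finset.sum_congr rfl fun m _ => by rw [MvPolynomial.map_monomial, hf]
    refine ⟨_, hQ, ?_, ?_, ?_⟩
    · exact isSkew_of_map lauToK_injective (by rw [hQ]; exact h1)
    · intro s hs i
      refine h2 s ?_ i
      rw [← hQ]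
      rw [MvPolynomial.mem_support_iff] at hs ⊢
      rw [MvPolynomial.coeff_map, Ne, map_eq_zero_iff _ lauToK_injective]
      exact hs
    · intro π
      rw [map_sum]
      exact Finset.sum_congr rfl fun m _ => by rw [MvPolynomial.map_monomial, hinv]
  · rintro ⟨Q, rfl, h1, h2, h3⟩
    refine ⟨map_isSkew _ h1, fun s hs => h2 s (MvPolynomial.support_map_subset _ _ hs), fun s => ?_⟩
    rw [isSymmLaurent_iff]
    refine ⟨Q.coeff s, (MvPolynomial.coeff_map _ _ _).symm, fun π => ?_⟩
    rw [← MvPolynomial.coeff_map, h3]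

/-- Substitution of a constant for the last variable. -/
def setLast {R : Type*} [CommRing R] {l : ℕ} (c : R) :
    MvPolynomial (Fin (l + 1)) R →ₐ[R] MvPolynomial (Fin l) R :=
  MvPolynomial.aeval (Fin.snoc MvPolynomial.X (MvPolynomial.C c) :
    Fin (l + 1) → MvPolynomial (Fin l) R)

/-- The factor `z^{-n-1} ∏_a (1 - X_a² z²)`. -/
def linkFactor {R : Type*} [CommRing R] (n l : ℕ) (c d : R) : MvPolynomial (Fin l) R :=
  MvPolynomial.C (d ^ (n + 1)) *
    ∏ a : Fin l, (1 - MvPolynomial.X a ^ 2 * MvPolynomial.C (c ^ 2))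

/-- The link relation for polynomials with Laurent polynomials as coefficients, for a specialization
`φ`, an inclusion `ι` and a value `x` of the variable `z` in an arbitrary field. -/
def SpecEqOver {S : Type} [Field S] (l : ℕ) (φ : Lau (n + 2) →+* S) (ι : Lau n →+* S) (x : S)
    (Q : MvPolynomial (Fin l) (Lau n)) (Q' : MvPolynomial (Fin (l + 1)) (Lau (n + 2))) : Prop :=
  setLast x⁻¹ (MvPolynomial.map φ Q') = linkFactor n l x x⁻¹ * MvPolynomial.map ι Q

/-- The link relation for polynomials with Laurent polynomials as coefficients. -/
def SpecEq (n l : ℕ) (Q : MvPolynomial (Fin l) (Lau n))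
    (Q' : MvPolynomial (Fin (l + 1)) (Lau (n + 2))) : Prop :=
  SpecEqOver l (spec n) ((RatFunc.C : K n →+* Kz n).comp (lauToK n)) RatFunc.X Q Q'

/-- The lift occurring in `IsLink` is unique by injectivity of `lauToK`, so it coincides with the
one that carries the properties of a deformed cycle. From here on links are handled with
coefficients in `Lau`. -/
theorem isLink_iff {l : ℕ} {P : MvPolynomial (Fin l) (K n)}
    {P' : MvPolynomial (Fin (l + 1)) (K (n + 2))} :
    IsLink n l P P' ↔ ∃ Q Q', MvPolynomial.map (lauToK n) Q = P ∧
      MvPolynomial.map (lauToK (n + 2)) Q' = P' ∧ LD n l Q ∧ LD (n + 2) (l + 1) Q' ∧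
      SpecEq n l Q Q' := by
  have key : ∀ Q : MvPolynomial (Fin l) (Lau n), ∀ Q', (MvPolynomial.eval₂
      ((MvPolynomial.C : Kz n →+* MvPolynomial (Fin l) (Kz n)).comp (spec n))
          (Fin.snoc MvPolynomial.X (MvPolynomial.C RatFunc.X⁻¹) :
            Fin (l + 1) → MvPolynomial (Fin l) (Kz n)) Q'
        = MvPolynomial.C ((RatFunc.X⁻¹ : Kz n) ^ (n + 1))
          * (∏ a : Fin l, (1 - MvPolynomial.X a ^ 2 * MvPolynomial.C (RatFunc.X ^ 2)))
          * MvPolynomial.map (RatFunc.C : K n →+* Kz n) (MvPolynomial.map (lauToK n) Q))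
      ↔ SpecEq n l Q Q' := by
    intro Q Q'
    rw [SpecEq, SpecEqOver, setLast, linkFactor, MvPolynomial.aeval_def, MvPolynomial.eval₂_map,
      MvPolynomial.map_map]
    rfl
  constructor
  · rintro ⟨h1, h2, Q', hQ', h⟩
    obtain ⟨Q, hQ, hd⟩ := isDeformedCycle_iff.mp h1
    obtain ⟨Q'', hQ'', hd'⟩ := isDeformedCycle_iff.mp h2
    obtain rfl : Q'' = Q' := MvPolynomial.map_injective _ lauToK_injective (hQ''.trans hQ'.symm)
    subst hQ
    exact ⟨Q, Q'', rfl, hQ', hd, hd', (key Q Q'').mp h⟩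
  · rintro ⟨Q, Q', rfl, rfl, hd, hd', h⟩
    exact ⟨isDeformedCycle_iff.mpr ⟨Q, rfl, hd⟩, isDeformedCycle_iff.mpr ⟨Q', rfl, hd'⟩, Q', rfl,
      (key Q Q').mpr h⟩

end Laurent

/-! ### Alternating sums and wedge products -/

section Alternation

variable {B : Type*} [Field B]

/-- A skew-symmetric function. -/
def IsSkewFn {l : ℕ} (e : (Fin l → B) → B) : Prop :=
  ∀ (σ : Equiv.Perm (Fin l)) v, e (v ∘ σ) = ((Equiv.Perm.sign σ : ℤˣ) : ℤ) * e v

/-- The alternating sum over all permutations of the arguments. -/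
def alt {m : ℕ} (h : (Fin m → B) → B) (v : Fin m → B) : B :=
  ∑ σ : Equiv.Perm (Fin m), (((Equiv.Perm.sign σ : ℤˣ) : ℤ) : B) * h (v ∘ σ)

theorem sign_mul_self {m : ℕ} (τ : Equiv.Perm (Fin m)) :
    ((((Equiv.Perm.sign τ : ℤˣ) : ℤ) : B) * ((Equiv.Perm.sign τ : ℤˣ) : ℤ)) = 1 := by
  rw [← Int.cast_mul, ← Units.val_mul, Int.units_mul_self]
  simp

/-- Reindexing by `σ ↦ τ * σ` turns the permutation of the arguments into a sign. -/
theorem alt_comp {m : ℕ} (h : (Fin m → B) → B) (v : Fin m → B) (τ : Equiv.Perm (Fin m)) :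
    alt h (v ∘ τ) = ((Equiv.Perm.sign τ : ℤˣ) : ℤ) * alt h v := by
  rw [alt, alt, Finset.mul_sum]
  refine Fintype.sum_equiv (Equiv.mulLeft τ) _ _ fun σ => ?_
  rw [Equiv.coe_mulLeft, Equiv.Perm.sign_mul, Units.val_mul, Int.cast_mul, ← mul_assoc,
    ← mul_assoc, sign_mul_self, one_mul, Equiv.Perm.coe_mul, Function.comp_assoc]

/-- A permutation of `Fin (m + 1)` from the image of `0` and a permutation of the rest. -/
def consPerm {m : ℕ} (p : Fin (m + 1) × Equiv.Perm (Fin m)) : Equiv.Perm (Fin (m + 1)) :=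
  p.1.cycleRange.symm * Equiv.Perm.decomposeFin.symm (0, p.2)

theorem consPerm_zero {m : ℕ} (p : Fin (m + 1) × Equiv.Perm (Fin m)) : consPerm p 0 = p.1 := by
  simp [consPerm, Fin.cycleRange_symm_zero]

theorem consPerm_succ {m : ℕ} (p : Fin (m + 1) × Equiv.Perm (Fin m)) (i : Fin m) :
    consPerm p i.succ = p.1.succAbove (p.2 i) := by
  simp [consPerm, Fin.cycleRange_symm_succ]

theorem sign_consPerm {m : ℕ} (p : Fin (m + 1) × Equiv.Perm (Fin m)) :
    Equiv.Perm.sign (consPerm p) = (-1) ^ (p.1 : ℕ) * Equiv.Perm.sign p.2 := by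
  rw [consPerm, Equiv.Perm.sign_mul, Equiv.Perm.sign_symm, Fin.sign_cycleRange,
    Equiv.Perm.decomposeFin.symm_sign]
  simp

theorem consPerm_bijective {m : ℕ} : Function.Bijective (consPerm (m := m)) := by
  rw [Fintype.bijective_iff_injective_and_card]
  refine ⟨fun p p' h => ?_, ?_⟩
  · have h1 : p.1 = p'.1 := by rw [← consPerm_zero, h, consPerm_zero]
    refine Prod.ext h1 (Equiv.ext fun i => ?_)
    have h2 := congrArg (fun σ => σ i.succ) h
    simp only [consPerm_succ, h1] at h2
    exact Fin.succAbove_right_injective h2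
  · rw [Fintype.card_prod, Fintype.card_fin, Fintype.card_perm, Fintype.card_perm,
      Fintype.card_fin, Fintype.card_fin, Nat.factorial_succ]

/-- The analogue of Laplace expansion: permutations are grouped by the argument `v p` they put
first, and `consPerm` has the sign (-1)^p times that of the remaining permutation. -/
theorem alt_succ {m : ℕ} (h : (Fin (m + 1) → B) → B) (v : Fin (m + 1) → B) :
    alt h v = ∑ p : Fin (m + 1), (-1) ^ (p : ℕ) *
      alt (fun w => h (Fin.cons (v p) w)) (v ∘ p.succAbove) := by
  rw [alt, ← (Equiv.ofBijective _ consPerm_bijective).sum_comp, Fintype.sum_prod_type]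
  refine Finset.sum_congr rfl fun p _ => ?_
  rw [alt, Finset.mul_sum]
  refine Finset.sum_congr rfl fun τ _ => ?_
  rw [Equiv.ofBijective_apply, sign_consPerm]
  have hv : v ∘ consPerm (p, τ) = Fin.cons (v p) ((v ∘ p.succAbove) ∘ τ) := by
    funext i
    refine Fin.cases ?_ (fun i => ?_) i
    · simp [consPerm_zero]
    · simp [consPerm_succ]
  rw [hv]
  push_cast
  ring

theorem alt_skew {m : ℕ} {e : (Fin m → B) → B} (he : IsSkewFn e) (v : Fin m → B) :
    alt e v = m.factorial * e v := by
  rw [alt]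
  simp_rw [he _ v, ← mul_assoc, sign_mul_self, one_mul]
  rw [Finset.sum_const, Finset.card_univ, Fintype.card_perm, Fintype.card_fin, nsmul_eq_mul]

theorem alt_mul_left {m : ℕ} (c : B) (h : (Fin m → B) → B) (v : Fin m → B) :
    alt (fun w => c * h w) v = c * alt h v := by
  rw [alt, alt, Finset.mul_sum]
  exact Finset.sum_congr rfl fun _ _ => by ring

/-- The wedge product with a function of one argument. -/
theorem wedge_one [CharZero B] {l : ℕ} (f : B → B) {e : (Fin l → B) → B} (he : IsSkewFn e)
    (v : Fin (l + 1) → B) :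
    (l.factorial : B)⁻¹ * alt (fun w => f (w 0) * e fun i => w i.succ) v
      = ∑ p : Fin (l + 1), (-1) ^ (p : ℕ) * (f (v p) * e (v ∘ p.succAbove)) := by
  rw [alt_succ, Finset.mul_sum]
  refine Finset.sum_congr rfl fun p _ => ?_
  simp only [Fin.cons_zero, Fin.cons_succ]
  rw [alt_mul_left, alt_skew he]
  have : (l.factorial : B) ≠ 0 := Nat.cast_ne_zero.mpr l.factorial_ne_zero
  field_simp

/-- The wedge product with a function of two arguments. -/
theorem wedge_two [CharZero B] {l : ℕ} (f : B → B → B) {e : (Fin l → B) → B} (he : IsSkewFn e)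
    (v : Fin (l + 2) → B) :
    (2 * l.factorial : B)⁻¹ * alt (fun w => f (w 0) (w 1) * e fun i => w i.succ.succ) v
      = 2⁻¹ * ∑ p : Fin (l + 2), (-1) ^ (p : ℕ) * ∑ r : Fin (l + 1), (-1) ^ (r : ℕ) *
        (f (v p) (v (p.succAbove r)) * e ((v ∘ p.succAbove) ∘ r.succAbove)) := by
  rw [alt_succ, mul_inv, mul_assoc, Finset.mul_sum]
  congr 1
  refine Finset.sum_congr rfl fun p _ => ?_
  simp only [Fin.cons_zero, Fin.cons_succ, Fin.cons_one]
  rw [mul_left_comm]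
  congr 1
  -- With the first argument frozen at `v p`, what remains is the wedge product with the function `f
  -- (v p)` of one argument.
  exact wedge_one (f (v p)) he (v ∘ p.succAbove)

end Alternation

/-! ### The formulas as functionals of an evaluation function; symmetry in the z_j -/

section Formulas

variable {B : Type*} [Field B] {n l : ℕ}

/-- `F_n(t) ∧ P`, for the evaluation function `e` of `P`. -/
def gXm (zs : Fin n → B) (t : B) (Xs : Fin (l + 1) → B) (e : (Fin l → B) → B) : B :=
  (l.factorial : B)⁻¹ * alt (fun w => F zs t (w 0) * e fun i => w i.succ) Xs

/-- `F^{(2)}_n(t) ∧ P`, for the evaluation function `e` of `P`. -/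
def gXm2 (zs : Fin n → B) (t : B) (Xs : Fin (l + 2) → B) (e : (Fin l → B) → B) : B :=
  (2 * l.factorial : B)⁻¹ * alt (fun w => F2 zs t (w 0) (w 1) * e fun i => w i.succ.succ) Xs

/-- `Θ_n(t)⁻¹ P(X_1, …, X_l, t)`, for the evaluation function `e` of `P`. -/
def gXp (zs : Fin n → B) (t : B) (Xs : Fin l → B) (e : (Fin (l + 1) → B) → B) : B :=
  1 / Th zs t * e (Fin.snoc Xs t)

/-- `a_+(t).P`, for the evaluation function `e` of `P`. -/
def gAp (zs : Fin n → B) (t : B) (Xs : Fin l → B) (e : (Fin l → B) → B) : B :=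
  (∑ j, zs j * t / (1 - zs j * t)) * e Xs
    + ∑ p : Fin l,
      ((t / (Xs p - t)) * ((Th zs (Xs p) / Th zs t) * e (Function.update Xs p t) - e Xs)
        + (-t / (Xs p - -t)) *
          ((Th zs (Xs p) / Th zs (-t)) * e (Function.update Xs p (-t)) - e Xs))

/-- `a_-(t).P`, for the evaluation function `e` of `P`. -/
def gAm (zs : Fin n → B) (t : B) (Xs : Fin l → B) (e : (Fin l → B) → B) : B :=
  -((∑ j, 1 / (1 - zs j * t)) * e Xs)
    - ∑ p : Fin l,
      ((t / (Xs p - t)) *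
          ((Th zs (Xs p) / Th zs t) * e (Function.update Xs p t) - (Xs p / t) * e Xs)
        + (-t / (Xs p - -t)) *
          ((Th zs (Xs p) / Th zs (-t)) * e (Function.update Xs p (-t)) - (Xs p / -t) * e Xs))

section Forms

variable {k : Type*} [Field k] [Algebra k B]

theorem formXm_apply (zs : Fin n → B) (t : B) (Xs : Fin (l + 1) → B) (P : MvPolynomial (Fin l) k) :
    formXm zs t Xs P = gXm zs t Xs fun v => MvPolynomial.aeval v P := by
  simp [formXm, gXm, ev, alt, LinearMap.sum_apply, mul_assoc]

theorem formXm2_apply (zs : Fin n → B) (t : B) (Xs : Fin (l + 2) → B)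
    (P : MvPolynomial (Fin l) k) :
    formXm2 zs t Xs P = gXm2 zs t Xs fun v => MvPolynomial.aeval v P := by
  simp [formXm2, gXm2, ev, alt, LinearMap.sum_apply, mul_assoc]

theorem formXp_apply (zs : Fin n → B) (t : B) (Xs : Fin l → B)
    (P : MvPolynomial (Fin (l + 1)) k) :
    formXp zs t Xs P = gXp zs t Xs fun v => MvPolynomial.aeval v P := by
  simp [formXp, gXp, ev]

theorem formAp_apply (zs : Fin n → B) (t : B) (Xs : Fin l → B) (P : MvPolynomial (Fin l) k) :
    formAp zs t Xs P = gAp zs t Xs fun v => MvPolynomial.aeval v P := by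
  simp [formAp, gAp, ev, LinearMap.sum_apply]

theorem formAm_apply (zs : Fin n → B) (t : B) (Xs : Fin l → B) (P : MvPolynomial (Fin l) k) :
    formAm zs t Xs P = gAm zs t Xs fun v => MvPolynomial.aeval v P := by
  simp [formAm, gAm, ev, LinearMap.sum_apply]

end Forms

/-- The formulas below involve the z_j only through Θ and through symmetric sums. This is where the
symmetry of the resulting coefficients comes from. -/
theorem Th_comp (zs : Fin n → B) (π : Equiv.Perm (Fin n)) : Th (zs ∘ π) = Th zs := by
  funext x
  exact Equiv.prod_comp π fun j => 1 - zs j * x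

theorem Th2_comp (zs : Fin n → B) (π : Equiv.Perm (Fin n)) : Th2 (zs ∘ π) = Th2 zs := by
  funext x y
  simp [Th2, Th_comp]

theorem gXm_comp_zs (zs : Fin n → B) (π : Equiv.Perm (Fin n)) (t : B) (Xs : Fin (l + 1) → B)
    (e : (Fin l → B) → B) : gXm (zs ∘ π) t Xs e = gXm zs t Xs e := by
  simp only [gXm, F, Th2_comp, Th_comp]

theorem gXm2_comp_zs (zs : Fin n → B) (π : Equiv.Perm (Fin n)) (t : B) (Xs : Fin (l + 2) → B)
    (e : (Fin l → B) → B) : gXm2 (zs ∘ π) t Xs e = gXm2 zs t Xs e := by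
  simp only [gXm2, F2, Th2_comp, Th_comp]

theorem gXp_comp_zs (zs : Fin n → B) (π : Equiv.Perm (Fin n)) (t : B) (Xs : Fin l → B)
    (e : (Fin (l + 1) → B) → B) : gXp (zs ∘ π) t Xs e = gXp zs t Xs e := by
  simp only [gXp, Th_comp]

theorem gAp_comp_zs (zs : Fin n → B) (π : Equiv.Perm (Fin n)) (t : B) (Xs : Fin l → B)
    (e : (Fin l → B) → B) : gAp (zs ∘ π) t Xs e = gAp zs t Xs e := by
  simp only [gAp, Th_comp]
  rw [← Equiv.sum_comp π fun j => zs j * t / (1 - zs j * t)]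
  rfl

theorem gAm_comp_zs (zs : Fin n → B) (π : Equiv.Perm (Fin n)) (t : B) (Xs : Fin l → B)
    (e : (Fin l → B) → B) : gAm (zs ∘ π) t Xs e = gAm zs t Xs e := by
  simp only [gAm, Th_comp]
  rw [← Equiv.sum_comp π fun j => 1 / (1 - zs j * t)]
  rfl

/-- The sum over permutations is skew whatever `e` is, so no condition on `e` appears. -/
theorem gXm_skew (zs : Fin n → B) (t : B) (e : (Fin l → B) → B) :
    IsSkewFn fun Xs => gXm zs t Xs e := by
  intro σ v
  simp only [gXm]
  rw [alt_comp]
  ring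

theorem gXm2_skew (zs : Fin n → B) (t : B) (e : (Fin l → B) → B) :
    IsSkewFn fun Xs => gXm2 zs t Xs e := by
  intro σ v
  simp only [gXm2]
  rw [alt_comp]
  ring


end Formulas

/-! ### Skew-symmetry of the remaining formulas, and the effect of adjoining z, -z -/

section Formulas

variable {B : Type*} [Field B] {n l : ℕ}

/-- The extension of a permutation by a fixed last point. -/
def snocPerm (σ : Equiv.Perm (Fin l)) : Equiv.Perm (Fin (l + 1)) :=
  finSuccEquivLast.symm.permCongr (Equiv.optionCongr σ)

theorem sign_snocPerm (σ : Equiv.Perm (Fin l)) :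
    Equiv.Perm.sign (snocPerm σ) = Equiv.Perm.sign σ := by
  rw [snocPerm, Equiv.Perm.sign_permCongr, Equiv.optionCongr_sign]

theorem snoc_comp_snocPerm {α : Type*} (σ : Equiv.Perm (Fin l)) (v : Fin l → α) (x : α) :
    (Fin.snoc v x : Fin (l + 1) → α) ∘ snocPerm σ = Fin.snoc (v ∘ σ) x := by
  funext i
  refine Fin.lastCases ?_ (fun i => ?_) i
  · simp [snocPerm, Equiv.permCongr_apply]
  · simp [snocPerm, Equiv.permCongr_apply]

theorem gXp_skew (zs : Fin n → B) (t : B) {e : (Fin (l + 1) → B) → B} (he : IsSkewFn e) :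
    IsSkewFn fun Xs : Fin l → B => gXp zs t Xs e := by
  intro σ v
  simp only [gXp]
  rw [← snoc_comp_snocPerm, he, sign_snocPerm]
  ring

theorem update_comp_perm {α : Type*} (σ : Equiv.Perm (Fin l)) (v : Fin l → α) (p : Fin l) (x : α) :
    Function.update (v ∘ σ) p x = Function.update v (σ p) x ∘ σ := by
  funext i
  rcases eq_or_ne i p with rfl | h
  · simp
  · simp [h]

theorem gAp_skew (zs : Fin n → B) (t : B) {e : (Fin l → B) → B} (he : IsSkewFn e) :
    IsSkewFn fun Xs : Fin l → B => gAp zs t Xs e := by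
  intro σ v
  simp only [gAp]
  rw [mul_add, Finset.mul_sum, he]
  congr 1
  · ring
  · refine Fintype.sum_equiv σ _ _ fun p => ?_
    simp only [update_comp_perm, he _ _, Function.comp_apply]
    ring

theorem gAm_skew (zs : Fin n → B) (t : B) {e : (Fin l → B) → B} (he : IsSkewFn e) :
    IsSkewFn fun Xs : Fin l → B => gAm zs t Xs e := by
  intro σ v
  simp only [gAm]
  rw [mul_sub, Finset.mul_sum, he]
  congr 1
  · ring
  · refine Fintype.sum_equiv σ _ _ fun p => ?_
    simp only [update_comp_perm, he _ _, Function.comp_apply]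
    ring

/-- The variables `z_1, …, z_n, z, -z`. -/
def addPair (zs : Fin n → B) (z : B) : Fin (n + 2) → B :=
  Fin.snoc (Fin.snoc zs z : Fin (n + 1) → B) (-z)

/-- The two new factors are 1 - zx and 1 + zx. That their product is even in x is what makes links
work: it comes out of both terms of Θ(x, y) alike. -/
theorem Th_addPair (zs : Fin n → B) (z x : B) :
    Th (addPair zs z) x = (1 - x ^ 2 * z ^ 2) * Th zs x := by
  simp only [Th, addPair, Fin.prod_univ_castSucc, Fin.snoc_castSucc, Fin.snoc_last]
  ring

theorem Th2_addPair (zs : Fin n → B) (z x y : B) :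
    Th2 (addPair zs z) x y = (1 - x ^ 2 * z ^ 2) * (1 - y ^ 2 * z ^ 2) * Th2 zs x y := by
  simp only [Th2, Th_addPair]
  ring

/-- The numerator Θ(t, -x) gains a factor for t and one for x; the former cancels against the factor
gained by Θ(t). -/
theorem F_addPair (zs : Fin n → B) {z t : B} (h : 1 - t ^ 2 * z ^ 2 ≠ 0) (x : B) :
    F (addPair zs z) t x = (1 - x ^ 2 * z ^ 2) * F zs t x := by
  rw [F, Th_addPair, Th2_addPair, mul_assoc, mul_div_mul_left _ _ h, F, neg_sq]
  ring

theorem F2_addPair (zs : Fin n → B) {z t : B} (h : 1 - t ^ 2 * z ^ 2 ≠ 0) (x y : B) :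
    F2 (addPair zs z) t x y = (1 - x ^ 2 * z ^ 2) * (1 - y ^ 2 * z ^ 2) * F2 zs t x y := by
  have aux : ∀ a b c d e : B, a * ((1 - t ^ 2 * z ^ 2) * b) / ((1 - t ^ 2 * z ^ 2) * c) * d
      = a * (b / c) * d := by
    intro a b c d e
    rw [mul_left_comm, mul_div_mul_left _ _ h, mul_div_assoc]
  have aux2 : ∀ a c d e : B, a / ((1 - t ^ 2 * z ^ 2) * c) * ((1 - t ^ 2 * z ^ 2) * d * e)
      = a / c * (d * e) := by
    intro a c d e
    rw [div_mul_eq_mul_div, div_mul_eq_mul_div, mul_assoc, mul_left_comm,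
      mul_div_mul_left _ _ h]
  simp only [F2, Th_addPair, Th2_addPair]
  rw [mul_assoc (t / (x - t) * (t / (y + t))), mul_assoc (t / (y - t) * (t / (x + t))), aux2, aux2]
  ring

/-- The relation between the evaluation functions of a link. -/
def LinkFn (n : ℕ) (z : B) (e : (Fin l → B) → B) (e' : (Fin (l + 1) → B) → B) : Prop :=
  ∀ v : Fin l → B, e' (Fin.snoc v z⁻¹)
    = (z⁻¹ ^ (n + 1) * ∏ a : Fin l, (1 - v a ^ 2 * z ^ 2)) * e v

theorem castSucc_succAbove_last {m : ℕ} (p : Fin (m + 1)) :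
    p.castSucc.succAbove (Fin.last m) = Fin.last (m + 1) := by
  rw [Fin.succAbove_of_le_castSucc _ _ (Fin.castSucc_le_castSucc_iff.mpr (Fin.le_last p)),
    Fin.succ_last]

theorem snoc_comp_succAbove_castSucc {α : Type*} (v : Fin (l + 1) → α) (x : α) (p : Fin (l + 1)) :
    (Fin.snoc v x : Fin (l + 2) → α) ∘ p.castSucc.succAbove = Fin.snoc (v ∘ p.succAbove) x := by
  funext i
  refine Fin.lastCases ?_ (fun i => ?_) i
  · simp
  · simp [Fin.castSucc_succAbove_castSucc]

/-- The factor 1 - x²z² vanishes at x = z⁻¹, so z⁻¹ can never be the argument consumed by F in a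
wedge product. -/
theorem F_inv (zs : Fin n → B) {z : B} (hz : z ≠ 0) (t : B) : F (addPair zs z) t z⁻¹ = 0 := by
  rw [F, Th2_addPair]
  simp [hz]

/-- The three terms contain Θ(x, y), Θ(t, -x) and Θ(-x) respectively, and each of these carries the
factor 1 - x²z². -/
theorem F2_inv_left (zs : Fin n → B) {z : B} (hz : z ≠ 0) (t y : B) :
    F2 (addPair zs z) t z⁻¹ y = 0 := by
  simp [F2, Th2_addPair, Th_addPair, hz]

theorem F2_inv_right (zs : Fin n → B) {z : B} (hz : z ≠ 0) (t x : B) :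
    F2 (addPair zs z) t x z⁻¹ = 0 := by
  simp [F2, Th2_addPair, Th_addPair, hz]

variable {zs : Fin n → B} {z t : B}

/-- The term in which F takes the last argument z⁻¹ is zero. In the term where F takes v_p, the link
of `e` and `e'` supplies the factors 1 - v_a²z² for a ≠ p and F supplies the one for p. -/
theorem gXm_link [CharZero B] (hz : z ≠ 0) (ht : 1 - t ^ 2 * z ^ 2 ≠ 0) {e : (Fin l → B) → B}
    {e' : (Fin (l + 1) → B) → B} (he : IsSkewFn e) (he' : IsSkewFn e') (h : LinkFn n z e e') :
    LinkFn n z (fun Xs => gXm zs t Xs e) fun Xs => gXm (addPair zs z) t Xs e' := by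
  intro v
  simp only [gXm]
  rw [wedge_one _ he, wedge_one _ he', Fin.sum_univ_castSucc, Fin.snoc_last, F_inv zs hz, zero_mul,
    mul_zero, add_zero, Finset.mul_sum]
  refine Finset.sum_congr rfl fun p _ => ?_
  rw [snoc_comp_succAbove_castSucc, h, Fin.snoc_castSucc, F_addPair zs ht, Fin.val_castSucc,
    Fin.prod_univ_succAbove _ p]
  simp only [Function.comp_apply]
  ring

/-- The bottom component on the n + 2 side has no partner with one variable fewer, so its image has
to be linked with zero. -/
theorem gXm_link_zero [CharZero B] (hz : z ≠ 0) {e' : (Fin 0 → B) → B} (v : Fin 0 → B) :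
    gXm (addPair zs z) t (Fin.snoc v z⁻¹ : Fin 1 → B) e' = 0 := by
  have he' : IsSkewFn e' := fun σ w => by
    rw [Subsingleton.elim (w ∘ σ) w, Subsingleton.elim σ 1]
    simp
  simp only [gXm]
  rw [wedge_one _ he', Fin.sum_univ_castSucc, Fin.snoc_last, F_inv zs hz]
  simp

/-- As for `gXm_link`, with z⁻¹ now excluded from both arguments of F^{(2)}, which supplies the two
missing factors. -/
theorem gXm2_link [CharZero B] (hz : z ≠ 0) (ht : 1 - t ^ 2 * z ^ 2 ≠ 0) {e : (Fin l → B) → B}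
    {e' : (Fin (l + 1) → B) → B} (he : IsSkewFn e) (he' : IsSkewFn e') (h : LinkFn n z e e') :
    LinkFn n z (fun Xs => gXm2 zs t Xs e) fun Xs => gXm2 (addPair zs z) t Xs e' := by
  intro v
  simp only [gXm2]
  rw [wedge_two _ he, wedge_two _ he', Fin.sum_univ_castSucc, Fin.snoc_last]
  simp only [F2_inv_left zs hz, zero_mul, mul_zero, Finset.sum_const_zero, add_zero]
  rw [mul_left_comm]
  congr 1
  rw [Finset.mul_sum]
  refine Finset.sum_congr rfl fun p _ => ?_
  rw [Fin.sum_univ_castSucc, castSucc_succAbove_last, Fin.snoc_last, F2_inv_right zs hz,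
    zero_mul, mul_zero, add_zero, Fin.val_castSucc, mul_left_comm]
  congr 1
  rw [Finset.mul_sum]
  refine Finset.sum_congr rfl fun r _ => ?_
  rw [snoc_comp_succAbove_castSucc, snoc_comp_succAbove_castSucc, h,
    Fin.castSucc_succAbove_castSucc, Fin.snoc_castSucc, Fin.snoc_castSucc, F2_addPair zs ht,
    Fin.val_castSucc, Fin.prod_univ_succAbove _ p, Fin.prod_univ_succAbove _ r]
  simp only [Function.comp_apply]
  ring

/-- There are only two arguments and F^{(2)} consumes both, so one of them is always z⁻¹. -/
theorem gXm2_link_zero [CharZero B] (hz : z ≠ 0) {e' : (Fin 0 → B) → B} (v : Fin 1 → B) :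
    gXm2 (addPair zs z) t (Fin.snoc v z⁻¹ : Fin 2 → B) e' = 0 := by
  have he' : IsSkewFn e' := fun σ w => by
    rw [Subsingleton.elim (w ∘ σ) w, Subsingleton.elim σ 1]
    simp
  simp only [gXm2]
  rw [wedge_two _ he', Fin.sum_univ_castSucc, Fin.snoc_last]
  simp only [F2_inv_left zs hz, zero_mul, mul_zero, Finset.sum_const_zero, add_zero]
  have : ∀ p : Fin 1, ∀ r : Fin 1, (Fin.snoc v z⁻¹ : Fin 2 → B) (p.castSucc.succAbove r) = z⁻¹ := by
    intro p r
    rw [Subsingleton.elim r (Fin.last 0)]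
    exact (congrArg _ (castSucc_succAbove_last p)).trans (Fin.snoc_last ..)
  simp only [this, F2_inv_right zs hz, zero_mul, mul_zero, Finset.sum_const_zero]

theorem snoc_snoc_swap {e : (Fin (l + 2) → B) → B} (he : IsSkewFn e) (v : Fin l → B) (x y : B) :
    e (Fin.snoc (Fin.snoc v x : Fin (l + 1) → B) y)
      = -e (Fin.snoc (Fin.snoc v y : Fin (l + 1) → B) x) := by
  have h := he (Equiv.swap (Fin.last l).castSucc (Fin.last (l + 1)))
    (Fin.snoc (Fin.snoc v y : Fin (l + 1) → B) x)
  rw [Equiv.Perm.sign_swap (Fin.castSucc_lt_last _).ne] at h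
  have h2 : (Fin.snoc (Fin.snoc v y : Fin (l + 1) → B) x : Fin (l + 2) → B)
      ∘ (Equiv.swap (Fin.last l).castSucc (Fin.last (l + 1)))
      = Fin.snoc (Fin.snoc v x : Fin (l + 1) → B) y := by
    funext i
    refine Fin.lastCases ?_ (fun i => ?_) i
    · simp
    · refine Fin.lastCases ?_ (fun i => ?_) i
      · simp
      · rw [Function.comp_apply, Equiv.swap_apply_of_ne_of_ne]
        · simp
        · exact fun h => (Fin.castSucc_lt_last i).ne (Fin.castSucc_injective _ h)
        · exact (Fin.castSucc_lt_last _).ne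
  rw [h2] at h
  simpa using h

/-- The link relation needs z⁻¹ in the last place, which t occupies; exchanging the two gives the
sign. The link factor for the argument t then cancels the extra factor of Θ(t). -/
theorem gXp_link (ht : 1 - t ^ 2 * z ^ 2 ≠ 0) {e : (Fin (l + 1) → B) → B}
    {e' : (Fin (l + 2) → B) → B} (he' : IsSkewFn e') (h : LinkFn n z e e') :
    LinkFn n z (fun Xs => gXp zs t Xs e) fun Xs => -gXp (addPair zs z) t Xs e' := by
  intro v
  simp only [gXp]
  rw [snoc_snoc_swap he', h, Th_addPair, Fin.prod_univ_castSucc, Fin.snoc_last]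
  simp only [Fin.snoc_castSucc]
  rw [mul_neg, neg_neg, one_div, mul_inv]
  field_simp

/-- At the modified point the link factor contains 1 - s²z² instead of 1 - v_p²z²; the quotient
Θ(v_p)/Θ(s) acquires exactly the inverse ratio. -/
theorem update_link (p : Fin l) {s : B} (hs : 1 - s ^ 2 * z ^ 2 ≠ 0) {e : (Fin l → B) → B}
    {e' : (Fin (l + 1) → B) → B} (h : LinkFn n z e e') (v : Fin l → B) :
    Th (addPair zs z) (v p) / Th (addPair zs z) s
        * e' (Function.update (Fin.snoc v z⁻¹ : Fin (l + 1) → B) p.castSucc s)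
      = (z⁻¹ ^ (n + 1) * ∏ a : Fin l, (1 - v a ^ 2 * z ^ 2)) *
        (Th zs (v p) / Th zs s * e (Function.update v p s)) := by
  rw [← Fin.snoc_update, h, Th_addPair, Th_addPair,
    ← Finset.mul_prod_erase Finset.univ (fun a => 1 - v a ^ 2 * z ^ 2) (Finset.mem_univ p),
    ← Finset.mul_prod_erase Finset.univ
      (fun a => 1 - Function.update v p s a ^ 2 * z ^ 2) (Finset.mem_univ p),
    Function.update_self,
    Finset.prod_congr rfl (fun a ha => by rw [Function.update_of_ne (Finset.ne_of_mem_erase ha)])]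
  generalize 1 - s ^ 2 * z ^ 2 = D at hs
  field_simp

/-- The summands of the old variables match by `update_link`. In the summand of the variable z⁻¹ the
quotient with Θ(z⁻¹) = 0 drops out, and the rest, -t/(z⁻¹ - t) + t/(z⁻¹ + t) times the value of
`e'`, cancels the new terms zt/(1 - zt) - zt/(1 + zt). -/
theorem gAp_link (hz : z ≠ 0) (ht : 1 - t ^ 2 * z ^ 2 ≠ 0) {e : (Fin l → B) → B}
    {e' : (Fin (l + 1) → B) → B} (h : LinkFn n z e e') :
    LinkFn n z (fun Xs => gAp zs t Xs e) fun Xs => gAp (addPair zs z) t Xs e' := by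
  intro v
  have ht' : 1 - (-t) ^ 2 * z ^ 2 ≠ 0 := by rwa [neg_sq]
  have hf : (1 - z * t) * (1 + z * t) ≠ 0 := by
    intro h0; apply ht; rw [← h0]; ring
  have h1 : 1 - z * t ≠ 0 := left_ne_zero_of_mul hf
  have h2 : 1 + z * t ≠ 0 := right_ne_zero_of_mul hf
  have h0 : Th (addPair zs z) z⁻¹ = 0 := by rw [Th_addPair]; simp [hz]
  have hs : ∑ j, addPair zs z j * t / (1 - addPair zs z j * t)
      = (∑ j, zs j * t / (1 - zs j * t)) + (z * t / (1 - z * t) + -z * t / (1 + z * t)) := by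
    simp only [addPair, Fin.sum_univ_castSucc, Fin.snoc_castSucc, Fin.snoc_last]
    rw [add_assoc, neg_mul, sub_neg_eq_add]
  have e1 : t / (z⁻¹ - t) = z * t / (1 - z * t) := by
    rw [show z⁻¹ - t = z⁻¹ * (1 - z * t) by field_simp]
    field_simp
  have e2 : -t / (z⁻¹ - -t) = -z * t / (1 + z * t) := by
    rw [show z⁻¹ - -t = z⁻¹ * (1 + z * t) by field_simp; ring]
    field_simp
  simp only [gAp]
  rw [hs, Fin.sum_univ_castSucc]
  simp only [Fin.snoc_castSucc, Fin.snoc_last,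
    update_link _ ht h, update_link _ ht' h, h0, zero_div, zero_mul, zero_sub, h v]
  generalize z⁻¹ ^ (n + 1) * ∏ a : Fin l, (1 - v a ^ 2 * z ^ 2) = C
  have hsum : ∑ p : Fin l,
      (t / (v p - t) * (C * (Th zs (v p) / Th zs t * e (Function.update v p t)) - C * e v)
        + -t / (v p - -t) *
          (C * (Th zs (v p) / Th zs (-t) * e (Function.update v p (-t))) - C * e v))
      = C * ∑ p : Fin l, (t / (v p - t) * (Th zs (v p) / Th zs t * e (Function.update v p t) - e v)
        + -t / (v p - -t) *
          (Th zs (v p) / Th zs (-t) * e (Function.update v p (-t)) - e v)) := by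
    rw [Finset.mul_sum]
    exact Finset.sum_congr rfl fun p _ => by ring
  linear_combination hsum - C * e v * e1 - C * e v * e2

/-- The cancellation is that of `gAp_link`: the additional factors z⁻¹/(±t) turn the surviving terms
into 1/(1 ∓ zt), the new summands of the sum over j. -/
theorem gAm_link (hz : z ≠ 0) (ht0 : t ≠ 0) (ht : 1 - t ^ 2 * z ^ 2 ≠ 0) {e : (Fin l → B) → B}
    {e' : (Fin (l + 1) → B) → B} (h : LinkFn n z e e') :
    LinkFn n z (fun Xs => gAm zs t Xs e) fun Xs => gAm (addPair zs z) t Xs e' := by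
  intro v
  have ht' : 1 - (-t) ^ 2 * z ^ 2 ≠ 0 := by rwa [neg_sq]
  have hf : (1 - z * t) * (1 + z * t) ≠ 0 := by
    intro h0; apply ht; rw [← h0]; ring
  have h1 : 1 - z * t ≠ 0 := left_ne_zero_of_mul hf
  have h2 : 1 + z * t ≠ 0 := right_ne_zero_of_mul hf
  have h0 : Th (addPair zs z) z⁻¹ = 0 := by rw [Th_addPair]; simp [hz]
  have hs : ∑ j, 1 / (1 - addPair zs z j * t)
      = (∑ j, 1 / (1 - zs j * t)) + (1 / (1 - z * t) + 1 / (1 + z * t)) := by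
    simp only [addPair, Fin.sum_univ_castSucc, Fin.snoc_castSucc, Fin.snoc_last]
    rw [add_assoc, neg_mul, sub_neg_eq_add]
  have e1 : t / (z⁻¹ - t) * (z⁻¹ / t) = 1 / (1 - z * t) := by
    rw [show z⁻¹ - t = z⁻¹ * (1 - z * t) by field_simp]
    field_simp
  have e2 : -t / (z⁻¹ - -t) * (z⁻¹ / -t) = 1 / (1 + z * t) := by
    rw [show z⁻¹ - -t = z⁻¹ * (1 + z * t) by field_simp; ring]
    field_simp
  simp only [gAm]
  rw [hs, Fin.sum_univ_castSucc]
  simp only [Fin.snoc_castSucc, Fin.snoc_last,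
    update_link _ ht h, update_link _ ht' h, h0, zero_div, zero_mul, zero_sub, h v]
  generalize z⁻¹ ^ (n + 1) * ∏ a : Fin l, (1 - v a ^ 2 * z ^ 2) = C
  have hsum : ∑ p : Fin l,
      (t / (v p - t) *
          (C * (Th zs (v p) / Th zs t * e (Function.update v p t)) - v p / t * (C * e v))
        + -t / (v p - -t) *
          (C * (Th zs (v p) / Th zs (-t) * e (Function.update v p (-t))) - v p / -t * (C * e v)))
      = C * ∑ p : Fin l,
        (t / (v p - t) * (Th zs (v p) / Th zs t * e (Function.update v p t) - v p / t * e v)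
        + -t / (v p - -t) *
          (Th zs (v p) / Th zs (-t) * e (Function.update v p (-t)) - v p / -t * e v)) := by
    rw [Finset.mul_sum]
    exact Finset.sum_congr rfl fun p _ => by ring
  linear_combination C * e v * e1 + C * e v * e2 - hsum

end Formulas

/-! ### Degree bounds under products, exact division and substitution -/

section Degree

variable {R : Type*} [CommRing R] {σ τ : Type*}

theorem degIn_succ_iff {i : σ} {n : ℕ} {p : MvPolynomial σ R} :
    DegIn i (n + 1) p ↔ MvPolynomial.degreeOf i p ≤ n := by
  rw [MvPolynomial.degreeOf_le_iff]
  exact forall₂_congr fun _ _ => Nat.lt_succ_iff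

theorem DegIn.mul_le {i : σ} {n d : ℕ} {p r : MvPolynomial σ R} (h : DegIn i n p)
    (hr : MvPolynomial.degreeOf i r ≤ d) : DegIn i (n + d) (r * p) := by
  classical
  intro s hs
  obtain ⟨a, ha, b, hb, rfl⟩ := Finset.mem_add.mp (MvPolynomial.support_mul r p hs)
  have h1 := MvPolynomial.monomial_le_degreeOf i ha
  have h2 := h b hb
  simp only [Finsupp.add_apply]
  omega

/-- Degrees in a variable add over a domain, so an exact division lowers the bound by the degree of
the divisor. This is how the bound n - 1 is recovered after clearing denominators. -/
theorem degIn_of_mul_of_degree [IsDomain R] {i : σ} {n : ℕ} {p d : MvPolynomial σ R} (hd : d ≠ 0)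
    (h : DegIn i (n + MvPolynomial.degreeOf i d) (d * p)) : DegIn i n p := by
  rcases eq_or_ne p 0 with rfl | hp
  · exact degIn_zero i n
  · intro s hs
    have h1 := MvPolynomial.monomial_le_degreeOf i hs
    have h2 : MvPolynomial.degreeOf i (d * p) < n + MvPolynomial.degreeOf i d := by
      rcases Nat.eq_zero_or_pos (n + MvPolynomial.degreeOf i d) with h0 | h0
      · rw [h0] at h
        obtain ⟨u, hu⟩ := MvPolynomial.support_nonempty.mpr (mul_ne_zero hd hp)
        exact absurd (h u hu) (Nat.not_lt_zero _)
      · exact (MvPolynomial.degreeOf_lt_iff h0).mpr h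
    rw [MvPolynomial.degreeOf_mul_eq hd hp] at h2
    omega

theorem degreeOf_X_sub_C_self [Nontrivial R] (i : σ) (c : R) :
    MvPolynomial.degreeOf i (MvPolynomial.X i - MvPolynomial.C c) = 1 := by
  classical
  rw [sub_eq_add_neg, ← map_neg, MvPolynomial.degreeOf_add_eq_of_degreeOf_lt] <;>
    simp [MvPolynomial.degreeOf_C]

theorem X_sub_C_ne_zero [Nontrivial R] (i : σ) (c : R) :
    (MvPolynomial.X i - MvPolynomial.C c : MvPolynomial σ R) ≠ 0 := by
  intro h
  have := degreeOf_X_sub_C_self i c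
  rw [h] at this
  simp at this

theorem degreeOf_X_sub_C_of_ne [Nontrivial R] {i j : σ} (h : i ≠ j) (c : R) :
    MvPolynomial.degreeOf i (MvPolynomial.X j - MvPolynomial.C c) = 0 := by
  classical
  rw [← Nat.le_zero]
  refine (MvPolynomial.degreeOf_sub_le _ _ _).trans ?_
  simp [MvPolynomial.degreeOf_X_of_ne h, MvPolynomial.degreeOf_C]

/-- Substitutions in which only the variable `j` contributes to the degree in `i`. -/
theorem DegIn.aeval {i : τ} {j : σ} {n : ℕ} {g : σ → MvPolynomial τ R}
    (hj : MvPolynomial.degreeOf i (g j) ≤ 1) (hg : ∀ k, k ≠ j → MvPolynomial.degreeOf i (g k) = 0)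
    {p : MvPolynomial σ R} (h : DegIn j n p) : DegIn i n (MvPolynomial.aeval g p) := by
  classical
  rw [MvPolynomial.aeval_def, MvPolynomial.eval₂_eq]
  refine DegIn.sum fun m hm => degIn_of_degreeOf_lt (lt_of_le_of_lt ?_ (h m hm))
  refine (MvPolynomial.degreeOf_C_mul_le _ _ _).trans ?_
  refine (MvPolynomial.degreeOf_prod_le _ _ _).trans ?_
  refine (Finset.sum_le_sum (g := fun k => if k = j then m j else 0) fun k _ => ?_).trans ?_
  · refine (MvPolynomial.degreeOf_pow_le _ _ _).trans ?_
    split_ifs with hk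
    · subst hk
      exact (Nat.mul_le_mul_left _ hj).trans (by simp)
    · simp [hg k hk]
  · rw [Finset.sum_ite_eq']
    split_ifs <;> simp

theorem DegIn.aeval_const {i : τ} {g : σ → MvPolynomial τ R}
    (hg : ∀ k, MvPolynomial.degreeOf i (g k) = 0)
    (p : MvPolynomial σ R) : DegIn i 1 (MvPolynomial.aeval g p) := by
  classical
  rw [MvPolynomial.aeval_def, MvPolynomial.eval₂_eq]
  refine DegIn.sum fun m hm => degIn_succ_iff.mpr ?_
  refine (MvPolynomial.degreeOf_C_mul_le _ _ _).trans ?_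
  refine (MvPolynomial.degreeOf_prod_le _ _ _).trans ?_
  refine (Finset.sum_le_sum (g := fun k => 0) fun k _ => ?_).trans (by simp)
  refine (MvPolynomial.degreeOf_pow_le _ _ _).trans ?_
  simp [hg k]

end Degree

/-! ### Θ over commutative rings and at polynomials -/

section Theta

variable {R S : Type*} [CommRing R] [CommRing S] {n : ℕ}

/-- The product `∏_j (1 - z_j x)` in a commutative ring. -/
def rTh (zs : Fin n → R) (x : R) : R := ∏ j, (1 - zs j * x)

theorem map_rTh (ψ : R →+* S) (zs : Fin n → R) (x : R) :
    ψ (rTh zs x) = rTh (fun j => ψ (zs j)) (ψ x) := by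
  simp [rTh, map_prod]

theorem rTh_eq_Th {B : Type*} [Field B] (zs : Fin n → B) (x : B) : rTh zs x = Th zs x := rfl

/-- The polynomial `Θ(p)`. -/
def pTh {σ : Type*} (zs : Fin n → R) (p : MvPolynomial σ R) : MvPolynomial σ R :=
  rTh (fun j => MvPolynomial.C (zs j)) p

theorem eval₂_pTh {σ : Type*} {B : Type*} [Field B] (ψ : R →+* B) (Xs : σ → B) (zs : Fin n → R)
    (p : MvPolynomial σ R) :
    MvPolynomial.eval₂ ψ Xs (pTh zs p) = Th (fun j => ψ (zs j)) (MvPolynomial.eval₂ ψ Xs p) := by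
  rw [← MvPolynomial.coe_eval₂Hom, pTh, map_rTh]
  simp [rTh_eq_Th]

theorem aeval_pTh {σ τ : Type*} (g : σ → MvPolynomial τ R) (zs : Fin n → R)
    (p : MvPolynomial σ R) :
    MvPolynomial.aeval g (pTh zs p) = pTh zs (MvPolynomial.aeval g p) := by
  rw [pTh, ← AlgHom.coe_toRingHom, map_rTh]
  simp [pTh]

theorem pTh_C {σ : Type*} (zs : Fin n → R) (x : R) :
    pTh zs (MvPolynomial.C x : MvPolynomial σ R) = MvPolynomial.C (rTh zs x) := by
  rw [map_rTh]
  rfl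

theorem degreeOf_pTh_le {σ : Type*} (i : σ) (zs : Fin n → R) {p : MvPolynomial σ R} {d : ℕ}
    (hp : MvPolynomial.degreeOf i p ≤ d) : MvPolynomial.degreeOf i (pTh zs p) ≤ n * d := by
  refine (MvPolynomial.degreeOf_prod_le _ _ _).trans ?_
  refine (Finset.sum_le_sum (g := fun _ => d) fun j _ => ?_).trans (by simp)
  refine (MvPolynomial.degreeOf_sub_le _ _ _).trans ?_
  simp only [MvPolynomial.degreeOf_one, zero_le, sup_of_le_right]
  exact (MvPolynomial.degreeOf_C_mul_le _ _ _).trans hp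

end Theta

/-! ### Formulas and the polynomials that represent them -/

/-- General position of the arguments at which the formulas are evaluated. -/
structure Gen {B : Type*} [Field B] {m : ℕ} (t : B) (Xs : Fin m → B) : Prop where
  t_ne : t ≠ 0
  sub_ne : ∀ i, Xs i - t ≠ 0
  add_ne : ∀ i, Xs i + t ≠ 0
  pair_ne : ∀ i j, i ≠ j → Xs i + Xs j ≠ 0

/-- A formula for an operator, written in an arbitrary field. -/
abbrev Formula (n l l' : ℕ) : Type 1 :=
  ∀ (B : Type) [Field B], (Fin n → B) → B → (Fin l' → B) → ((Fin l → B) → B) → B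

/-- The polynomial `O` has degree less than `n` in each variable, and its values are given by the
formula `G` applied to `P`. -/
structure Represents {A : Type} [CommRing A] {n l l' : ℕ} (G : Formula n l l') (zs : Fin n → A)
    (t : A) (P : MvPolynomial (Fin l) A) (O : MvPolynomial (Fin l') A) : Prop where
  deg : DegLT n O
  eval : ∀ (B : Type) [Field B] (ψ : A →+* B) (Xs : Fin l' → B), Gen (ψ t) Xs →
    MvPolynomial.eval₂ ψ Xs O
      = G B (fun j => ψ (zs j)) (ψ t) Xs fun v => MvPolynomial.eval₂ ψ v P

/-! ### Representing polynomials for the currents of x^± and for a_± -/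

section Existence

variable {A : Type} [CommRing A] [IsDomain A] [Algebra ℂ A] {n l : ℕ} {zs : Fin n → A} {t : A}

theorem map_algebraMap_inv {B : Type*} [Field B] (ψ : A →+* B) (m : ℕ) :
    ψ (algebraMap ℂ A (m : ℂ)⁻¹) = (m : B)⁻¹ := by
  have h := map_inv₀ (ψ.comp (algebraMap ℂ A)) (m : ℂ)
  rwa [map_natCast] at h

theorem natCast_ne_zero_of_hom {B : Type*} [Field B] (ψ : A →+* B) {m : ℕ} (hm : m ≠ 0) :
    (m : B) ≠ 0 := by
  have h : (m : B) = (ψ.comp (algebraMap ℂ A)) (m : ℂ) := by simp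
  rw [h]
  exact (map_ne_zero _).mpr (Nat.cast_ne_zero.mpr hm)

variable {ws : Fin n → A}

theorem rTh_mul_prod (hw : ∀ j, (1 - zs j * t) * ws j = 1) : rTh zs t * ∏ j, ws j = 1 := by
  rw [rTh, ← Finset.prod_mul_distrib]
  exact Finset.prod_eq_one fun j _ => hw j

theorem map_prod_ws (hw : ∀ j, (1 - zs j * t) * ws j = 1) {B : Type*} [Field B] (ψ : A →+* B) :
    ψ (∏ j, ws j) = (Th (fun j => ψ (zs j)) (ψ t))⁻¹ := by
  have h := congrArg ψ (rTh_mul_prod hw)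
  rw [map_mul, map_rTh, map_one, rTh_eq_Th] at h
  exact eq_inv_of_mul_eq_one_right h

theorem Th_map_ne_zero (hw : ∀ j, (1 - zs j * t) * ws j = 1) {B : Type*} [Field B] (ψ : A →+* B) :
    Th (fun j => ψ (zs j)) (ψ t) ≠ 0 := by
  have h := congrArg ψ (rTh_mul_prod hw)
  rw [map_mul, map_rTh, map_one, rTh_eq_Th] at h
  exact left_ne_zero_of_mul_eq_one h

/-- The polynomial `Θ(t, -x) / (x - t)`. -/
theorem exists_quot (zs : Fin n → A) (t : A) : ∃ g : MvPolynomial (Fin 1) A, DegIn 0 n g ∧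
    (MvPolynomial.X 0 - MvPolynomial.C t) * g
      = MvPolynomial.C (rTh zs t) * pTh zs (-MvPolynomial.X 0)
        - MvPolynomial.C (rTh zs (-t)) * pTh zs (MvPolynomial.X 0) := by
  have h : MvPolynomial.X 0 - MvPolynomial.C t ∣
      MvPolynomial.C (rTh zs t) * pTh zs (-MvPolynomial.X 0)
        - MvPolynomial.C (rTh zs (-t)) * pTh zs (MvPolynomial.X (0 : Fin 1)) := by
    -- At x = t the two products coincide.
    apply X_sub_dvd_of_aeval_eq_zero
    simp only [map_sub, map_mul, aeval_pTh, map_neg, MvPolynomial.aeval_X, MvPolynomial.algHom_C,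
      MvPolynomial.algebraMap_eq, Function.update_self]
    rw [← map_neg, pTh_C, pTh_C]
    ring
  obtain ⟨g, hg⟩ := h
  refine ⟨g, ?_, hg.symm⟩
  -- The numerator has degree at most n in x, so the quotient has degree less than n.
  refine degIn_of_mul_of_degree (X_sub_C_ne_zero 0 t) ?_
  rw [← hg, degreeOf_X_sub_C_self]
  refine DegIn.sub ?_ ?_ <;> rw [degIn_succ_iff] <;>
    refine (MvPolynomial.degreeOf_C_mul_le _ _ _).trans
      ((degreeOf_pTh_le (d := 1) _ _ ?_).trans (by simp))
  · rw [MvPolynomial.degreeOf_neg]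
    simp
  · simp

theorem eval₂_aeval {A σ τ : Type*} [CommRing A] {B : Type*} [CommRing B] (ψ : A →+* B)
    (Xs : τ → B) (g : σ → MvPolynomial τ A) (p : MvPolynomial σ A) :
    MvPolynomial.eval₂ ψ Xs (MvPolynomial.aeval g p)
      = MvPolynomial.eval₂ ψ (fun j => MvPolynomial.eval₂ ψ Xs (g j)) p := by
  rw [← MvPolynomial.coe_eval₂Hom, MvPolynomial.aeval_def, MvPolynomial.algebraMap_eq,
    MvPolynomial.eval₂_comp_left]
  have h : (MvPolynomial.eval₂Hom ψ Xs).comp MvPolynomial.C = ψ := by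
    ext
    simp
  rw [h]
  rfl

theorem eval₂_alt {A : Type*} [CommRing A] {B : Type*} [Field B] (ψ : A →+* B) {m : ℕ}
    (p : Equiv.Perm (Fin m) → MvPolynomial (Fin m) A) (Xs : Fin m → B) (h : (Fin m → B) → B)
    (hp : ∀ σ, MvPolynomial.eval₂ ψ Xs (p σ) = h (Xs ∘ σ)) :
    MvPolynomial.eval₂ ψ Xs (∑ σ : Equiv.Perm (Fin m), ((Equiv.Perm.sign σ : ℤˣ) : ℤ) • p σ)
      = alt h Xs := by
  rw [← MvPolynomial.coe_eval₂Hom, map_sum, alt]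
  refine Finset.sum_congr rfl fun σ _ => ?_
  rw [map_zsmul, MvPolynomial.coe_eval₂Hom, hp, zsmul_eq_mul]

theorem DegIn.zsmul {R σ : Type*} [CommRing R] {i : σ} {n : ℕ} {p : MvPolynomial σ R}
    (h : DegIn i n p) (c : ℤ) : DegIn i n (c • p) := by
  have : c • p = MvPolynomial.C (c : R) * p := by
    rw [zsmul_eq_mul, map_intCast]
  rw [this]
  exact h.mul (MvPolynomial.degreeOf_C _ _)

/-- The denominators of F are 2, x - t and Θ(t): the first is inverted in `ℂ`, the second divides
Θ(t, -x) by `exists_quot`, and the third is inverted by the given `ws`. -/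
theorem exists_gXm (hw : ∀ j, (1 - zs j * t) * ws j = 1) {P : MvPolynomial (Fin l) A}
    (hP : DegLT n P) : ∃ O, Represents (fun _ _ => gXm) zs t P O (l' := l + 1) := by
  obtain ⟨g, hdeg, hg⟩ := exists_quot zs t
  refine ⟨MvPolynomial.C (algebraMap ℂ A (l.factorial : ℂ)⁻¹) *
    ∑ σ : Equiv.Perm (Fin (l + 1)), ((Equiv.Perm.sign σ : ℤˣ) : ℤ) •
      (MvPolynomial.C (algebraMap ℂ A ((2 : ℕ) : ℂ)⁻¹ * t * ∏ j, ws j) *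
        (MvPolynomial.rename (fun _ => σ 0) g * MvPolynomial.rename (fun i => σ i.succ) P)),
    ?_, ?_⟩
  · rw [degIn_of_forall_aeval]
    intro i
    refine DegIn.mul (DegIn.sum fun σ _ => DegIn.zsmul (DegIn.mul ?_ (MvPolynomial.degreeOf_C _ _)) _)
      (MvPolynomial.degreeOf_C _ _)
    have hinj : Function.Injective fun i : Fin l => σ i.succ :=
      σ.injective.comp (Fin.succ_injective l)
    -- The variable with index `σ 0` occurs only in the factor `g` and every other one only in `P`,
    -- so the degrees of the two factors never add up.
    obtain ⟨i, rfl⟩ := σ.surjective i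
    refine Fin.cases ?_ (fun i => ?_) i
    · rw [mul_comm]
      exact DegIn.mul (hdeg.rename (f := fun _ => σ 0) (Function.injective_of_subsingleton _))
        (degreeOf_rename_of_notMem (fun j h => (Fin.succ_ne_zero j) (σ.injective h)) _)
    · exact DegIn.mul (DegIn.rename hinj (degIn_of_forall_aeval.mp hP i))
        (degreeOf_rename_of_notMem (fun j h => (Fin.succ_ne_zero i) (σ.injective h.symm)) _)
  · intro B _ ψ Xs hX
    rw [MvPolynomial.eval₂_mul, MvPolynomial.eval₂_C, map_algebraMap_inv, gXm]
    congr 1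
    apply eval₂_alt ψ _ Xs (h := fun w => F (fun j => ψ (zs j)) (ψ t) (w 0) *
      MvPolynomial.eval₂ ψ (fun i => w i.succ) P)
    intro σ
    rw [MvPolynomial.eval₂_mul, MvPolynomial.eval₂_mul, MvPolynomial.eval₂_C,
      MvPolynomial.eval₂_rename, MvPolynomial.eval₂_rename, ← mul_assoc]
    congr 1
    have h := congrArg (MvPolynomial.eval₂ ψ (fun _ => Xs (σ 0))) hg
    simp only [← MvPolynomial.coe_eval₂Hom, map_sub, map_mul] at h
    simp only [MvPolynomial.coe_eval₂Hom, eval₂_pTh, MvPolynomial.eval₂_C, MvPolynomial.eval₂_X,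
      map_rTh, rTh_eq_Th, MvPolynomial.eval₂_neg, map_neg] at h
    have h2 := hX.sub_ne (σ 0)
    have hT := Th_map_ne_zero hw ψ
    have h3 : (2 : B) ≠ 0 := by exact_mod_cast natCast_ne_zero_of_hom ψ two_ne_zero
    simp only [map_mul, map_algebraMap_inv, map_prod_ws hw, F, Th2, Function.comp_apply, neg_neg]
    rw [← h]
    push_cast
    simp only [Function.comp_def]
    field_simp

theorem exists_gXp (hw : ∀ j, (1 - zs j * t) * ws j = 1) {P : MvPolynomial (Fin (l + 1)) A}
    (hP : DegLT n P) : ∃ O, Represents (fun _ _ => gXp) zs t P O (l' := l) := by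
  refine ⟨MvPolynomial.C (∏ j, ws j) * setLast t P, ?_, ?_⟩
  · rw [degIn_of_forall_aeval]
    intro i
    refine DegIn.mul (DegIn.aeval (j := i.castSucc) ?_ (fun k => ?_)
      (degIn_of_forall_aeval.mp hP _)) (MvPolynomial.degreeOf_C _ _)
    · simp
    · refine Fin.lastCases (fun _ => ?_) (fun k hk => ?_) k
      · simp [MvPolynomial.degreeOf_C]
      · rw [Fin.snoc_castSucc]
        exact MvPolynomial.degreeOf_X_of_ne fun h => hk (by rw [h])
  · intro B _ ψ Xs hX
    rw [MvPolynomial.eval₂_mul, MvPolynomial.eval₂_C, map_prod_ws hw, gXp, one_div]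
    congr 1
    rw [setLast, eval₂_aeval]
    congr 1
    funext j
    refine Fin.lastCases ?_ (fun j => ?_) j <;> simp

theorem eval₂_aeval_update (P : MvPolynomial (Fin l) A) {B : Type*} [Field B] (ψ : A →+* B)
    (Xs : Fin l → B) (p : Fin l) (s : A) :
    MvPolynomial.eval₂ ψ Xs
        (MvPolynomial.aeval (Function.update MvPolynomial.X p (MvPolynomial.C s)) P)
      = MvPolynomial.eval₂ ψ (Function.update Xs p (ψ s)) P := by
  rw [eval₂_aeval]
  congr 1
  funext j
  rcases eq_or_ne j p with rfl | hj
  · simp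
  · simp [hj]

theorem degIn_aeval_update {P : MvPolynomial (Fin l) A} {i p : Fin l} (hip : i ≠ p) (s : A)
    (hP : DegIn i n P) : DegIn i n
      (MvPolynomial.aeval (Function.update MvPolynomial.X p (MvPolynomial.C s)) P) := by
  refine DegIn.aeval (j := i) ?_ (fun k hk => ?_) hP
  · simp [hip]
  · rcases eq_or_ne k p with rfl | hkp
    · simp [MvPolynomial.degreeOf_C]
    · rw [Function.update_of_ne hkp]
      exact MvPolynomial.degreeOf_X_of_ne hk.symm

theorem degIn_aeval_update_self (P : MvPolynomial (Fin l) A) (p : Fin l) (s : A) : DegIn p 1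
      (MvPolynomial.aeval (Function.update MvPolynomial.X p (MvPolynomial.C s)) P) := by
  refine DegIn.aeval_const (fun k => ?_) P
  rcases eq_or_ne k p with rfl | hkp
  · simp [MvPolynomial.degreeOf_C]
  · rw [Function.update_of_ne hkp]
    exact MvPolynomial.degreeOf_X_of_ne hkp.symm

/-- Division of `Θ(X_p) P|_{X_p = s} - r P` by `X_p - s`, when `r` takes the value `Θ(s)` at
`X_p = s`. -/
theorem exists_update_quot (zs : Fin n → A) (s : A) {P : MvPolynomial (Fin l) A} (hP : DegLT n P)
    (p : Fin l) {r : MvPolynomial (Fin l) A}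
    (hr : MvPolynomial.aeval (Function.update MvPolynomial.X p (MvPolynomial.C s)) r
      = MvPolynomial.C (rTh zs s))
    (hr1 : MvPolynomial.degreeOf p r ≤ 1) (hr0 : ∀ i, i ≠ p → MvPolynomial.degreeOf i r = 0) :
    ∃ O : MvPolynomial (Fin l) A, DegLT n O ∧
      (MvPolynomial.X p - MvPolynomial.C s) * O = pTh zs (MvPolynomial.X p) *
        MvPolynomial.aeval (Function.update MvPolynomial.X p (MvPolynomial.C s)) P - r * P := by
  have h : MvPolynomial.X p - MvPolynomial.C s ∣ pTh zs (MvPolynomial.X p) *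
        MvPolynomial.aeval (Function.update MvPolynomial.X p (MvPolynomial.C s)) P - r * P := by
    -- At `X_p = s` both terms become Θ(s) times `P` at `X_p = s`, because the substitution is
    -- idempotent.
    apply X_sub_dvd_of_aeval_eq_zero
    have h2 : MvPolynomial.aeval (Function.update MvPolynomial.X p (MvPolynomial.C s))
        (MvPolynomial.aeval (Function.update MvPolynomial.X p (MvPolynomial.C s)) P)
        = MvPolynomial.aeval (Function.update MvPolynomial.X p (MvPolynomial.C s)) P := by
      rw [← AlgHom.comp_apply]
      congr 1
      ext1 j
      rcases eq_or_ne j p with rfl | hj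
      · simp
      · simp [hj]
    rw [map_sub, map_mul, map_mul, hr, h2, aeval_pTh, MvPolynomial.aeval_X, Function.update_self,
      pTh_C, sub_self]
  obtain ⟨O, hO⟩ := h
  refine ⟨O, ?_, hO.symm⟩
  rw [degIn_of_forall_aeval] at hP ⊢
  intro i
  refine degIn_of_mul_of_degree (X_sub_C_ne_zero p s) ?_
  rw [← hO]
  rcases eq_or_ne i p with rfl | hip
  · rw [degreeOf_X_sub_C_self]
    -- In `X_p` itself the first term owes its degree, at most n, to Θ alone, and the second has
    -- degree at most (n - 1) + 1. Dividing by a linear factor gives the bound.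
    refine DegIn.sub ?_ ((hP i).mul_le hr1)
    rw [add_comm]
    exact (degIn_aeval_update_self P i s).mul_le
      ((degreeOf_pTh_le (d := 1) _ _ (by simp)).trans (by simp))
  · rw [degreeOf_X_sub_C_of_ne hip, add_zero]
    refine DegIn.sub (DegIn.mul (degIn_aeval_update hip s (hP i)) ?_) ((hP i).mul (hr0 i hip))
    have := degreeOf_pTh_le (d := 0) i zs (MvPolynomial.degreeOf_X_of_ne hip).le
    simpa using this

theorem exists_gAp {ws' : Fin n → A} (hw : ∀ j, (1 - zs j * t) * ws j = 1)
    (hw' : ∀ j, (1 - zs j * -t) * ws' j = 1) {P : MvPolynomial (Fin l) A}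
    (hP : DegLT n P) : ∃ O, Represents (fun _ _ => gAp) zs t P O (l' := l) := by
  have key : ∀ s : A, ∀ p, ∃ O : MvPolynomial (Fin l) A, DegLT n O ∧
      (MvPolynomial.X p - MvPolynomial.C s) * O = pTh zs (MvPolynomial.X p) *
        MvPolynomial.aeval (Function.update MvPolynomial.X p (MvPolynomial.C s)) P
          - MvPolynomial.C (rTh zs s) * P := fun s p =>
    exists_update_quot zs s hP p (MvPolynomial.algHom_C _ _)
      (by simp [MvPolynomial.degreeOf_C]) (fun _ _ => MvPolynomial.degreeOf_C _ _)
  choose O hdeg hO using key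
  -- The quotients for `s = t` and `s = -t` still lack the division by Θ(s), which `ws` and `ws'`
  -- provide. The minus sign is that of the prefactor t under t → -t.
  refine ⟨MvPolynomial.C (∑ j, zs j * t * ws j) * P + ∑ p : Fin l,
    (MvPolynomial.C (t * ∏ j, ws j) * O t p - MvPolynomial.C (t * ∏ j, ws' j) * O (-t) p), ?_, ?_⟩
  · rw [degIn_of_forall_aeval]
    intro i
    refine DegIn.add (DegIn.mul (degIn_of_forall_aeval.mp hP i) (MvPolynomial.degreeOf_C _ _))
      (DegIn.sum fun p _ => DegIn.sub ?_ ?_) <;>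
    exact DegIn.mul (degIn_of_forall_aeval.mp (hdeg _ _) i) (MvPolynomial.degreeOf_C _ _)
  · intro B _ ψ Xs hX
    have hev : ∀ s p, (Xs p - ψ s) * MvPolynomial.eval₂ ψ Xs (O s p)
        = Th (fun j => ψ (zs j)) (Xs p) * MvPolynomial.eval₂ ψ (Function.update Xs p (ψ s)) P
          - Th (fun j => ψ (zs j)) (ψ s) * MvPolynomial.eval₂ ψ Xs P := by
      intro s p
      have h := congrArg (MvPolynomial.eval₂ ψ Xs) (hO s p)
      simp only [← MvPolynomial.coe_eval₂Hom, map_sub, map_mul] at h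
      simpa only [MvPolynomial.coe_eval₂Hom, eval₂_pTh, MvPolynomial.eval₂_C, MvPolynomial.eval₂_X,
        map_rTh, rTh_eq_Th, eval₂_aeval_update] using h
    have h1 : ∀ j, ψ (ws j) = (1 - ψ (zs j) * ψ t)⁻¹ := fun j => by
      refine eq_inv_of_mul_eq_one_right ?_
      simpa using congrArg ψ (hw j)
    have hT := Th_map_ne_zero hw ψ
    have hT' := Th_map_ne_zero hw' ψ
    rw [map_neg] at hT'
    simp only [gAp, ← MvPolynomial.coe_eval₂Hom, map_add, map_sum, map_sub, map_mul]
    simp only [MvPolynomial.coe_eval₂Hom, MvPolynomial.eval₂_C, h1,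
      map_prod_ws hw, map_prod_ws hw', map_neg, div_eq_mul_inv]
    congr 1
    refine Finset.sum_congr rfl fun p _ => ?_
    have e1 := hev t p
    have e2 := hev (-t) p
    have n1 := hX.sub_ne p
    have n2 := hX.add_ne p
    rw [map_neg, sub_neg_eq_add] at e2
    rw [sub_neg_eq_add]
    rw [mul_comm, ← eq_div_iff n1] at e1
    rw [mul_comm, ← eq_div_iff n2] at e2
    rw [e1, e2]
    field_simp
    ring

/-- Compared with `exists_gAp`, P is multiplied by X_p/t. In `exists_update_quot` this means r = c
X_p with cs = Θ(s), and such a c exists because t is invertible. -/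
theorem exists_gAm {ws' : Fin n → A} (hw : ∀ j, (1 - zs j * t) * ws j = 1)
    (hw' : ∀ j, (1 - zs j * -t) * ws' j = 1) {ti : A} (hti : ti * t = 1)
    {P : MvPolynomial (Fin l) A}
    (hP : DegLT n P) : ∃ O, Represents (fun _ _ => gAm) zs t P O (l' := l) := by
  have key : ∀ s c : A, c * s = rTh zs s → ∀ p, ∃ O : MvPolynomial (Fin l) A, DegLT n O ∧
      (MvPolynomial.X p - MvPolynomial.C s) * O = pTh zs (MvPolynomial.X p) *
        MvPolynomial.aeval (Function.update MvPolynomial.X p (MvPolynomial.C s)) P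
          - MvPolynomial.C c * MvPolynomial.X p * P := fun s c hc p =>
    exists_update_quot zs s hP p
      (by simp [← hc]) ((MvPolynomial.degreeOf_C_mul_le _ _ _).trans (by simp))
      (fun i hi => Nat.le_zero.mp ((MvPolynomial.degreeOf_C_mul_le _ _ _).trans
        (MvPolynomial.degreeOf_X_of_ne hi).le))
  choose O hdeg hO using key
  have c1 : rTh zs t * ti * t = rTh zs t := by rw [mul_assoc, hti, mul_one]
  have c2 : -(rTh zs (-t) * ti) * -t = rTh zs (-t) := by
    rw [neg_mul_neg, mul_assoc, hti, mul_one]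
  refine ⟨-(MvPolynomial.C (∑ j, ws j) * P) - ∑ p : Fin l,
    (MvPolynomial.C (t * ∏ j, ws j) * O t _ c1 p
      - MvPolynomial.C (t * ∏ j, ws' j) * O (-t) _ c2 p), ?_, ?_⟩
  · rw [degIn_of_forall_aeval]
    intro i
    refine DegIn.sub (DegIn.neg (DegIn.mul (degIn_of_forall_aeval.mp hP i)
      (MvPolynomial.degreeOf_C _ _))) (DegIn.sum fun p _ => DegIn.sub ?_ ?_) <;>
    exact DegIn.mul (degIn_of_forall_aeval.mp (hdeg _ _ _ _) i) (MvPolynomial.degreeOf_C _ _)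
  · intro B _ ψ Xs hX
    have hev : ∀ s c hc p, (Xs p - ψ s) * MvPolynomial.eval₂ ψ Xs (O s c hc p)
        = Th (fun j => ψ (zs j)) (Xs p) * MvPolynomial.eval₂ ψ (Function.update Xs p (ψ s)) P
          - ψ c * Xs p * MvPolynomial.eval₂ ψ Xs P := by
      intro s c hc p
      have h := congrArg (MvPolynomial.eval₂ ψ Xs) (hO s c hc p)
      simp only [← MvPolynomial.coe_eval₂Hom, map_sub, map_mul] at h
      simpa only [MvPolynomial.coe_eval₂Hom, eval₂_pTh, MvPolynomial.eval₂_C, MvPolynomial.eval₂_X,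
        map_rTh, rTh_eq_Th, eval₂_aeval_update] using h
    have h1 : ∀ j, ψ (ws j) = (1 - ψ (zs j) * ψ t)⁻¹ := fun j => by
      refine eq_inv_of_mul_eq_one_right ?_
      simpa using congrArg ψ (hw j)
    have hti' : ψ ti = (ψ t)⁻¹ := eq_inv_of_mul_eq_one_left (by simpa using congrArg ψ hti)
    have hT := Th_map_ne_zero hw ψ
    have hT' := Th_map_ne_zero hw' ψ
    have ht := hX.t_ne
    rw [map_neg] at hT'
    simp only [gAm, ← MvPolynomial.coe_eval₂Hom, map_sum, map_sub, map_mul, map_neg]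
    simp only [MvPolynomial.coe_eval₂Hom, MvPolynomial.eval₂_C, h1,
      map_prod_ws hw, map_prod_ws hw', map_neg, one_div]
    congr 1
    refine Finset.sum_congr rfl fun p _ => ?_
    have e1 := hev t _ c1 p
    have e2 := hev (-t) _ c2 p
    have n1 := hX.sub_ne p
    have n2 := hX.add_ne p
    rw [map_neg, sub_neg_eq_add, map_neg] at e2
    rw [map_mul, map_rTh, rTh_eq_Th, hti'] at e1 e2
    rw [map_neg] at e2
    rw [sub_neg_eq_add]
    rw [mul_comm, ← eq_div_iff n1] at e1
    rw [mul_comm, ← eq_div_iff n2] at e2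
    rw [e1, e2]
    field_simp
    ring

end Existence

/-! ### The representing polynomial for the divided square of x⁻ -/

section Existence

variable {A : Type} [CommRing A] [IsDomain A] [Algebra ℂ A] {n l : ℕ} {zs : Fin n → A} {t : A}
variable {ws : Fin n → A}

theorem aeval_update_rename {σ : Type*} [DecidableEq σ] {R : Type*} [CommRing R] {m : ℕ}
    (f : Fin m → σ) (i : σ)
    (hf : ∀ j, f j ≠ i) (c : MvPolynomial σ R) (g : MvPolynomial (Fin m) R) :
    MvPolynomial.aeval (Function.update MvPolynomial.X i c) (MvPolynomial.rename f g)
      = MvPolynomial.rename f g := by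
  rw [MvPolynomial.aeval_rename, MvPolynomial.rename_eq_aeval]
  congr 2
  funext j
  simp [hf j]

/-- The numerator of `F^{(2)}(t|x, y)`, divided by the factors of the denominator. -/
theorem exists_quot_two (zs : Fin n → A) (t : A) :
    ∃ (g : MvPolynomial (Fin 1) A) (E N : MvPolynomial (Fin 2) A), DegIn 0 n N ∧ DegIn 1 n N ∧
    (MvPolynomial.X 0 - MvPolynomial.C t) * g
      = MvPolynomial.C (rTh zs t) * pTh zs (-MvPolynomial.X 0)
        - MvPolynomial.C (rTh zs (-t)) * pTh zs (MvPolynomial.X 0) ∧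
    (MvPolynomial.X 0 - -MvPolynomial.X 1) * E
      = pTh zs (MvPolynomial.X 0) * pTh zs (MvPolynomial.X 1)
        - pTh zs (-MvPolynomial.X 0) * pTh zs (-MvPolynomial.X 1) ∧
    (MvPolynomial.X 0 - MvPolynomial.C (-t)) * ((MvPolynomial.X 1 - MvPolynomial.C (-t)) * N)
      = (MvPolynomial.X 0 - MvPolynomial.X 1) * E * MvPolynomial.C (rTh zs t)
        + pTh zs (-MvPolynomial.X 1) * MvPolynomial.rename (fun _ => 0) g
            * (MvPolynomial.X 0 - MvPolynomial.C (-t))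
        - pTh zs (-MvPolynomial.X 0) * MvPolynomial.rename (fun _ => 1) g
            * (MvPolynomial.X 1 - MvPolynomial.C (-t)) := by
  obtain ⟨g, hgdeg, hg⟩ := exists_quot zs t
  have hE : MvPolynomial.X 0 - -MvPolynomial.X 1 ∣
      pTh zs (MvPolynomial.X 0) * pTh zs (MvPolynomial.X 1)
        - pTh zs (-MvPolynomial.X 0) * pTh zs (-MvPolynomial.X (1 : Fin 2)) := by
    apply X_sub_dvd_of_aeval_eq_zero
    simp only [map_sub, map_mul, aeval_pTh, map_neg, MvPolynomial.aeval_X, Function.update_self,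
      Function.update_of_ne (show (1 : Fin 2) ≠ 0 by decide), neg_neg]
    ring
  obtain ⟨E, hE⟩ := hE
  have hg' : ∀ i : Fin 2, (MvPolynomial.X i - MvPolynomial.C t) * MvPolynomial.rename (fun _ => i) g
      = MvPolynomial.C (rTh zs t) * pTh zs (-MvPolynomial.X i)
        - MvPolynomial.C (rTh zs (-t)) * pTh zs (MvPolynomial.X i) := by
    intro i
    have h := congrArg (MvPolynomial.rename (fun _ => i)) hg
    rw [MvPolynomial.rename_eq_aeval] at h ⊢
    simpa only [map_sub, map_mul, aeval_pTh, map_neg, MvPolynomial.aeval_X, MvPolynomial.algHom_C,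
      MvPolynomial.algebraMap_eq, Function.comp_apply] using h
  -- With g(x) = Θ(t, -x)/(x - t) and E = Θ(x, y)/(x + y), this is F^{(2)}(t | x, y) multiplied by
  -- (x + t)(y + t)Θ(t)/t². It remains to divide by x + t and by y + t.
  set M := (MvPolynomial.X 0 - MvPolynomial.X 1) * E * MvPolynomial.C (rTh zs t)
        + pTh zs (-MvPolynomial.X 1) * MvPolynomial.rename (fun _ => 0) g
            * (MvPolynomial.X 0 - MvPolynomial.C (-t))
        - pTh zs (-MvPolynomial.X 0) * MvPolynomial.rename (fun _ => 1) g
            * (MvPolynomial.X 1 - MvPolynomial.C (-t)) with hM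
  have h0 : MvPolynomial.aeval
      (Function.update MvPolynomial.X (0 : Fin 2) (MvPolynomial.C (-t))) M = 0 := by
    have h1 := congrArg (MvPolynomial.aeval
      (Function.update MvPolynomial.X (0 : Fin 2) (MvPolynomial.C (-t)))) hE
    have h2 := hg' 1
    simp only [hM, map_add, map_sub, map_mul, aeval_pTh, map_neg, MvPolynomial.aeval_X,
      Function.update_self, Function.update_of_ne (show (1 : Fin 2) ≠ 0 by decide),
      MvPolynomial.algHom_C, MvPolynomial.algebraMap_eq, neg_neg,
      aeval_update_rename (fun _ : Fin 1 => (1 : Fin 2)) 0 (fun _ => by decide)] at h1 ⊢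
    simp only [← map_neg, pTh_C] at h1 h2 ⊢
    have hc : (MvPolynomial.C (-t) : MvPolynomial (Fin 2) A) = -MvPolynomial.C t := map_neg _ _
    generalize MvPolynomial.aeval (Function.update
      (MvPolynomial.X : Fin 2 → MvPolynomial (Fin 2) A) 0 (MvPolynomial.C (-t))) E = E' at h1 ⊢
    -- After multiplication by y - t both sides are Θ(t)Θ(-y) - Θ(-t)Θ(y). Consequently at x = -t
    -- the first and third terms of `M` cancel, while the second vanishes with its factor x + t.
    have h3 : MvPolynomial.rename (fun _ => (1 : Fin 2)) g = -E' := by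
      apply mul_left_cancel₀ (X_sub_C_ne_zero (R := A) (1 : Fin 2) t)
      linear_combination h2 - h1 - hc * E'
    rw [h3]
    ring
  obtain ⟨N1, hN1⟩ := X_sub_dvd_of_aeval_eq_zero h0
  have h1 : MvPolynomial.aeval
      (Function.update MvPolynomial.X (1 : Fin 2) (MvPolynomial.C (-t))) N1 = 0 := by
    apply mul_left_cancel₀ (X_sub_C_ne_zero (R := A) (0 : Fin 2) (-t))
    have h1 := congrArg (MvPolynomial.aeval
      (Function.update MvPolynomial.X (1 : Fin 2) (MvPolynomial.C (-t)))) hE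
    have h2 := hg' 0
    have h3 := congrArg (MvPolynomial.aeval
      (Function.update MvPolynomial.X (1 : Fin 2) (MvPolynomial.C (-t)))) hN1
    simp only [hM, map_add, map_sub, map_mul, aeval_pTh, map_neg, MvPolynomial.aeval_X,
      Function.update_self, Function.update_of_ne (show (0 : Fin 2) ≠ 1 by decide),
      MvPolynomial.algHom_C, MvPolynomial.algebraMap_eq, neg_neg,
      aeval_update_rename (fun _ : Fin 1 => (0 : Fin 2)) 1 (fun _ => by decide)] at h1 h3 ⊢
    simp only [← map_neg, pTh_C] at h1 h2 h3 ⊢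
    generalize MvPolynomial.aeval (Function.update
      (MvPolynomial.X : Fin 2 → MvPolynomial (Fin 2) A) 1 (MvPolynomial.C (-t))) E = E' at h1 h3 ⊢
    have h4 : MvPolynomial.rename (fun _ => (0 : Fin 2)) g = -E' := by
      apply mul_left_cancel₀ (X_sub_C_ne_zero (R := A) (0 : Fin 2) t)
      linear_combination h2 - h1
    rw [mul_zero, ← h3, h4]
    ring
  obtain ⟨N, hN⟩ := X_sub_dvd_of_aeval_eq_zero h1
  have hN' : (MvPolynomial.X 0 - MvPolynomial.C (-t)) * ((MvPolynomial.X 1 - MvPolynomial.C (-t)) * N)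
      = M := by rw [← hN, ← hN1]
  have hX : ∀ i j : Fin 2, MvPolynomial.degreeOf i (MvPolynomial.X j : MvPolynomial (Fin 2) A)
      = if i = j then 1 else 0 := by
    intro i j
    rw [MvPolynomial.degreeOf_X]
  have hXC : ∀ i j : Fin 2, MvPolynomial.degreeOf i
      (MvPolynomial.X j - MvPolynomial.C (-t) : MvPolynomial (Fin 2) A)
      = if i = j then 1 else 0 := by
    intro i j
    split_ifs with h
    · rw [h]
      exact degreeOf_X_sub_C_self _ _
    · exact degreeOf_X_sub_C_of_ne h _
  have hT : ∀ i j : Fin 2, MvPolynomial.degreeOf i (pTh zs (MvPolynomial.X j))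
      ≤ if i = j then n else 0 := by
    intro i j
    refine (degreeOf_pTh_le _ _ (hX i j).le).trans ?_
    split_ifs <;> simp
  have hT' : ∀ i j : Fin 2, MvPolynomial.degreeOf i (pTh zs (-MvPolynomial.X j))
      ≤ if i = j then n else 0 := by
    intro i j
    refine (degreeOf_pTh_le (d := if i = j then 1 else 0) _ _ (by
      rw [MvPolynomial.degreeOf_neg]; exact (hX i j).le)).trans ?_
    split_ifs <;> simp
  have hsum : ∀ i : Fin 2, MvPolynomial.degreeOf i
      (MvPolynomial.X 0 - -MvPolynomial.X 1 : MvPolynomial (Fin 2) A) = 1 := by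
    intro i
    rw [sub_neg_eq_add]
    obtain rfl | rfl : i = 0 ∨ i = 1 := by omega
    · rw [MvPolynomial.degreeOf_add_eq_of_degreeOf_lt (by simp [hX]), hX, if_pos rfl]
    · rw [add_comm, MvPolynomial.degreeOf_add_eq_of_degreeOf_lt (by simp [hX]), hX, if_pos rfl]
  have hsum0 : (MvPolynomial.X 0 - -MvPolynomial.X 1 : MvPolynomial (Fin 2) A) ≠ 0 := by
    intro h
    have := hsum 0
    rw [h] at this
    simp at this
  have hEdeg : ∀ i, DegIn i n E := by
    intro i
    refine degIn_of_mul_of_degree hsum0 ?_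
    rw [← hE, hsum i]
    refine DegIn.sub ?_ ?_ <;> rw [degIn_succ_iff]
    · refine (MvPolynomial.degreeOf_mul_le _ _ _).trans ((add_le_add (hT i 0) (hT i 1)).trans ?_)
      fin_cases i <;> simp
    · refine (MvPolynomial.degreeOf_mul_le _ _ _).trans ((add_le_add (hT' i 0) (hT' i 1)).trans ?_)
      fin_cases i <;> simp
  have hterm1 : ∀ i, DegIn i (n + 1)
      ((MvPolynomial.X 0 - MvPolynomial.X 1) * E * MvPolynomial.C (rTh zs t)) := by
    intro i
    rw [mul_comm]
    refine DegIn.mul ((hEdeg i).mul_le ((MvPolynomial.degreeOf_sub_le _ _ _).trans ?_))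
      (MvPolynomial.degreeOf_C _ _)
    rw [hX, hX]
    fin_cases i <;> simp
  have hterm : ∀ i j k : Fin 2, j ≠ k → DegIn i (n + 1)
      (pTh zs (-MvPolynomial.X k) * MvPolynomial.rename (fun _ => j) g
            * (MvPolynomial.X j - MvPolynomial.C (-t))) := by
    intro i j k hjk
    rcases eq_or_ne i j with rfl | hij
    · rw [mul_assoc]
      refine DegIn.mul ?_ (Nat.le_zero.mp ((hT' i k).trans (by simp [hjk])))
      rw [mul_comm]
      refine DegIn.mul_le (hgdeg.rename (f := fun _ : Fin 1 => i)
        (Function.injective_of_subsingleton _)) ?_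
      rw [hXC, if_pos rfl]
    · rw [degIn_succ_iff]
      refine (MvPolynomial.degreeOf_mul_le _ _ _).trans ?_
      rw [hXC, if_neg hij, add_zero]
      refine (MvPolynomial.degreeOf_mul_le _ _ _).trans ?_
      rw [degreeOf_rename_of_notMem (fun _ => hij.symm), add_zero]
      refine (hT' i k).trans ?_
      split_ifs <;> simp
  have hNdeg : ∀ i, DegIn i n N := by
    intro i
    -- Each term of `M` has degree at most n in either variable, and the divisor has degree exactly
    -- 1 in it.
    refine degIn_of_mul_of_degree (mul_ne_zero (X_sub_C_ne_zero 0 (-t)) (X_sub_C_ne_zero 1 (-t))) ?_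
    rw [mul_assoc, hN', MvPolynomial.degreeOf_mul_eq (X_sub_C_ne_zero 0 (-t))
      (X_sub_C_ne_zero 1 (-t)), hXC, hXC]
    have h1 : ((if i = 0 then 1 else 0) + if i = 1 then 1 else 0) = 1 := by
      fin_cases i <;> simp
    rw [h1]
    exact ((hterm1 i).add (hterm i 0 1 (by decide))).sub (hterm i 1 0 (by decide))
  exact ⟨g, E, N, hNdeg 0, hNdeg 1, hg, hE.symm, hN'⟩

theorem exists_gXm2 (hw : ∀ j, (1 - zs j * t) * ws j = 1) {P : MvPolynomial (Fin l) A}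
    (hP : DegLT n P) : ∃ O, Represents (fun _ _ => gXm2) zs t P O (l' := l + 2) := by
  obtain ⟨g, E, N, hd0, hd1, hg, hE, hN⟩ := exists_quot_two zs t
  have hdeg : ∀ i, DegIn i n N := by
    intro i
    fin_cases i
    · exact hd0
    · exact hd1
  refine ⟨MvPolynomial.C (algebraMap ℂ A (((2 * l.factorial : ℕ)) : ℂ)⁻¹) *
    ∑ σ : Equiv.Perm (Fin (l + 2)), ((Equiv.Perm.sign σ : ℤˣ) : ℤ) •
      (MvPolynomial.C (t ^ 2 * ∏ j, ws j) *
        (MvPolynomial.rename (fun i : Fin 2 => σ (Fin.castAdd l i |>.cast (add_comm _ _))) N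
          * MvPolynomial.rename (fun i => σ i.succ.succ) P)),
    ?_, ?_⟩
  · rw [degIn_of_forall_aeval]
    intro i
    refine DegIn.mul (DegIn.sum fun σ _ => DegIn.zsmul (DegIn.mul ?_ (MvPolynomial.degreeOf_C _ _)) _)
      (MvPolynomial.degreeOf_C _ _)
    have hinj : Function.Injective fun i : Fin l => σ i.succ.succ :=
      σ.injective.comp ((Fin.succ_injective _).comp (Fin.succ_injective l))
    have hinj2 : Function.Injective fun i : Fin 2 => σ (Fin.castAdd l i |>.cast (add_comm _ _)) :=
      σ.injective.comp ((Fin.cast_injective _).comp (Fin.castAdd_injective _ _))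
    have hne : ∀ (i : Fin 2) (j : Fin l),
        σ (Fin.castAdd l i |>.cast (add_comm _ _)) ≠ σ j.succ.succ := by
      intro i j h
      have := congrArg Fin.val (σ.injective h)
      simp at this
      omega
    obtain ⟨i, rfl⟩ := σ.surjective i
    have hi : (∃ k : Fin 2, i = (Fin.castAdd l k |>.cast (add_comm _ _))) ∨
        ∃ k : Fin l, i = k.succ.succ := by
      rcases lt_or_ge (i : ℕ) 2 with h | h
      · exact Or.inl ⟨⟨i, h⟩, rfl⟩
      · exact Or.inr ⟨⟨i - 2, by omega⟩, by ext; simp; omega⟩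
    rcases hi with ⟨k, rfl⟩ | ⟨k, rfl⟩
    · rw [mul_comm]
      exact DegIn.mul ((hdeg k).rename hinj2)
        (degreeOf_rename_of_notMem (fun j h => hne _ _ h.symm) _)
    · exact DegIn.mul (DegIn.rename hinj (degIn_of_forall_aeval.mp hP k))
        (degreeOf_rename_of_notMem (fun j h => hne _ _ h) _)
  · intro B _ ψ Xs hX
    rw [MvPolynomial.eval₂_mul, MvPolynomial.eval₂_C, map_algebraMap_inv, gXm2]
    push_cast
    congr 1
    apply eval₂_alt ψ _ Xs (h := fun w => F2 (fun j => ψ (zs j)) (ψ t) (w 0) (w 1) *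
      MvPolynomial.eval₂ ψ (fun i => w i.succ.succ) P)
    intro σ
    rw [MvPolynomial.eval₂_mul, MvPolynomial.eval₂_mul, MvPolynomial.eval₂_C,
      MvPolynomial.eval₂_rename, MvPolynomial.eval₂_rename, ← mul_assoc]
    congr 1
    have hfun : (Xs ∘ fun i : Fin 2 => σ (Fin.castAdd l i |>.cast (add_comm _ _)))
        = ![Xs (σ 0), Xs (σ 1)] := by
      funext i
      fin_cases i <;> rfl
    rw [hfun]
    have hgx : ∀ x : B, x - ψ t ≠ 0 → MvPolynomial.eval₂ ψ (fun _ => x) g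
        = Th2 (fun j => ψ (zs j)) (ψ t) (-x) / (x - ψ t) := by
      intro x hx
      have h := congrArg (MvPolynomial.eval₂ ψ (fun _ => x)) hg
      simp only [← MvPolynomial.coe_eval₂Hom, map_sub, map_mul] at h
      simp only [MvPolynomial.coe_eval₂Hom, eval₂_pTh, MvPolynomial.eval₂_C, MvPolynomial.eval₂_X,
        map_rTh, rTh_eq_Th, MvPolynomial.eval₂_neg, map_neg] at h
      rw [eq_div_iff hx, mul_comm, h, Th2, neg_neg]
    have hx1 := hX.sub_ne (σ 0)
    have hy1 := hX.sub_ne (σ 1)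
    have hx2 := hX.add_ne (σ 0)
    have hy2 := hX.add_ne (σ 1)
    have hxy := hX.pair_ne (σ 0) (σ 1) (fun h => by simpa using σ.injective h)
    have hT := Th_map_ne_zero hw ψ
    simp only [Function.comp_apply]
    generalize Xs (σ 0) = x at *
    generalize Xs (σ 1) = y at *
    have hEv : MvPolynomial.eval₂ ψ ![x, y] E = Th2 (fun j => ψ (zs j)) x y / (x + y) := by
      have h := congrArg (MvPolynomial.eval₂ ψ ![x, y]) hE
      simp only [← MvPolynomial.coe_eval₂Hom, map_sub, map_mul] at h
      simp only [MvPolynomial.coe_eval₂Hom, eval₂_pTh, MvPolynomial.eval₂_X,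
        MvPolynomial.eval₂_neg, Matrix.cons_val_zero, Matrix.cons_val_one, sub_neg_eq_add] at h
      rw [eq_div_iff hxy, mul_comm, h, Th2]
    have hNv := congrArg (MvPolynomial.eval₂ ψ ![x, y]) hN
    simp only [← MvPolynomial.coe_eval₂Hom, map_sub, map_mul, map_add] at hNv
    simp only [MvPolynomial.coe_eval₂Hom, eval₂_pTh, MvPolynomial.eval₂_X, MvPolynomial.eval₂_C,
        MvPolynomial.eval₂_neg, Matrix.cons_val_zero, Matrix.cons_val_one, sub_neg_eq_add, map_neg,
        MvPolynomial.eval₂_rename, Function.comp_def, hgx x hx1, hgx y hy1, hEv, map_rTh,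
        rTh_eq_Th] at hNv
    rw [← mul_assoc, mul_comm, ← eq_div_iff (mul_ne_zero hx2 hy2)] at hNv
    simp only [hNv, map_mul, map_pow, map_prod_ws hw, F2]
    field_simp

end Existence

/-! ### The generic point in the field of rational functions -/

section GenericPoint

variable (R : Type) [CommRing R] [IsDomain R] (l : ℕ)

/-- The field of rational functions in `X_1, …, X_l` over the Laurent series over `R`. -/
def FB : Type := FractionRing (MvPolynomial (Fin l) (HahnSeries ℤ R))

instance : Field (FB R l) :=
  inferInstanceAs (Field (FractionRing (MvPolynomial (Fin l) (HahnSeries ℤ R))))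

instance : Algebra (MvPolynomial (Fin l) (HahnSeries ℤ R)) (FB R l) :=
  inferInstanceAs (Algebra _ (FractionRing (MvPolynomial (Fin l) (HahnSeries ℤ R))))

instance : IsFractionRing (MvPolynomial (Fin l) (HahnSeries ℤ R)) (FB R l) :=
  inferInstanceAs (IsFractionRing _ (FractionRing (MvPolynomial (Fin l) (HahnSeries ℤ R))))

/-- The inclusion of Laurent series. -/
def psi : HahnSeries ℤ R →+* FB R l :=
  (algebraMap (MvPolynomial (Fin l) (HahnSeries ℤ R)) (FB R l)).comp MvPolynomial.C

/-- The generic point. -/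
def gX (i : Fin l) : FB R l :=
  algebraMap (MvPolynomial (Fin l) (HahnSeries ℤ R)) (FB R l) (MvPolynomial.X i)

variable {R l}

theorem algebraMap_FB_injective :
    Function.Injective (algebraMap (MvPolynomial (Fin l) (HahnSeries ℤ R)) (FB R l)) :=
  IsFractionRing.injective _ _

theorem eval₂_gX (O : MvPolynomial (Fin l) (HahnSeries ℤ R)) :
    MvPolynomial.eval₂ (psi R l) (gX R l) O = algebraMap _ (FB R l) O := by
  have h := MvPolynomial.eval₂_comp_left (algebraMap _ (FB R l)) MvPolynomial.C MvPolynomial.X O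
  rw [MvPolynomial.eval₂_eta] at h
  exact h.symm

theorem eval₂_gX_injective {O O' : MvPolynomial (Fin l) (HahnSeries ℤ R)}
    (h : MvPolynomial.eval₂ (psi R l) (gX R l) O = MvPolynomial.eval₂ (psi R l) (gX R l) O') :
    O = O' := by
  rw [eval₂_gX, eval₂_gX] at h
  exact algebraMap_FB_injective h

theorem tauR_ne_zero (e : Side) : tauR R e ≠ 0 := by
  cases e <;> simp [tauR]

theorem psi_injective : Function.Injective (psi R l) :=
  algebraMap_FB_injective.comp (MvPolynomial.C_injective _ _)

theorem gX_sub_psi_ne_zero (i : Fin l) (a : HahnSeries ℤ R) : gX R l i - psi R l a ≠ 0 := by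
  rw [gX, psi, RingHom.comp_apply, ← map_sub, Ne, map_eq_zero_iff _ algebraMap_FB_injective]
  exact X_sub_C_ne_zero i a

theorem gX_add_psi_ne_zero (i : Fin l) (a : HahnSeries ℤ R) : gX R l i + psi R l a ≠ 0 := by
  rw [← sub_neg_eq_add, ← map_neg]
  exact gX_sub_psi_ne_zero i _

theorem gX_add_gX_ne_zero {i j : Fin l} (hij : i ≠ j) : gX R l i + gX R l j ≠ 0 := by
  rw [gX, gX, ← map_add, Ne, map_eq_zero_iff _ algebraMap_FB_injective]
  intro h
  have := congrArg (MvPolynomial.eval (Pi.single i 1)) h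
  simp [hij.symm] at this

theorem gen_gX (e : Side) : Gen (psi R l (tauR R e)) (gX R l) where
  t_ne := by
    rw [Ne, map_eq_zero_iff _ psi_injective]
    exact tauR_ne_zero e
  sub_ne i := gX_sub_psi_ne_zero i _
  add_ne i := gX_add_psi_ne_zero i _
  pair_ne _ _ hij := gX_add_gX_ne_zero hij

theorem Gen.comp_perm {B : Type*} [Field B] {t : B} {Xs : Fin l → B} (h : Gen t Xs)
    (σ : Equiv.Perm (Fin l)) : Gen t (Xs ∘ σ) where
  t_ne := h.t_ne
  sub_ne _ := h.sub_ne _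
  add_ne _ := h.add_ne _
  pair_ne _ _ hij := h.pair_ne _ _ fun h => hij (σ.injective h)

theorem C_sub_tauR_ne_zero {c : R} (hc : c ≠ 0) (e : Side) :
    (HahnSeries.C c : HahnSeries ℤ R) - tauR R e ≠ 0 := by
  intro h
  have := congrArg (fun f : HahnSeries ℤ R => f.coeff 0) h
  cases e <;> simp [tauR, HahnSeries.C_apply] at this <;> exact hc this

/-- A nonzero constant differs from ±t because t has no constant coefficient. This is the point
(X_1, …, X_l, z⁻¹) at which links are tested. -/
theorem gen_snoc (e : Side) {c : R} (hc : c ≠ 0) :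
    Gen (psi R l (tauR R e))
      (Fin.snoc (gX R l) (psi R l (HahnSeries.C c)) : Fin (l + 1) → FB R l) where
  t_ne := (gen_gX e).t_ne
  sub_ne i := by
    refine Fin.lastCases ?_ (fun i => ?_) i
    · rw [Fin.snoc_last, ← map_sub, Ne, map_eq_zero_iff _ psi_injective]
      exact C_sub_tauR_ne_zero hc e
    · rw [Fin.snoc_castSucc]
      exact gX_sub_psi_ne_zero i _
  add_ne i := by
    refine Fin.lastCases ?_ (fun i => ?_) i
    · rw [Fin.snoc_last, ← map_add, Ne, map_eq_zero_iff _ psi_injective, ← neg_eq_zero, neg_add',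
        ← map_neg]
      exact C_sub_tauR_ne_zero (neg_ne_zero.mpr hc) e
    · rw [Fin.snoc_castSucc]
      exact gX_add_psi_ne_zero i _
  pair_ne i j := by
    refine Fin.lastCases ?_ (fun i => ?_) i <;> refine Fin.lastCases ?_ (fun j => ?_) j
    · exact fun h => absurd rfl h
    · intro _
      rw [Fin.snoc_last, Fin.snoc_castSucc, add_comm]
      exact gX_add_psi_ne_zero j _
    · intro _
      rw [Fin.snoc_last, Fin.snoc_castSucc]
      exact gX_add_psi_ne_zero i _
    · intro h
      rw [Fin.snoc_castSucc, Fin.snoc_castSucc]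
      exact gX_add_gX_ne_zero fun h' => h (by rw [h'])

end GenericPoint

/-! ### From formulas to operators on deformed cycles -/

section Transfer

variable {n l l' : ℕ}

/-- The variables `z_j` as constant Laurent series. -/
def zT (n : ℕ) (j : Fin n) : HahnSeries ℤ (Lau n) := HahnSeries.C (LZ j : Lau n)

theorem one_sub_zT_mul (e : Side) (j : Fin n) :
    (1 - zT n j * tauR (Lau n) e) * geom (LZ j) e = 1 := one_sub_mul_geom _ _

theorem one_sub_zT_mul_neg (e : Side) (j : Fin n) :
    (1 - zT n j * -tauR (Lau n) e) * geom (-LZ j) e = 1 := by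
  have h : zT n j * -tauR (Lau n) e
      = HahnSeries.C ((-LZ j : (Lau n)ˣ) : Lau n) * tauR (Lau n) e := by
    rw [zT, Units.val_neg, map_neg]
    ring
  rw [h]
  exact one_sub_mul_geom _ _

theorem exists_tauR_inv (R : Type*) [CommRing R] (e : Side) : ∃ ti, ti * tauR R e = 1 := by
  cases e
  · exact ⟨HahnSeries.single (-1) 1, by simp [tauR]⟩
  · exact ⟨HahnSeries.single 1 1, by simp [tauR]⟩

/-- Formulas which define operators on the spaces of deformed cycles. -/
structure IsOperatorFormula (e : Side) (G : Formula n l l') : Prop where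
  comp_zs : ∀ (B : Type) [Field B] (zs : Fin n → B) (π : Equiv.Perm (Fin n)) t Xs f,
    G B (zs ∘ π) t Xs f = G B zs t Xs f
  skew : ∀ (B : Type) [Field B] (zs : Fin n → B) t f, IsSkewFn f →
    IsSkewFn fun Xs => G B zs t Xs f
  exist : ∀ Q : MvPolynomial (Fin l) (Lau n), DegLT n Q → ∃ O,
    Represents G (zT n) (tauR (Lau n) e) (MvPolynomial.map HahnSeries.C Q) O

theorem isSkewFn_eval₂ {R : Type*} [CommRing R] {B : Type*} [Field B] (ψ : R →+* B)
    {Q : MvPolynomial (Fin l) R} (hQ : IsSkew Q) :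
    IsSkewFn fun v => MvPolynomial.eval₂ ψ v Q := by
  intro σ v
  show MvPolynomial.eval₂ ψ (v ∘ σ) Q = _ * MvPolynomial.eval₂ ψ v Q
  rw [← MvPolynomial.eval₂_rename, hQ σ, ← MvPolynomial.coe_eval₂Hom, map_zsmul, zsmul_eq_mul]

variable {e : Side} {G : Formula n l l'} {Q : MvPolynomial (Fin l) (Lau n)}
  {O : MvPolynomial (Fin l') (HahnSeries ℤ (Lau n))}

/-- Permuting the coordinates of the generic point keeps it in general position, so skew-symmetry of
the formula there becomes skew-symmetry of `O`. -/
theorem Represents.isSkew (hG : IsOperatorFormula e G) (hQ : LD n l Q)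
    (hO : Represents G (zT n) (tauR (Lau n) e) (MvPolynomial.map HahnSeries.C Q) O) :
    IsSkew O := by
  intro σ
  apply eval₂_gX_injective
  rw [MvPolynomial.eval₂_rename, hO.eval _ _ _ ((gen_gX e).comp_perm σ)]
  have h := hG.skew _ (fun j => psi _ l' (zT n j)) (psi _ l' (tauR (Lau n) e)) _
    (isSkewFn_eval₂ (psi (Lau n) l') (map_isSkew HahnSeries.C hQ.skew)) σ (gX _ l')
  simp only at h
  rw [h, ← hO.eval _ _ _ (gen_gX e), ← MvPolynomial.coe_eval₂Hom, map_zsmul, zsmul_eq_mul]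

theorem mapT_permLau_zT (π : Equiv.Perm (Fin n)) (j : Fin n) :
    mapT (permLau π) (zT n j) = zT n (π j) := by
  rw [zT, mapT_C, permLau_LZ, zT]

theorem eval₂_comp_mapT_permLau (hQ : LD n l Q) (π : Equiv.Perm (Fin n)) {B : Type} [Field B]
    (ψ : HahnSeries ℤ (Lau n) →+* B) (v : Fin l → B) :
    MvPolynomial.eval₂ (ψ.comp (mapT (permLau π))) v (MvPolynomial.map HahnSeries.C Q)
      = MvPolynomial.eval₂ ψ v (MvPolynomial.map HahnSeries.C Q) := by
  have h : (ψ.comp (mapT (permLau π))).comp HahnSeries.C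
      = (ψ.comp HahnSeries.C).comp (permLau π) := by
    ext r
    simp only [RingHom.comp_apply, mapT_C]
  rw [MvPolynomial.eval₂_map, MvPolynomial.eval₂_map, h, ← MvPolynomial.eval₂_map, hQ.symm π]

/-- Evaluate `O` through the homomorphism twisted by π. The coefficients of `Q` do not feel the
twist, the z_j are permuted, and the formula is symmetric in them; hence the value at the generic
point is unchanged. -/
theorem Represents.symm (hG : IsOperatorFormula e G) (hQ : LD n l Q)
    (hO : Represents G (zT n) (tauR (Lau n) e) (MvPolynomial.map HahnSeries.C Q) O)
    (π : Equiv.Perm (Fin n)) : MvPolynomial.map (mapT (permLau π)) O = O := by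
  apply eval₂_gX_injective
  have ht : ((psi (Lau n) l').comp (mapT (permLau π))) (tauR (Lau n) e)
      = psi (Lau n) l' (tauR (Lau n) e) := by
    rw [RingHom.comp_apply, mapT_tauR]
  have hz : (fun j => ((psi (Lau n) l').comp (mapT (permLau π))) (zT n j))
      = (fun j => psi (Lau n) l' (zT n j)) ∘ π := by
    funext j
    rw [RingHom.comp_apply, mapT_permLau_zT, Function.comp_apply]
  have hev := hO.eval (FB (Lau n) l') ((psi (Lau n) l').comp (mapT (permLau π))) (gX (Lau n) l')
    (by rw [ht]; exact gen_gX e)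
  simp only [eval₂_comp_mapT_permLau hQ] at hev
  rw [ht, hz, hG.comp_zs _ _ π] at hev
  rw [MvPolynomial.eval₂_map, hev, hO.eval _ _ _ (gen_gX e)]

theorem Represents.LD (hG : IsOperatorFormula e G) (hQ : LD n l Q)
    (hO : Represents G (zT n) (tauR (Lau n) e) (MvPolynomial.map HahnSeries.C Q) O) (k : ℤ) :
    LD n l' (cP e k O) where
  skew σ := by rw [← cP_rename, hO.isSkew hG hQ σ, map_zsmul]
  deg := degIn_of_forall_aeval.mpr fun i => (degIn_of_forall_aeval.mp hO.deg i).cP e k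
  symm π := by rw [← cP_map, hO.symm hG hQ π]

/-- The inclusion of Laurent series with Laurent polynomials as coefficients. -/
def mapL (n : ℕ) : HahnSeries ℤ (Lau n) →+* L n :=
  (mapT (lauToK n) : HahnSeries ℤ (Lau n) →+* HahnSeries ℤ (K n))

theorem mapL_C (r : Lau n) : mapL n (HahnSeries.C r) = algebraMap (K n) (L n) (lauToK n r) := by
  refine (mapT_C (lauToK n) r).trans ?_
  symm
  exact (HahnSeries.algebraMap_apply (Γ := ℤ) (R := K n) (A := K n) ..)

theorem mapL_tauR (e : Side) : mapL n (tauR (Lau n) e) = tau n e := by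
  refine (mapT_tauR (lauToK n) e).trans ?_
  cases e <;> rfl

/-- The inclusion of Laurent series into the field in which the formulas are evaluated. -/
def psiB (n l : ℕ) : HahnSeries ℤ (Lau n) →+* B n l := (algebraMap (L n) (B n l)).comp (mapL n)

theorem eval₂_psiB (O : MvPolynomial (Fin l) (HahnSeries ℤ (Lau n))) :
    MvPolynomial.eval₂ (psiB n l) (X n l) O
      = algebraMap (MvPolynomial (Fin l) (L n)) (B n l) (MvPolynomial.map (mapL n) O) := by
  have h := MvPolynomial.eval₂_comp_left (algebraMap (MvPolynomial (Fin l) (L n)) (B n l))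
    MvPolynomial.C MvPolynomial.X (MvPolynomial.map (mapL n) O)
  rw [MvPolynomial.eval₂_eta, MvPolynomial.eval₂_map] at h
  rw [h]
  rfl

theorem mapT_injective {R S : Type*} [CommRing R] [CommRing S] {φ : R →+* S}
    (hφ : Function.Injective φ) : Function.Injective (mapT φ) := by
  intro x y h
  ext k
  apply hφ
  rw [← mapT_coeff, h, mapT_coeff]

theorem psiB_injective : Function.Injective (psiB n l) :=
  (algebraMap (L n) (B n l)).injective.comp (mapT_injective lauToK_injective)

theorem X_sub_algebraMap_ne_zero (i : Fin l) (a : L n) :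
    X n l i - algebraMap (L n) (B n l) a ≠ 0 := by
  rw [IsScalarTower.algebraMap_apply (L n) (MvPolynomial (Fin l) (L n)) (B n l), X, ← map_sub, Ne,
    map_eq_zero_iff _ (IsFractionRing.injective (MvPolynomial (Fin l) (L n)) (B n l))]
  exact X_sub_C_ne_zero i a

theorem gen_B (e : Side) : Gen (psiB n l (tauR (Lau n) e)) (X n l) where
  t_ne := by
    rw [Ne, map_eq_zero_iff _ psiB_injective]
    exact tauR_ne_zero e
  sub_ne i := X_sub_algebraMap_ne_zero i _
  add_ne i := by
    rw [← sub_neg_eq_add, ← map_neg]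
    exact X_sub_algebraMap_ne_zero i _
  pair_ne i j hij := by
    rw [X, X, ← map_add, Ne,
      map_eq_zero_iff _ (IsFractionRing.injective (MvPolynomial (Fin l) (L n)) (B n l))]
    intro h
    have := congrArg (MvPolynomial.eval (Pi.single i 1)) h
    simp [hij.symm] at this

theorem coeffT_eval₂ (e : Side) (k : ℤ) (O : MvPolynomial (Fin l) (HahnSeries ℤ (Lau n))) :
    coeffT n l e k (MvPolynomial.eval₂ (psiB n l) (X n l) O)
      = MvPolynomial.map (lauToK n) (cP e k O) := by
  rw [eval₂_psiB, coeffT, LinearMap.comp_apply, LinearMap.restrictScalars_apply, toPoly_algebraMap]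
  ext m
  rw [MvPolynomial.coeff_map, coeff_cP]
  have h : (coeffPoly n l e k (MvPolynomial.map (mapL n) O)).coeff m
      = tCoeff n e k ((MvPolynomial.map (mapL n) O).coeff m) := by
    simp [coeffPoly, MvPolynomial.coeff]
  rw [h, MvPolynomial.coeff_map]
  cases e <;> rfl

theorem psiB_zT (j : Fin n) : psiB n l (zT n j) = zB n l j := by
  rw [psiB, RingHom.comp_apply, zT, mapL_C, lauToK_LZ]
  rfl

theorem psiB_tauR (e : Side) : psiB n l (tauR (Lau n) e) = tB n l e := by
  rw [psiB, RingHom.comp_apply, mapL_tauR, tB]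

theorem aeval_map_lauToK (v : Fin l → B n l') (Q : MvPolynomial (Fin l) (Lau n)) :
    MvPolynomial.aeval v (MvPolynomial.map (lauToK n) Q)
      = MvPolynomial.eval₂ (psiB n l') v (MvPolynomial.map HahnSeries.C Q) := by
  have h : (algebraMap (K n) (B n l')).comp (lauToK n) = (psiB n l').comp HahnSeries.C := by
    refine RingHom.ext fun r => ?_
    rw [RingHom.comp_apply, RingHom.comp_apply, psiB, RingHom.comp_apply, mapL_C]
    exact IsScalarTower.algebraMap_apply (K n) (L n) (B n l') _
  rw [MvPolynomial.aeval_def, MvPolynomial.eval₂_map, MvPolynomial.eval₂_map, h]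

/-- Identifies the operator of the statement, computed in `B n l'`, with extraction of a coefficient
from `O`. The value of the formula is the image of a polynomial, so the choice made in `toPoly` does
not matter. -/
theorem Represents.coeffT_eq
    (hO : Represents G (zT n) (tauR (Lau n) e) (MvPolynomial.map HahnSeries.C Q) O) (k : ℤ) :
    coeffT n l' e k (G (B n l') (zB n l') (tB n l' e) (X n l')
        fun v => MvPolynomial.aeval v (MvPolynomial.map (lauToK n) Q))
      = MvPolynomial.map (lauToK n) (cP e k O) := by
  have h := hO.eval (B n l') (psiB n l') (X n l') (gen_B e)
  simp only [psiB_zT, psiB_tauR, ← aeval_map_lauToK] at h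
  rw [← coeffT_eval₂, h]

end Transfer

/-! ### Transfer of the link relation to the coefficients of t^k -/

section LinkTransfer

variable {n l l' : ℕ} {e : Side} {S : Type} [Field S] (φ : Lau (n + 2) →+* S) (ι : Lau n →+* S)
  (x : S)

theorem psi_C_inv : psi S l (HahnSeries.C x⁻¹) = (psi S l (HahnSeries.C x))⁻¹ := by
  have h := map_inv₀ ((psi S l).comp HahnSeries.C) x
  exact h

theorem psi_C_ne_zero {x : S} (hx : x ≠ 0) : psi S l (HahnSeries.C x) ≠ 0 := by
  rw [Ne, map_eq_zero_iff _ psi_injective, map_eq_zero_iff _ HahnSeries.C_injective]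
  exact hx

/-- The point `(X_1, …, X_l, z⁻¹)`. -/
def gXz (l : ℕ) (x : S) : Fin (l + 1) → FB S l := Fin.snoc (gX S l) (psi S l (HahnSeries.C x))⁻¹

/-- The evaluation of Laurent series at the generic point after a change of coefficients. -/
def psiOf {R : Type} [CommRing R] (l : ℕ) (φ : R →+* S) : HahnSeries ℤ R →+* FB S l :=
  (psi S l).comp (mapT φ)

theorem psiOf_tauR {R : Type} [CommRing R] (φ : R →+* S) :
    psiOf l φ (tauR R e) = psi S l (tauR S e) := by
  rw [psiOf, RingHom.comp_apply, mapT_tauR]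

theorem psiOf_comp_C {R : Type} [CommRing R] (φ : R →+* S) :
    (psiOf l φ).comp HahnSeries.C = ((psi S l).comp HahnSeries.C).comp φ := by
  refine RingHom.ext fun r => ?_
  rw [RingHom.comp_apply, psiOf, RingHom.comp_apply, mapT_C]
  rfl

variable {φ ι x}

/-- The map `φ` is a specialization `z_{n+1} = x`, `z_{n+2} = -x`, compatible with `ι`. -/
def IsSpec (φ : Lau (n + 2) →+* S) (ι : Lau n →+* S) (x : S) : Prop := (fun j => φ (LZ j)) = addPair (fun j : Fin n => ι (LZ j)) x

theorem IsSpec.psiOf_zT (h : IsSpec φ ι x) : (fun j => psiOf l φ (zT (n + 2) j))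
    = addPair (fun j => psiOf l ι (zT n j)) (psi S l (HahnSeries.C x)) := by
  have h1 : ∀ j : Fin (n + 2), psiOf l φ (zT (n + 2) j)
      = psi S l (HahnSeries.C (addPair (fun j : Fin n => ι (LZ j)) x j)) := by
    intro j
    rw [psiOf, RingHom.comp_apply, zT, mapT_C, ← h]
  funext j
  rw [h1, addPair, addPair]
  refine Fin.lastCases ?_ (fun j => ?_) j
  · rw [Fin.snoc_last, Fin.snoc_last, map_neg, map_neg]
  · rw [Fin.snoc_castSucc, Fin.snoc_castSucc]
    refine Fin.lastCases ?_ (fun j => ?_) j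
    · rw [Fin.snoc_last, Fin.snoc_last]
    · rw [Fin.snoc_castSucc, Fin.snoc_castSucc, psiOf, RingHom.comp_apply, zT, mapT_C]

theorem gen_gXz (e : Side) (hx : x ≠ 0) : Gen (psiOf l φ (tauR (Lau (n + 2)) e)) (gXz l x) := by
  rw [psiOf_tauR, gXz, ← psi_C_inv]
  exact gen_snoc e (inv_ne_zero hx)

theorem gen_gX_psiOf (e : Side) : Gen (psiOf l ι (tauR (Lau n) e)) (gX S l) := by
  rw [psiOf_tauR]
  exact gen_gX e

theorem Gen.one_sub_ne_zero {B : Type*} [Field B] {t z : B} {Xs : Fin l → B}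
    (h : Gen t (Fin.snoc Xs z⁻¹ : Fin (l + 1) → B)) (hz : z ≠ 0) : 1 - t ^ 2 * z ^ 2 ≠ 0 := by
  have h1 := h.sub_ne (Fin.last l)
  have h2 := h.add_ne (Fin.last l)
  rw [Fin.snoc_last] at h1 h2
  have h3 : 1 - t ^ 2 * z ^ 2 = z ^ 2 * ((z⁻¹ - t) * (z⁻¹ + t)) := by
    field_simp
    ring
  rw [h3]
  exact mul_ne_zero (pow_ne_zero _ hz) (mul_ne_zero h1 h2)

theorem setLast_cP {R : Type*} [CommRing R] (c : R) (k : ℤ)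
    (O : MvPolynomial (Fin (l + 1)) (HahnSeries ℤ R)) :
    setLast c (cP e k O) = cP e k (setLast (HahnSeries.C c) O) := by
  have h : (fun i => MvPolynomial.map HahnSeries.C ((Fin.snoc MvPolynomial.X (MvPolynomial.C c) :
      Fin (l + 1) → MvPolynomial (Fin l) R) i))
      = (Fin.snoc MvPolynomial.X (MvPolynomial.C (HahnSeries.C c)) :
        Fin (l + 1) → MvPolynomial (Fin l) (HahnSeries ℤ R)) := by
    funext i
    refine Fin.lastCases ?_ (fun i => ?_) i
    · rw [Fin.snoc_last, Fin.snoc_last, MvPolynomial.map_C]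
    · rw [Fin.snoc_castSucc, Fin.snoc_castSucc, MvPolynomial.map_X]
  rw [setLast, setLast, ← cP_aeval, h]

theorem map_linkFactor {R S : Type*} [CommRing R] [CommRing S] (φ : R →+* S) (m l : ℕ) (c d : R) :
    MvPolynomial.map φ (linkFactor m l c d) = linkFactor m l (φ c) (φ d) := by
  simp [linkFactor]

theorem eval₂_setLast {R S : Type*} [CommRing R] [CommRing S] (ψ : R →+* S) (v : Fin l → S)
    (c : R) (O : MvPolynomial (Fin (l + 1)) R) :
    MvPolynomial.eval₂ ψ v (setLast c O)
      = MvPolynomial.eval₂ ψ (Fin.snoc v (ψ c) : Fin (l + 1) → S) O := by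
  rw [setLast, eval₂_aeval]
  congr 1
  funext i
  refine Fin.lastCases ?_ (fun i => ?_) i
  · simp
  · simp

theorem eval₂_linkFactor {R S : Type*} [CommRing R] [CommRing S] (ψ : R →+* S) (v : Fin l → S)
    (m : ℕ) (c d : R) :
    MvPolynomial.eval₂ ψ v (linkFactor m l c d)
      = ψ d ^ (m + 1) * ∏ a : Fin l, (1 - v a ^ 2 * ψ c ^ 2) := by
  rw [← MvPolynomial.coe_eval₂Hom]
  simp [linkFactor]

/-- An equality at the generic point is one of polynomials over Laurent series. Neither the
substitution z⁻¹ nor the link factor involves t, so taking the coefficient of t^k commutes with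
both. -/
theorem specEqOver_cP {O : MvPolynomial (Fin l) (HahnSeries ℤ (Lau n))}
    {O' : MvPolynomial (Fin (l + 1)) (HahnSeries ℤ (Lau (n + 2)))}
    (h : MvPolynomial.eval₂ (psiOf l φ) (gXz l x) O'
      = ((psi S l (HahnSeries.C x))⁻¹ ^ (n + 1) *
        ∏ a : Fin l, (1 - gX S l a ^ 2 * psi S l (HahnSeries.C x) ^ 2)) *
        MvPolynomial.eval₂ (psiOf l ι) (gX S l) O) (k : ℤ) :
    SpecEqOver l φ ι x (cP e k O) (cP e k O') := by
  rw [SpecEqOver, ← cP_map, ← cP_map, setLast_cP, mul_comm, ← cP_mul_map_C, map_linkFactor]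
  congr 1
  apply eval₂_gX_injective
  rw [eval₂_setLast, MvPolynomial.eval₂_map, psi_C_inv, MvPolynomial.eval₂_mul,
    MvPolynomial.eval₂_map, eval₂_linkFactor, psi_C_inv, mul_comm]
  exact h

theorem SpecEqOver.linkFn {Q : MvPolynomial (Fin l) (Lau n)}
    {Q' : MvPolynomial (Fin (l + 1)) (Lau (n + 2))} (h : SpecEqOver l φ ι x Q Q') (m : ℕ) :
    LinkFn n (psi S m (HahnSeries.C x))
      (fun v => MvPolynomial.eval₂ (psiOf m ι) v (MvPolynomial.map HahnSeries.C Q))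
      fun v => MvPolynomial.eval₂ (psiOf m φ) v (MvPolynomial.map HahnSeries.C Q') := by
  intro v
  have h2 := congrArg (MvPolynomial.eval₂ ((psi S m).comp HahnSeries.C) v) h
  rw [eval₂_setLast, MvPolynomial.eval₂_mul, eval₂_linkFactor, MvPolynomial.eval₂_map,
    MvPolynomial.eval₂_map, RingHom.comp_apply, RingHom.comp_apply, psi_C_inv] at h2
  simp only [MvPolynomial.eval₂_map, psiOf_comp_C]
  exact h2

instance [CharZero S] : CharZero (FB S l) :=
  charZero_of_injective_ringHom ((psi S l).comp HahnSeries.C).injective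

/-- A pair of formulas which preserves links. -/
def IsLinkFormula (G : Formula n l l') (G' : Formula (n + 2) (l + 1) (l' + 1)) : Prop :=
  ∀ (B : Type) [Field B] [CharZero B] (zs : Fin n → B) (z t : B) (f : (Fin l → B) → B)
    (f' : (Fin (l + 1) → B) → B), z ≠ 0 → t ≠ 0 → 1 - t ^ 2 * z ^ 2 ≠ 0 → IsSkewFn f →
    IsSkewFn f' → LinkFn n z f f' →
    LinkFn n z (fun Xs => G B zs t Xs f) fun Xs => G' B (addPair zs z) t Xs f'

/-- The representing polynomial for n + 2 is evaluated through the specialization `φ`, where its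
variables z_j form the pair-extended family, so the field-level statement about `G` and `G'` applies
verbatim. -/
theorem IsLinkFormula.specEqOver [CharZero S] (hs : IsSpec φ ι x) (hx : x ≠ 0)
    {G : Formula n l l'} {G' : Formula (n + 2) (l + 1) (l' + 1)}
    (hG : IsLinkFormula G G') {Q : MvPolynomial (Fin l) (Lau n)}
    {Q' : MvPolynomial (Fin (l + 1)) (Lau (n + 2))} (hQ : IsSkew Q) (hQ' : IsSkew Q')
    (h : SpecEqOver l φ ι x Q Q') {O : MvPolynomial (Fin l') (HahnSeries ℤ (Lau n))}
    {O' : MvPolynomial (Fin (l' + 1)) (HahnSeries ℤ (Lau (n + 2)))}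
    (hO : Represents G (zT n) (tauR (Lau n) e) (MvPolynomial.map HahnSeries.C Q) O)
    (hO' : Represents G' (zT (n + 2)) (tauR (Lau (n + 2)) e) (MvPolynomial.map HahnSeries.C Q') O')
    (k : ℤ) : SpecEqOver l' φ ι x (cP e k O) (cP e k O') := by
  apply specEqOver_cP
  rw [hO.eval _ _ _ (gen_gX_psiOf e), hO'.eval _ _ _ (gen_gXz e hx), hs.psiOf_zT, psiOf_tauR,
    ← psiOf_tauR ι]
  exact hG _ _ _ _ _ _ (psi_C_ne_zero hx) (gen_gX_psiOf e).t_ne 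
    (by rw [psiOf_tauR ι, ← psiOf_tauR φ]; exact (gen_gXz e hx).one_sub_ne_zero (psi_C_ne_zero hx))
    (isSkewFn_eval₂ _ (map_isSkew _ hQ)) (isSkewFn_eval₂ _ (map_isSkew _ hQ')) (h.linkFn l') _

theorem specEqOver_zero [CharZero S] (hs : IsSpec φ ι x) (hx : x ≠ 0)
    {G' : Formula (n + 2) l (l' + 1)}
    (hG : ∀ (B : Type) [Field B] [CharZero B] (zs : Fin n → B) (z t : B) (f : (Fin l → B) → B),
      z ≠ 0 → ∀ v : Fin l' → B, G' B (addPair zs z) t (Fin.snoc v z⁻¹ : Fin (l' + 1) → B) f = 0)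
    {Q' : MvPolynomial (Fin l) (Lau (n + 2))}
    {O' : MvPolynomial (Fin (l' + 1)) (HahnSeries ℤ (Lau (n + 2)))}
    (hO' : Represents G' (zT (n + 2)) (tauR (Lau (n + 2)) e) (MvPolynomial.map HahnSeries.C Q') O')
    (k : ℤ) : SpecEqOver l' φ ι x 0 (cP e k O') := by
  rw [← map_zero (cP e k)]
  apply specEqOver_cP
  rw [hO'.eval _ _ _ (gen_gXz e hx), hs.psiOf_zT, gXz, MvPolynomial.eval₂_zero, mul_zero]
  exact hG _ _ _ _ _ (psi_C_ne_zero hx) _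

theorem isSpec_spec (n : ℕ) :
    IsSpec (spec n) ((RatFunc.C : K n →+* Kz n).comp (lauToK n)) RatFunc.X := by
  funext j
  rw [spec_LZ, specVals, addPair]
  congr 2
  funext j
  rw [RingHom.comp_apply, lauToK_LZ]

instance (n : ℕ) : CharZero (Kz n) :=
  charZero_of_injective_ringHom ((RatFunc.C : K n →+* Kz n).comp (algebraMap ℂ (K n))).injective

theorem IsLinkFormula.specEq {G : Formula n l l'} {G' : Formula (n + 2) (l + 1) (l' + 1)}
    (hG : IsLinkFormula G G') {Q : MvPolynomial (Fin l) (Lau n)}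
    {Q' : MvPolynomial (Fin (l + 1)) (Lau (n + 2))} (hQ : IsSkew Q) (hQ' : IsSkew Q')
    (h : SpecEq n l Q Q') {O : MvPolynomial (Fin l') (HahnSeries ℤ (Lau n))}
    {O' : MvPolynomial (Fin (l' + 1)) (HahnSeries ℤ (Lau (n + 2)))}
    (hO : Represents G (zT n) (tauR (Lau n) e) (MvPolynomial.map HahnSeries.C Q) O)
    (hO' : Represents G' (zT (n + 2)) (tauR (Lau (n + 2)) e) (MvPolynomial.map HahnSeries.C Q') O')
    (k : ℤ) : SpecEq n l' (cP e k O) (cP e k O') :=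
  hG.specEqOver (isSpec_spec n) RatFunc.X_ne_zero hQ hQ' h hO hO' k

theorem specEq_zero {G' : Formula (n + 2) l (l' + 1)}
    (hG : ∀ (B : Type) [Field B] [CharZero B] (zs : Fin n → B) (z t : B) (f : (Fin l → B) → B),
      z ≠ 0 → ∀ v : Fin l' → B, G' B (addPair zs z) t (Fin.snoc v z⁻¹ : Fin (l' + 1) → B) f = 0)
    {Q' : MvPolynomial (Fin l) (Lau (n + 2))}
    {O' : MvPolynomial (Fin (l' + 1)) (HahnSeries ℤ (Lau (n + 2)))}
    (hO' : Represents G' (zT (n + 2)) (tauR (Lau (n + 2)) e) (MvPolynomial.map HahnSeries.C Q') O')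
    (k : ℤ) : SpecEq n l' 0 (cP e k O') :=
  specEqOver_zero (isSpec_spec n) RatFunc.X_ne_zero hG hO' k

end LinkTransfer

/-! ### Link preservation for x^±, a_± and the divided square of x⁻ -/

section Operators

variable {n l l' : ℕ} {e : Side}

/-- The coefficient of `t^k` in the result of applying a formula. -/
def opCoeff (e : Side) (k : ℤ) (G : Formula n l l') (P : MvPolynomial (Fin l) (K n)) :
    MvPolynomial (Fin l') (K n) :=
  coeffT n l' e k (G (B n l') (zB n l') (tB n l' e) (X n l') fun v => MvPolynomial.aeval v P)

theorem IsOperatorFormula.isDeformedCycle {G : Formula n l l'} (hG : IsOperatorFormula e G)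
    {P : MvPolynomial (Fin l) (K n)} (hP : IsDeformedCycle n l P) (k : ℤ) :
    IsDeformedCycle n l' (opCoeff e k G P) := by
  obtain ⟨Q, rfl, hQ⟩ := isDeformedCycle_iff.mp hP
  obtain ⟨O, hO⟩ := hG.exist Q hQ.deg
  rw [opCoeff, hO.coeffT_eq]
  exact isDeformedCycle_iff.mpr ⟨_, rfl, hO.LD hG hQ k⟩

theorem IsOperatorFormula.isLink {G : Formula n l l'} {G' : Formula (n + 2) (l + 1) (l' + 1)}
    (hG : IsOperatorFormula e G) (hG' : IsOperatorFormula e G') (h : IsLinkFormula G G')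
    {P : MvPolynomial (Fin l) (K n)} {P' : MvPolynomial (Fin (l + 1)) (K (n + 2))}
    (hP : IsLink n l P P') (k : ℤ) : IsLink n l' (opCoeff e k G P) (opCoeff e k G' P') := by
  obtain ⟨Q, Q', rfl, rfl, hQ, hQ', hs⟩ := isLink_iff.mp hP
  obtain ⟨O, hO⟩ := hG.exist Q hQ.deg
  obtain ⟨O', hO'⟩ := hG'.exist Q' hQ'.deg
  rw [opCoeff, opCoeff, hO.coeffT_eq, hO'.coeffT_eq]
  exact isLink_iff.mpr ⟨_, _, rfl, rfl, hO.LD hG hQ k, hO'.LD hG' hQ' k,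
    h.specEq hQ.skew hQ'.skew hs hO hO' k⟩

theorem LD_zero : LD n l 0 where
  skew σ := by simp
  deg s hs := by simp at hs
  symm π := by simp

theorem IsOperatorFormula.isLink_zero {G' : Formula (n + 2) l (l' + 1)}
    (hG' : IsOperatorFormula e G')
    (h : ∀ (B : Type) [Field B] [CharZero B] (zs : Fin n → B) (z t : B) (f : (Fin l → B) → B),
      z ≠ 0 → ∀ v : Fin l' → B, G' B (addPair zs z) t (Fin.snoc v z⁻¹ : Fin (l' + 1) → B) f = 0)
    {P' : MvPolynomial (Fin l) (K (n + 2))} (hP : IsDeformedCycle (n + 2) l P') (k : ℤ) :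
    IsLink n l' 0 (opCoeff e k G' P') := by
  obtain ⟨Q', rfl, hQ'⟩ := isDeformedCycle_iff.mp hP
  obtain ⟨O', hO'⟩ := hG'.exist Q' hQ'.deg
  rw [opCoeff, hO'.coeffT_eq]
  exact isLink_iff.mpr ⟨0, _, by simp, rfl, LD_zero, hO'.LD hG' hQ' k, specEq_zero h hO' k⟩

theorem DegLT.map_C {R : Type*} [CommRing R] {Q : MvPolynomial (Fin l) R} (hQ : DegLT n Q) :
    DegLT n (MvPolynomial.map (HahnSeries.C : R →+* HahnSeries ℤ R) Q) :=
  fun s hs => hQ s (MvPolynomial.support_map_subset _ _ hs)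

theorem isOperatorFormula_gXm : IsOperatorFormula e (fun _ _ => gXm : Formula n l (l + 1)) where
  comp_zs _ _ := gXm_comp_zs
  skew _ _ zs t f _ := gXm_skew zs t f
  exist _ hQ := exists_gXm (one_sub_zT_mul e) hQ.map_C

theorem isOperatorFormula_gXm2 : IsOperatorFormula e (fun _ _ => gXm2 : Formula n l (l + 2)) where
  comp_zs _ _ := gXm2_comp_zs
  skew _ _ zs t f _ := gXm2_skew zs t f
  exist _ hQ := exists_gXm2 (one_sub_zT_mul e) hQ.map_C

theorem isOperatorFormula_gXp : IsOperatorFormula e (fun _ _ => gXp : Formula n (l + 1) l) where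
  comp_zs _ _ := gXp_comp_zs
  skew _ _ zs t _ hf := gXp_skew zs t hf
  exist _ hQ := exists_gXp (one_sub_zT_mul e) hQ.map_C

/-- The formula for x⁺ respects links only up to a sign, which is absorbed into the formula used on
the n + 2 side. -/
theorem isOperatorFormula_neg_gXp :
    IsOperatorFormula e (fun _ _ zs t Xs f => -gXp zs t Xs f : Formula n (l + 1) l) where
  comp_zs _ _ zs π t Xs f := by rw [gXp_comp_zs]
  skew _ _ zs t _ hf := by
    intro σ v
    have h := gXp_skew zs t hf σ v
    simp only at h ⊢
    rw [h, mul_neg]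
  exist _ hQ := by
    obtain ⟨O, hO⟩ := exists_gXp (one_sub_zT_mul e) hQ.map_C
    refine ⟨-O, fun s hs => hO.deg s (by rwa [MvPolynomial.support_neg] at hs), fun B _ ψ Xs h => ?_⟩
    rw [MvPolynomial.eval₂_neg, hO.eval B ψ Xs h]

theorem isOperatorFormula_gAp : IsOperatorFormula e (fun _ _ => gAp : Formula n l l) where
  comp_zs _ _ := gAp_comp_zs
  skew _ _ zs t _ hf := gAp_skew zs t hf
  exist _ hQ := exists_gAp (one_sub_zT_mul e) (one_sub_zT_mul_neg e) hQ.map_C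

theorem isOperatorFormula_gAm : IsOperatorFormula e (fun _ _ => gAm : Formula n l l) where
  comp_zs _ _ := gAm_comp_zs
  skew _ _ zs t _ hf := gAm_skew zs t hf
  exist _ hQ := by
    obtain ⟨ti, hti⟩ := exists_tauR_inv (Lau n) e
    exact exists_gAm (one_sub_zT_mul e) (one_sub_zT_mul_neg e) hti hQ.map_C

theorem isLink_opCoeff_gXm {P : MvPolynomial (Fin l) (K n)}
    {P' : MvPolynomial (Fin (l + 1)) (K (n + 2))} (h : IsLink n l P P') (k : ℤ) :
    IsLink n (l + 1) (opCoeff e k (fun _ _ => gXm) P) (opCoeff e k (fun _ _ => gXm) P') :=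
  isOperatorFormula_gXm.isLink isOperatorFormula_gXm
    (fun _ _ _ _ _ _ _ _ hz _ ht hf hf' h => gXm_link hz ht hf hf' h) h k

theorem isLink_opCoeff_gXm2 {P : MvPolynomial (Fin l) (K n)}
    {P' : MvPolynomial (Fin (l + 1)) (K (n + 2))} (h : IsLink n l P P') (k : ℤ) :
    IsLink n (l + 2) (opCoeff e k (fun _ _ => gXm2) P) (opCoeff e k (fun _ _ => gXm2) P') :=
  isOperatorFormula_gXm2.isLink isOperatorFormula_gXm2
    (fun _ _ _ _ _ _ _ _ hz _ ht hf hf' h => gXm2_link hz ht hf hf' h) h k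

theorem opCoeff_neg (G : Formula n l l') (k : ℤ) (P : MvPolynomial (Fin l) (K n)) :
    opCoeff e k (fun B _ zs t Xs f => -G B zs t Xs f) P = -opCoeff e k G P := by
  rw [opCoeff, map_neg, opCoeff]

theorem isLink_opCoeff_gXp {P : MvPolynomial (Fin (l + 1)) (K n)}
    {P' : MvPolynomial (Fin (l + 2)) (K (n + 2))} (h : IsLink n (l + 1) P P') (k : ℤ) :
    IsLink n l (opCoeff e k (fun _ _ => gXp) P) (-opCoeff e k (fun _ _ => gXp) P') := by
  rw [← opCoeff_neg]
  exact isOperatorFormula_gXp.isLink isOperatorFormula_neg_gXp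
    (fun _ _ _ _ _ _ _ _ _ _ ht _ hf' h => gXp_link ht hf' h) h k

theorem isLink_opCoeff_gAp {P : MvPolynomial (Fin l) (K n)}
    {P' : MvPolynomial (Fin (l + 1)) (K (n + 2))} (h : IsLink n l P P') (k : ℤ) :
    IsLink n l (opCoeff e k (fun _ _ => gAp) P) (opCoeff e k (fun _ _ => gAp) P') :=
  isOperatorFormula_gAp.isLink isOperatorFormula_gAp
    (fun _ _ _ _ _ _ _ _ hz _ ht _ _ h => gAp_link hz ht h) h k

theorem isLink_opCoeff_gAm {P : MvPolynomial (Fin l) (K n)}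
    {P' : MvPolynomial (Fin (l + 1)) (K (n + 2))} (h : IsLink n l P P') (k : ℤ) :
    IsLink n l (opCoeff e k (fun _ _ => gAm) P) (opCoeff e k (fun _ _ => gAm) P') :=
  isOperatorFormula_gAm.isLink isOperatorFormula_gAm
    (fun _ _ _ _ _ _ _ _ hz ht0 ht _ _ h => gAm_link hz ht0 ht h) h k

theorem isLink_opCoeff_gXm_zero {P' : MvPolynomial (Fin 0) (K (n + 2))}
    (h : IsDeformedCycle (n + 2) 0 P') (k : ℤ) :
    IsLink n 0 0 (opCoeff e k (fun _ _ => gXm) P') :=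
  isOperatorFormula_gXm.isLink_zero (fun _ _ _ _ _ _ _ hz v => gXm_link_zero hz v) h k

theorem isLink_opCoeff_gXm2_zero {P' : MvPolynomial (Fin 0) (K (n + 2))}
    (h : IsDeformedCycle (n + 2) 0 P') (k : ℤ) :
    IsLink n 1 0 (opCoeff e k (fun _ _ => gXm2) P') :=
  isOperatorFormula_gXm2.isLink_zero (fun _ _ _ _ _ _ _ hz v => gXm2_link_zero hz v) h k

end Operators

/-! ### The divided square of x⁺ as an explicit sum -/

section ResidueSum

/-- The substitution `P(X_1, …, X_l, -u, u)`. -/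
def pairSub {R : Type*} [CommRing R] {l : ℕ} (u : R) :
    MvPolynomial (Fin (l + 2)) R →ₐ[R] MvPolynomial (Fin l) R :=
  (setLast (-u)).comp (setLast u)

theorem eval₂_pairSub {R S : Type*} [CommRing R] [CommRing S] {l : ℕ} (ψ : R →+* S)
    (v : Fin l → S) (u : R) (P : MvPolynomial (Fin (l + 2)) R) :
    MvPolynomial.eval₂ ψ v (pairSub u P) = MvPolynomial.eval₂ ψ
      (Fin.snoc (Fin.snoc v (-ψ u) : Fin (l + 1) → S) (ψ u) : Fin (l + 2) → S) P := by
  rw [pairSub, AlgHom.comp_apply, eval₂_setLast, eval₂_setLast, map_neg]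

theorem map_setLast {R S : Type*} [CommRing R] [CommRing S] {l : ℕ} (φ : R →+* S) (c : R)
    (P : MvPolynomial (Fin (l + 1)) R) :
    MvPolynomial.map φ (setLast c P) = setLast (φ c) (MvPolynomial.map φ P) := by
  have h := eval₂_setLast (MvPolynomial.C.comp φ) (MvPolynomial.X : Fin l → MvPolynomial (Fin l) S)
    c P
  have h2 : (MvPolynomial.eval₂ (MvPolynomial.C.comp φ)
      (MvPolynomial.X : Fin l → MvPolynomial (Fin l) S)) (setLast c P)
      = MvPolynomial.map φ (setLast c P) := by
    rw [← MvPolynomial.eval₂_map, MvPolynomial.eval₂_eta]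
  rw [← h2, h, setLast, MvPolynomial.aeval_def, MvPolynomial.eval₂_map]
  rfl

theorem map_pairSub {R S : Type*} [CommRing R] [CommRing S] {l : ℕ} (φ : R →+* S) (u : R)
    (P : MvPolynomial (Fin (l + 2)) R) :
    MvPolynomial.map φ (pairSub u P) = pairSub (φ u) (MvPolynomial.map φ P) := by
  rw [pairSub, pairSub, AlgHom.comp_apply, AlgHom.comp_apply, map_setLast, map_setLast, map_neg]

theorem DegLT.setLast {R : Type*} [CommRing R] [Nontrivial R] {n l : ℕ} (c : R) {P : MvPolynomial (Fin (l + 1)) R}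
    (h : DegLT n P) : DegLT n (setLast c P) := by
  rw [degIn_of_forall_aeval] at h ⊢
  intro i
  refine (h i.castSucc).aeval ?_ fun k => ?_
  · rw [Fin.snoc_castSucc]
    simp
  · refine Fin.lastCases ?_ (fun k => ?_) k
    · intro _
      rw [Fin.snoc_last, MvPolynomial.degreeOf_C]
    · intro hk
      rw [Fin.snoc_castSucc]
      exact MvPolynomial.degreeOf_X_of_ne fun h' => hk (by rw [h'])

theorem isSkew_setLast {R : Type*} [CommRing R] {l : ℕ} (c : R) {P : MvPolynomial (Fin (l + 1)) R}
    (h : IsSkew P) : IsSkew (setLast c P) := by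
  intro σ
  have h2 := congrArg (setLast c) (h (snocPerm σ))
  rw [map_zsmul, sign_snocPerm] at h2
  have h3 : (fun i => MvPolynomial.rename σ ((Fin.snoc MvPolynomial.X (MvPolynomial.C c) :
      Fin (l + 1) → MvPolynomial (Fin l) R) i))
      = (Fin.snoc MvPolynomial.X (MvPolynomial.C c) : Fin (l + 1) → MvPolynomial (Fin l) R)
        ∘ snocPerm σ := by
    rw [snoc_comp_snocPerm]
    funext i
    refine Fin.lastCases ?_ (fun i => ?_) i
    · rw [Fin.snoc_last, Fin.snoc_last, MvPolynomial.rename_C]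
    · rw [Fin.snoc_castSucc, Fin.snoc_castSucc, MvPolynomial.rename_X]
      rfl
  rw [← h2, setLast, MvPolynomial.aeval_rename, MvPolynomial.comp_aeval_apply, h3]

/-- The sum of residues at `z_a⁻¹`, up to a constant factor and after taking a coefficient. -/
def resSum {F : Type*} [Field F] {n l : ℕ} (zs : Fin n → F) (k : ℤ)
    (P : MvPolynomial (Fin (l + 2)) F) : MvPolynomial (Fin l) F :=
  ∑ a, MvPolynomial.C ((∏ j ∈ Finset.univ.erase a, (1 - zs j ^ 2 * (zs a)⁻¹ ^ 2))⁻¹) *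
    (MvPolynomial.C (zs a ^ k) * pairSub (zs a)⁻¹ P)

theorem resSum_comp {F : Type*} [Field F] {n l : ℕ} (zs : Fin n → F) (k : ℤ)
    (P : MvPolynomial (Fin (l + 2)) F) (π : Equiv.Perm (Fin n)) :
    resSum (zs ∘ π) k P = resSum zs k P := by
  rw [resSum, resSum]
  refine Fintype.sum_equiv π _ _ fun a => ?_
  have h : ∏ j ∈ Finset.univ.erase a, (1 - (zs ∘ π) j ^ 2 * ((zs ∘ π) a)⁻¹ ^ 2)
      = ∏ j ∈ Finset.univ.erase (π a), (1 - zs j ^ 2 * (zs (π a))⁻¹ ^ 2) := by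
    refine Finset.prod_equiv π (fun j => ?_) fun j _ => rfl
    simp
  rw [h]
  rfl

theorem resSum_isSkew {F : Type*} [Field F] {n l : ℕ} (zs : Fin n → F) (k : ℤ)
    {P : MvPolynomial (Fin (l + 2)) F} (h : IsSkew P) : IsSkew (resSum zs k P) := by
  intro σ
  rw [resSum, map_sum, Finset.smul_sum]
  refine Finset.sum_congr rfl fun a _ => ?_
  rw [map_mul, map_mul, MvPolynomial.rename_C, MvPolynomial.rename_C, pairSub, AlgHom.comp_apply,
    isSkew_setLast _ (isSkew_setLast _ h) σ, mul_smul_comm, mul_smul_comm]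

theorem DegLT.resSum {F : Type*} [Field F] {n m l : ℕ} (zs : Fin n → F) (k : ℤ)
    {P : MvPolynomial (Fin (l + 2)) F} (h : DegLT m P) : DegLT m (resSum zs k P) := by
  rw [degIn_of_forall_aeval]
  intro i
  refine DegIn.sum fun a _ => DegIn.mul (DegIn.mul ?_ (MvPolynomial.degreeOf_C _ _))
    (MvPolynomial.degreeOf_C _ _)
  rw [pairSub, AlgHom.comp_apply]
  exact degIn_of_forall_aeval.mp ((h.setLast _).setLast _) i

theorem prod_one_sub_ne_zero {F : Type*} [Field F] {n : ℕ} (zs : Fin n → F)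
    (h : Function.Injective fun a => zs a ^ 2) (h0 : ∀ a, zs a ≠ 0) (a : Fin n) :
    (∏ j ∈ Finset.univ.erase a, (1 - zs j ^ 2 * (zs a)⁻¹ ^ 2)) ≠ 0 := by
  rw [Finset.prod_ne_zero_iff]
  intro j hj h1
  apply Finset.ne_of_mem_erase hj
  apply h
  have h2 := h0 a
  have h3 : zs j ^ 2 = zs a ^ 2 := by
    field_simp at h1
    linear_combination -h1
  exact h3

theorem z_sq_injective {n : ℕ} : Function.Injective fun a : Fin n => (z a : K n) ^ 2 := by
  intro a b h
  simp only [z, ← map_pow] at h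
  have h1 := algebraMap_K_injective h
  by_contra hab
  have := congrArg (MvPolynomial.eval (Pi.single a (1 : ℂ))) h1
  simp [Ne.symm hab] at this

instance (n : ℕ) : CharZero (K n) := charZero_of_injective_ringHom (algebraMap ℂ (K n)).injective

/-- Only the derivative of the factor 1 - z_a u contributes at u = z_a⁻¹, giving -z_a. Its partner 1
+ z_a u takes the value 2, and z_a(u - t) becomes 1 - z_a t. -/
theorem eval_derivative_resDenom {F : Type*} [Field F] {n : ℕ} {zs : Fin n → F} (t : F)
    (a : Fin n) (ha : zs a ≠ 0) :
    (resDenom zs t).derivative.eval (zs a)⁻¹ =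
      -2 * (∏ j ∈ Finset.univ.erase a, (1 - zs j ^ 2 * (zs a)⁻¹ ^ 2)) * (1 - zs a * t) := by
  have h1 : (∏ j, (1 - Polynomial.C (zs j) * Polynomial.X) : Polynomial F)
      = (1 - Polynomial.C (zs a) * Polynomial.X) *
        ∏ j ∈ Finset.univ.erase a, (1 - Polynomial.C (zs j) * Polynomial.X) :=
    (Finset.mul_prod_erase _ _ (Finset.mem_univ a)).symm
  have h2 : (∏ j ∈ Finset.univ.erase a, (1 - zs j ^ 2 * (zs a)⁻¹ ^ 2))
      = (∏ j ∈ Finset.univ.erase a, (1 + zs j * (zs a)⁻¹)) *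
        ∏ j ∈ Finset.univ.erase a, (1 - zs j * (zs a)⁻¹) := by
    rw [← Finset.prod_mul_distrib]
    exact Finset.prod_congr rfl fun j _ => by ring
  have h3 : (∏ j, (1 + zs j * (zs a)⁻¹)) = 2 * ∏ j ∈ Finset.univ.erase a, (1 + zs j * (zs a)⁻¹) := by
    rw [← Finset.mul_prod_erase _ _ (Finset.mem_univ a), mul_inv_cancel₀ ha]
    ring
  have h4 : zs a * (zs a)⁻¹ = 1 := mul_inv_cancel₀ ha
  rw [resDenom, h1, h2]
  simp only [Polynomial.derivative_mul, Polynomial.derivative_sub, Polynomial.derivative_one,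
    Polynomial.derivative_X, Polynomial.derivative_C, Polynomial.eval_add, Polynomial.eval_mul,
    Polynomial.eval_sub, Polynomial.eval_one, Polynomial.eval_C, Polynomial.eval_X,
    Polynomial.eval_prod, h4, h3, Polynomial.eval_zero]
  field_simp
  ring

theorem tCoeff_eq {n : ℕ} (e : Side) (k : ℤ) (f : HahnSeries ℤ (K n)) :
    tCoeff n e k f = f.coeff (expo e k) := by
  cases e <;> rfl

/-- The expansion of `(1 - z_a t)⁻¹`. -/
def geomL (n : ℕ) (a : Fin n) (e : Side) : L n :=
  (geom (Units.mk0 (z a : K n) (z_ne_zero a)) e : HahnSeries ℤ (K n))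

theorem one_sub_mul_geomL {n : ℕ} (a : Fin n) (e : Side) :
    (1 - algebraMap (K n) (L n) (z a) * tau n e) * geomL n a e = 1 := by
  have h := one_sub_mul_geom (Units.mk0 (z a : K n) (z_ne_zero a)) e
  cases e <;> exact h

theorem tCoeff_geomL {n : ℕ} (a : Fin n) (e : Side) (k : ℤ) :
    tCoeff n e k (geomL n a e) = (geomSign e k : K n) * z a ^ k := by
  refine (tCoeff_eq e k _).trans ((geom_coeff _ e k).trans ?_)
  rw [Units.val_zpow_eq_zpow_val, Units.val_mk0]

theorem coeffT_mul_aeval {n l : ℕ} (e : Side) (k : ℤ) (f : L n) (p : MvPolynomial (Fin l) (K n)) :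
    coeffT n l e k (algebraMap (L n) (B n l) f * MvPolynomial.aeval (X n l) p)
      = MvPolynomial.C (tCoeff n e k f) * p := by
  have h1 : MvPolynomial.aeval (X n l) p = algebraMap (MvPolynomial (Fin l) (L n)) (B n l)
      (MvPolynomial.map (algebraMap (K n) (L n)) p) := by
    have h := MvPolynomial.eval₂_comp_left (algebraMap (MvPolynomial (Fin l) (L n)) (B n l))
      MvPolynomial.C MvPolynomial.X (MvPolynomial.map (algebraMap (K n) (L n)) p)
    rw [MvPolynomial.eval₂_eta, MvPolynomial.eval₂_map] at h
    rw [h]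
    rfl
  rw [h1, IsScalarTower.algebraMap_apply (L n) (MvPolynomial (Fin l) (L n)) (B n l), ← map_mul,
    coeffT, LinearMap.comp_apply, LinearMap.restrictScalars_apply, toPoly_algebraMap]
  ext m
  have h2 : ∀ q : MvPolynomial (Fin l) (L n),
      (coeffPoly n l e k q).coeff m = tCoeff n e k (q.coeff m) := fun q => by
    simp [coeffPoly, MvPolynomial.coeff]
  rw [h2, MvPolynomial.algebraMap_eq, MvPolynomial.coeff_C_mul, MvPolynomial.coeff_map,
    MvPolynomial.coeff_C_mul, mul_comm, ← Algebra.smul_def, map_smul, smul_eq_mul, mul_comm]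

/-- In each residue t occurs only in 1/(1 - z_a t), whose coefficient of t^k is z_a^k up to a sign
or zero common to all a. -/
theorem coeffT_formXp2 {n l : ℕ} (e : Side) (k : ℤ) (P : MvPolynomial (Fin (l + 2)) (K n)) :
    coeffT n l e k (formXp2 (zB n l) (tB n l e) (X n l) P)
      = MvPolynomial.C ((geomSign e k : K n) * (-2)⁻¹) * resSum z k P := by
  have hz : ∀ a, zB n l a ≠ 0 := fun a => (map_ne_zero _).mpr (z_ne_zero a)
  rw [formXp2, LinearMap.sum_apply, map_sum, resSum, Finset.mul_sum]
  refine Finset.sum_congr rfl fun a _ => ?_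
  have h1 : ((resDenom (zB n l) (tB n l e)).derivative.eval (zB n l a)⁻¹)⁻¹
      = algebraMap (L n) (B n l) (algebraMap (K n) (L n)
        ((-2)⁻¹ * (∏ j ∈ Finset.univ.erase a, (1 - z j ^ 2 * (z a)⁻¹ ^ 2))⁻¹) * geomL n a e) := by
    rw [eval_derivative_resDenom _ _ (hz a)]
    apply inv_eq_of_mul_eq_one_right
    have hK : ∏ j ∈ Finset.univ.erase a, (1 - zB n l j ^ 2 * (zB n l a)⁻¹ ^ 2)
        = algebraMap (K n) (B n l)
          (∏ j ∈ Finset.univ.erase a, (1 - z j ^ 2 * (z a)⁻¹ ^ 2)) := by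
      rw [map_prod]
      refine Finset.prod_congr rfl fun j _ => ?_
      rw [map_sub, map_one, map_mul, map_pow, map_pow, map_inv₀]
      rfl
    have hL : 1 - zB n l a * tB n l e
        = algebraMap (L n) (B n l) (1 - algebraMap (K n) (L n) (z a) * tau n e) := by
      rw [map_sub, map_one, map_mul]
      rfl
    have hne : (∏ j ∈ Finset.univ.erase a, (1 - z j ^ 2 * (z a)⁻¹ ^ 2) : K n) ≠ 0 :=
      prod_one_sub_ne_zero z (fun b c h => z_sq_injective h) z_ne_zero a
    have h2 : (2 : K n) ≠ 0 := two_ne_zero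
    have hc : (-2 * ∏ j ∈ Finset.univ.erase a, (1 - z j ^ 2 * (z a)⁻¹ ^ 2) : K n) *
        ((-2)⁻¹ * (∏ j ∈ Finset.univ.erase a, (1 - z j ^ 2 * (z a)⁻¹ ^ 2))⁻¹) = 1 := by
      generalize (∏ j ∈ Finset.univ.erase a, (1 - z j ^ 2 * (z a)⁻¹ ^ 2) : K n) = D at hne
      field_simp
    rw [hK, hL, map_mul (algebraMap (L n) (B n l)),
      ← IsScalarTower.algebraMap_apply (K n) (L n) (B n l), mul_mul_mul_comm, ← map_mul,
      one_sub_mul_geomL, map_one, mul_one]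
    have h := congrArg (algebraMap (K n) (B n l)) hc
    rw [map_mul, map_mul, map_one, map_neg, map_ofNat] at h
    exact h
  have h2 : (ev (Fin.snoc (Fin.snoc (X n l) (-(zB n l a)⁻¹) : Fin (l + 1) → B n l) (zB n l a)⁻¹ :
      Fin (l + 2) → B n l) P) = MvPolynomial.aeval (X n l) (pairSub (z a)⁻¹ P) := by
    rw [MvPolynomial.aeval_def, eval₂_pairSub, map_inv₀]
    rfl
  rw [LinearMap.smul_apply, h2, smul_eq_mul, h1, coeffT_mul_aeval, ← Algebra.smul_def, map_smul,
    tCoeff_geomL, smul_eq_mul]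
  simp only [map_mul]
  ring

end ResidueSum

/-! ### Universality of the link relation, and vanishing at opposite variables -/

section UniversalLink

variable {n l : ℕ}

/-- The embedding of polynomials in `z_1, …, z_n, z` into `K_n(z)`. -/
def polyToKz (n : ℕ) : MvPolynomial (Fin (n + 1)) ℂ →+* Kz n :=
  (algebraMap (Polynomial (K n)) (Kz n)).comp
    ((Polynomial.mapRingHom (algebraMap (MvPolynomial (Fin n) ℂ) (K n))).comp
      ((MvPolynomial.optionEquivLeft ℂ (Fin n)).toRingHom.comp
        (MvPolynomial.renameEquiv ℂ finSuccEquivLast).toRingHom))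

theorem polyToKz_injective : Function.Injective (polyToKz n) := by
  refine (RatFunc.algebraMap_injective (K n)).comp
    ((Polynomial.map_injective _ algebraMap_K_injective).comp ?_)
  exact (MvPolynomial.optionEquivLeft ℂ (Fin n)).injective.comp
    (MvPolynomial.renameEquiv ℂ finSuccEquivLast).injective

theorem polyToKz_castSucc (j : Fin n) :
    polyToKz n (MvPolynomial.X j.castSucc) = RatFunc.C (z j) := by
  simp [polyToKz, z]

theorem polyToKz_last : polyToKz n (MvPolynomial.X (Fin.last n)) = RatFunc.X := by
  simp [polyToKz]

theorem polyToKz_C (c : ℂ) :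
    polyToKz n (MvPolynomial.C c) = RatFunc.C (algebraMap ℂ (K n) c) := by
  simp only [polyToKz, RingHom.comp_apply]
  have h : (MvPolynomial.renameEquiv ℂ (finSuccEquivLast (n := n))).toRingHom (MvPolynomial.C c)
      = MvPolynomial.C c := MvPolynomial.rename_C _ _
  have h2 : (MvPolynomial.optionEquivLeft ℂ (Fin n)).toRingHom (MvPolynomial.C c)
      = Polynomial.C (MvPolynomial.C c) := MvPolynomial.optionEquivLeft_C _ _ _
  rw [h, h2, Polynomial.coe_mapRingHom, Polynomial.map_C, RatFunc.algebraMap_C]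
  rfl

theorem lau_injective_of_poly {D : Type*} [CommRing D] {f : Lau n →+* D}
    (h : Function.Injective (f.comp (algebraMap (MvPolynomial (Fin n) ℂ) (Lau n)))) :
    Function.Injective f := by
  rw [injective_iff_map_eq_zero]
  intro s hs
  obtain ⟨N, p, hp⟩ := lau_exists_mul s
  have h0 : p = 0 := by
    apply h
    rw [RingHom.comp_apply, ← hp, map_mul, hs, zero_mul, map_zero]
  rw [h0, map_zero] at hp
  exact (isUnit_varProd.pow N).mul_left_eq_zero.mp hp

theorem Units.val_inv_map {R S : Type*} [CommRing R] [Field S] (f : R →+* S) (u : Rˣ) :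
    f (u⁻¹ : Rˣ) = (f u)⁻¹ := by
  apply eq_inv_of_mul_eq_one_left
  rw [← map_mul, Units.inv_mul, map_one]

/-- The Laurent polynomials in `z_1, …, z_n`, as Laurent polynomials in `z_1, …, z_{n+1}`. -/
def lauIncl (n : ℕ) : Lau n →+* Lau (n + 1) :=
  lauHom (algebraMap ℂ (Lau (n + 1))) fun j => LZ j.castSucc

/-- The specialization `z_{n+2} = -z_{n+1}`. -/
def lauSpec (n : ℕ) : Lau (n + 2) →+* Lau (n + 1) :=
  lauHom (algebraMap ℂ (Lau (n + 1)))
    (Fin.snoc (Fin.snoc (fun j : Fin n => LZ j.castSucc) (LZ (Fin.last n)) :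
      Fin (n + 1) → (Lau (n + 1))ˣ) (-LZ (Fin.last n)) : Fin (n + 2) → (Lau (n + 1))ˣ)

/-- Both sides of the link relation have coefficients in the Laurent polynomials in z_1, …, z_n, z,
which embed into K_n(z). The identity therefore holds over that ring and can be pushed to any field,
including non-generic values of the z_j. -/
theorem SpecEq.specEqOver {Q : MvPolynomial (Fin l) (Lau n)}
    {Q' : MvPolynomial (Fin (l + 1)) (Lau (n + 2))} (h : SpecEq n l Q Q') {S : Type} [Field S]
    {φ : Lau (n + 2) →+* S} {ι : Lau n →+* S} {x : S} (hx : x ≠ 0) (hs : IsSpec φ ι x)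
    (hc : ∀ c : ℂ, φ (algebraMap ℂ _ c) = ι (algebraMap ℂ _ c)) : SpecEqOver l φ ι x Q Q' := by
  have hg : ∀ {T : Type} [Field T] (φ : Lau (n + 2) →+* T) (ι : Lau n →+* T) (x : T)
      (θ : Lau (n + 1) →+* T), IsSpec φ ι x →
      (∀ c : ℂ, φ (algebraMap ℂ _ c) = θ (algebraMap ℂ _ c)) →
      (∀ c : ℂ, ι (algebraMap ℂ _ c) = θ (algebraMap ℂ _ c)) →
      (∀ j : Fin n, θ (LZ j.castSucc) = ι (LZ j)) → θ (LZ (Fin.last n)) = x →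
      θ.comp (lauSpec n) = φ ∧ θ.comp (lauIncl n) = ι := by
    intro T _ φ ι x θ hs h1 h2 h3 h4
    constructor
    · apply lau_hom_ext
      · intro c
        rw [RingHom.comp_apply, lauSpec, lauHom_C, h1]
      · intro j
        have hj : φ (LZ j) = _ := congrFun hs j
        rw [RingHom.comp_apply, lauSpec, lauHom_LZ, hj, addPair]
        refine Fin.lastCases ?_ (fun j => ?_) j
        · rw [Fin.snoc_last, Fin.snoc_last, Units.val_neg, map_neg, h4]
        · rw [Fin.snoc_castSucc, Fin.snoc_castSucc]
          refine Fin.lastCases ?_ (fun j => ?_) j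
          · rw [Fin.snoc_last, Fin.snoc_last, h4]
          · rw [Fin.snoc_castSucc, Fin.snoc_castSucc, h3]
    · apply lau_hom_ext
      · intro c
        rw [RingHom.comp_apply, lauIncl, lauHom_C, h2]
      · intro j
        rw [RingHom.comp_apply, lauIncl, lauHom_LZ, h3]
  -- The universal form of the relation over `Lau (n + 1)`, with the last variable in the role of z.
  have hu : setLast (((LZ (Fin.last n))⁻¹ : (Lau (n + 1))ˣ) : Lau (n + 1)) (MvPolynomial.map (lauSpec n) Q')
      = linkFactor n l (LZ (Fin.last n) : Lau (n + 1)) ((LZ (Fin.last n))⁻¹ : (Lau (n + 1))ˣ) *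
        MvPolynomial.map (lauIncl n) Q := by
    have hv : ∀ j : Fin (n + 1), polyToKz n (MvPolynomial.X j) ≠ 0 := fun j => by
      rw [Ne, map_eq_zero_iff _ polyToKz_injective]
      exact MvPolynomial.X_ne_zero j
    let θ : Lau (n + 1) →+* Kz n := lauHom (RatFunc.C.comp (algebraMap ℂ (K n)))
      fun j => Units.mk0 _ (hv j)
    have hθ : Function.Injective θ := by
      apply lau_injective_of_poly
      have : θ.comp (algebraMap (MvPolynomial (Fin (n + 1)) ℂ) (Lau (n + 1))) = polyToKz n := by
        apply MvPolynomial.ringHom_ext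
        · intro c
          simp only [RingHom.comp_apply, θ, lauHom_algebraMap, MvPolynomial.eval₂_C, polyToKz_C]
        · intro j
          simp only [RingHom.comp_apply, θ, lauHom_algebraMap, MvPolynomial.eval₂_X, Units.val_mk0]
      rw [this]
      exact polyToKz_injective
    obtain ⟨e1, e2⟩ := hg (spec n) ((RatFunc.C : K n →+* Kz n).comp (lauToK n)) RatFunc.X θ
      (isSpec_spec n) (fun c => by simp only [θ, lauHom_C, spec_C, RingHom.comp_apply])
      (fun c => by simp only [θ, lauHom_C, lauToK_C, RingHom.comp_apply])
      (fun j => by simp only [θ, lauHom_LZ, Units.val_mk0, polyToKz_castSucc, lauToK_LZ,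
        RingHom.comp_apply])
      (by simp only [θ, lauHom_LZ, Units.val_mk0, polyToKz_last])
    have e3 : θ (LZ (Fin.last n)) = RatFunc.X := by
      simp only [θ, lauHom_LZ, Units.val_mk0, polyToKz_last]
    apply MvPolynomial.map_injective θ hθ
    rw [map_mul, map_setLast, map_linkFactor, MvPolynomial.map_map, MvPolynomial.map_map, e1, e2,
      Units.val_inv_map, e3]
    exact h
  let θ : Lau (n + 1) →+* S := lauHom (φ.comp (algebraMap ℂ (Lau (n + 2))))
    (Fin.snoc (fun j => Units.map ι.toMonoidHom (LZ j)) (Units.mk0 x hx) : Fin (n + 1) → Sˣ)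
  have e3 : θ (LZ (Fin.last n)) = x := by
    simp only [θ, lauHom_LZ, Fin.snoc_last, Units.val_mk0]
  obtain ⟨e1, e2⟩ := hg φ ι x θ hs (fun c => by simp only [θ, lauHom_C, RingHom.comp_apply])
    (fun c => by simp only [θ, lauHom_C, RingHom.comp_apply, hc])
    (fun j => by simp only [θ, lauHom_LZ, Fin.snoc_castSucc]; rfl) e3
  have h2 := congrArg (MvPolynomial.map θ) hu
  rw [map_mul, map_setLast, map_linkFactor, MvPolynomial.map_map, MvPolynomial.map_map, e1, e2,
    Units.val_inv_map, e3] at h2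
  exact h2

theorem exists_perm_of_ne {α : Type*} [DecidableEq α] {p q a b : α} (hpq : p ≠ q) (hab : a ≠ b) :
    ∃ π : Equiv.Perm α, π p = a ∧ π q = b := by
  refine ⟨(Equiv.swap p a).trans (Equiv.swap (Equiv.swap p a q) b), ?_, ?_⟩
  · rw [Equiv.trans_apply, Equiv.swap_apply_left, Equiv.swap_apply_of_ne_of_ne _ hab]
    intro h
    apply hpq
    rw [← (Equiv.swap p a).injective.eq_iff, ← h, Equiv.swap_apply_left]
  · rw [Equiv.trans_apply, Equiv.swap_apply_left]

theorem SpecEqOver.eval₂ {Q : MvPolynomial (Fin l) (Lau n)}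
    {Q' : MvPolynomial (Fin (l + 1)) (Lau (n + 2))} {S : Type} [Field S]
    {φ : Lau (n + 2) →+* S} {ι : Lau n →+* S} {x : S} (h : SpecEqOver l φ ι x Q Q')
    (v : Fin l → S) :
    MvPolynomial.eval₂ φ (Fin.snoc v x⁻¹ : Fin (l + 1) → S) Q'
      = (x⁻¹ ^ (n + 1) * ∏ a, (1 - v a ^ 2 * x ^ 2)) * MvPolynomial.eval₂ ι v Q := by
  have h2 := congrArg (MvPolynomial.eval₂ (RingHom.id S) v) h
  rw [eval₂_setLast, MvPolynomial.eval₂_mul, eval₂_linkFactor, MvPolynomial.eval₂_map,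
    MvPolynomial.eval₂_map, RingHom.id_comp, RingHom.id_comp] at h2
  exact h2

/-- Since `Q'` is symmetric in the z_j, the opposite pair z_a, z_b = -z_a may be moved to the last
two places. The link relation then applies with z = z_a, and its factor 1 - v_i²z_a² is zero. -/
theorem SpecEq.eval₂_eq_zero {Q : MvPolynomial (Fin l) (Lau n)}
    {Q' : MvPolynomial (Fin (l + 1)) (Lau (n + 2))} (h : SpecEq n l Q Q')
    (hQ' : ∀ π, MvPolynomial.map (permLau π) Q' = Q') {S : Type} [Field S]
    (φ : Lau (n + 2) →+* S) {a b : Fin (n + 2)} (hab : a ≠ b) (hφ : φ (LZ b) = -φ (LZ a))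
    (v : Fin l → S) (i : Fin l) (hv : v i ^ 2 * φ (LZ a) ^ 2 = 1) :
    MvPolynomial.eval₂ φ (Fin.snoc v (φ (LZ a))⁻¹ : Fin (l + 1) → S) Q' = 0 := by
  obtain ⟨π, h1, h2⟩ := exists_perm_of_ne (Fin.castSucc_lt_last (Fin.last n)).ne hab
  let ι : Lau n →+* S := ((φ.comp (permLau π)).comp (lauIncl (n + 1))).comp (lauIncl n)
  have hs : IsSpec (φ.comp (permLau π)) ι (φ (LZ a)) := by
    funext j
    refine Fin.lastCases ?_ (fun j => ?_) j
    · rw [RingHom.comp_apply, permLau_LZ, h2, addPair, Fin.snoc_last, hφ]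
    · refine Fin.lastCases ?_ (fun j => ?_) j
      · rw [RingHom.comp_apply, permLau_LZ, h1, addPair, Fin.snoc_castSucc, Fin.snoc_last]
      · rw [addPair, Fin.snoc_castSucc, Fin.snoc_castSucc]
        simp only [ι, RingHom.comp_apply, lauIncl, lauHom_LZ]
  have hx : φ (LZ a) ≠ 0 := by
    intro h0
    rw [h0] at hv
    simp at hv
  have h3 := (h.specEqOver hx hs fun c => by
    simp only [ι, RingHom.comp_apply, lauIncl, lauHom_C]).eval₂ v
  rw [← MvPolynomial.eval₂_map, hQ' π, Finset.prod_eq_zero (Finset.mem_univ i)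
    (by rw [hv, sub_self]), mul_zero, zero_mul] at h3
  exact h3

/-- The vanishing condition under which the divided square of `x⁺` has Laurent polynomials as
coefficients. -/
def PairVanish (Q : MvPolynomial (Fin (l + 2)) (Lau n)) : Prop :=
  ∀ (S : Type) [Field S] (φ : Lau n →+* S) (a b : Fin n), a ≠ b → φ (LZ b) = -φ (LZ a) →
    ∀ v : Fin l → S, MvPolynomial.eval₂ φ (Fin.snoc (Fin.snoc v (-(φ (LZ a))⁻¹) : Fin (l + 1) → S)
      (φ (LZ a))⁻¹ : Fin (l + 2) → S) Q = 0

theorem map_LZ_ne_zero {S : Type*} [Field S] (φ : Lau n →+* S) (a : Fin n) : φ (LZ a) ≠ 0 :=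
  ((LZ a).isUnit.map φ).ne_zero

/-- The argument -z_a⁻¹ next to z_a⁻¹ makes a link factor vanish. -/
theorem SpecEq.pairVanish_right {Q : MvPolynomial (Fin (l + 1)) (Lau n)}
    {Q' : MvPolynomial (Fin (l + 2)) (Lau (n + 2))} (h : SpecEq n (l + 1) Q Q')
    (hQ' : ∀ π, MvPolynomial.map (permLau π) Q' = Q') : PairVanish Q' := by
  intro S _ φ a b hab hφ v
  refine h.eval₂_eq_zero hQ' φ hab hφ _ (Fin.last l) ?_
  have := map_LZ_ne_zero φ a
  rw [Fin.snoc_last]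
  field_simp

theorem one_sub_C_sq_mul_X_sq_ne_zero {S : Type*} [Field S] (s : S) :
    (1 - RatFunc.C s ^ 2 * RatFunc.X ^ 2 : RatFunc S) ≠ 0 := by
  have h : (1 - RatFunc.C s ^ 2 * RatFunc.X ^ 2 : RatFunc S) = algebraMap (Polynomial S) (RatFunc S)
      (1 - Polynomial.C s ^ 2 * Polynomial.X ^ 2) := by
    simp
  rw [h, Ne, map_eq_zero_iff _ (RatFunc.algebraMap_injective S)]
  intro h0
  have := congrArg (Polynomial.eval 0) h0
  simp at this

/-- The vanishing is inherited from `Q'`: adjoin a transcendental z to the field and extend the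
specialization by z, -z. The opposite pair z_a, z_b is still present, so `Q'` vanishes at the
relevant point, and the link factor relating it to `Q` is nonzero. -/
theorem SpecEq.pairVanish_left {Q : MvPolynomial (Fin (l + 2)) (Lau n)}
    {Q' : MvPolynomial (Fin (l + 3)) (Lau (n + 2))} (h : SpecEq n (l + 2) Q Q')
    (hQ' : LD (n + 2) (l + 3) Q') : PairVanish Q := by
  intro S _ φ a b hab hφ v
  let ι : Lau n →+* RatFunc S := (RatFunc.C : S →+* RatFunc S).comp φ
  let ψ : Lau (n + 2) →+* RatFunc S := lauHom (ι.comp (algebraMap ℂ (Lau n)))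
    (Fin.snoc (Fin.snoc (fun j => Units.map ι.toMonoidHom (LZ j))
        (Units.mk0 RatFunc.X RatFunc.X_ne_zero) : Fin (n + 1) → (RatFunc S)ˣ)
      (-(Units.mk0 RatFunc.X RatFunc.X_ne_zero)) : Fin (n + 2) → (RatFunc S)ˣ)
  have hs : IsSpec ψ ι RatFunc.X := by
    funext j
    simp only [ψ, lauHom_LZ, addPair]
    refine Fin.lastCases ?_ (fun j => ?_) j
    · simp only [Fin.snoc_last, Units.val_neg, Units.val_mk0]
    · rw [Fin.snoc_castSucc, Fin.snoc_castSucc]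
      refine Fin.lastCases ?_ (fun j => ?_) j
      · simp only [Fin.snoc_last, Units.val_mk0]
      · rw [Fin.snoc_castSucc, Fin.snoc_castSucc]
        rfl
  have hψ : ∀ j : Fin n, ψ (LZ j.castSucc.castSucc) = ι (LZ j) := fun j => by
    simp only [ψ, lauHom_LZ, Fin.snoc_castSucc]
    rfl
  have hι : ∀ j : Fin n, ι (LZ j) = RatFunc.C (φ (LZ j)) := fun j => rfl
  let w : Fin (l + 1) → RatFunc S := Fin.snoc (fun i => RatFunc.C (v i)) (-(ι (LZ a))⁻¹)
  have key := (h.specEqOver RatFunc.X_ne_zero hs fun c => by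
    simp only [ψ, lauHom_C, RingHom.comp_apply]).eval₂
      (Fin.snoc w (ι (LZ a))⁻¹ : Fin (l + 2) → RatFunc S)
  have h0 := h.eval₂_eq_zero hQ'.symm ψ (a := a.castSucc.castSucc) (b := b.castSucc.castSucc)
    (fun h' => hab (Fin.castSucc_injective _ (Fin.castSucc_injective _ h')))
    (by rw [hψ, hψ, hι, hι, hφ, map_neg])
    (Fin.snoc w (RatFunc.X)⁻¹ : Fin (l + 2) → RatFunc S) (Fin.last l).castSucc (by
      have := map_LZ_ne_zero ι a
      rw [Fin.snoc_castSucc, hψ]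
      simp only [w, Fin.snoc_last]
      field_simp)
  rw [hψ] at h0
  -- The link relation wants z⁻¹ last, the vanishing statement wants z_a⁻¹ last; skew-symmetry
  -- exchanges them.
  have hsw := snoc_snoc_swap (isSkewFn_eval₂ ψ hQ'.skew) w (ι (LZ a))⁻¹ (RatFunc.X)⁻¹
  rw [hsw, h0, neg_zero] at key
  -- All these arguments are constants, so no factor can vanish at the transcendental z.
  have hw : ∀ i, (1 - (Fin.snoc w (ι (LZ a))⁻¹ : Fin (l + 2) → RatFunc S) i ^ 2 * RatFunc.X ^ 2)
      ≠ 0 := by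
    have hC : ∀ y : RatFunc S, (∃ s, y = RatFunc.C s) → 1 - y ^ 2 * RatFunc.X ^ 2 ≠ 0 := by
      rintro _ ⟨s, rfl⟩
      exact one_sub_C_sq_mul_X_sq_ne_zero s
    intro i
    apply hC
    refine Fin.lastCases ?_ (fun i => ?_) i
    · exact ⟨(φ (LZ a))⁻¹, by rw [Fin.snoc_last, hι, map_inv₀]⟩
    · rw [Fin.snoc_castSucc]
      refine Fin.lastCases ?_ (fun i => ?_) i
      · exact ⟨-(φ (LZ a))⁻¹, by simp only [w, Fin.snoc_last, hι, map_neg, map_inv₀]⟩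
      · exact ⟨v i, by simp only [w, Fin.snoc_castSucc]⟩
  have h1 := (mul_eq_zero.mp key.symm).resolve_left
    (mul_ne_zero (pow_ne_zero _ (inv_ne_zero RatFunc.X_ne_zero))
      (Finset.prod_ne_zero_iff.mpr fun i _ => hw i))
  have hv : (Fin.snoc w (ι (LZ a))⁻¹ : Fin (l + 2) → RatFunc S) = (RatFunc.C : S →+* RatFunc S) ∘
      (Fin.snoc (Fin.snoc v (-(φ (LZ a))⁻¹) : Fin (l + 1) → S) (φ (LZ a))⁻¹ :
        Fin (l + 2) → S) := by
    funext i
    rw [Function.comp_apply]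
    refine Fin.lastCases ?_ (fun i => ?_) i
    · rw [Fin.snoc_last, Fin.snoc_last, hι, map_inv₀]
    · rw [Fin.snoc_castSucc, Fin.snoc_castSucc]
      refine Fin.lastCases ?_ (fun i => ?_) i
      · simp only [w, Fin.snoc_last, hι, map_neg, map_inv₀]
      · simp only [w, Fin.snoc_castSucc]
  rw [hv, ← MvPolynomial.eval₂_comp_left] at h1
  exact (map_eq_zero _).mp h1

end UniversalLink

/-! ### Cofactors of the Vandermonde matrix -/

section Vandermonde

/-- The a-th column of the inverse Vandermonde matrix lists the coefficients of the a-th Lagrange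
basis polynomial, whose top coefficient is the inverse of ∏_{j≠a}(y_a - y_j). -/
theorem adjugate_vandermonde_last {F : Type*} [Field F] {m : ℕ} {y : Fin (m + 1) → F}
    (hy : Function.Injective y) (a : Fin (m + 1)) :
    (Matrix.vandermonde y).adjugate (Fin.last m) a
      = (Matrix.vandermonde y).det * (∏ j ∈ Finset.univ.erase a, (y a - y j))⁻¹ := by
  have hinj : Set.InjOn y (Finset.univ : Finset (Fin (m + 1))) := hy.injOn
  set P := Lagrange.basis Finset.univ y a with hP
  have hdeg : P.degree < (Finset.univ : Finset (Fin (m + 1))).card := by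
    rw [hP, Lagrange.degree_basis hinj (Finset.mem_univ a), Finset.card_univ, Fintype.card_fin]
    exact_mod_cast Nat.lt_succ_self m
  have hnat : P.natDegree < m + 1 := by
    rw [hP, Lagrange.natDegree_basis hinj (Finset.mem_univ a), Finset.card_univ, Fintype.card_fin]
    exact Nat.lt_succ_self m
  have heval : ∀ b, P.eval (y b) = Pi.single (M := fun _ => F) a 1 b := by
    intro b
    rcases eq_or_ne b a with rfl | h
    · rw [hP, Lagrange.eval_basis_self hinj (Finset.mem_univ b), Pi.single_eq_same]
    · rw [hP, Lagrange.eval_basis_of_ne h.symm (Finset.mem_univ b), Pi.single_eq_of_ne h]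
  have hmul : (Matrix.vandermonde y).mulVec (fun i : Fin (m + 1) => P.coeff i)
      = Pi.single a 1 := by
    funext b
    rw [← heval, Polynomial.eval_eq_sum_range' hnat, ← Fin.sum_univ_eq_sum_range
      (fun i => P.coeff i * y b ^ i), Matrix.mulVec, dotProduct]
    exact Finset.sum_congr rfl fun i _ => by rw [Matrix.vandermonde_apply, mul_comm]
  have h1 := congrArg (fun v => (Matrix.vandermonde y).adjugate.mulVec v (Fin.last m)) hmul
  simp only [Matrix.mulVec_mulVec, Matrix.adjugate_mul, Matrix.smul_mulVec, Matrix.one_mulVec,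
    Pi.smul_apply, smul_eq_mul, Matrix.mulVec_single_one, Matrix.col_apply] at h1
  rw [← h1, Fin.val_last]
  congr 1
  have h2 := Lagrange.coeff_eq_sum hinj hdeg
  rw [Finset.card_univ, Fintype.card_fin, Nat.add_sub_cancel] at h2
  rw [h2, Finset.sum_eq_single a]
  · rw [heval, Pi.single_eq_same, one_div]
  · intro b _ hb
    rw [heval, Pi.single_eq_of_ne hb, zero_div]
  · exact fun h => absurd (Finset.mem_univ a) h

end Vandermonde

/-! ### The residue sum has Laurent polynomials as coefficients -/

section Laurentness

variable {n l : ℕ}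

/-- The specialization `z_b = u`. -/
def lauUpdate (b : Fin n) (u : (Lau n)ˣ) : Lau n →+* Lau n :=
  lauHom (algebraMap ℂ (Lau n)) (Function.update LZ b u)

theorem lauUpdate_self (b : Fin n) (u : (Lau n)ˣ) : lauUpdate b u (LZ b) = u := by
  rw [lauUpdate, lauHom_LZ, Function.update_self]

theorem lauUpdate_of_ne {b j : Fin n} (h : j ≠ b) (u : (Lau n)ˣ) : lauUpdate b u (LZ j) = LZ j := by
  rw [lauUpdate, lauHom_LZ, Function.update_of_ne h]

/-- Modulo z_b - u the specialization z_b = u is the identity. -/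
theorem dvd_of_lauUpdate_eq_zero {b : Fin n} {u : (Lau n)ˣ} {s : Lau n}
    (h : lauUpdate b u s = 0) : (LZ b - u : Lau n) ∣ s := by
  let I := Ideal.span {(LZ b - u : Lau n)}
  have h1 : (Ideal.Quotient.mk I).comp (lauUpdate b u) = Ideal.Quotient.mk I := by
    apply lau_hom_ext
    · intro c
      rw [RingHom.comp_apply, lauUpdate, lauHom_C]
    · intro j
      rw [RingHom.comp_apply]
      rcases eq_or_ne j b with rfl | hj
      · rw [lauUpdate_self, eq_comm, Ideal.Quotient.eq]
        exact Ideal.subset_span rfl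
      · rw [lauUpdate_of_ne hj]
  rw [← Ideal.mem_span_singleton, ← Ideal.Quotient.eq_zero_iff_mem]
  change Ideal.Quotient.mk I s = 0
  rw [← h1, RingHom.comp_apply, h, map_zero]

theorem C_dvd_of_map_lauUpdate_eq_zero {σ : Type*} {b : Fin n} {u : (Lau n)ˣ}
    {p : MvPolynomial σ (Lau n)} (h : MvPolynomial.map (lauUpdate b u) p = 0) :
    MvPolynomial.C (LZ b - u : Lau n) ∣ p := by
  rw [MvPolynomial.C_dvd_iff_dvd_coeff]
  intro s
  apply dvd_of_lauUpdate_eq_zero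
  rw [← MvPolynomial.coeff_map, h, MvPolynomial.coeff_zero]

/-- The variable `± z_a`. -/
def sgnZ (s : ℤˣ) (a : Fin n) : (Lau n)ˣ := Units.map (Int.castRingHom (Lau n)).toMonoidHom s * LZ a

theorem coe_sgnZ (s : ℤˣ) (a : Fin n) : (sgnZ s a : Lau n) = ((s : ℤ) : Lau n) * LZ a := rfl

theorem sgnZ_sq (s : ℤˣ) (a : Fin n) : (sgnZ s a : Lau n) ^ 2 = (LZ a : Lau n) ^ 2 := by
  rw [coe_sgnZ]
  rcases Int.units_eq_one_or s with rfl | rfl <;> simp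

/-- Setting z_a = 2 and all other variables to 1 separates the elements ±z_j involved. -/
theorem sgnZ_mul_injective {s s' : ℤˣ} {a a' : Fin n}
    (h : ((s : ℤ) : Lau n) * LZ a = ((s' : ℤ) : Lau n) * LZ a') : a = a' ∧ s = s' := by
  have h1 := congrArg (lauHom (RingHom.id ℂ)
    (Function.update (fun _ => 1) a (Units.mk0 2 two_ne_zero))) h
  rw [map_mul, map_mul, lauHom_LZ, lauHom_LZ, Function.update_self, map_intCast, map_intCast,
    Units.val_mk0] at h1
  by_cases ha : a' = a
  · subst ha
    rw [Function.update_self, Units.val_mk0] at h1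
    have h2 : ((s : ℤ) : ℂ) = ((s' : ℤ) : ℂ) := mul_right_cancel₀ two_ne_zero h1
    exact ⟨rfl, Units.ext (by exact_mod_cast h2)⟩
  · rw [Function.update_of_ne ha] at h1
    exfalso
    have h3 : ((s : ℤ) : ℂ) * 2 = ((s' : ℤ) : ℂ) := by simpa using h1
    have h4 : (s : ℤ) * 2 = s' := by exact_mod_cast h3
    rcases Int.units_eq_one_or s with rfl | rfl <;> rcases Int.units_eq_one_or s' with rfl | rfl <;>
      simp at h4

/-- Different hyperplanes z_j = ±z_i do not contain one another. The ordering of the indices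
excludes naming the same hyperplane twice. -/
theorem lauUpdate_sub_ne_zero {i j i' j' : Fin n} {s s' : ℤˣ} (hij : i < j) (hij' : i' < j')
    (h : ¬(i = i' ∧ j = j' ∧ s = s')) :
    lauUpdate j (sgnZ s i) (LZ j' - sgnZ s' i') ≠ 0 := by
  intro h0
  rw [map_sub, coe_sgnZ, map_mul, map_intCast, sub_eq_zero] at h0
  by_cases hj : j' = j
  · subst hj
    rw [lauUpdate_self, lauUpdate_of_ne hij'.ne, coe_sgnZ] at h0
    obtain ⟨h1, h2⟩ := sgnZ_mul_injective h0
    exact h ⟨h1, rfl, h2⟩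
  · rw [lauUpdate_of_ne hj] at h0
    by_cases hi : i' = j
    · subst hi
      rw [lauUpdate_self, coe_sgnZ, ← mul_assoc, ← Int.cast_mul, ← Units.val_mul] at h0
      have h1 : (((1 : ℤˣ) : ℤ) : Lau n) * LZ j' = (((s' * s : ℤˣ) : ℤ) : Lau n) * LZ i := by
        rw [← h0]
        simp
      have := (sgnZ_mul_injective h1).1
      omega
    · rw [lauUpdate_of_ne hi] at h0
      have h1 : (((1 : ℤˣ) : ℤ) : Lau n) * LZ j' = ((s' : ℤ) : Lau n) * LZ i' := by
        rw [← h0]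
        simp
      have := (sgnZ_mul_injective h1).1
      omega

/-- Divisibility by the Vandermonde determinant of the squares of the variables. -/
theorem det_vandermonde_dvd {p : MvPolynomial (Fin l) (Lau n)}
    (h : ∀ i j, i < j → ∀ s, MvPolynomial.map (lauUpdate j (sgnZ s i)) p = 0) :
    MvPolynomial.C (Matrix.vandermonde fun a : Fin n => (LZ a : Lau n) ^ 2).det ∣ p := by
  classical
  let I : Finset (Fin n × Fin n × ℤˣ) := Finset.univ.filter fun x => x.1 < x.2.1
  have h1 := prod_dvd_of_ker I (fun x => (MvPolynomial.C (LZ x.2.1 - sgnZ x.2.2 x.1 : Lau n) :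
    MvPolynomial (Fin l) (Lau n))) (fun _ => MvPolynomial (Fin l) (Lau n))
    (fun x => MvPolynomial.map (lauUpdate x.2.1 (sgnZ x.2.2 x.1)))
    (fun x _ p hp => C_dvd_of_map_lauUpdate_eq_zero hp) (fun x hx x' hx' hne => by
      rw [MvPolynomial.map_C, Ne, MvPolynomial.C_eq_zero]
      refine lauUpdate_sub_ne_zero (Finset.mem_filter.mp hx).2 (Finset.mem_filter.mp hx').2 ?_
      rintro ⟨e1, e2, e3⟩
      exact hne (Prod.ext e1 (Prod.ext e2 e3))) p
    (fun x hx => h _ _ (Finset.mem_filter.mp hx).2 _)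
  have h2 : ∀ i j : Fin n, ∏ s : ℤˣ, (LZ j - sgnZ s i : Lau n) = (LZ j : Lau n) ^ 2 - LZ i ^ 2 := by
    intro i j
    rw [UnitsInt.univ, Finset.prod_pair (by decide), coe_sgnZ, coe_sgnZ]
    simp only [Units.val_one, Units.val_neg, Int.cast_one, Int.cast_neg]
    ring
  have h3 : (Matrix.vandermonde fun a : Fin n => (LZ a : Lau n) ^ 2).det
      = ∏ x ∈ I, (LZ x.2.1 - sgnZ x.2.2 x.1 : Lau n) := by
    rw [Matrix.det_vandermonde, Finset.prod_filter, Fintype.prod_prod_type]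
    refine Finset.prod_congr rfl fun i _ => ?_
    rw [Fintype.prod_prod_type, ← Finset.filter_lt_eq_Ioi, Finset.prod_filter]
    refine Finset.prod_congr rfl fun j _ => ?_
    split_ifs with hij
    · exact (h2 i j).symm
    · simp
  rw [h3, map_prod]
  exact h1

/-- The numerator of the residue sum. -/
def resNumer (k : ℤ) (Q : MvPolynomial (Fin (l + 2)) (Lau (n + 1))) :
    MvPolynomial (Fin l) (Lau (n + 1)) :=
  ∑ a : Fin (n + 1), MvPolynomial.C
      ((Matrix.vandermonde fun a : Fin (n + 1) => (LZ a : Lau (n + 1)) ^ 2).adjugate (Fin.last n) a) *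
    (MvPolynomial.C ((LZ a ^ (k + 2 * n) : (Lau (n + 1))ˣ) : Lau (n + 1)) *
      pairSub ((LZ a)⁻¹ : (Lau (n + 1))ˣ).val Q)

/-- By Cramer's rule the sum is the determinant of `M` with column `r` replaced by `f`, a matrix
with two equal rows. -/
theorem sum_adjugate_mul_eq_zero {R : Type*} [CommRing R] {M : Matrix (Fin n) (Fin n) R}
    {f : Fin n → R} {i j r : Fin n} (hij : i ≠ j) (hM : ∀ c, M i c = M j c) (hf : f i = f j) :
    ∑ a, M.adjugate r a * f a = 0 := by
  have h : ∑ a, M.adjugate r a * f a = (M.updateCol r f).det := by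
    rw [← Matrix.cramer_apply, Matrix.cramer_eq_adjugate_mulVec]
    rfl
  rw [h]
  refine Matrix.det_zero_of_row_eq hij ?_
  funext c
  rw [Matrix.updateCol_apply, Matrix.updateCol_apply, hf, hM]

/-- The generic point in the fraction field of the polynomial ring already separates polynomials.
Restricting to injective `ψ` lets facts such as 2 ≠ 0 carry over to the field. -/
theorem eq_of_forall_eval₂ {R : Type} [CommRing R] [IsDomain R] {p p' : MvPolynomial (Fin l) R}
    (h : ∀ (S : Type) [Field S] (ψ : R →+* S), Function.Injective ψ → ∀ v : Fin l → S,
      MvPolynomial.eval₂ ψ v p = MvPolynomial.eval₂ ψ v p') : p = p' := by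
  have hi : Function.Injective (algebraMap (MvPolynomial (Fin l) R)
      (FractionRing (MvPolynomial (Fin l) R))) := IsFractionRing.injective _ _
  have h1 := h (FractionRing (MvPolynomial (Fin l) R)) ((algebraMap _ _).comp MvPolynomial.C)
    (hi.comp (MvPolynomial.C_injective _ _))
    (fun i => algebraMap (MvPolynomial (Fin l) R) _ (MvPolynomial.X i))
  have h2 : ∀ r : MvPolynomial (Fin l) R, MvPolynomial.eval₂
      ((algebraMap (MvPolynomial (Fin l) R) (FractionRing (MvPolynomial (Fin l) R))).comp
        MvPolynomial.C)
      (fun i => algebraMap (MvPolynomial (Fin l) R) _ (MvPolynomial.X i)) r = algebraMap _ _ r := by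
    intro r
    have h3 := MvPolynomial.eval₂_comp_left
      (algebraMap (MvPolynomial (Fin l) R) (FractionRing (MvPolynomial (Fin l) R)))
      MvPolynomial.C MvPolynomial.X r
    rw [MvPolynomial.eval₂_eta] at h3
    exact h3.symm
  rw [h2, h2] at h1
  exact hi h1

theorem pairSub_neg {R : Type} [CommRing R] [IsDomain R] {Q : MvPolynomial (Fin (l + 2)) R}
    (hQ : IsSkew Q) (u : R) : pairSub (-u) Q = -pairSub u Q := by
  refine eq_of_forall_eval₂ fun S _ ψ _ v => ?_
  rw [← MvPolynomial.coe_eval₂Hom, map_neg, MvPolynomial.coe_eval₂Hom, eval₂_pairSub,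
    eval₂_pairSub, map_neg, neg_neg]
  exact snoc_snoc_swap (isSkewFn_eval₂ ψ hQ) v _ _

/-- On z_j = ±z_i the rows i and j of the Vandermonde matrix of squares coincide, so
`sum_adjugate_mul_eq_zero` needs only equal entries in the replaced column. For the sign + they are
equal; for the sign - both vanish by `PairVanish`. -/
theorem map_lauUpdate_resNumer {Q : MvPolynomial (Fin (l + 2)) (Lau (n + 1))} (hQ : IsSkew Q)
    (hv : PairVanish Q) (k : ℤ) {i j : Fin (n + 1)} (hij : i < j) (s : ℤˣ) :
    MvPolynomial.map (lauUpdate j (sgnZ s i)) (resNumer k Q) = 0 := by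
  set χ := lauUpdate j (sgnZ s i) with hχ
  set V := Matrix.vandermonde fun a : Fin (n + 1) => (LZ a : Lau (n + 1)) ^ 2 with hV
  let g : Lau (n + 1) →+* MvPolynomial (Fin l) (Lau (n + 1)) := MvPolynomial.C.comp χ
  have h1 : MvPolynomial.map χ (resNumer k Q) = ∑ a, (g.mapMatrix V).adjugate (Fin.last n) a *
      (MvPolynomial.C (χ ((LZ a ^ (k + 2 * n) : (Lau (n + 1))ˣ) : Lau (n + 1))) *
        pairSub (χ ((LZ a)⁻¹ : (Lau (n + 1))ˣ).val) (MvPolynomial.map χ Q)) := by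
    rw [resNumer, map_sum, ← RingHom.map_adjugate]
    refine Finset.sum_congr rfl fun a _ => ?_
    rw [map_mul, map_mul, MvPolynomial.map_C, MvPolynomial.map_C, map_pairSub]
    rfl
  have hi : χ (LZ i) = LZ i := lauUpdate_of_ne hij.ne _
  have hj : χ (LZ j) = sgnZ s i := lauUpdate_self _ _
  rw [h1]
  refine sum_adjugate_mul_eq_zero hij.ne (fun c => ?_) ?_
  · have h2 : χ (LZ i ^ 2) = χ (LZ j ^ 2) := by
      rw [map_pow, map_pow, hi, hj, sgnZ_sq]
    have h3 : χ (V i c) = χ (V j c) := by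
      rw [hV, Matrix.vandermonde_apply, Matrix.vandermonde_apply, map_pow, map_pow χ (_ ^ 2), h2]
    exact congrArg MvPolynomial.C h3
  · have hu : ∀ (a : Fin (n + 1)) (u : (Lau (n + 1))ˣ) (e : ℤ), χ (LZ a) = u →
        χ ((LZ a ^ e : (Lau (n + 1))ˣ) : Lau (n + 1)) = ((u ^ e : (Lau (n + 1))ˣ) : Lau (n + 1)) := by
      intro a u e h
      have h2 : Units.map χ.toMonoidHom (LZ a) = u := Units.ext h
      rw [← h2, ← map_zpow]
      rfl
    have hu1 : ∀ (a : Fin (n + 1)) (u : (Lau (n + 1))ˣ), χ (LZ a) = u →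
        χ ((LZ a)⁻¹ : (Lau (n + 1))ˣ).val = (u⁻¹ : (Lau (n + 1))ˣ).val := by
      intro a u h
      have := hu a u (-1) h
      rwa [zpow_neg_one, zpow_neg_one] at this
    rw [hu i _ _ hi, hu j _ _ hj, hu1 i _ hi, hu1 j _ hj]
    rcases Int.units_eq_one_or s with rfl | rfl
    · have : (sgnZ 1 i : (Lau (n + 1))ˣ) = LZ i := by
        rw [sgnZ, map_one, one_mul]
      rw [this]
    · have h2 : (sgnZ (-1) i : (Lau (n + 1))ˣ) = -LZ i := Units.ext (by
        rw [coe_sgnZ, Units.val_neg]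
        simp)
      have h3 : pairSub ((LZ i)⁻¹ : (Lau (n + 1))ˣ).val (MvPolynomial.map χ Q) = 0 := by
        refine eq_of_forall_eval₂ fun S _ ψ _ v => ?_
        have h4 := hv S (ψ.comp χ) i j hij.ne
          (by rw [RingHom.comp_apply, RingHom.comp_apply, hi, hj, h2, Units.val_neg, map_neg]) v
        rw [eval₂_pairSub, MvPolynomial.eval₂_map, Units.val_inv_map]
        rw [RingHom.comp_apply, hi] at h4
        rw [h4, ← MvPolynomial.coe_eval₂Hom, map_zero]
      rw [h2, h3, inv_neg, Units.val_neg, pairSub_neg (map_isSkew _ hQ), h3]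
      simp

theorem map_units_zpow {F : Type*} [Field F] {R : Type*} [CommRing R] (φ : R →+* F) (u : Rˣ)
    (k : ℤ) : φ ((u ^ k : Rˣ) : R) = φ u ^ k := by
  have h : Units.map φ.toMonoidHom (u ^ k) = Units.map φ.toMonoidHom u ^ k := map_zpow _ _ _
  have h2 := congrArg Units.val h
  rwa [Units.val_zpow_eq_zpow_val] at h2

theorem sum_adjugate_eq_det_mul_resSum {F : Type*} [Field F] {zs : Fin (n + 1) → F}
    (h : Function.Injective fun a => zs a ^ 2) (h0 : ∀ a, zs a ≠ 0) (k : ℤ)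
    (P : MvPolynomial (Fin (l + 2)) F) :
    ∑ a, MvPolynomial.C ((Matrix.vandermonde fun a => zs a ^ 2).adjugate (Fin.last n) a) *
        (MvPolynomial.C (zs a ^ (k + 2 * n)) * pairSub (zs a)⁻¹ P)
      = MvPolynomial.C (Matrix.vandermonde fun a => zs a ^ 2).det * resSum zs k P := by
  rw [resSum, Finset.mul_sum]
  refine Finset.sum_congr rfl fun a _ => ?_
  -- Taking z_a² out of each of the n factors explains the shift of the exponent from k to k + 2n.
  have h1 : ∏ j ∈ Finset.univ.erase a, (zs a ^ 2 - zs j ^ 2)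
      = zs a ^ (2 * (n : ℤ)) * ∏ j ∈ Finset.univ.erase a, (1 - zs j ^ 2 * (zs a)⁻¹ ^ 2) := by
    have h2 : zs a ^ (2 * (n : ℤ)) = ∏ j ∈ Finset.univ.erase a, zs a ^ 2 := by
      rw [Finset.prod_const, Finset.card_erase_of_mem (Finset.mem_univ a), Finset.card_univ,
        Fintype.card_fin, Nat.add_sub_cancel, zpow_mul, zpow_natCast, zpow_ofNat]
    rw [h2, ← Finset.prod_mul_distrib]
    refine Finset.prod_congr rfl fun j _ => ?_
    have := h0 a
    field_simp
  have h3 : zs a ^ (2 * (n : ℤ)) ≠ 0 := zpow_ne_zero _ (h0 a)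
  have h4 : (Matrix.vandermonde fun a => zs a ^ 2).adjugate (Fin.last n) a *
      zs a ^ (k + 2 * (n : ℤ)) = (Matrix.vandermonde fun a => zs a ^ 2).det *
        ((∏ j ∈ Finset.univ.erase a, (1 - zs j ^ 2 * (zs a)⁻¹ ^ 2))⁻¹ * zs a ^ k) := by
    rw [adjugate_vandermonde_last h, h1, zpow_add₀ (h0 a), mul_inv]
    field_simp
  rw [← mul_assoc, ← map_mul, h4, map_mul, map_mul, mul_assoc, mul_assoc]

/-- Over the common denominator, the Vandermonde determinant of the z_a², the sum has the numerator
`resNumer`; this vanishes on every hyperplane z_j = ±z_i, so the determinant divides it. -/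
theorem exists_map_eq_resSum {Q : MvPolynomial (Fin (l + 2)) (Lau n)} (hQ : IsSkew Q)
    (hv : PairVanish Q) (k : ℤ) : ∃ R : MvPolynomial (Fin l) (Lau n),
      MvPolynomial.map (lauToK n) R = resSum z k (MvPolynomial.map (lauToK n) Q) := by
  cases n with
  | zero => exact ⟨0, (map_zero _).trans (Fintype.sum_empty _).symm⟩
  | succ n =>
    obtain ⟨R, hR⟩ := det_vandermonde_dvd fun i j hij s => map_lauUpdate_resNumer hQ hv k hij s
    refine ⟨R, ?_⟩
    have hV : (lauToK (n + 1)).mapMatrix (Matrix.vandermonde fun a : Fin (n + 1) =>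
        (LZ a : Lau (n + 1)) ^ 2) = Matrix.vandermonde fun a : Fin (n + 1) => (z a : K (n + 1)) ^ 2 := by
      ext i j
      rw [RingHom.mapMatrix_apply, Matrix.map_apply, Matrix.vandermonde_apply,
        Matrix.vandermonde_apply, map_pow, map_pow, lauToK_LZ]
    have h1 := congrArg (MvPolynomial.map (lauToK (n + 1))) hR
    rw [map_mul, MvPolynomial.map_C, RingHom.map_det, hV, resNumer, map_sum] at h1
    have h2 := sum_adjugate_eq_det_mul_resSum (zs := (z : Fin (n + 1) → K (n + 1)))
      z_sq_injective z_ne_zero k (MvPolynomial.map (lauToK (n + 1)) Q)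
    have h3 : (Matrix.vandermonde fun a : Fin (n + 1) => (z a : K (n + 1)) ^ 2).det ≠ 0 :=
      Matrix.det_vandermonde_ne_zero_iff.mpr z_sq_injective
    apply mul_left_cancel₀ ((MvPolynomial.C_ne_zero (σ := Fin l)).mpr h3)
    rw [← h1, ← h2]
    refine Finset.sum_congr rfl fun a _ => ?_
    have h4 : lauToK (n + 1) ((LZ a ^ (k + 2 * n) : (Lau (n + 1))ˣ) : Lau (n + 1))
        = z a ^ (k + 2 * (n : ℤ)) := by
      rw [← lauToK_LZ]
      exact map_units_zpow _ _ _
    rw [map_mul, map_mul, MvPolynomial.map_C, MvPolynomial.map_C, map_pairSub, h4,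
      Units.val_inv_map, lauToK_LZ, ← hV, ← RingHom.map_adjugate]
    rfl

end Laurentness

/-! ### The residue sum under homomorphisms of the coefficients -/

section Specialization

theorem C_prod_mul_C_inv_mul {A E σ ι : Type*} [CommRing A] [Field E] [Fintype ι] [DecidableEq ι]
    (g : A →+* E) {d : ι → A} (p : ι → MvPolynomial σ A) (hg : ∀ a, g (d a) ≠ 0) (a : ι) :
    MvPolynomial.C (g (∏ b, d b)) * (MvPolynomial.C (g (d a))⁻¹ * MvPolynomial.map g (p a))
      = MvPolynomial.map g (MvPolynomial.C (∏ b ∈ Finset.univ.erase a, d b) * p a) := by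
  rw [← Finset.mul_prod_erase _ _ (Finset.mem_univ a), map_mul, map_mul, map_mul,
    MvPolynomial.map_C]
  have : (MvPolynomial.C (g (d a)) * MvPolynomial.C (g (d a))⁻¹ : MvPolynomial σ E) = 1 := by
    rw [← map_mul, mul_inv_cancel₀ (hg a), map_one]
  linear_combination (MvPolynomial.C (g (∏ b ∈ Finset.univ.erase a, d b)) *
    MvPolynomial.map g (p a)) * this

/-- Clearing denominators turns the hypothesis into an identity over `A`, by injectivity of `f`. Its
image under `φ` can be divided again, as the denominators stay nonzero. -/
theorem map_eq_sum_of_injective {A F F' σ ι : Type*} [CommRing A] [Field F] [Field F']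
    {f : A →+* F} (hf : Function.Injective f) (φ : A →+* F') [Fintype ι] [DecidableEq ι]
    (d : ι → A) (p : ι → MvPolynomial σ A) (hd : ∀ a, φ (d a) ≠ 0) {R : MvPolynomial σ A}
    (h : MvPolynomial.map f R = ∑ a, MvPolynomial.C (f (d a))⁻¹ * MvPolynomial.map f (p a)) :
    MvPolynomial.map φ R = ∑ a, MvPolynomial.C (φ (d a))⁻¹ * MvPolynomial.map φ (p a) := by
  have hfd : ∀ a, f (d a) ≠ 0 := fun a h0 => hd a (by
    rw [map_eq_zero_iff f hf] at h0
    rw [h0, map_zero])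
  have h1 : MvPolynomial.C (∏ b, d b) * R
      = ∑ a, MvPolynomial.C (∏ b ∈ Finset.univ.erase a, d b) * p a := by
    apply MvPolynomial.map_injective f hf
    rw [map_mul, MvPolynomial.map_C, h, Finset.mul_sum, map_sum]
    exact Finset.sum_congr rfl fun a _ => C_prod_mul_C_inv_mul f p hfd a
  have h2 : φ (∏ b, d b) ≠ 0 := by
    rw [map_prod]
    exact Finset.prod_ne_zero_iff.mpr fun a _ => hd a
  apply mul_left_cancel₀ ((MvPolynomial.C_ne_zero (σ := σ)).mpr h2)
  have h3 := congrArg (MvPolynomial.map φ) h1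
  rw [map_mul, MvPolynomial.map_C, map_sum] at h3
  rw [h3, Finset.mul_sum]
  exact Finset.sum_congr rfl fun a _ => (C_prod_mul_C_inv_mul φ p hd a).symm

variable {n l : ℕ}

/-- The denominators in the residue sum. -/
def resD (a : Fin n) : Lau n :=
  ∏ j ∈ Finset.univ.erase a, (1 - (LZ j : Lau n) ^ 2 * ((LZ a)⁻¹ : (Lau n)ˣ).val ^ 2)

/-- The numerators in the residue sum. -/
def resN (k : ℤ) (Q : MvPolynomial (Fin (l + 2)) (Lau n)) (a : Fin n) :
    MvPolynomial (Fin l) (Lau n) :=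
  MvPolynomial.C ((LZ a ^ k : (Lau n)ˣ) : Lau n) * pairSub ((LZ a)⁻¹ : (Lau n)ˣ).val Q

theorem map_resD {F : Type*} [Field F] (φ : Lau n →+* F) (a : Fin n) :
    φ (resD a) = ∏ j ∈ Finset.univ.erase a, (1 - φ (LZ j) ^ 2 * (φ (LZ a))⁻¹ ^ 2) := by
  rw [resD, map_prod]
  refine Finset.prod_congr rfl fun j _ => ?_
  rw [map_sub, map_one, map_mul, map_pow, map_pow, Units.val_inv_map]

theorem map_resN {F : Type*} [Field F] (φ : Lau n →+* F) (k : ℤ)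
    (Q : MvPolynomial (Fin (l + 2)) (Lau n)) (a : Fin n) :
    MvPolynomial.map φ (resN k Q a)
      = MvPolynomial.C (φ (LZ a) ^ k) * pairSub (φ (LZ a))⁻¹ (MvPolynomial.map φ Q) := by
  rw [resN, map_mul, MvPolynomial.map_C, map_pairSub, Units.val_inv_map, map_units_zpow]

theorem resSum_map {F : Type*} [Field F] (φ : Lau n →+* F) (k : ℤ)
    (Q : MvPolynomial (Fin (l + 2)) (Lau n)) :
    resSum (fun j : Fin n => φ (LZ j)) k (MvPolynomial.map φ Q)
      = ∑ a, MvPolynomial.C (φ (resD a))⁻¹ * MvPolynomial.map φ (resN k Q a) := by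
  rw [resSum]
  refine Finset.sum_congr rfl fun a _ => ?_
  rw [map_resD, map_resN]

theorem map_eq_resSum {F : Type*} [Field F] (φ : Lau n →+* F)
    (hφ : Function.Injective fun a : Fin n => φ (LZ a) ^ 2) {k : ℤ} {R : MvPolynomial (Fin l) (Lau n)}
    {Q : MvPolynomial (Fin (l + 2)) (Lau n)}
    (h : MvPolynomial.map (lauToK n) R = resSum z k (MvPolynomial.map (lauToK n) Q)) :
    MvPolynomial.map φ R = resSum (fun j : Fin n => φ (LZ j)) k (MvPolynomial.map φ Q) := by
  have hz : (z : Fin n → K n) = fun j => lauToK n (LZ j) := funext fun j => (lauToK_LZ j).symm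
  rw [hz, resSum_map] at h
  rw [resSum_map]
  refine map_eq_sum_of_injective lauToK_injective φ resD (resN k Q) (fun a => ?_) h
  rw [map_resD]
  exact prod_one_sub_ne_zero (fun j => φ (LZ j)) hφ (map_LZ_ne_zero φ) a

theorem LD_of_map_eq_resSum {k : ℤ} {R : MvPolynomial (Fin l) (Lau n)}
    {Q : MvPolynomial (Fin (l + 2)) (Lau n)} (hQ : LD n (l + 2) Q)
    (h : MvPolynomial.map (lauToK n) R = resSum z k (MvPolynomial.map (lauToK n) Q)) :
    LD n l R where
  skew := isSkew_of_map lauToK_injective (by rw [h]; exact resSum_isSkew _ _ (map_isSkew _ hQ.skew))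
  deg := by
    intro s hs i
    have h1 : DegLT n (resSum z k (MvPolynomial.map (lauToK n) Q)) := DegLT.resSum _ _
      fun s hs => hQ.deg s (MvPolynomial.support_map_subset _ _ hs)
    refine h1 s ?_ i
    rw [← h]
    rw [MvPolynomial.mem_support_iff] at hs ⊢
    rw [MvPolynomial.coeff_map, Ne, map_eq_zero_iff _ lauToK_injective]
    exact hs
  symm π := by
    apply MvPolynomial.map_injective _ lauToK_injective
    have hz : (fun j => (lauToK n).comp (permLau π) (LZ j)) = (z ∘ π : Fin n → K n) := by
      funext j
      rw [RingHom.comp_apply, permLau_LZ, lauToK_LZ, Function.comp_apply]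
    -- A permutation of the variables is one more specialization; it permutes the summands and fixes
    -- `Q`.
    have h1 := map_eq_resSum ((lauToK n).comp (permLau π)) (by
      intro a b hab
      have hj := fun j => congrFun hz j
      simp only [hj] at hab
      exact π.injective (z_sq_injective hab)) h
    rw [hz, resSum_comp, ← MvPolynomial.map_map, ← MvPolynomial.map_map, hQ.symm π, ← h] at h1
    exact h1

end Specialization

/-! ### The residue sum and the link relation -/

section ResidueLink

variable {n l : ℕ}

theorem prod_erase_eq {M : Type*} [CommMonoid M] {m : ℕ} (g : Fin m → M) (a : Fin m) :
    ∏ j ∈ Finset.univ.erase a, g j = ∏ j, if j = a then 1 else g j := by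
  rw [← Finset.mul_prod_erase _ _ (Finset.mem_univ a), if_pos rfl, one_mul]
  exact Finset.prod_congr rfl fun j hj => (if_neg (Finset.ne_of_mem_erase hj)).symm

theorem prod_erase_last {M : Type*} [CommMonoid M] {m : ℕ} (g : Fin (m + 1) → M) :
    ∏ j ∈ Finset.univ.erase (Fin.last m), g j = ∏ j : Fin m, g j.castSucc := by
  rw [prod_erase_eq, Fin.prod_univ_castSucc, if_pos rfl, mul_one]
  exact Finset.prod_congr rfl fun j _ => if_neg (Fin.castSucc_lt_last j).ne

theorem prod_erase_castSucc {M : Type*} [CommMonoid M] {m : ℕ} (g : Fin (m + 1) → M) (a : Fin m) :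
    ∏ j ∈ Finset.univ.erase a.castSucc, g j
      = (∏ j ∈ Finset.univ.erase a, g j.castSucc) * g (Fin.last m) := by
  rw [prod_erase_eq, prod_erase_eq, Fin.prod_univ_castSucc, if_neg (Fin.castSucc_lt_last a).ne']
  congr 1
  exact Finset.prod_congr rfl fun j _ => by simp only [Fin.castSucc_inj]

/-- The substitution `P(X_1, …, X_l, c, -u, u)`, where `u` is the last variable. -/
def tripleSub {R : Type*} [CommRing R] {l : ℕ} (c : R) :
    MvPolynomial (Fin (l + 3)) R →ₐ[R] MvPolynomial (Fin (l + 1)) R :=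
  MvPolynomial.aeval (Fin.snoc (Fin.snoc (Fin.snoc (fun i : Fin l => MvPolynomial.X i.castSucc)
    (MvPolynomial.C c) : Fin (l + 1) → MvPolynomial (Fin (l + 1)) R)
    (-MvPolynomial.X (Fin.last l)) : Fin (l + 2) → MvPolynomial (Fin (l + 1)) R)
    (MvPolynomial.X (Fin.last l)) : Fin (l + 3) → MvPolynomial (Fin (l + 1)) R)

/-- The point `(v, a, b, c)`. -/
def snoc3 {S : Type*} (v : Fin l → S) (a b c : S) : Fin (l + 3) → S :=
  Fin.snoc (Fin.snoc (Fin.snoc v a : Fin (l + 1) → S) b : Fin (l + 2) → S) c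

theorem eval₂_tripleSub {R S : Type*} [CommRing R] [CommRing S] (ψ : R →+* S) (w : Fin (l + 1) → S)
    (c : R) (Q : MvPolynomial (Fin (l + 3)) R) :
    MvPolynomial.eval₂ ψ w (tripleSub c Q)
      = MvPolynomial.eval₂ ψ (snoc3 (fun i => w i.castSucc) (ψ c) (-w (Fin.last l))
        (w (Fin.last l))) Q := by
  rw [tripleSub, eval₂_aeval]
  congr 1
  funext i
  rw [snoc3]
  refine Fin.lastCases ?_ (fun i => ?_) i
  · rw [Fin.snoc_last, Fin.snoc_last, MvPolynomial.eval₂_X]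
  · rw [Fin.snoc_castSucc, Fin.snoc_castSucc]
    refine Fin.lastCases ?_ (fun i => ?_) i
    · rw [Fin.snoc_last, Fin.snoc_last, MvPolynomial.eval₂_neg, MvPolynomial.eval₂_X]
    · rw [Fin.snoc_castSucc, Fin.snoc_castSucc]
      refine Fin.lastCases ?_ (fun i => ?_) i
      · rw [Fin.snoc_last, Fin.snoc_last, MvPolynomial.eval₂_C]
      · rw [Fin.snoc_castSucc, Fin.snoc_castSucc, MvPolynomial.eval₂_X]

theorem IsSkewFn.snoc {B : Type*} [Field B] {m : ℕ} {f : (Fin (m + 1) → B) → B} (hf : IsSkewFn f)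
    (c : B) : IsSkewFn fun w : Fin m → B => f (Fin.snoc w c) := by
  intro σ v
  simp only
  rw [← snoc_comp_snocPerm, hf, sign_snocPerm]

theorem snoc3_swap {B : Type*} [Field B] {f : (Fin (l + 3) → B) → B} (hf : IsSkewFn f)
    (v : Fin l → B) (a b c : B) : f (snoc3 v a b c) = -f (snoc3 v b a c) :=
  snoc_snoc_swap (e := fun w => f (Fin.snoc w c : Fin (l + 3) → B)) (hf.snoc c) v a b

theorem snoc3_swap' {B : Type*} [Field B] {f : (Fin (l + 3) → B) → B} (hf : IsSkewFn f)
    (v : Fin l → B) (a b c : B) : f (snoc3 v a b c) = -f (snoc3 v a c b) :=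
  snoc_snoc_swap hf _ b c

/-- At u = ±c two of the arguments c, -u, u coincide, so the skew polynomial vanishes and is
divisible by u² - c². The quotient is kept because the denominator of the summand of z_{n+2}
degenerates under the specialization. -/
theorem tripleSub_eq_mul {R : Type} [CommRing R] [IsDomain R] (h2 : (2 : R) ≠ 0)
    {Q : MvPolynomial (Fin (l + 3)) R} (hQ : IsSkew Q) {c : R} (hc : c ≠ 0) :
    ∃ M, tripleSub c Q
      = (MvPolynomial.X (Fin.last l) ^ 2 - MvPolynomial.C (c ^ 2)) * M := by
  classical
  let ev : ℤˣ → (MvPolynomial (Fin (l + 1)) R →+* MvPolynomial (Fin (l + 1)) R) := fun s =>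
    (MvPolynomial.aeval (Function.update MvPolynomial.X (Fin.last l)
      (MvPolynomial.C (((s : ℤ) : R) * c)) : Fin (l + 1) → MvPolynomial (Fin (l + 1)) R) :
      MvPolynomial (Fin (l + 1)) R →ₐ[R] MvPolynomial (Fin (l + 1)) R)
  have h0 : ∀ s, ev s (tripleSub c Q) = 0 := by
    intro s
    refine eq_of_forall_eval₂ fun S _ ψ hψ v => ?_
    have h2' : (2 : S) ≠ 0 := by
      have := (map_ne_zero_iff ψ hψ).mpr h2
      rwa [map_ofNat] at this
    have hf := isSkewFn_eval₂ ψ hQ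
    have h1 : ∀ (v : Fin l → S) (a : S), MvPolynomial.eval₂ ψ (snoc3 v a a (-a)) Q = 0 := by
      intro v a
      have := snoc3_swap hf v a a (-a)
      have h3 : (2 : S) * MvPolynomial.eval₂ ψ (snoc3 v a a (-a)) Q = 0 := by
        linear_combination this
      exact (mul_eq_zero.mp h3).resolve_left h2'
    have h4 : MvPolynomial.eval₂ ψ v (ev s (tripleSub c Q)) = MvPolynomial.eval₂ ψ
        (Function.update v (Fin.last l) (((s : ℤ) : S) * ψ c)) (tripleSub c Q) := by
      change MvPolynomial.eval₂ ψ v (MvPolynomial.aeval _ _) = _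
      rw [eval₂_aeval]
      congr 1
      funext i
      rcases eq_or_ne i (Fin.last l) with rfl | hi
      · rw [Function.update_self, Function.update_self, MvPolynomial.eval₂_C, map_mul, map_intCast]
      · rw [Function.update_of_ne hi, Function.update_of_ne hi, MvPolynomial.eval₂_X]
    rw [h4, eval₂_tripleSub, Function.update_self, MvPolynomial.eval₂_zero]
    rcases Int.units_eq_one_or s with rfl | rfl
    · rw [Units.val_one, Int.cast_one, one_mul]
      have := snoc3_swap' hf (fun i => Function.update v (Fin.last l) (ψ c) (Fin.castSucc i)) (ψ c)
        (-ψ c) (ψ c)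
      rw [h1, neg_zero] at this
      exact this
    · rw [Units.val_neg, Units.val_one, Int.cast_neg, Int.cast_one, neg_one_mul, neg_neg]
      exact h1 _ _
  have h1 := prod_dvd_of_ker Finset.univ
    (fun s : ℤˣ => (MvPolynomial.X (Fin.last l) - MvPolynomial.C (((s : ℤ) : R) * c) :
      MvPolynomial (Fin (l + 1)) R)) (fun _ => MvPolynomial (Fin (l + 1)) R) ev
    (fun s _ p hp => X_sub_dvd_of_aeval_eq_zero hp) (fun s _ s' _ hs => by
      have h3 : ev s (MvPolynomial.X (Fin.last l) - MvPolynomial.C (((s' : ℤ) : R) * c))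
          = MvPolynomial.C (((s : ℤ) : R) * c - ((s' : ℤ) : R) * c) := by
        change MvPolynomial.aeval _ _ = _
        rw [map_sub, MvPolynomial.aeval_X, MvPolynomial.aeval_C, Function.update_self, map_sub]
        rfl
      rw [h3, MvPolynomial.C_ne_zero, ← sub_mul]
      refine mul_ne_zero ?_ hc
      rcases Int.units_eq_one_or s with rfl | rfl <;>
        rcases Int.units_eq_one_or s' with rfl | rfl
      · exact absurd rfl hs
      · simp only [Units.val_one, Units.val_neg, Int.cast_one, Int.cast_neg, sub_neg_eq_add,
          one_add_one_eq_two]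
        exact h2
      · simp only [Units.val_one, Units.val_neg, Int.cast_one, Int.cast_neg]
        rw [← neg_add', one_add_one_eq_two]
        exact neg_ne_zero.mpr h2
      · exact absurd rfl hs)
    (tripleSub c Q) (fun s _ => h0 s)
  obtain ⟨M, hM⟩ := h1
  refine ⟨M, ?_⟩
  rw [hM, UnitsInt.univ, Finset.prod_pair (by decide)]
  simp only [Units.val_one, Units.val_neg, Int.cast_one, Int.cast_neg, map_mul, map_neg, map_one,
    map_pow]
  ring

variable {S : Type} [Field S] {φ : Lau (n + 2) →+* S} {ι : Lau n →+* S} {x : S}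

theorem IsSpec.map_castSucc (h : IsSpec φ ι x) (j : Fin n) :
    φ (LZ j.castSucc.castSucc) = ι (LZ j) :=
  (congrFun h j.castSucc.castSucc).trans (by rw [addPair, Fin.snoc_castSucc, Fin.snoc_castSucc])

theorem IsSpec.map_castSucc_last (h : IsSpec φ ι x) : φ (LZ (Fin.last n).castSucc) = x :=
  (congrFun h (Fin.last n).castSucc).trans (by rw [addPair, Fin.snoc_castSucc, Fin.snoc_last])

theorem IsSpec.map_last (h : IsSpec φ ι x) : φ (LZ (Fin.last (n + 1))) = -x :=
  (congrFun h (Fin.last (n + 1))).trans (by rw [addPair, Fin.snoc_last])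

theorem IsSpec.comp (h : IsSpec φ ι x) {S' : Type} [Field S'] (ψ : S →+* S') :
    IsSpec (ψ.comp φ) (ψ.comp ι) (ψ x) := by
  funext j
  have hj : φ (LZ j) = _ := congrFun h j
  rw [RingHom.comp_apply, hj, addPair, addPair]
  refine Fin.lastCases ?_ (fun j => ?_) j
  · rw [Fin.snoc_last, Fin.snoc_last, map_neg]
  · rw [Fin.snoc_castSucc, Fin.snoc_castSucc]
    refine Fin.lastCases ?_ (fun j => ?_) j
    · rw [Fin.snoc_last, Fin.snoc_last]
    · rw [Fin.snoc_castSucc, Fin.snoc_castSucc, RingHom.comp_apply]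

/-- A specialization which agrees with the inclusion on constants. -/
def SpecConst (φ : Lau (n + 2) →+* S) (ι : Lau n →+* S) : Prop :=
  ∀ c : ℂ, φ (algebraMap ℂ _ c) = ι (algebraMap ℂ _ c)

variable {Q : MvPolynomial (Fin (l + 2)) (Lau n)} {Q' : MvPolynomial (Fin (l + 3)) (Lau (n + 2))}

/-- Moving x⁻¹ to the last place takes two transpositions, hence no sign. The arguments -u and u
contribute equal link factors, hence the square. -/
theorem SpecEq.eval₂_snoc3 (h : SpecEq n (l + 2) Q Q') (hQ' : IsSkew Q') (hs : IsSpec φ ι x)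
    (hx : x ≠ 0) (hc : SpecConst φ ι) (v : Fin l → S) (u : S) :
    MvPolynomial.eval₂ φ (snoc3 v x⁻¹ (-u) u) Q'
      = x⁻¹ ^ (n + 1) * (∏ a, (1 - v a ^ 2 * x ^ 2)) * (1 - u ^ 2 * x ^ 2) ^ 2 *
        MvPolynomial.eval₂ ι
          (Fin.snoc (Fin.snoc v (-u) : Fin (l + 1) → S) u : Fin (l + 2) → S) Q := by
  have hf := isSkewFn_eval₂ φ hQ'
  have h1 := (h.specEqOver hx hs hc).eval₂
    (Fin.snoc (Fin.snoc v (-u) : Fin (l + 1) → S) u : Fin (l + 2) → S)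
  rw [snoc3_swap hf v, snoc3_swap' hf v, neg_neg, snoc3, h1, Fin.prod_univ_castSucc,
    Fin.prod_univ_castSucc]
  simp only [Fin.snoc_last, Fin.snoc_castSucc]
  ring

theorem SpecEq.setLast_pairSub (h : SpecEq n (l + 2) Q Q') (hQ' : IsSkew Q') (hs : IsSpec φ ι x)
    (hx : x ≠ 0) (hc : SpecConst φ ι) (u : S) :
    setLast x⁻¹ (pairSub u (MvPolynomial.map φ Q')) = MvPolynomial.C ((1 - u ^ 2 * x ^ 2) ^ 2) *
      (linkFactor n l x x⁻¹ * pairSub u (MvPolynomial.map ι Q)) := by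
  refine eq_of_forall_eval₂ fun S' _ ψ _ v => ?_
  have h1 := h.eval₂_snoc3 hQ' (hs.comp ψ) ((map_ne_zero ψ).mpr hx)
    (fun c => congrArg ψ (hc c)) v (ψ u)
  rw [MvPolynomial.eval₂_mul, MvPolynomial.eval₂_mul, eval₂_linkFactor, eval₂_setLast,
    eval₂_pairSub, eval₂_pairSub, MvPolynomial.eval₂_map, MvPolynomial.eval₂_map,
    MvPolynomial.eval₂_C, map_inv₀]
  refine h1.trans ?_
  simp only [map_pow, map_sub, map_mul, map_one]
  ring

/-- After specialization the link relation gives the squared factor (1 - u²x²)², that is, double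
zeros at u = ±x⁻¹. `M` is obtained by removing u² - x⁻² only once, so it still vanishes there. -/
theorem SpecEq.setLast_quotient (h : SpecEq n (l + 2) Q Q') (hQ' : IsSkew Q') (hs : IsSpec φ ι x)
    (hx : x ≠ 0) (hc : SpecConst φ ι) {M : MvPolynomial (Fin (l + 1)) (Lau (n + 2))}
    (hM : tripleSub ((LZ (Fin.last n).castSucc)⁻¹ : (Lau (n + 2))ˣ).val Q'
      = (MvPolynomial.X (Fin.last l) ^ 2 -
        MvPolynomial.C (((LZ (Fin.last n).castSucc)⁻¹ : (Lau (n + 2))ˣ).val ^ 2)) * M) :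
    setLast (-x)⁻¹ (MvPolynomial.map φ M) = 0 := by
  let D : MvPolynomial (Fin (l + 1)) S :=
    MvPolynomial.X (Fin.last l) ^ 2 - MvPolynomial.C (x⁻¹ ^ 2)
  let N : MvPolynomial (Fin (l + 2)) S →ₐ[S] MvPolynomial (Fin (l + 1)) S := MvPolynomial.aeval
    (Fin.snoc (Fin.snoc (fun i : Fin l => MvPolynomial.X i.castSucc)
    (-MvPolynomial.X (Fin.last l)) : Fin (l + 1) → MvPolynomial (Fin (l + 1)) S)
    (MvPolynomial.X (Fin.last l)) : Fin (l + 2) → MvPolynomial (Fin (l + 1)) S)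
  have hN : ∀ {S' : Type} [Field S'] (ψ : S →+* S') (v : Fin (l + 1) → S')
      (p : MvPolynomial (Fin (l + 2)) S), MvPolynomial.eval₂ ψ v (N p) = MvPolynomial.eval₂ ψ
        (Fin.snoc (Fin.snoc (fun i => v i.castSucc) (-v (Fin.last l)) : Fin (l + 1) → S')
          (v (Fin.last l)) : Fin (l + 2) → S') p := by
    intro S' _ ψ v p
    simp only [N]
    rw [eval₂_aeval]
    congr 1
    funext i
    refine Fin.lastCases ?_ (fun i => ?_) i
    · rw [Fin.snoc_last, Fin.snoc_last, MvPolynomial.eval₂_X]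
    · rw [Fin.snoc_castSucc, Fin.snoc_castSucc]
      refine Fin.lastCases ?_ (fun i => ?_) i
      · rw [Fin.snoc_last, Fin.snoc_last, MvPolynomial.eval₂_neg, MvPolynomial.eval₂_X]
      · rw [Fin.snoc_castSucc, Fin.snoc_castSucc, MvPolynomial.eval₂_X]
  have key : D * MvPolynomial.map φ M = D * (D * (MvPolynomial.C (x⁻¹ ^ (n + 1) * x ^ 4) *
      (∏ a : Fin l, (1 - MvPolynomial.X a.castSucc ^ 2 * MvPolynomial.C (x ^ 2))) *
        N (MvPolynomial.map ι Q))) := by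
    refine eq_of_forall_eval₂ fun S' _ ψ _ v => ?_
    have hs' := hs.comp ψ
    have hx' := (map_ne_zero ψ).mpr hx
    have h1 := h.eval₂_snoc3 hQ' hs' hx'
      (fun c => congrArg ψ (hc c)) (fun i => v i.castSucc) (v (Fin.last l))
    have h2 := congrArg (MvPolynomial.eval₂ (ψ.comp φ) v) hM
    rw [eval₂_tripleSub, Units.val_inv_map, hs'.map_castSucc_last, h1, MvPolynomial.eval₂_mul,
      MvPolynomial.eval₂_sub, MvPolynomial.eval₂_pow, MvPolynomial.eval₂_X, MvPolynomial.eval₂_C,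
      map_pow, Units.val_inv_map, hs'.map_castSucc_last] at h2
    have hD : MvPolynomial.eval₂ ψ v D = v (Fin.last l) ^ 2 - (ψ x)⁻¹ ^ 2 := by
      simp only [D]
      rw [MvPolynomial.eval₂_sub, MvPolynomial.eval₂_pow, MvPolynomial.eval₂_X,
        MvPolynomial.eval₂_C, map_pow, map_inv₀]
    have hP : MvPolynomial.eval₂ ψ v
        (∏ a : Fin l, (1 - MvPolynomial.X a.castSucc ^ 2 * MvPolynomial.C (x ^ 2)))
        = ∏ a : Fin l, (1 - v a.castSucc ^ 2 * ψ x ^ 2) := by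
      rw [← MvPolynomial.coe_eval₂Hom, map_prod]
      exact Finset.prod_congr rfl fun a _ => by simp
    rw [MvPolynomial.eval₂_mul, MvPolynomial.eval₂_mul, MvPolynomial.eval₂_mul,
      MvPolynomial.eval₂_mul, MvPolynomial.eval₂_mul, hD, hP, hN, MvPolynomial.eval₂_C,
      MvPolynomial.eval₂_map, MvPolynomial.eval₂_map, ← h2]
    simp only [map_mul, map_pow, map_inv₀]
    have h3 : (1 - v (Fin.last l) ^ 2 * ψ x ^ 2) ^ 2
        = ψ x ^ 4 * (v (Fin.last l) ^ 2 - (ψ x)⁻¹ ^ 2) ^ 2 := by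
      field_simp
      ring
    rw [h3]
    ring
  have hD0 : D ≠ 0 := by
    intro h0
    have := congrArg (MvPolynomial.eval (fun _ => (0 : S))) h0
    simp [D, hx] at this
  have hDx : setLast (-x)⁻¹ D = 0 := by
    simp only [D, setLast]
    rw [map_sub, map_pow, MvPolynomial.aeval_X, Fin.snoc_last, MvPolynomial.aeval_C,
      MvPolynomial.algebraMap_eq, ← map_pow, ← map_sub, inv_neg, neg_sq, sub_self, map_zero]
  rw [mul_left_cancel₀ hD0 key, map_mul, hDx, zero_mul]

/-- Set the last variable equal to z_{n+1}⁻¹ before specializing. The summand of z_{n+1} is zero;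
that of z_{n+2} has a denominator vanishing at z_{n+2} = -z_{n+1}, which is cancelled first and
leaves a numerator that specializes to zero. In the others the squared link factor of ±z_a⁻¹ cancels
the two denominator factors of ±x. -/
theorem SpecEq.specEqOver_resSum (h : SpecEq n (l + 2) Q Q') (hQ' : IsSkew Q')
    (hs : IsSpec φ ι x) (hx : x ≠ 0) (hc : SpecConst φ ι)
    (hι : Function.Injective fun a : Fin n => ι (LZ a) ^ 2) (hι' : ∀ a : Fin n, ι (LZ a) ^ 2 ≠ x ^ 2)
    {k : ℤ} {R : MvPolynomial (Fin l) (Lau n)} {R' : MvPolynomial (Fin (l + 1)) (Lau (n + 2))}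
    (hR : MvPolynomial.map (lauToK n) R = resSum z k (MvPolynomial.map (lauToK n) Q))
    (hR' : MvPolynomial.map (lauToK (n + 2)) R'
      = resSum z k (MvPolynomial.map (lauToK (n + 2)) Q')) : SpecEqOver l φ ι x R R' := by
  classical
  let p : Fin (n + 2) := (Fin.last n).castSucc
  let r : Fin (n + 2) := Fin.last (n + 1)
  let c : Lau (n + 2) := ((LZ p)⁻¹ : (Lau (n + 2))ˣ).val
  let c' : Lau (n + 2) := ((LZ r)⁻¹ : (Lau (n + 2))ˣ).val
  have h2 : (2 : Lau (n + 2)) ≠ 0 := by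
    intro h0
    have := congrArg (lauToK (n + 2)) h0
    rw [map_ofNat, map_zero] at this
    exact two_ne_zero this
  obtain ⟨M, hM⟩ := tripleSub_eq_mul h2 hQ' (c := c) (Units.ne_zero _)
  have hcx : φ c = x⁻¹ := by rw [Units.val_inv_map, hs.map_castSucc_last]
  have hcx' : φ c' = (-x)⁻¹ := by rw [Units.val_inv_map, hs.map_last]
  -- The denominator of the summand of z_{n+2} without its factor for z_{n+1}, the one that vanishes
  -- under the specialization. The index `none` stands for this summand, `some a` for the old
  -- variables.
  let dr : Lau (n + 2) := ∏ j : Fin n, (1 - (LZ j.castSucc.castSucc : Lau (n + 2)) ^ 2 * c' ^ 2)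
  let d : Option (Fin n) → Lau (n + 2) := fun o => o.elim dr fun a => resD a.castSucc.castSucc
  let N : Option (Fin n) → MvPolynomial (Fin l) (Lau (n + 2)) := fun o => o.elim
    (MvPolynomial.C ((LZ r ^ k : (Lau (n + 2))ˣ) : Lau (n + 2)) *
      (MvPolynomial.C (-c ^ 2) * setLast c' M)) fun a => setLast c (resN k Q' a.castSucc.castSucc)
  have hpr : resD r = dr * (1 - (LZ p : Lau (n + 2)) ^ 2 * c' ^ 2) := by
    rw [resD, prod_erase_last, Fin.prod_univ_castSucc]
  -- The critical factor is also in the numerator: c'² - c² = -c²(1 - z_{n+1}²c'²), where c and c'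
  -- are the inverses of z_{n+1} and z_{n+2}.
  have hNr : setLast c (resN k Q' r)
      = MvPolynomial.C (1 - (LZ p : Lau (n + 2)) ^ 2 * c' ^ 2) * N none := by
    have h3 : setLast c (pairSub c' Q') = MvPolynomial.C (c' ^ 2 - c ^ 2) * setLast c' M := by
      have h4 : setLast c (pairSub c' Q') = setLast c' (tripleSub c Q') := by
        refine eq_of_forall_eval₂ fun S' _ ψ _ v => ?_
        rw [eval₂_setLast, eval₂_pairSub, eval₂_setLast, eval₂_tripleSub]
        simp only [Fin.snoc_last, Fin.snoc_castSucc, snoc3]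
      rw [h4, hM, map_mul, map_sub, map_pow, setLast, MvPolynomial.aeval_X, Fin.snoc_last,
        MvPolynomial.aeval_C, MvPolynomial.algebraMap_eq, map_sub, map_pow, map_pow]
    have h5 : c' ^ 2 - c ^ 2 = (1 - (LZ p : Lau (n + 2)) ^ 2 * c' ^ 2) * (-c ^ 2) := by
      have h6 : (LZ p : Lau (n + 2)) * c = 1 := Units.mul_inv _
      linear_combination (-c' ^ 2 * ((LZ p : Lau (n + 2)) * c + 1)) * h6
    have h7 : setLast c (MvPolynomial.C ((LZ r ^ k : (Lau (n + 2))ˣ) : Lau (n + 2)))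
        = (MvPolynomial.C ((LZ r ^ k : (Lau (n + 2))ˣ) : Lau (n + 2)) :
          MvPolynomial (Fin l) (Lau (n + 2))) := by
      rw [setLast, MvPolynomial.aeval_C, MvPolynomial.algebraMap_eq]
    rw [resN, map_mul, h7, h3, h5, map_mul]
    simp only [N, Option.elim]
    ring
  -- Here the arguments are c, -c, c, with a repetition.
  have hNp : setLast c (resN k Q' p) = 0 := by
    have h3 : setLast c (pairSub c Q') = 0 := by
      refine eq_of_forall_eval₂ fun S' _ ψ hψ v => ?_
      have h2' : (2 : S') ≠ 0 := by
        have := (map_ne_zero_iff ψ hψ).mpr h2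
        rwa [map_ofNat] at this
      rw [eval₂_setLast, eval₂_pairSub, MvPolynomial.eval₂_zero]
      have h4 := snoc3_swap' (isSkewFn_eval₂ ψ hQ') v (ψ c) (-ψ c) (ψ c)
      have h5 := snoc3_swap (isSkewFn_eval₂ ψ hQ') v (ψ c) (ψ c) (-ψ c)
      have h6 : (2 : S') * MvPolynomial.eval₂ ψ (snoc3 v (ψ c) (-ψ c) (ψ c)) Q' = 0 := by
        linear_combination 2 * h4 - h5
      exact (mul_eq_zero.mp h6).resolve_left h2'
    rw [resN, map_mul, h3, mul_zero]
  have hT : MvPolynomial.map (lauToK (n + 2)) (setLast c R')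
      = ∑ o, MvPolynomial.C (lauToK (n + 2) (d o))⁻¹ * MvPolynomial.map (lauToK (n + 2)) (N o) := by
    have hz : (z : Fin (n + 2) → K (n + 2)) = fun j => lauToK (n + 2) (LZ j) :=
      funext fun j => (lauToK_LZ j).symm
    have hr0 : lauToK (n + 2) (resD r) ≠ 0 := by
      rw [map_resD]
      have h3 := prod_one_sub_ne_zero (z : Fin (n + 2) → K (n + 2)) z_sq_injective z_ne_zero r
      simp only [lauToK_LZ]
      exact h3
    have hC : ∀ (y : K (n + 2)) (G : MvPolynomial (Fin (l + 1)) (K (n + 2))),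
        setLast (lauToK (n + 2) c) (MvPolynomial.C y * G)
          = MvPolynomial.C y * setLast (lauToK (n + 2) c) G := by
      intro y G
      rw [map_mul, setLast, MvPolynomial.aeval_C, MvPolynomial.algebraMap_eq]
    rw [map_setLast, hR', hz, resSum_map, map_sum, Fin.sum_univ_castSucc, Fin.sum_univ_castSucc,
      Fintype.sum_option, hC, hC, ← map_setLast, ← map_setLast]
    have e1 : MvPolynomial.map (lauToK (n + 2)) (setLast c (resN k Q' (Fin.last n).castSucc)) = 0 := by
      rw [show setLast c (resN k Q' (Fin.last n).castSucc) = 0 from hNp, map_zero]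
    have e2 : MvPolynomial.C (lauToK (n + 2) (resD r))⁻¹ *
        MvPolynomial.map (lauToK (n + 2)) (setLast c (resN k Q' r))
        = MvPolynomial.C (lauToK (n + 2) (d none))⁻¹ *
          MvPolynomial.map (lauToK (n + 2)) (N none) := by
      rw [hpr, map_mul] at hr0
      have h3 := right_ne_zero_of_mul hr0
      rw [hNr, map_mul (MvPolynomial.map _), MvPolynomial.map_C, ← mul_assoc, ← map_mul, hpr,
        map_mul (lauToK (n + 2)), mul_inv, mul_assoc (lauToK (n + 2) dr)⁻¹, inv_mul_cancel₀ h3,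
        mul_one]
      rfl
    rw [e1, mul_zero, add_zero]
    refine (add_comm _ _).trans (congrArg₂ (· + ·) e2 (Finset.sum_congr rfl fun a _ => ?_))
    rw [hC, ← map_setLast]
    rfl
  -- The variables x and -x contribute equal factors to the denominator, matching the square in
  -- `SpecEq.setLast_pairSub`.
  have hprod : ∀ a : Fin n, φ (resD a.castSucc.castSucc)
      = ι (resD a) * (1 - (ι (LZ a))⁻¹ ^ 2 * x ^ 2) ^ 2 := by
    intro a
    rw [map_resD, map_resD, prod_erase_castSucc, prod_erase_castSucc, hs.map_castSucc_last,
      hs.map_last, hs.map_castSucc]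
    simp only [hs.map_castSucc]
    ring
  have hι0 : ∀ a : Fin n, ι (resD a) ≠ 0 := fun a => by
    rw [map_resD]
    exact prod_one_sub_ne_zero (fun j : Fin n => ι (LZ j)) hι (map_LZ_ne_zero ι) a
  have h10 : ∀ a : Fin n, 1 - (ι (LZ a))⁻¹ ^ 2 * x ^ 2 ≠ 0 := by
    intro a h0
    apply hι' a
    have := map_LZ_ne_zero ι a
    field_simp at h0
    linear_combination h0
  have hd : ∀ o, φ (d o) ≠ 0 := by
    rintro (_ | a)
    · change φ dr ≠ 0
      rw [map_prod, Finset.prod_ne_zero_iff]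
      intro a _ h0
      apply hι' a
      rw [map_sub, map_one, map_mul, map_pow, map_pow, hs.map_castSucc, hcx'] at h0
      field_simp at h0
      linear_combination -h0
    · change φ (resD a.castSucc.castSucc) ≠ 0
      rw [hprod]
      exact mul_ne_zero (hι0 a) (pow_ne_zero _ (h10 a))
  have hfin := map_eq_sum_of_injective lauToK_injective φ d N hd hT
  have hM' : setLast (-x)⁻¹ (MvPolynomial.map φ M) = 0 := h.setLast_quotient hQ' hs hx hc hM
  have hnone : MvPolynomial.map φ (N none) = 0 := by
    simp only [N, Option.elim]
    rw [map_mul, map_mul, map_setLast, hcx', hM', mul_zero, mul_zero]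
  rw [Fintype.sum_option, hnone, mul_zero, zero_add, map_setLast, hcx] at hfin
  rw [SpecEqOver, hfin, map_eq_resSum ι hι hR, resSum_map, Finset.mul_sum]
  refine Finset.sum_congr rfl fun a _ => ?_
  have h11 : MvPolynomial.map φ (setLast c (resN k Q' a.castSucc.castSucc))
      = MvPolynomial.C ((1 - (ι (LZ a))⁻¹ ^ 2 * x ^ 2) ^ 2) *
        (linkFactor n l x x⁻¹ * MvPolynomial.map ι (resN k Q a)) := by
    rw [map_setLast, hcx, map_resN, hs.map_castSucc, map_mul, h.setLast_pairSub hQ' hs hx hc,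
      setLast, MvPolynomial.aeval_C, MvPolynomial.algebraMap_eq, map_resN]
    ring
  change MvPolynomial.C (φ (resD a.castSucc.castSucc))⁻¹ *
    MvPolynomial.map φ (setLast c (resN k Q' a.castSucc.castSucc)) = _
  rw [h11, hprod, ← mul_assoc, ← map_mul, mul_inv, mul_assoc (ι (resD a))⁻¹,
    inv_mul_cancel₀ (pow_ne_zero 2 (h10 a)), mul_one]
  ring

theorem SpecEq.resSum (h : SpecEq n (l + 2) Q Q') (hQ' : IsSkew Q') {k : ℤ}
    {R : MvPolynomial (Fin l) (Lau n)} {R' : MvPolynomial (Fin (l + 1)) (Lau (n + 2))}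
    (hR : MvPolynomial.map (lauToK n) R = resSum z k (MvPolynomial.map (lauToK n) Q))
    (hR' : MvPolynomial.map (lauToK (n + 2)) R'
      = LoopSl2.resSum z k (MvPolynomial.map (lauToK (n + 2)) Q')) : SpecEq n l R R' := by
  have hz : ∀ a : Fin n, (RatFunc.C.comp (lauToK n)) (LZ a) ^ 2 = RatFunc.C (z a ^ 2) := by
    intro a
    rw [RingHom.comp_apply, lauToK_LZ, map_pow]
  refine h.specEqOver_resSum hQ' (isSpec_spec n) RatFunc.X_ne_zero
    (fun c => by rw [spec_C, RingHom.comp_apply, lauToK_C]) (fun a b hab => ?_) (fun a h0 => ?_)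
    hR hR'
  · simp only [hz] at hab
    exact z_sq_injective (RatFunc.C.injective hab)
  · apply one_sub_C_sq_mul_X_sq_ne_zero (z a : K n)⁻¹
    rw [← h0, hz, ← map_pow, ← map_mul, ← mul_pow, inv_mul_cancel₀ (z_ne_zero a), one_pow, map_one,
      sub_self]

end ResidueLink

/-! ### Linear combinations of links, and links for the divided square of x⁺ -/

section LinkAlgebra

variable {n l : ℕ}

theorem DegLT.add' {R : Type*} [CommRing R] {Q Q₂ : MvPolynomial (Fin l) R} (h : DegLT n Q)
    (h₂ : DegLT n Q₂) : DegLT n (Q + Q₂) :=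
  degIn_of_forall_aeval.mpr fun i =>
    (degIn_of_forall_aeval.mp h i).add (degIn_of_forall_aeval.mp h₂ i)

theorem IsSkew.add' {R : Type*} [CommRing R] {Q Q₂ : MvPolynomial (Fin l) R} (h : IsSkew Q)
    (h₂ : IsSkew Q₂) : IsSkew (Q + Q₂) := fun σ => by rw [map_add, h σ, h₂ σ, smul_add]

theorem IsSkew.C_mul {R : Type*} [CommRing R] {Q : MvPolynomial (Fin l) R} (h : IsSkew Q) (c : R) :
    IsSkew (MvPolynomial.C c * Q) := fun σ => by
  rw [map_mul, h σ, MvPolynomial.rename_C, mul_smul_comm]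

theorem DegLT.C_mul {R : Type*} [CommRing R] {Q : MvPolynomial (Fin l) R} (h : DegLT n Q) (c : R) :
    DegLT n (MvPolynomial.C c * Q) := fun s hs i => by
  refine h s ?_ i
  rw [MvPolynomial.mem_support_iff, MvPolynomial.coeff_C_mul] at hs
  exact MvPolynomial.mem_support_iff.mpr (right_ne_zero_of_mul hs)

theorem LD.add {Q Q₂ : MvPolynomial (Fin l) (Lau n)} (h : LD n l Q) (h₂ : LD n l Q₂) :
    LD n l (Q + Q₂) where
  skew := h.skew.add' h₂.skew
  deg := h.deg.add' h₂.deg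
  symm π := by rw [map_add, h.symm π, h₂.symm π]

theorem LD.C_mul {Q : MvPolynomial (Fin l) (Lau n)} (h : LD n l Q) (c : ℂ) :
    LD n l (MvPolynomial.C (algebraMap ℂ (Lau n) c) * Q) where
  skew := h.skew.C_mul _
  deg := h.deg.C_mul _
  symm π := by rw [map_mul, h.symm π, MvPolynomial.map_C, permLau_C]

theorem SpecEq.add {Q Q₂ : MvPolynomial (Fin l) (Lau n)}
    {Q' Q₂' : MvPolynomial (Fin (l + 1)) (Lau (n + 2))} (h : SpecEq n l Q Q')
    (h₂ : SpecEq n l Q₂ Q₂') : SpecEq n l (Q + Q₂) (Q' + Q₂') := by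
  rw [SpecEq, SpecEqOver, map_add, map_add, map_add, mul_add]
  exact congrArg₂ (· + ·) h h₂

theorem SpecEqOver.C_mul {S : Type} [Field S] {φ : Lau (n + 2) →+* S} {ι : Lau n →+* S} {x : S}
    {Q : MvPolynomial (Fin l) (Lau n)} {Q' : MvPolynomial (Fin (l + 1)) (Lau (n + 2))}
    (h : SpecEqOver l φ ι x Q Q') (hc : SpecConst φ ι) (c : ℂ) :
    SpecEqOver l φ ι x (MvPolynomial.C (algebraMap ℂ (Lau n) c) * Q)
      (MvPolynomial.C (algebraMap ℂ (Lau (n + 2)) c) * Q') := by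
  rw [SpecEqOver] at h ⊢
  rw [map_mul, map_mul, map_mul, h, MvPolynomial.map_C, MvPolynomial.map_C, hc c, setLast,
    MvPolynomial.aeval_C, MvPolynomial.algebraMap_eq]
  ring

theorem specConst_spec (n : ℕ) : SpecConst (spec n) (RatFunc.C.comp (lauToK n)) :=
  fun c => by rw [spec_C, RingHom.comp_apply, lauToK_C]

theorem smul_eq_C_mul' {R : Type*} [CommRing R] [Algebra ℂ R] {σ : Type*} (c : ℂ)
    (P : MvPolynomial σ R) : c • P = MvPolynomial.C (algebraMap ℂ R c) * P := by
  rw [← MvPolynomial.smul_eq_C_mul, algebraMap_smul]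

theorem map_C_mul_lauToK (c : ℂ) (Q : MvPolynomial (Fin l) (Lau n)) :
    MvPolynomial.map (lauToK n) (MvPolynomial.C (algebraMap ℂ (Lau n) c) * Q)
      = MvPolynomial.C (algebraMap ℂ (K n) c) * MvPolynomial.map (lauToK n) Q := by
  rw [map_mul, MvPolynomial.map_C, lauToK_C]

theorem IsDeformedCycle.add {P P₂ : MvPolynomial (Fin l) (K n)} (h : IsDeformedCycle n l P)
    (h₂ : IsDeformedCycle n l P₂) : IsDeformedCycle n l (P + P₂) := by
  obtain ⟨Q, rfl, hQ⟩ := isDeformedCycle_iff.mp h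
  obtain ⟨Q₂, rfl, hQ₂⟩ := isDeformedCycle_iff.mp h₂
  exact isDeformedCycle_iff.mpr ⟨_, map_add _ _ _, hQ.add hQ₂⟩

theorem IsDeformedCycle.C_mul {P : MvPolynomial (Fin l) (K n)} (h : IsDeformedCycle n l P) (c : ℂ) :
    IsDeformedCycle n l (MvPolynomial.C (algebraMap ℂ (K n) c) * P) := by
  obtain ⟨Q, rfl, hQ⟩ := isDeformedCycle_iff.mp h
  exact isDeformedCycle_iff.mpr ⟨_, map_C_mul_lauToK c Q, hQ.C_mul c⟩

theorem isDeformedCycle_zero : IsDeformedCycle n l 0 :=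
  isDeformedCycle_iff.mpr ⟨0, map_zero _, LD_zero⟩

variable {P P₂ : MvPolynomial (Fin l) (K n)} {P' P₂' : MvPolynomial (Fin (l + 1)) (K (n + 2))}

theorem IsLink.add (h : IsLink n l P P') (h₂ : IsLink n l P₂ P₂') :
    IsLink n l (P + P₂) (P' + P₂') := by
  obtain ⟨Q, Q', rfl, rfl, hQ, hQ', hs⟩ := isLink_iff.mp h
  obtain ⟨Q₂, Q₂', rfl, rfl, hQ₂, hQ₂', hs₂⟩ := isLink_iff.mp h₂
  exact isLink_iff.mpr ⟨_, _, map_add _ _ _, map_add _ _ _, hQ.add hQ₂, hQ'.add hQ₂', hs.add hs₂⟩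

theorem IsLink.C_mul (h : IsLink n l P P') (c : ℂ) :
    IsLink n l (MvPolynomial.C (algebraMap ℂ (K n) c) * P)
      (MvPolynomial.C (algebraMap ℂ (K (n + 2)) c) * P') := by
  obtain ⟨Q, Q', rfl, rfl, hQ, hQ', hs⟩ := isLink_iff.mp h
  exact isLink_iff.mpr ⟨_, _, map_C_mul_lauToK c Q, map_C_mul_lauToK c Q', hQ.C_mul c, hQ'.C_mul c,
    SpecEqOver.C_mul hs (specConst_spec n) c⟩

theorem isLink_zero : IsLink n l 0 0 := by
  refine isLink_iff.mpr ⟨0, 0, map_zero _, map_zero _, LD_zero, LD_zero, ?_⟩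
  rw [SpecEq, SpecEqOver, map_zero, map_zero, map_zero, mul_zero]

theorem coeffT_formXp2_eq (e : Side) (k : ℤ) (P : MvPolynomial (Fin (l + 2)) (K n)) :
    coeffT n l e k (formXp2 (zB n l) (tB n l e) (X n l) P)
      = MvPolynomial.C (algebraMap ℂ (K n) ((geomSign e k : ℂ) * (-2)⁻¹)) * resSum z k P := by
  have h : algebraMap ℂ (K n) ((geomSign e k : ℂ) * (-2)⁻¹) = (geomSign e k : K n) * (-2)⁻¹ := by
    rw [map_mul, map_inv₀, map_neg, map_ofNat, map_intCast]
  rw [coeffT_formXp2, h]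

theorem isLink_formXp2 {P : MvPolynomial (Fin (l + 2)) (K n)}
    {P' : MvPolynomial (Fin (l + 3)) (K (n + 2))} (h : IsLink n (l + 2) P P') (e : Side) (k : ℤ) :
    IsLink n l (coeffT n l e k (formXp2 (zB n l) (tB n l e) (X n l) P))
      (coeffT (n + 2) (l + 1) e k
        (formXp2 (zB (n + 2) (l + 1)) (tB (n + 2) (l + 1) e) (X (n + 2) (l + 1)) P')) := by
  obtain ⟨Q, Q', rfl, rfl, hQ, hQ', hs⟩ := isLink_iff.mp h
  obtain ⟨R, hR⟩ := exists_map_eq_resSum hQ.skew (hs.pairVanish_left hQ') k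
  obtain ⟨R', hR'⟩ := exists_map_eq_resSum hQ'.skew (SpecEq.pairVanish_right hs hQ'.symm) k
  rw [coeffT_formXp2_eq, coeffT_formXp2_eq, ← hR, ← hR']
  exact IsLink.C_mul (isLink_iff.mpr ⟨R, R', rfl, rfl, LD_of_map_eq_resSum hQ hR,
    LD_of_map_eq_resSum hQ' hR', hs.resSum hQ'.skew hR hR'⟩) _

/-- Serves the bottom component for n + 2, whose image has no partner. Its Laurent coefficients
still depend on `P'` belonging to a link. -/
theorem isDeformedCycle_formXp2 {P : MvPolynomial (Fin (l + 1)) (K n)}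
    {P' : MvPolynomial (Fin (l + 2)) (K (n + 2))} (h : IsLink n (l + 1) P P') (e : Side) (k : ℤ) :
    IsDeformedCycle (n + 2) l (coeffT (n + 2) l e k
      (formXp2 (zB (n + 2) l) (tB (n + 2) l e) (X (n + 2) l) P')) := by
  obtain ⟨Q, Q', rfl, rfl, hQ, hQ', hs⟩ := isLink_iff.mp h
  obtain ⟨R', hR'⟩ := exists_map_eq_resSum hQ'.skew (hs.pairVanish_right hQ'.symm) k
  rw [coeffT_formXp2_eq, ← hR']
  exact (isDeformedCycle_iff.mpr ⟨R', rfl, LD_of_map_eq_resSum hQ' hR'⟩).C_mul _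

end LinkAlgebra

/-! ### Generators and noncommutative polynomials acting on linked pairs -/

section LinkPairs

variable {n l : ℕ}

theorem IsLink.smul {P : MvPolynomial (Fin l) (K n)} {P' : MvPolynomial (Fin (l + 1)) (K (n + 2))}
    (h : IsLink n l P P') {a : K n} {b : K (n + 2)} (c : ℂ) (ha : a = algebraMap ℂ (K n) c)
    (hb : b = algebraMap ℂ (K (n + 2)) c) : IsLink n l (a • P) (b • P') := by
  rw [MvPolynomial.smul_eq_C_mul, MvPolynomial.smul_eq_C_mul, ha, hb]
  exact h.C_mul c

theorem IsDeformedCycle.smul {P : MvPolynomial (Fin l) (K n)} (h : IsDeformedCycle n l P) {a : K n}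
    (c : ℂ) (ha : a = algebraMap ℂ (K n) c) : IsDeformedCycle n l (a • P) := by
  rw [MvPolynomial.smul_eq_C_mul, ha]
  exact h.C_mul c

theorem iK_zpow (n : ℕ) (m : ℤ) : iK n ^ m = algebraMap ℂ (K n) (Complex.I ^ m) := by
  rw [iK, map_zpow₀]

theorem op_t (s : ℤˣ) (P : V n) (l : ℕ) : UGen.op n (.t s) P l
    = iK n ^ ((s : ℤ) * ((n : ℤ) - 2 * (l : ℤ))) • P l := rfl

theorem op_a_pos {m : ℤ} (hm : m ≠ 0) (h : 0 < m) (P : V n) (l : ℕ) :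
    UGen.op n (.a m hm) P l = opCoeff Side.zero m (fun _ _ => gAp) (P l) := by
  rw [opCoeff, ← formAp_apply]
  change (if 0 < m then _ else _ : MvPolynomial (Fin l) (K n) →ₗ[K n] _) (P l) = _
  rw [if_pos h]
  rfl

theorem op_a_neg {m : ℤ} (hm : m ≠ 0) (h : ¬0 < m) (P : V n) (l : ℕ) :
    UGen.op n (.a m hm) P l = opCoeff Side.inf m (fun _ _ => gAm) (P l) := by
  rw [opCoeff, ← formAm_apply]
  change (if 0 < m then _ else _ : MvPolynomial (Fin l) (K n) →ₗ[K n] _) (P l) = _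
  rw [if_neg h]
  rfl

theorem op_xp (k : ℤ) (P : V n) (l : ℕ) : UGen.op n (.x 1 k) P l
    = ((sideSign (sideOf 1 k) : K n) * iK n ^ k * (iK n ^ (1 - (n : ℤ)))⁻¹) •
      opCoeff (sideOf 1 k) k (fun _ _ => gXp) (P (l + 1)) := by
  rw [opCoeff, ← formXp_apply, UGen.op]
  simp only [if_true]
  rfl

theorem neg_one_ne_one_unit : (-1 : ℤˣ) ≠ 1 := by decide

theorem op_xm_succ (k : ℤ) (P : V n) (l : ℕ) : UGen.op n (.x (-1) k) P (l + 1)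
    = ((sideSign (sideOf (-1) k) : K n) * iK n ^ k) •
      opCoeff (sideOf (-1) k) k (fun _ _ => gXm) (P l) := by
  rw [opCoeff, ← formXm_apply, UGen.op]
  simp only [if_neg neg_one_ne_one_unit]
  rfl

theorem op_xm_zero (k : ℤ) (P : V n) : UGen.op n (.x (-1) k) P 0 = 0 := by
  rw [UGen.op]
  simp only [if_neg neg_one_ne_one_unit]
  change ((sideSign (sideOf (-1) k) : K n) * iK n ^ k) • (0 : MvPolynomial (Fin 0) (K n)) = 0
  exact smul_zero _

theorem op_xxp (e : Side) (N : ℤ) (P : V n) (l : ℕ) : UGen.op n (.xx 1 e N) P l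
    = (iK n ^ N * (iK n * (-1) ^ (n + 1))⁻¹) •
      coeffT n l e N (formXp2 (zB n l) (tB n l e) (X n l) (P (l + 2))) := by
  rw [UGen.op]
  simp only [if_true]
  rfl

theorem op_xxm_add_two (e : Side) (N : ℤ) (P : V n) (l : ℕ) : UGen.op n (.xx (-1) e N) P (l + 2)
    = (iK n ^ N * (-4 * iK n)⁻¹) • opCoeff e N (fun _ _ => gXm2) (P l) := by
  rw [opCoeff, ← formXm2_apply, UGen.op]
  simp only [if_neg neg_one_ne_one_unit]
  rfl

theorem op_xxm_zero (e : Side) (N : ℤ) (P : V n) : UGen.op n (.xx (-1) e N) P 0 = 0 := by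
  rw [UGen.op]
  simp only [if_neg neg_one_ne_one_unit]
  change (iK n ^ N * (-4 * iK n)⁻¹) • (0 : MvPolynomial (Fin 0) (K n)) = 0
  exact smul_zero _

theorem op_xxm_one (e : Side) (N : ℤ) (P : V n) : UGen.op n (.xx (-1) e N) P 1 = 0 := by
  rw [UGen.op]
  simp only [if_neg neg_one_ne_one_unit]
  change (iK n ^ N * (-4 * iK n)⁻¹) • (0 : MvPolynomial (Fin 1) (K n)) = 0
  exact smul_zero _

theorem IsLinkPair.right {P : V n} {P' : V (n + 2)} (h : IsLinkPair n P P') (l : ℕ) :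
    IsDeformedCycle (n + 2) l (P' l) := by
  cases l with
  | zero => exact h.1
  | succ l => exact (h.2 l).2.1

theorem IsLinkPair.op_t {P : V n} {P' : V (n + 2)} (h : IsLinkPair n P P') (s : ℤˣ) :
    IsLinkPair n (UGen.op n (.t s) P) (UGen.op (n + 2) (.t s) P') := by
  refine ⟨h.1.smul _ (iK_zpow _ _), fun l => ?_⟩
  rw [LoopSl2.op_t, LoopSl2.op_t]
  refine (h.2 l).smul _ (iK_zpow _ _) ?_
  rw [iK_zpow]
  -- The weight n - 2l is the same for (n, l) and (n + 2, l + 1).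
  congr 3
  push_cast
  ring

theorem IsLinkPair.op_a {P : V n} {P' : V (n + 2)} (h : IsLinkPair n P P') {m : ℤ} (hm : m ≠ 0) :
    IsLinkPair n (UGen.op n (.a m hm) P) (UGen.op (n + 2) (.a m hm) P') := by
  by_cases h0 : 0 < m
  · refine ⟨?_, fun l => ?_⟩
    · rw [op_a_pos hm h0]
      exact isOperatorFormula_gAp.isDeformedCycle h.1 m
    · rw [op_a_pos hm h0, op_a_pos hm h0]
      exact isLink_opCoeff_gAp (h.2 l) m
  · refine ⟨?_, fun l => ?_⟩
    · rw [op_a_neg hm h0]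
      exact isOperatorFormula_gAm.isDeformedCycle h.1 m
    · rw [op_a_neg hm h0, op_a_neg hm h0]
      exact isLink_opCoeff_gAm (h.2 l) m

theorem sideSign_mul_iK_zpow (n : ℕ) (e : Side) (k : ℤ) : (sideSign e : K n) * iK n ^ k
    = algebraMap ℂ (K n) ((sideSign e : ℂ) * Complex.I ^ k) := by
  rw [map_mul, map_intCast, iK_zpow]

theorem IsLinkPair.op_xp {P : V n} {P' : V (n + 2)} (h : IsLinkPair n P P') (k : ℤ) :
    IsLinkPair n (UGen.op n (.x 1 k) P) (UGen.op (n + 2) (.x 1 k) P') := by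
  have hc : ∀ m : ℕ, (sideSign (sideOf 1 k) : K m) * iK m ^ k * (iK m ^ (1 - (m : ℤ)))⁻¹
      = algebraMap ℂ (K m) ((sideSign (sideOf 1 k) : ℂ) * Complex.I ^ k *
        (Complex.I ^ (1 - (m : ℤ)))⁻¹) := by
    intro m
    rw [sideSign_mul_iK_zpow, iK_zpow, ← map_inv₀, ← map_mul]
  refine ⟨?_, fun l => ?_⟩
  · rw [LoopSl2.op_xp]
    have h1 := (isOperatorFormula_gXp (n := n + 2) (l := 0) (e := sideOf 1 k)).isDeformedCycle
      (P := P' (0 + 1)) (h.right (0 + 1)) k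
    exact h1.smul _ (hc (n + 2))
  -- Passing from n to n + 2 changes the sign of i^{1-n}, which compensates the sign in
  -- `isLink_opCoeff_gXp`.
  · have h2 : Complex.I ^ (1 - ((n + 2 : ℕ) : ℤ)) = -Complex.I ^ (1 - (n : ℤ)) := by
      have h3 : (1 - ((n + 2 : ℕ) : ℤ)) = (1 - (n : ℤ)) + (-2) := by
        push_cast
        ring
      rw [h3, zpow_add₀ Complex.I_ne_zero, zpow_neg, zpow_ofNat, Complex.I_sq, inv_neg, inv_one,
        mul_neg, mul_one]
    have h4 := hc (n + 2)
    rw [h2, inv_neg, mul_neg, map_neg] at h4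
    have h1 := (isLink_opCoeff_gXp (e := sideOf 1 k) (h.2 (l + 1)) k).smul _ (hc n)
      (neg_eq_iff_eq_neg.mpr h4)
    rw [neg_smul_neg] at h1
    rw [LoopSl2.op_xp, LoopSl2.op_xp]
    exact h1

theorem IsLinkPair.op_xm {P : V n} {P' : V (n + 2)} (h : IsLinkPair n P P') (k : ℤ) :
    IsLinkPair n (UGen.op n (.x (-1) k) P) (UGen.op (n + 2) (.x (-1) k) P') := by
  refine ⟨?_, fun l => ?_⟩
  · rw [op_xm_zero]
    exact isDeformedCycle_zero
  · cases l with
    | zero =>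
      have h1 := (isLink_opCoeff_gXm_zero (e := sideOf (-1) k) h.1 k).smul _
        (sideSign_mul_iK_zpow n (sideOf (-1) k) k) (sideSign_mul_iK_zpow (n + 2) _ k)
      rw [smul_zero] at h1
      rw [op_xm_zero, op_xm_succ]
      exact h1
    | succ l =>
      rw [op_xm_succ, op_xm_succ]
      exact (isLink_opCoeff_gXm (h.2 l) k).smul _ (sideSign_mul_iK_zpow _ _ _)
        (sideSign_mul_iK_zpow _ _ _)

theorem IsLinkPair.op_xxp {P : V n} {P' : V (n + 2)} (h : IsLinkPair n P P') (e : Side) (N : ℤ) :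
    IsLinkPair n (UGen.op n (.xx 1 e N) P) (UGen.op (n + 2) (.xx 1 e N) P') := by
  have hc : ∀ m : ℕ, iK m ^ N * (iK m * (-1) ^ (m + 1))⁻¹
      = algebraMap ℂ (K m) (Complex.I ^ N * (Complex.I * (-1) ^ (m + 1))⁻¹) := by
    intro m
    rw [iK_zpow, map_mul, map_inv₀, map_mul, map_pow, map_neg, map_one]
    rfl
  refine ⟨?_, fun l => ?_⟩
  · rw [LoopSl2.op_xxp]
    exact (isDeformedCycle_formXp2 (h.2 1) e N).smul _ (hc _)
  · rw [LoopSl2.op_xxp, LoopSl2.op_xxp]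
    refine (isLink_formXp2 (h.2 (l + 2)) e N).smul _ (hc n) ?_
    rw [hc]
    congr 4
    rw [show n + 2 + 1 = n + 1 + 2 by ring, pow_add _ _ 2, neg_one_sq, mul_one]

theorem IsLinkPair.op_xxm {P : V n} {P' : V (n + 2)} (h : IsLinkPair n P P') (e : Side) (N : ℤ) :
    IsLinkPair n (UGen.op n (.xx (-1) e N) P) (UGen.op (n + 2) (.xx (-1) e N) P') := by
  have hc : ∀ m : ℕ, iK m ^ N * (-4 * iK m)⁻¹
      = algebraMap ℂ (K m) (Complex.I ^ N * (-4 * Complex.I)⁻¹) := by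
    intro m
    rw [iK_zpow, map_mul, map_inv₀, map_mul, map_neg, map_ofNat]
    rfl
  refine ⟨?_, fun l => ?_⟩
  · rw [op_xxm_zero]
    exact isDeformedCycle_zero
  · match l with
    | 0 =>
      rw [op_xxm_zero, op_xxm_one]
      exact isLink_zero
    | 1 =>
      have h1 := (isLink_opCoeff_gXm2_zero (e := e) h.1 N).smul _ (hc n) (hc (n + 2))
      rw [smul_zero] at h1
      rw [op_xxm_one, op_xxm_add_two]
      exact h1
    | l + 2 =>
      rw [op_xxm_add_two, op_xxm_add_two]
      exact (isLink_opCoeff_gXm2 (h.2 l) N).smul _ (hc _) (hc _)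

theorem IsLinkPair.op_gen {P : V n} {P' : V (n + 2)} (h : IsLinkPair n P P') (γ : UGen) :
    IsLinkPair n (UGen.op n γ P) (UGen.op (n + 2) γ P') := by
  match γ with
  | .t s => exact h.op_t s
  | .a m hm => exact h.op_a hm
  | .x s k =>
    rcases Int.units_eq_one_or s with rfl | rfl
    · exact h.op_xp k
    · exact h.op_xm k
  | .xx s e N =>
    rcases Int.units_eq_one_or s with rfl | rfl
    · exact h.op_xxp e N
    · exact h.op_xxm e N

theorem IsLinkPair.add {P P₂ : V n} {P' P₂' : V (n + 2)} (h : IsLinkPair n P P')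
    (h₂ : IsLinkPair n P₂ P₂') : IsLinkPair n (P + P₂) (P' + P₂') :=
  ⟨h.1.add h₂.1, fun l => (h.2 l).add (h₂.2 l)⟩

theorem IsLinkPair.smul {P : V n} {P' : V (n + 2)} (h : IsLinkPair n P P') (c : ℂ) :
    IsLinkPair n (c • P) (c • P') := by
  refine ⟨?_, fun l => ?_⟩
  · rw [Pi.smul_apply, smul_eq_C_mul']
    exact h.1.C_mul c
  · rw [Pi.smul_apply, Pi.smul_apply, smul_eq_C_mul', smul_eq_C_mul']
    exact (h.2 l).C_mul c

theorem IsLinkPair.op (f : Expr) : ∀ {P : V n} {P' : V (n + 2)}, IsLinkPair n P P' →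
    IsLinkPair n (Expr.op n f P) (Expr.op (n + 2) f P') := by
  induction f using FreeAlgebra.induction with
  | grade0 c =>
    intro P P' h
    rw [AlgHom.commutes, AlgHom.commutes, Module.algebraMap_end_apply, Module.algebraMap_end_apply]
    exact h.smul c
  | grade1 γ =>
    intro P P' h
    rw [Expr.op, Expr.op, FreeAlgebra.lift_ι_apply, FreeAlgebra.lift_ι_apply]
    exact h.op_gen γ
  | mul a b ha hb =>
    intro P P' h
    rw [map_mul, map_mul]
    exact ha (hb h)
  | add a b ha hb =>
    intro P P' h
    rw [map_add, map_add]
    exact (ha h).add (hb h)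

/-- All other components are zero, and zero is linked with zero. Passing to pairs of full vectors
makes the property stable under operators that mix the numbers of variables. -/
theorem isLinkPair_of_pure {P : V n} {P' : V (n + 2)} (hP : Pure l P) (hP' : Pure (l + 1) P')
    (h : IsLink n l (P l) (P' (l + 1))) : IsLinkPair n P P' := by
  refine ⟨?_, fun m => ?_⟩
  · rw [hP' 0 (Nat.succ_ne_zero l).symm]
    exact isDeformedCycle_zero
  · rcases eq_or_ne m l with rfl | hm
    · exact h
    · rw [hP m hm, hP' (m + 1) fun h => hm (Nat.succ_injective h)]
      exact isLink_zero

end LinkPairs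

/-! ### The action on ∞-cycles -/

section InfinityCycles

/-- The component of weight `m`. -/
def IsWeight (m : ℤ) (p : (n : ℕ) → V n) : Prop :=
  ∀ n l : ℕ, (n : ℤ) - 2 * (l : ℤ) ≠ m → p n l = 0

/-- Pairs off the diagonal n - 2l = m consist of zeros, so the links may be demanded for all l at
once and the results on pairs apply. -/
theorem isInfCycle_iff {m : ℤ} {p : (n : ℕ) → V n} : IsInfCycle m p ↔
    IsWeight m p ∧ ∀ n, IsLinkPair n (p n) (p (n + 2)) := by
  constructor
  · intro h
    have h0 : ∀ n l, IsDeformedCycle n l (p n l) := by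
      intro n l
      by_cases hm : (n : ℤ) - 2 * (l : ℤ) = m
      · exact ((h n l).2 hm).1
      · rw [(h n l).1 hm]
        exact isDeformedCycle_zero
    refine ⟨fun n l => (h n l).1, fun n => ⟨h0 _ _, fun l => ?_⟩⟩
    by_cases hm : (n : ℤ) - 2 * (l : ℤ) = m
    · exact ((h n l).2 hm).2
    · rw [(h n l).1 hm, (h (n + 2) (l + 1)).1 (by push_cast; omega)]
      exact isLink_zero
  · rintro ⟨h, h'⟩ n l
    exact ⟨h n l, fun _ => ⟨((h' n).2 l).1, (h' n).2 l⟩⟩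

/-- The weight by which a generator shifts. -/
def UGen.shift : UGen → ℤ
  | .t _ => 0
  | .a _ _ => 0
  | .x s _ => 2 * s
  | .xx s _ _ => 4 * s

theorem IsWeight.op_gen {m : ℤ} {p : (n : ℕ) → V n} (h : IsWeight m p) (γ : UGen) :
    IsWeight (m + γ.shift) fun n => UGen.op n γ (p n) := by
  intro n l hm
  simp only
  match γ with
  | .t s =>
    rw [op_t, h n l (by simpa [UGen.shift] using hm), smul_zero]
  | .a k hk =>
    have h0 := h n l (by simpa [UGen.shift] using hm)
    by_cases hk' : 0 < k
    · rw [op_a_pos hk hk', h0, opCoeff, ← formAp_apply, map_zero, map_zero]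
    · rw [op_a_neg hk hk', h0, opCoeff, ← formAm_apply, map_zero, map_zero]
  | .x s k =>
    rcases Int.units_eq_one_or s with rfl | rfl
    · rw [op_xp, h n (l + 1) (by simp [UGen.shift] at hm; push_cast; omega), opCoeff,
        ← formXp_apply, map_zero, map_zero, smul_zero]
    · cases l with
      | zero => exact op_xm_zero k _
      | succ l =>
        rw [op_xm_succ, h n l (by simp [UGen.shift] at hm; omega), opCoeff,
          ← formXm_apply, map_zero, map_zero, smul_zero]
  | .xx s e N =>
    rcases Int.units_eq_one_or s with rfl | rfl
    · rw [op_xxp, h n (l + 2) (by simp [UGen.shift] at hm; push_cast; omega), map_zero, map_zero,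
        smul_zero]
    · match l with
      | 0 => exact op_xxm_zero e N _
      | 1 => exact op_xxm_one e N _
      | l + 2 =>
        rw [op_xxm_add_two, h n l (by simp [UGen.shift] at hm; omega), opCoeff, ← formXm2_apply,
          map_zero, map_zero, smul_zero]

/-- The componentwise action of noncommutative polynomials. -/
def opAll : Expr →ₐ[ℂ] Module.End ℂ ((n : ℕ) → V n) :=
  FreeAlgebra.lift ℂ fun γ => LinearMap.pi fun n =>
    (UGen.op n γ).restrictScalars ℂ ∘ₗ LinearMap.proj n

theorem opAll_apply (f : Expr) : ∀ (p : (n : ℕ) → V n) (n : ℕ), opAll f p n = Expr.op n f (p n) := by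
  induction f using FreeAlgebra.induction with
  | grade0 c =>
    intro p n
    rw [AlgHom.commutes, AlgHom.commutes, Module.algebraMap_end_apply, Module.algebraMap_end_apply]
    rfl
  | grade1 γ =>
    intro p n
    rw [Expr.op, opAll, FreeAlgebra.lift_ι_apply, FreeAlgebra.lift_ι_apply]
    rfl
  | mul a b ha hb =>
    intro p n
    rw [map_mul, map_mul]
    exact (ha _ n).trans (congrArg _ (hb p n))
  | add a b ha hb =>
    intro p n
    rw [map_add, map_add]
    exact congrArg₂ (· + ·) (ha p n) (hb p n)

/-- By linearity it suffices to treat ∞-cycles of a single weight, which a generator sends to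
∞-cycles of the shifted weight. A general polynomial is not homogeneous, so one passes to the span
already here. -/
theorem opAll_gen_mem (γ : UGen) {p : (n : ℕ) → V n} (hp : p ∈ InfCycles) :
    opAll (FreeAlgebra.ι ℂ γ) p ∈ InfCycles := by
  have h : InfCycles ≤ InfCycles.comap (opAll (FreeAlgebra.ι ℂ γ)) := by
    refine Submodule.span_le.mpr ?_
    rintro p ⟨m, hm⟩
    obtain ⟨h1, h2⟩ := isInfCycle_iff.mp hm
    refine Submodule.subset_span ⟨m + γ.shift, ?_⟩
    have h3 : opAll (FreeAlgebra.ι ℂ γ) p = fun n => UGen.op n γ (p n) := by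
      funext n
      rw [opAll_apply, Expr.op, FreeAlgebra.lift_ι_apply]
    rw [h3]
    exact isInfCycle_iff.mpr ⟨h1.op_gen γ, fun n => (h2 n).op_gen γ⟩
  exact h hp

theorem opAll_mem (f : Expr) : ∀ {p : (n : ℕ) → V n}, p ∈ InfCycles → opAll f p ∈ InfCycles := by
  induction f using FreeAlgebra.induction with
  | grade0 c =>
    intro p hp
    rw [AlgHom.commutes, Module.algebraMap_end_apply]
    exact InfCycles.smul_mem c hp
  | grade1 γ => exact fun hp => opAll_gen_mem γ hp
  | mul a b ha hb =>
    intro p hp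
    rw [map_mul]
    exact ha (hb hp)
  | add a b ha hb =>
    intro p hp
    rw [map_add]
    exact InfCycles.add_mem (ha hp) (hb hp)

theorem op_mem_infCycles (f : Expr) {p : (n : ℕ) → V n} (hp : p ∈ InfCycles) :
    (fun n => Expr.op n f (p n)) ∈ InfCycles := by
  have h : opAll f p = fun n => Expr.op n f (p n) := funext (opAll_apply f p)
  rw [← h]
  exact opAll_mem f hp

theorem IsAction.toUi_apply {ρ : (n : ℕ) → Ui →ₐ[ℂ] Module.End (K n) (A n)} (h : IsAction ρ)
    (n : ℕ) (f : Expr) : ∀ P : A n, ((ρ n (Expr.toUi f) P : A n) : V n) = Expr.op n f (P : V n) := by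
  induction f using FreeAlgebra.induction with
  | grade0 c =>
    intro P
    rw [AlgHom.commutes, AlgHom.commutes, AlgHom.commutes, Module.algebraMap_end_apply,
      Module.algebraMap_end_apply]
    rfl
  | grade1 γ =>
    intro P
    rw [Expr.op, Expr.toUi, FreeAlgebra.lift_ι_apply, FreeAlgebra.lift_ι_apply]
    exact h n γ P
  | mul a b ha hb =>
    intro P
    rw [map_mul, map_mul, map_mul]
    exact (ha _).trans (congrArg _ (hb P))
  | add a b ha hb =>
    intro P
    rw [map_add, map_add, map_add]
    exact congrArg₂ (· + ·) (ha P) (hb P)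

end InfinityCycles

/-! ### Elements of the integral form with values generated by the given generators -/

section Values

/-- The elements of the integral form whose specializations are polynomials in the generators. -/
def genSub : Subalgebra ℂ Uq := (Expr.toUi.range.comap specialize).map Ures.val

theorem mem_genSub {u : Uq} : u ∈ genSub ↔ ∃ h : u ∈ Ures, ∃ f, Expr.toUi f = specialize ⟨u, h⟩ := by
  constructor
  · rintro ⟨⟨u, h⟩, ⟨f, hf⟩, rfl⟩
    exact ⟨h, f, hf⟩
  · rintro ⟨h, f, hf⟩
    exact ⟨⟨u, h⟩, ⟨f, hf⟩, rfl⟩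

theorem gen_mem {u : Uq} (h : u ∈ Ures) (γ : UGen) (hγ : γ.toUi = specialize ⟨u, h⟩) : u ∈ genSub :=
  mem_genSub.mpr ⟨h, FreeAlgebra.ι ℂ γ, by rw [Expr.toUi, FreeAlgebra.lift_ι_apply, hγ]⟩

/-- The scalar `c` lies in the integral form and specializes to `r`. -/
def HasVal (c : Cq) (r : ℂ) : Prop :=
  ∃ h : algebraMap Cq Uq c ∈ Ures, specialize ⟨_, h⟩ = algebraMap ℂ Ui r

theorem HasVal.add {c d : Cq} {r s : ℂ} (hc : HasVal c r) (hd : HasVal d s) :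
    HasVal (c + d) (r + s) := by
  obtain ⟨h, e⟩ := hc
  obtain ⟨h', e'⟩ := hd
  have h1 : (algebraMap Cq Uq (c + d)) = algebraMap Cq Uq c + algebraMap Cq Uq d := map_add _ _ _
  refine ⟨by rw [h1]; exact add_mem h h', ?_⟩
  rw [map_add (algebraMap ℂ Ui), ← e, ← e']
  exact (congrArg specialize (Subtype.ext h1)).trans (map_add specialize ⟨_, h⟩ ⟨_, h'⟩)

theorem HasVal.mul {c d : Cq} {r s : ℂ} (hc : HasVal c r) (hd : HasVal d s) :
    HasVal (c * d) (r * s) := by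
  obtain ⟨h, e⟩ := hc
  obtain ⟨h', e'⟩ := hd
  have h1 : (algebraMap Cq Uq (c * d)) = algebraMap Cq Uq c * algebraMap Cq Uq d := map_mul _ _ _
  refine ⟨by rw [h1]; exact mul_mem h h', ?_⟩
  rw [map_mul (algebraMap ℂ Ui), ← e, ← e']
  exact (congrArg specialize (Subtype.ext h1)).trans (map_mul specialize ⟨_, h⟩ ⟨_, h'⟩)

theorem hasVal_C (a : ℂ) : HasVal (algebraMap ℂ Cq a) a := by
  have h1 : algebraMap Cq Uq (algebraMap ℂ Cq a) = ((algebraMap ℂ Ures a : Ures) : Uq) :=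
    (IsScalarTower.algebraMap_apply ℂ Cq Uq a).symm
  refine ⟨by rw [h1]; exact Subtype.prop _, ?_⟩
  rw [← AlgHom.commutes specialize a]
  exact congrArg _ (Subtype.ext h1)

theorem hasVal_one : HasVal 1 1 := by
  have h := hasVal_C 1
  rwa [map_one] at h

theorem hasVal_zero : HasVal 0 0 := by
  have h := hasVal_C 0
  rwa [map_zero] at h

theorem HasVal.neg {c : Cq} {r : ℂ} (hc : HasVal c r) : HasVal (-c) (-r) := by
  have h := (hasVal_C (-1)).mul hc
  rwa [map_neg, map_one, neg_one_mul, neg_one_mul] at h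

theorem HasVal.sub {c d : Cq} {r s : ℂ} (hc : HasVal c r) (hd : HasVal d s) :
    HasVal (c - d) (r - s) := by
  rw [sub_eq_add_neg, sub_eq_add_neg]
  exact hc.add hd.neg

theorem HasVal.pow {c : Cq} {r : ℂ} (hc : HasVal c r) (k : ℕ) : HasVal (c ^ k) (r ^ k) := by
  induction k with
  | zero => simpa using hasVal_one
  | succ k ih =>
    rw [pow_succ, pow_succ]
    exact ih.mul hc

theorem hasVal_q : HasVal q Complex.I :=
  ⟨algebraMap_q_mem, (RingQuot.mkAlgHom_rel ℂ ⟨rfl, rfl⟩).trans (AlgHom.commutes specialize _)⟩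

/-- The defining relation only concerns q; the value of its inverse is forced because q q⁻¹ = 1
holds already in the integral form. -/
theorem hasVal_q_inv : HasVal q⁻¹ Complex.I⁻¹ := by
  refine ⟨algebraMap_qinv_mem, ?_⟩
  obtain ⟨h, e⟩ := hasVal_q
  have h1 : specialize ⟨_, h⟩ * specialize ⟨_, algebraMap_qinv_mem⟩ = 1 := by
    rw [← map_mul, ← map_one specialize]
    refine congrArg _ (Subtype.ext ?_)
    change algebraMap Cq Uq q * algebraMap Cq Uq q⁻¹ = 1
    rw [← map_mul, mul_inv_cancel₀ q_ne_zero, map_one]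
  rw [e] at h1
  calc specialize ⟨_, algebraMap_qinv_mem⟩
      = algebraMap ℂ Ui Complex.I⁻¹ * (algebraMap ℂ Ui Complex.I *
        specialize ⟨_, algebraMap_qinv_mem⟩) := by
        rw [← mul_assoc, ← map_mul, inv_mul_cancel₀ Complex.I_ne_zero, map_one, one_mul]
    _ = algebraMap ℂ Ui Complex.I⁻¹ := by rw [h1, mul_one]

theorem hasVal_q_zpow (m : ℤ) : HasVal (q ^ m) (Complex.I ^ m) := by
  obtain ⟨k, rfl | rfl⟩ := m.eq_nat_or_neg
  · rw [zpow_natCast, zpow_natCast]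
    exact hasVal_q.pow k
  · rw [zpow_neg, zpow_neg, zpow_natCast, zpow_natCast, ← inv_pow, ← inv_pow]
    exact hasVal_q_inv.pow k

theorem HasVal.smul_mem {c : Cq} {r : ℂ} (hc : HasVal c r) {u : Uq} (hu : u ∈ genSub) :
    c • u ∈ genSub := by
  rw [Algebra.smul_def]
  refine mul_mem ?_ hu
  obtain ⟨h, e⟩ := hc
  exact mem_genSub.mpr ⟨h, algebraMap ℂ Expr r, by rw [e, AlgHom.commutes]⟩

theorem HasVal.algebraMap_mem {c : Cq} {r : ℂ} (hc : HasVal c r) : algebraMap Cq Uq c ∈ genSub := by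
  rw [Algebra.algebraMap_eq_smul_one]
  exact hc.smul_mem (one_mem _)

/-- Scalars with nonzero value at q = i can be divided out after specialization, provided `u` is
known to lie in the integral form. All later generation arguments clear denominators in this way. -/
theorem HasVal.mem_of_smul_mem {c : Cq} {r : ℂ} (hc : HasVal c r) (hr : r ≠ 0) {u : Uq}
    (hu : u ∈ Ures) (h : c • u ∈ genSub) : u ∈ genSub := by
  obtain ⟨h1, f, hf⟩ := mem_genSub.mp h
  obtain ⟨h2, e⟩ := hc
  refine mem_genSub.mpr ⟨hu, r⁻¹ • f, ?_⟩
  have h3 : specialize ⟨c • u, h1⟩ = algebraMap ℂ Ui r * specialize ⟨u, hu⟩ := by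
    rw [← e, ← map_mul]
    exact congrArg _ (Subtype.ext (Algebra.smul_def c u))
  rw [map_smul, hf, h3, ← Algebra.smul_def, smul_smul, inv_mul_cancel₀ hr, one_smul]

end Values

/-! ### Values of quantum integers at q = i -/

section QuantumIntegers

theorem qInt_eq (m : ℤ) : (q - q⁻¹) * qInt m = q ^ m - q ^ (-m) := mul_div_cancel₀ _ q_sub_ne_zero

theorem qInt_add_two (m : ℤ) : qInt (m + 2) = qInt 2 * qInt (m + 1) - qInt m := by
  apply mul_left_cancel₀ q_sub_ne_zero
  have h0 := q_ne_zero
  have e1 := qInt_eq (m + 2)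
  have e2 := qInt_eq (m + 1)
  have e3 := qInt_eq m
  rw [mul_sub, mul_left_comm, e1, e2, e3, qInt_two]
  have h1 : ∀ a b : ℤ, q ^ (a + b) = q ^ a * q ^ b := fun a b => zpow_add₀ h0 a b
  rw [neg_add, neg_add, h1, h1, h1, h1, zpow_ofNat, zpow_neg q 2, zpow_ofNat, zpow_one, zpow_neg q 1,
    zpow_one]
  field_simp
  ring

theorem qInt_zero : qInt 0 = 0 := by rw [qInt, neg_zero, sub_self, zero_div]

theorem qInt_neg (m : ℤ) : qInt (-m) = -qInt m := by
  rw [qInt, qInt, neg_neg, ← neg_div, neg_sub]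

/-- This zero is the whole difficulty: elements with [2] in the denominator are not obtained by
division. -/
theorem hasVal_qInt_two : HasVal (qInt 2) 0 := by
  have h := hasVal_q.add hasVal_q_inv
  rwa [← qInt_two, Complex.inv_I, add_neg_cancel] at h

/-- The ratio `[2 j] / [2]`. -/
def evenInt (j : ℤ) : Cq := (qInt 2)⁻¹ * qInt (2 * j)

theorem two_mul_evenInt (j : ℤ) : qInt 2 * evenInt j = qInt (2 * j) :=
  mul_inv_cancel_left₀ qInt_two_ne_zero _

theorem evenInt_neg (j : ℤ) : evenInt (-j) = -evenInt j := by
  rw [evenInt, evenInt, mul_neg, qInt_neg, mul_neg]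

/-- Joint induction from [m+2] = [2][m+1] - [m]. For odd indices the first term has value zero,
leaving alternating signs; for even indices divide the recursion by [2]. -/
theorem hasVal_odd_even (j : ℕ) : HasVal (qInt (2 * (j : ℤ) + 1)) ((-1) ^ j) ∧
    HasVal (evenInt ((j : ℤ) + 1)) ((-1) ^ j * (j + 1)) := by
  have hz : evenInt ((0 : ℕ) + 1 : ℤ) = 1 := by
    rw [evenInt, Nat.cast_zero, zero_add, mul_one, inv_mul_cancel₀ qInt_two_ne_zero]
  induction j with
  | zero =>
    refine ⟨?_, ?_⟩
    · rw [Nat.cast_zero, mul_zero, zero_add, qInt_one, pow_zero]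
      exact hasVal_one
    · rw [hz, pow_zero, Nat.cast_zero, zero_add, mul_one]
      exact hasVal_one
  | succ j ih =>
    have e1 : qInt (2 * ((j + 1 : ℕ) : ℤ) + 1)
        = qInt 2 * (qInt 2 * evenInt ((j : ℤ) + 1)) - qInt (2 * (j : ℤ) + 1) := by
      rw [two_mul_evenInt, ← show (2 * (j : ℤ) + 1 + 1) = 2 * ((j : ℤ) + 1) by ring,
        ← qInt_add_two]
      congr 1
    have h1 : HasVal (qInt (2 * ((j + 1 : ℕ) : ℤ) + 1)) ((-1) ^ (j + 1)) := by
      rw [e1]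
      have h := (hasVal_qInt_two.mul (hasVal_qInt_two.mul ih.2)).sub ih.1
      rwa [zero_mul, zero_sub, ← neg_one_mul, ← pow_succ'] at h
    refine ⟨h1, ?_⟩
    have e2 : evenInt (((j + 1 : ℕ) : ℤ) + 1)
        = qInt (2 * ((j + 1 : ℕ) : ℤ) + 1) - evenInt ((j : ℤ) + 1) := by
      apply mul_left_cancel₀ qInt_two_ne_zero
      rw [mul_sub, two_mul_evenInt, two_mul_evenInt,
        show 2 * (((j + 1 : ℕ) : ℤ) + 1) = 2 * ((j + 1 : ℕ) : ℤ) + 2 by ring, qInt_add_two]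
      congr 2
    rw [e2]
    have h := h1.sub ih.2
    convert h using 1
    push_cast
    ring

theorem exists_hasVal_evenInt (j : ℤ) : ∃ r, HasVal (evenInt j) r := by
  have hn : ∀ j : ℕ, ∃ r, HasVal (evenInt j) r := by
    intro j
    cases j with
    | zero =>
      have h0 : evenInt ((0 : ℕ) : ℤ) = 0 := by
        rw [evenInt, Nat.cast_zero, mul_zero, qInt_zero, mul_zero]
      exact ⟨0, h0 ▸ hasVal_zero⟩
    | succ j => exact ⟨_, by have := (hasVal_odd_even j).2; rwa [← Nat.cast_succ] at this⟩
  obtain ⟨k, rfl | rfl⟩ := j.eq_nat_or_neg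
  · exact hn k
  · obtain ⟨r, hr⟩ := hn k
    exact ⟨-r, by rw [evenInt_neg]; exact hr.neg⟩

theorem exists_hasVal_qInt (m : ℤ) : ∃ r, HasVal (qInt m) r := by
  have hn : ∀ j : ℕ, (∃ r, HasVal (qInt j) r) ∧ ∃ r, HasVal (qInt (j + 1 : ℕ)) r := by
    intro j
    induction j with
    | zero =>
      refine ⟨⟨0, ?_⟩, ⟨1, ?_⟩⟩
      · rw [Nat.cast_zero, qInt_zero]
        exact hasVal_zero
      · rw [zero_add, Nat.cast_one, qInt_one]
        exact hasVal_one
    | succ j ih =>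
      obtain ⟨⟨r, hr⟩, s, hs⟩ := ih
      refine ⟨⟨s, hs⟩, 0 * s - r, ?_⟩
      have h : qInt ((j + 1 + 1 : ℕ) : ℤ) = qInt 2 * qInt ((j + 1 : ℕ) : ℤ) - qInt (j : ℤ) := by
        push_cast
        rw [← qInt_add_two]
        congr 1
      rw [h]
      exact (hasVal_qInt_two.mul hs).sub hr
  obtain ⟨k, rfl | rfl⟩ := m.eq_nat_or_neg
  · exact (hn k).1
  · obtain ⟨r, hr⟩ := (hn k).1
    exact ⟨-r, by rw [qInt_neg]; exact hr.neg⟩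

/-- The quantity `[2 k]! / [2]^k`. -/
def halfFact (k : ℕ) : Cq :=
  ∏ j ∈ Finset.range k, qInt (2 * (j : ℤ) + 1) * evenInt ((j : ℤ) + 1)

theorem qFact_succ (r : ℕ) : qFact (r + 1) = qFact r * qInt ((r + 1 : ℕ) : ℤ) := by
  rw [qFact, qFact, Finset.prod_Icc_succ_top (by omega)]

/-- Isolates the exact power of [2] in the factorial; the cofactor has a nonzero value at q = i. -/
theorem qFact_two_mul (k : ℕ) : qFact (2 * k) = qInt 2 ^ k * halfFact k := by
  induction k with
  | zero => simp [qFact, halfFact]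
  | succ k ih =>
    rw [show 2 * (k + 1) = 2 * k + 1 + 1 by ring, qFact_succ, qFact_succ, ih, halfFact, halfFact,
      Finset.prod_range_succ, pow_succ,
      show ((2 * k + 1 + 1 : ℕ) : ℤ) = 2 * ((k : ℤ) + 1) by push_cast; ring, ← two_mul_evenInt,
      show ((2 * k + 1 : ℕ) : ℤ) = 2 * (k : ℤ) + 1 by push_cast; ring]
    ring

theorem exists_hasVal_halfFact (k : ℕ) : ∃ r, r ≠ 0 ∧ HasVal (halfFact k) r := by
  induction k with
  | zero => exact ⟨1, one_ne_zero, by simpa [halfFact] using hasVal_one⟩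
  | succ k ih =>
    obtain ⟨r, hr, h⟩ := ih
    obtain ⟨h1, h2⟩ := hasVal_odd_even k
    refine ⟨_, ?_, by rw [halfFact, Finset.prod_range_succ]; exact h.mul (h1.mul h2)⟩
    have h3 : ((-1 : ℂ)) ^ k ≠ 0 := pow_ne_zero _ (neg_ne_zero.mpr one_ne_zero)
    have h4 : ((k : ℂ) + 1) ≠ 0 := Nat.cast_add_one_ne_zero k
    exact mul_ne_zero hr (mul_ne_zero h3 (mul_ne_zero h3 h4))

/-- The indeterminate q is not a root of unity. -/
theorem qFact_ne_zero (r : ℕ) : qFact r ≠ 0 := by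
  have hq : ∀ k : ℕ, q ^ (k + 1) ≠ 1 := by
    intro k h
    have h1 : algebraMap (Polynomial ℂ) Cq (Polynomial.X ^ (k + 1)) = algebraMap (Polynomial ℂ) Cq 1 := by
      rw [map_pow, RatFunc.algebraMap_X, map_one]
      exact h
    have h2 := congrArg Polynomial.natDegree (RatFunc.algebraMap_injective ℂ h1)
    simp at h2
  rw [qFact, Finset.prod_ne_zero_iff]
  intro j hj
  have hj' := (Finset.mem_Icc.mp hj).1
  intro h
  have h1 := qInt_eq j
  rw [h, mul_zero, zpow_neg, zpow_natCast] at h1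
  have h2 : q ^ j ≠ 0 := pow_ne_zero _ q_ne_zero
  have h3 : q ^ j * q ^ j = 1 := by
    have h4 : q ^ j = (q ^ j)⁻¹ := sub_eq_zero.mp h1.symm
    nth_rewrite 2 [h4]
    exact mul_inv_cancel₀ h2
  rw [← pow_add] at h3
  exact hq (j + j - 1) (by rwa [Nat.sub_add_cancel (by omega)])

end QuantumIntegers

/-! ### Divided powers from the divided squares of half currents -/

section DividedPowers

theorem x_mem_genSub (s : ℤˣ) (k : ℤ) : Uq.x s k ∈ genSub := gen_mem (x_mem s k) (.x s k) rfl

theorem t_mem_genSub (s : ℤˣ) : Uq.t s ∈ genSub := gen_mem (t_mem s) (.t s) rfl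

theorem curSq_mem_genSub (s : ℤˣ) (e : Side) (N : ℤ) : Uq.curSq s e N ∈ genSub :=
  gen_mem (curSq_mem s e N) (.xx s e N) rfl

/-- By the quadratic relation this sum is a combination of products of the x's without the
denominator [2]. So, modulo generated elements, moving the two indices one step apart changes the
sign of the symmetrized product. -/
theorem symm_succ_add_symm_mem (s : ℤˣ) (k l : ℤ) :
    Uq.symm s (l + 1) k + Uq.symm s l (k + 1) ∈ genSub := by
  rw [symm_step, sub_add_cancel]
  have h := hasVal_q_zpow (s : ℤ)
  exact add_mem (h.smul_mem (mul_mem (x_mem_genSub s _) (x_mem_genSub s _)))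
    (h.smul_mem (mul_mem (x_mem_genSub s _) (x_mem_genSub s _)))

theorem symm_sub_mem (s : ℤˣ) (k : ℤ) (j : ℕ) :
    Uq.symm s (k + j) (k - j) - ((-1) ^ j : ℂ) • Uq.symm s k k ∈ genSub := by
  induction j with
  | zero =>
    rw [Nat.cast_zero, add_zero, sub_zero, pow_zero, one_smul, sub_self]
    exact zero_mem _
  | succ j ih =>
    have h := symm_succ_add_symm_mem s (k - (j + 1 : ℕ)) (k + j)
    rw [show k - ((j + 1 : ℕ) : ℤ) + 1 = k - j by push_cast; ring,
      show k + (j : ℤ) + 1 = k + ((j + 1 : ℕ) : ℤ) by push_cast; ring] at h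
    have h2 := sub_mem h ih
    have h3 : Uq.symm s (k + (j + 1 : ℕ)) (k - (j + 1 : ℕ)) - ((-1) ^ (j + 1) : ℂ) • Uq.symm s k k
        = Uq.symm s (k + (j + 1 : ℕ)) (k - (j + 1 : ℕ)) + Uq.symm s (k + j) (k - j)
          - (Uq.symm s (k + j) (k - j) - ((-1) ^ j : ℂ) • Uq.symm s k k) := by
      rw [pow_succ, mul_neg_one]
      module
    rw [h3]
    exact h2

theorem sum_Icc_sub_add_succ {M : Type*} [AddCommMonoid M] (f : ℤ → M) (k : ℤ) (d : ℕ) :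
    ∑ m ∈ Finset.Icc (k - (d + 1 : ℕ)) (k + (d + 1 : ℕ)), f m
      = f (k - (d + 1 : ℕ)) + (f (k + (d + 1 : ℕ)) + ∑ m ∈ Finset.Icc (k - d) (k + d), f m) := by
  have h : Finset.Icc (k - (d + 1 : ℕ)) (k + (d + 1 : ℕ))
      = insert (k - ((d + 1 : ℕ) : ℤ)) (insert (k + ((d + 1 : ℕ) : ℤ))
        (Finset.Icc (k - d) (k + d))) := by
    ext m
    simp only [Finset.mem_Icc, Finset.mem_insert]
    push_cast
    omega
  rw [h, Finset.sum_insert, Finset.sum_insert]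
  · simp only [Finset.mem_Icc]
    push_cast
    omega
  · simp only [Finset.mem_Icc, Finset.mem_insert]
    push_cast
    omega

/-- Modulo generated elements the sum is 1 + 2∑_{j=1}^d (-1)^j = (-1)^d times the central term. -/
theorem sum_symm_sub_mem (s : ℤˣ) (k : ℤ) (d : ℕ) :
    ∑ m ∈ Finset.Icc (k - d) (k + d), Uq.symm s m (2 * k - m) - ((-1) ^ d : ℂ) • Uq.symm s k k
      ∈ genSub := by
  induction d with
  | zero =>
    rw [Nat.cast_zero, add_zero, sub_zero, Finset.Icc_self, Finset.sum_singleton, pow_zero, one_smul,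
      show 2 * k - k = k by ring, sub_self]
    exact zero_mem _
  | succ d ih =>
    have h := symm_sub_mem s k (d + 1)
    rw [sum_Icc_sub_add_succ, show 2 * k - (k - ((d + 1 : ℕ) : ℤ)) = k + ((d + 1 : ℕ) : ℤ) by ring,
      show 2 * k - (k + ((d + 1 : ℕ) : ℤ)) = k - ((d + 1 : ℕ) : ℤ) by ring,
      symm_comm s (k - ((d + 1 : ℕ) : ℤ))]
    have h2 := add_mem (add_mem h h) ih
    convert h2 using 1
    rw [pow_succ, mul_neg_one]
    module

theorem curSq_eq (s : ℤˣ) (e : Side) (N : ℤ) :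
    Uq.curSq s e N = (1 / 2 : ℂ) • ∑ k ∈ pairs s e N, Uq.symm s k (N - k) := by
  have hI : ∀ k ∈ pairs s e N, N - k ∈ pairs s e N := by
    intro k hk
    cases e <;> simp only [pairs, Finset.mem_Icc] at hk ⊢ <;> omega
  have h : ∑ k ∈ pairs s e N, Uq.x s (N - k) * Uq.x s k
      = ∑ k ∈ pairs s e N, Uq.x s k * Uq.x s (N - k) :=
    Finset.sum_nbij' (fun k => N - k) (fun k => N - k) hI hI (by simp) (by simp) (by simp)
  rw [Uq.curSq]
  simp only [Uq.symm, ← Finset.smul_sum, Finset.sum_add_distrib, h]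
  rw [← two_smul ℂ (∑ k ∈ pairs s e N, Uq.x s k * Uq.x s (N - k)), smul_comm (qInt 2)⁻¹ (2 : ℂ),
    smul_smul]
  norm_num

/-- Exactly one half current contains x_k, and the index pairs contributing to the coefficient 2k of
its square form an interval centred at k. -/
theorem exists_pairs_eq (s : ℤˣ) (k : ℤ) :
    ∃ (e : Side) (d : ℕ), pairs s e (2 * k) = Finset.Icc (k - d) (k + d) := by
  rcases lt_or_ge k (start s) with h | h
  · refine ⟨Side.inf, (start s - 1 - k).toNat, ?_⟩
    rw [pairs, Int.toNat_of_nonneg (by omega)]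
    congr 1 <;> ring
  · refine ⟨Side.zero, (k - start s).toNat, ?_⟩
    rw [pairs, Int.toNat_of_nonneg (by omega)]
    congr 1 <;> ring

/-- Twice the coefficient with index 2k of a divided square is ± the symmetrized product of x_k with
itself, modulo generated elements, and x_k^{(2)} is half of that product. -/
theorem xDiv_two_mem_genSub (s : ℤˣ) (k : ℤ) : Uq.xDiv s k 2 ∈ genSub := by
  obtain ⟨e, d, hd⟩ := exists_pairs_eq s k
  have h1 := curSq_mem_genSub s e (2 * k)
  rw [curSq_eq, hd] at h1
  have h2 := sub_mem (genSub.smul_mem h1 2) (sum_symm_sub_mem s k d)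
  rw [smul_smul, show (2 : ℂ) * (1 / 2) = 1 by norm_num, one_smul, sub_sub_cancel] at h2
  have h3 := genSub.smul_mem h2 ((1 / 2 : ℂ) * (-1) ^ d)
  have h4 : ((1 / 2 : ℂ) * (-1) ^ d) • ((-1) ^ d : ℂ) • Uq.symm s k k = Uq.xDiv s k 2 := by
    rw [smul_smul, mul_assoc, ← mul_pow, neg_one_mul, neg_neg, one_pow, mul_one, xDiv_two, Uq.symm,
      smul_comm, ← two_smul ℂ (Uq.x s k * Uq.x s k), smul_smul]
    norm_num
  rwa [h4] at h3

/-- With r = 2k + ε, a multiple of x^{(r)} equals (x^{(2)})^k x^ε; by `qFact_two_mul` the multiplier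
contains no factor [2]. -/
theorem xDiv_mem_genSub (s : ℤˣ) (n : ℤ) (r : ℕ) : Uq.xDiv s n r ∈ genSub := by
  have key : ∀ k ε : ℕ, (∃ a, a ≠ 0 ∧ ∃ c, HasVal c a ∧ qFact (2 * k + ε) = qInt 2 ^ k * c) →
      Uq.xDiv s n (2 * k + ε) ∈ genSub := by
    rintro k ε ⟨a, ha, c, hc, h⟩
    refine hc.mem_of_smul_mem ha (xDiv_mem s n _) ?_
    have h1 : c • Uq.xDiv s n (2 * k + ε) = Uq.xDiv s n 2 ^ k * Uq.x s n ^ ε := by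
      have h2 := qFact_ne_zero (2 * k + ε)
      have h3 : c * (qFact (2 * k + ε))⁻¹ = (qInt 2)⁻¹ ^ k := by
        rw [h] at h2 ⊢
        have h4 := right_ne_zero_of_mul h2
        rw [mul_inv, mul_left_comm, mul_inv_cancel₀ h4, mul_one, inv_pow]
      rw [Uq.xDiv, smul_smul, h3, xDiv_two, smul_pow, ← pow_two, ← pow_mul, smul_mul_assoc, ← pow_add]
    rw [h1]
    exact mul_mem (pow_mem (xDiv_two_mem_genSub s n) k) (pow_mem (x_mem_genSub s n) ε)
  obtain ⟨a, ha, h⟩ := exists_hasVal_halfFact (r / 2)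
  rcases Nat.mod_two_eq_zero_or_one r with h0 | h0
  · have hr := key (r / 2) 0 ⟨a, ha, _, h, qFact_two_mul _⟩
    rwa [show 2 * (r / 2) + 0 = r by omega] at hr
  · have hr := key (r / 2) 1 ⟨_, mul_ne_zero ha (pow_ne_zero (r / 2) (neg_ne_zero.mpr one_ne_zero)), _,
      h.mul (hasVal_odd_even (r / 2)).1, by
        rw [qFact_succ, qFact_two_mul, mul_assoc]
        push_cast
        rfl⟩
    rwa [show 2 * (r / 2) + 1 = r by omega] at hr

end DividedPowers

/-! ### The binomials in t₁ -/

section CartanBinomials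

theorem t_mul_tinv : Uq.t 1 * Uq.t (-1) = 1 := by
  have h := RingQuot.mkAlgHom_rel Cq DRel.t_mul_tinv
  rwa [map_mul, map_one] at h

theorem tinv_mul_t : Uq.t (-1) * Uq.t 1 = 1 := by
  have h := RingQuot.mkAlgHom_rel Cq DRel.tinv_mul_t
  rwa [map_mul, map_one] at h

theorem t_mul_x (s : ℤˣ) (k : ℤ) : Uq.t 1 * Uq.x s k = q ^ (2 * (s : ℤ)) • (Uq.x s k * Uq.t 1) := by
  have h := RingQuot.mkAlgHom_rel Cq (DRel.t_x s k)
  rw [map_mul, map_mul, map_smul] at h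
  have h2 : Uq.t 1 * Uq.x s k * Uq.t (-1) = q ^ (2 * (s : ℤ)) • Uq.x s k := h
  rw [← smul_mul_assoc, ← h2, mul_assoc _ _ (Uq.t 1), tinv_mul_t, mul_one]

theorem tinv_mul_x (s : ℤˣ) (k : ℤ) :
    Uq.t (-1) * Uq.x s k = (q ^ (2 * (s : ℤ)))⁻¹ • (Uq.x s k * Uq.t (-1)) := by
  have h := congrArg (fun u => Uq.t (-1) * u * Uq.t (-1)) (t_mul_x s k)
  beta_reduce at h
  rw [← mul_assoc, tinv_mul_t, one_mul, mul_smul_comm, smul_mul_assoc, mul_assoc, mul_assoc,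
    t_mul_tinv, mul_one] at h
  rw [h, smul_smul, inv_mul_cancel₀ (zpow_ne_zero _ q_ne_zero), one_smul]

theorem phi_zero (s : ℤˣ) : FreeD.phi s 0 = FreeD.t s := by
  rw [FreeD.phi, mul_zero, if_pos le_rfl, Int.toNat_zero, FreeD.expCoeff, zero_add,
    Finset.sum_range_one, pow_zero, Nat.factorial_zero, Nat.cast_one, inv_one, one_smul,
    PowerSeries.coeff_zero_one, mul_one]

theorem xp_mul_xm : Uq.x 1 0 * Uq.x (-1) 0
    = Uq.x (-1) 0 * Uq.x 1 0 + (q - q⁻¹)⁻¹ • (Uq.t 1 - Uq.t (-1)) := by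
  have h := RingQuot.mkAlgHom_rel Cq (DRel.xp_xm 0 0)
  rw [add_zero, phi_zero, phi_zero, map_sub, map_mul, map_mul, map_smul, map_sub] at h
  exact sub_eq_iff_eq_add'.mp h

/-- The element `q^m t₁ - q^{-m} t₁⁻¹`. -/
def tDiff (m : ℤ) : Uq := q ^ m • Uq.t 1 - q ^ (-m) • Uq.t (-1)

theorem tDiff_mem_genSub (m : ℤ) : tDiff m ∈ genSub :=
  sub_mem ((hasVal_q_zpow m).smul_mem (t_mem_genSub 1)) ((hasVal_q_zpow _).smul_mem (t_mem_genSub _))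

theorem tBinom_succ (n : ℤ) (r : ℕ) : Uq.tBinom n (r + 1) = Uq.tBinom n r *
    (((q - q⁻¹) * qInt ((r : ℤ) + 1))⁻¹ • tDiff (n - r)) := by
  simp only [Uq.tBinom, List.range_succ, List.pure_def, List.bind_eq_flatMap, List.flatMap_append,
    List.flatMap_singleton, List.map_append, List.prod_append, List.map_singleton,
    List.prod_singleton, qInt_eq, tDiff, neg_sub, neg_add_eq_sub]

theorem tBinom_zero (n : ℤ) : Uq.tBinom n 0 = 1 := rfl

theorem tBinom_one (n : ℤ) : Uq.tBinom n 1 = (q - q⁻¹)⁻¹ • tDiff n := by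
  rw [tBinom_succ, tBinom_zero, one_mul, Nat.cast_zero, zero_add, qInt_one, mul_one, sub_zero]

theorem tBinom_two (n : ℤ) : Uq.tBinom n 2
    = ((q - q⁻¹)⁻¹ * ((q - q⁻¹) * qInt 2)⁻¹) • (tDiff n * tDiff (n - 1)) := by
  rw [tBinom_succ, tBinom_one, smul_mul_smul_comm, Nat.cast_one]
  rfl

theorem tBinom_mem (n : ℤ) (r : ℕ) : Uq.tBinom n r ∈ Ures :=
  Algebra.subset_adjoin (Or.inl (Or.inr ⟨n, r, rfl⟩))

theorem hasVal_q_sub : HasVal (q - q⁻¹) (2 * Complex.I) := by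
  have h := hasVal_q.sub hasVal_q_inv
  rwa [Complex.inv_I, sub_neg_eq_add, ← two_mul] at h

theorem two_mul_I_ne_zero : (2 * Complex.I : ℂ) ≠ 0 := mul_ne_zero two_ne_zero Complex.I_ne_zero

/-- The only denominator is q - q⁻¹, whose value 2i is invertible. -/
theorem tBinom_one_mem_genSub (n : ℤ) : Uq.tBinom n 1 ∈ genSub := by
  refine hasVal_q_sub.mem_of_smul_mem two_mul_I_ne_zero (tBinom_mem n 1) ?_
  rw [tBinom_one, smul_smul, mul_inv_cancel₀ q_sub_ne_zero, one_smul]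
  exact tDiff_mem_genSub n

/-- The commutator of the squares of two elements of an `sl₂`-triple. -/
theorem sq_mul_sq {F R : Type*} [Field F] [Ring R] [Algebra F R] {e f t t' : R} {v p : F}
    (hv : v ≠ 0) (hte : t * e = v ^ 2 • (e * t)) (hte' : t' * e = (v ^ 2)⁻¹ • (e * t'))
    (htf : t * f = (v ^ 2)⁻¹ • (f * t)) (htf' : t' * f = v ^ 2 • (f * t'))
    (hef : e * f = f * e + p • (t - t')) :
    e * e * (f * f) = f * f * (e * e)
      + (v + v⁻¹) ^ 2 • (f * (p • ((v ^ 2)⁻¹ • t - v ^ 2 • t')) * e)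
      + (v + v⁻¹) • (p • (t - t') * (p • (v⁻¹ • t - v • t'))) := by
  -- Moving `f` to the left past `p • (t - t')` turns that element into `D`, and the sum of the two
  -- is (v + v⁻¹) times `C`. Each power of `f` thus produces a factor v + v⁻¹.
  obtain ⟨C, hC⟩ : ∃ C, C = p • (v⁻¹ • t - v • t') := ⟨_, rfl⟩
  obtain ⟨D, hD⟩ : ∃ D, D = p • ((v ^ 2)⁻¹ • t - v ^ 2 • t') := ⟨_, rfl⟩
  rw [← hC, ← hD]
  have h1 : p • (t - t') * f = f * D := by
    rw [hD, smul_mul_assoc, sub_mul, htf, htf', mul_smul_comm, mul_sub, mul_smul_comm, mul_smul_comm]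
  have h2 : p • (t - t') + D = (v + v⁻¹) • C := by
    rw [hD, hC]
    match_scalars <;> (field_simp; try ring)
  have h3 : e * C = ((v + v⁻¹) • D - C) * e := by
    rw [hD, hC]
    simp only [mul_smul_comm, mul_sub, sub_mul, smul_mul_assoc, hte, hte', smul_sub]
    match_scalars <;> field_simp <;> ring
  have h4 : e * (f * f) = f * f * e + (v + v⁻¹) • (f * C) := by
    rw [← mul_assoc, hef, add_mul, mul_assoc, hef, h1, mul_add, add_assoc, ← mul_add, ← mul_assoc, h2,
      mul_smul_comm]
  have h5 : e * (f * C) = f * ((v + v⁻¹) • D - C) * e + p • (t - t') * C := by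
    rw [← mul_assoc, hef, add_mul, mul_assoc, h3, mul_assoc]
  rw [mul_assoc, h4, mul_add, ← mul_assoc, h4, mul_smul_comm, h5]
  simp only [mul_sub, sub_mul, add_mul, mul_smul_comm, smul_mul_assoc, mul_assoc, smul_add, smul_sub,
    smul_smul]
  module

/-- Divide `sq_mul_sq` by [2]²: the middle term loses its coefficient [2]², and the last keeps one
[2] in the denominator, exactly as in the binomial. So this binomial is a polynomial in elements
already generated. -/
theorem tBinom_zero_two_eq : Uq.tBinom 0 2 = Uq.xDiv 1 0 2 * Uq.xDiv (-1) 0 2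
    - Uq.xDiv (-1) 0 2 * Uq.xDiv 1 0 2 - Uq.x (-1) 0 * Uq.tBinom (-2) 1 * Uq.x 1 0 := by
  have h2 := qInt_two_ne_zero
  have hp : ((2 : ℤ) * ((1 : ℤˣ) : ℤ)) = 2 := by norm_num
  have hm : ((2 : ℤ) * ((-1 : ℤˣ) : ℤ)) = -2 := by norm_num
  have hte := t_mul_x 1 0
  have hte' := tinv_mul_x 1 0
  have htf := t_mul_x (-1) 0
  have htf' := tinv_mul_x (-1) 0
  rw [hp, zpow_ofNat] at hte hte'
  rw [hm, zpow_neg, zpow_ofNat] at htf htf'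
  rw [inv_inv] at htf'
  have key := sq_mul_sq q_ne_zero hte hte' htf htf' xp_mul_xm
  rw [← qInt_two] at key
  have hd : ∀ m : ℤ, tDiff m = q ^ m • Uq.t 1 - q ^ (-m) • Uq.t (-1) := fun _ => rfl
  have h0 : Uq.t 1 - Uq.t (-1) = tDiff 0 := by
    rw [hd, neg_zero, zpow_zero, one_smul, one_smul]
  have h1 : q⁻¹ • Uq.t 1 - q • Uq.t (-1) = tDiff (0 - 1) := by
    rw [hd, zero_sub, neg_neg, zpow_neg_one, zpow_one]
  have h3 : (q ^ 2)⁻¹ • Uq.t 1 - q ^ 2 • Uq.t (-1) = tDiff (-2) := by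
    rw [hd, neg_neg, zpow_neg, zpow_ofNat]
  rw [h0, h1, h3, ← tBinom_one (-2), smul_mul_smul_comm, smul_smul] at key
  rw [xDiv_two, xDiv_two, smul_mul_smul_comm, smul_mul_smul_comm, key, tBinom_two, smul_add, smul_add,
    smul_smul, smul_smul]
  have e1 : (qInt 2)⁻¹ * (qInt 2)⁻¹ * qInt 2 ^ 2 = 1 := by field_simp
  have e2 : (qInt 2)⁻¹ * (qInt 2)⁻¹ * (qInt 2 * ((q - q⁻¹)⁻¹ * (q - q⁻¹)⁻¹))
      = (q - q⁻¹)⁻¹ * ((q - q⁻¹) * qInt 2)⁻¹ := by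
    rw [mul_inv]
    generalize qInt 2 = w at h2
    field_simp
  rw [e1, e2, one_smul]
  abel

theorem tDiff_mul_tDiff (n : ℤ) : tDiff n * tDiff (n - 1) = (q ^ n * (q ^ n * q⁻¹)) • (Uq.t 1 * Uq.t 1)
    - ((q ^ n)⁻¹ * (q ^ n * q⁻¹)) • (1 : Uq)
    - ((q ^ n * (q * (q ^ n)⁻¹)) • (1 : Uq)
      - ((q ^ n)⁻¹ * (q * (q ^ n)⁻¹)) • (Uq.t (-1) * Uq.t (-1))) := by
  have e1 : q ^ (n - 1) = q ^ n * q⁻¹ := zpow_sub_one₀ q_ne_zero n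
  have e2 : q ^ (1 - n) = q * (q ^ n)⁻¹ := by
    rw [zpow_sub₀ q_ne_zero, zpow_one, div_eq_mul_inv]
  rw [tDiff, tDiff, neg_sub, e1, e2, zpow_neg]
  simp only [sub_mul, mul_sub, smul_mul_smul_comm, t_mul_tinv, tinv_mul_t]

/-- With v = q, Q = q^n, w = [2] and T, e, T' = t₁², 1, t₁⁻²: scaling the case n = 0 by Q² matches
the coefficient of T, and the remaining discrepancies are multiples of [n] and of [2n]/[2], both
integral. -/
theorem smul_two_term_product {F M : Type*} [Field F] [Ring M] [Algebra F M] {v Q w : F}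
    (hv : v ≠ 0) (hQ : Q ≠ 0) (hw : w ≠ 0) (hd : v - v⁻¹ ≠ 0) (hwv : w = v + v⁻¹) (T e T' : M) :
    (v - v⁻¹) • ((v - v⁻¹)⁻¹ * ((v - v⁻¹) * w)⁻¹) •
        ((Q * (Q * v⁻¹)) • T - (Q⁻¹ * (Q * v⁻¹)) • e
          - ((Q * (v * Q⁻¹)) • e - (Q⁻¹ * (v * Q⁻¹)) • T'))
      = ((v - v⁻¹) * Q ^ 2) • ((v - v⁻¹)⁻¹ * ((v - v⁻¹) * w)⁻¹) •
          ((1 * (1 * v⁻¹)) • T - (1⁻¹ * (1 * v⁻¹)) • e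
            - ((1 * (v * 1⁻¹)) • e - (1⁻¹ * (v * 1⁻¹)) • T'))
        + ((Q * ((v - v⁻¹)⁻¹ * (Q - Q⁻¹))) • e
          - (v * (w⁻¹ * ((v - v⁻¹)⁻¹ * (Q ^ 2 - (Q ^ 2)⁻¹)))) • T') := by
  have hv' : w * v = v ^ 2 + 1 := by
    rw [hwv]
    field_simp
  have hdv : (v - v⁻¹) * v = v ^ 2 - 1 := by field_simp
  clear hwv
  generalize v - v⁻¹ = d at hd hdv ⊢
  match_scalars
  · field_simp
  · field_simp
    linear_combination (1 - Q ^ 2) * hv'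
  · field_simp
    ring

theorem tBinom_two_mem_genSub (n : ℤ) : Uq.tBinom n 2 ∈ genSub := by
  have h0 : Uq.tBinom 0 2 ∈ genSub := by
    rw [tBinom_zero_two_eq]
    exact sub_mem (sub_mem (mul_mem (xDiv_two_mem_genSub _ _) (xDiv_two_mem_genSub _ _))
      (mul_mem (xDiv_two_mem_genSub _ _) (xDiv_two_mem_genSub _ _)))
      (mul_mem (mul_mem (x_mem_genSub _ _) (tBinom_one_mem_genSub _)) (x_mem_genSub _ _))
  have key : (q - q⁻¹) • Uq.tBinom n 2 = ((q - q⁻¹) * q ^ (2 * n)) • Uq.tBinom 0 2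
      + ((q ^ n * qInt n) • (1 : Uq) - (q * evenInt n) • (Uq.t (-1) * Uq.t (-1))) := by
    have hq := q_ne_zero
    have e1 : qInt n = (q - q⁻¹)⁻¹ * (q ^ n - (q ^ n)⁻¹) := by
      rw [qInt, zpow_neg, div_eq_inv_mul]
    have e3 : q ^ (2 * n) = (q ^ n) ^ 2 := by rw [mul_comm 2 n, zpow_mul, zpow_ofNat]
    have e2 : evenInt n = (qInt 2)⁻¹ * ((q - q⁻¹)⁻¹ * ((q ^ n) ^ 2 - ((q ^ n) ^ 2)⁻¹)) := by
      rw [evenInt, show qInt (2 * n) = (q ^ (2 * n) - q ^ (-(2 * n))) / (q - q⁻¹) from rfl,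
        zpow_neg, div_eq_inv_mul, e3]
    rw [tBinom_two, tBinom_two, tDiff_mul_tDiff, tDiff_mul_tDiff, e1, e2, e3, zpow_zero]
    exact smul_two_term_product hq (zpow_ne_zero n hq) qInt_two_ne_zero q_sub_ne_zero qInt_two
      (Uq.t 1 * Uq.t 1) (1 : Uq) (Uq.t (-1) * Uq.t (-1))
  refine hasVal_q_sub.mem_of_smul_mem two_mul_I_ne_zero (tBinom_mem n 2) ?_
  rw [key]
  obtain ⟨r, hr⟩ := exists_hasVal_qInt n
  obtain ⟨s, hs⟩ := exists_hasVal_evenInt n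
  exact add_mem ((hasVal_q_sub.mul (hasVal_q_zpow _)).smul_mem h0)
    (sub_mem (((hasVal_q_zpow n).mul hr).smul_mem (one_mem _))
      ((hasVal_q.mul hs).smul_mem (mul_mem (t_mem_genSub _) (t_mem_genSub _))))

/-- Factors are added two at a time: the binomial of length 2k + 2 times [2k+1][2k+2]/[2] is that of
length 2k times one of length 2 with shifted parameter. An odd length needs one more factor, with
the invertible [2k+1]. -/
theorem tBinom_mem_genSub (n : ℤ) (r : ℕ) : Uq.tBinom n r ∈ genSub := by
  have hne : ∀ j : ℕ, qInt ((j : ℤ) + 1) ≠ 0 := by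
    intro j
    have h := qFact_ne_zero (j + 1)
    rw [qFact_succ] at h
    have h1 := right_ne_zero_of_mul h
    rwa [Nat.cast_add, Nat.cast_one] at h1
  have heven : ∀ k : ℕ, Uq.tBinom n (2 * k) ∈ genSub := by
    intro k
    induction k with
    | zero =>
      rw [mul_zero, tBinom_zero]
      exact one_mem _
    | succ k ih =>
      obtain ⟨h1, h2⟩ := hasVal_odd_even k
      have h3 : ((-1 : ℂ)) ^ k ≠ 0 := pow_ne_zero _ (neg_ne_zero.mpr one_ne_zero)
      have h4 : ((k : ℂ) + 1) ≠ 0 := Nat.cast_add_one_ne_zero k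
      refine (h1.mul h2).mem_of_smul_mem (mul_ne_zero h3 (mul_ne_zero h3 h4)) (tBinom_mem n _) ?_
      have h5 := mul_mem ih (tBinom_two_mem_genSub (n - 2 * k))
      have h6 : (qInt (2 * (k : ℤ) + 1) * evenInt ((k : ℤ) + 1)) • Uq.tBinom n (2 * (k + 1))
          = Uq.tBinom n (2 * k) * Uq.tBinom (n - 2 * k) 2 := by
        have hw := qInt_two_ne_zero
        have e1 := hne (2 * k)
        have e2 := hne (2 * k + 1)
        have e3 : (((2 * k + 1 : ℕ) : ℤ) + 1) = 2 * ((k : ℤ) + 1) := by push_cast; ring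
        rw [e3, ← two_mul_evenInt] at e2
        rw [Nat.cast_mul, Nat.cast_ofNat] at e1
        have e4 := right_ne_zero_of_mul e2
        rw [show 2 * (k + 1) = 2 * k + 1 + 1 by ring, tBinom_succ, tBinom_succ, tBinom_two, e3,
          ← two_mul_evenInt, Nat.cast_mul, Nat.cast_ofNat, mul_assoc, smul_mul_smul_comm,
          mul_smul_comm, mul_smul_comm, smul_smul,
          show (n - ((2 * k + 1 : ℕ) : ℤ)) = n - 2 * k - 1 by push_cast; ring]
        congr 1
        have hd := q_sub_ne_zero
        generalize q - q⁻¹ = d at hd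
        generalize qInt 2 = w at hw
        generalize qInt (2 * (k : ℤ) + 1) = a at e1
        generalize evenInt ((k : ℤ) + 1) = b at e4
        field_simp
      rw [h6]
      exact h5
  rcases Nat.mod_two_eq_zero_or_one r with h0 | h0
  · have h := heven (r / 2)
    rwa [show 2 * (r / 2) = r by omega] at h
  · have h1 := (hasVal_odd_even (r / 2)).1
    have h3 : ((-1 : ℂ)) ^ (r / 2) ≠ 0 := pow_ne_zero _ (neg_ne_zero.mpr one_ne_zero)
    refine h1.mem_of_smul_mem h3 (tBinom_mem n _) ?_
    have e1 := hne (2 * (r / 2))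
    have h4 : qInt (2 * ((r / 2 : ℕ) : ℤ) + 1) • Uq.tBinom n (2 * (r / 2) + 1)
        = Uq.tBinom n (2 * (r / 2)) * Uq.tBinom (n - (2 * (r / 2) : ℕ)) 1 := by
      rw [tBinom_succ, tBinom_one, mul_smul_comm, mul_smul_comm, smul_smul]
      congr 1
      have hd := q_sub_ne_zero
      rw [Nat.cast_mul, Nat.cast_ofNat] at e1 ⊢
      rw [mul_inv, mul_left_comm, mul_inv_cancel₀ e1, mul_one]
    rw [show 2 * (r / 2) + 1 = r by omega] at h4
    rw [h4]
    exact mul_mem (heven _) (tBinom_one_mem_genSub _)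

end CartanBinomials

/-! ### Generation of the specialized algebra -/

section Generation

theorem Ures_le_genSub : Ures ≤ genSub := by
  refine Algebra.adjoin_le ?_
  rintro u ((((h | ⟨s, n, r, rfl⟩) | ⟨s, rfl⟩) | ⟨n, r, rfl⟩) | ⟨n, hn, rfl⟩)
  · rcases h with rfl | rfl
    · exact hasVal_q.algebraMap_mem
    · exact hasVal_q_inv.algebraMap_mem
  · exact xDiv_mem_genSub s n r
  · exact t_mem_genSub s
  · exact tBinom_mem_genSub n r
  · exact gen_mem (atilde_mem n hn) (.a n hn) rfl

theorem toUi_surjective (g : Ui) : ∃ f : Expr, Expr.toUi f = g := by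
  obtain ⟨u, rfl⟩ := RingQuot.mkAlgHom_surjective ℂ _ g
  obtain ⟨_, f, hf⟩ := mem_genSub.mp (Ures_le_genSub u.2)
  exact ⟨f, hf⟩

end Generation

end LoopSl2

end

theorem proposition3p1 :
    (∀ g : LoopSl2.Ui,
      (∃ f : LoopSl2.Expr, LoopSl2.Expr.toUi f = g) ∧
      ∀ f : LoopSl2.Expr, LoopSl2.Expr.toUi f = g →
        (∀ (n l : ℕ) (P : LoopSl2.V n) (P' : LoopSl2.V (n + 2)),
          LoopSl2.Pure l P → LoopSl2.Pure (l + 1) P' →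
          LoopSl2.IsLink n l (P l) (P' (l + 1)) →
          LoopSl2.IsLinkPair n (LoopSl2.Expr.op n f P) (LoopSl2.Expr.op (n + 2) f P')) ∧
        (∀ p ∈ LoopSl2.InfCycles,
          (fun n => LoopSl2.Expr.op n f (p n)) ∈ LoopSl2.InfCycles)) ∧
    (∀ ρ : (n : ℕ) → LoopSl2.Ui →ₐ[ℂ] Module.End (LoopSl2.K n) (LoopSl2.A n),
      LoopSl2.IsAction ρ → ∀ g : LoopSl2.Ui,
        (∀ (n l : ℕ) (P : LoopSl2.A n) (P' : LoopSl2.A (n + 2)),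
          LoopSl2.Pure l (P : LoopSl2.V n) → LoopSl2.Pure (l + 1) (P' : LoopSl2.V (n + 2)) →
          LoopSl2.IsLink n l ((P : LoopSl2.V n) l) ((P' : LoopSl2.V (n + 2)) (l + 1)) →
          LoopSl2.IsLinkPair n (ρ n g P : LoopSl2.A n) (ρ (n + 2) g P' : LoopSl2.A (n + 2))) ∧
        (∀ p : (n : ℕ) → LoopSl2.A n,
          (fun n => (p n : LoopSl2.V n)) ∈ LoopSl2.InfCycles →
          (fun n => ((ρ n g (p n) : LoopSl2.A n) : LoopSl2.V n)) ∈ LoopSl2.InfCycles)) := by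
  refine ⟨fun g => ⟨LoopSl2.toUi_surjective g, fun f _ => ⟨fun n l P P' hP hP' h =>
    (LoopSl2.isLinkPair_of_pure hP hP' h).op f, fun p hp => LoopSl2.op_mem_infCycles f hp⟩⟩,
    fun ρ hρ g => ?_⟩
  -- Any action agreeing with the formulas on generators makes `g` act as the operator of any
  -- polynomial with value `g`, so part 2 follows from the results on polynomials.
  obtain ⟨f, rfl⟩ := LoopSl2.toUi_surjective g
  refine ⟨fun n l P P' hP hP' h => ?_, fun p hp => ?_⟩
  · rw [hρ.toUi_apply, hρ.toUi_apply]
    exact (LoopSl2.isLinkPair_of_pure hP hP' h).op f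
  · have h1 : (fun n => ((ρ n (LoopSl2.Expr.toUi f) (p n) : LoopSl2.A n) : LoopSl2.V n))
        = fun n => LoopSl2.Expr.op n f (p n : LoopSl2.V n) := funext fun n => hρ.toUi_apply n f (p n)
    rw [h1]
    exact LoopSl2.op_mem_infCycles f hp
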